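/- Let $M$ be a smooth Riemannian manifold (Hausdorff, second countable, without boundary, of dimension $n$; not assumed complete, connected or oriented), and let $E\to M$ be a smooth real vector bundle of finite rank with a flat connection $D$ and a smooth Riemannian metric along the fibres (not assumed $D$-parallel). Let $d_D$ be the de Rham differential on $E$-valued forms twisted by $D$, let $\delta_D$ be its formal adjoint, and let $P:=d_D+\delta_D$, regarded as an unbounded operator in the Hilbert space $L^2(M,\Lambda^*M\otimes E)$ with domain $\mathcal C^\infty_c(M,\Lambda^*M\otimes E)$, the smooth compactly supported forms. Let $d_{\min},\delta_{\min}$ be the closures in $L^2$ of $d_D,\delta_D$ with domain $\mathcal C_c^\infty$, let $d_{\max}$ be the maximal extension of $d_D$ (that is, $u\in L^2$ is in its domain, with $d_{\max}u=v\in L^2$, if and only if $\langle u,\delta_D\varphi\rangle=\langle v,\varphi\rangle$ for all $\varphi\in\mathcal C^\infty_c$), and let $H^1_{\min}$ be the domain of the closure of $P$. Assume that 1. for every $k=0,\dots,n$, $\langle (d_D+\delta_D)^2\varphi-\varphi,\varphi\rangle_{L^2}\ge 0$ for all $\varphi\in\mathcal C^\infty_c(M,\Lambda^kM\otimes E)$;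 2. $P$ is essentially self-adjoint (its closure equals its Hilbert space adjoint). Then for every $k$ and every $\alpha\in L^2(M,\Lambda^kM\otimes E)$ which is closed, i.e. $d_{\max}\alpha=0$, there is a form $\gamma\in L^2$ of degree $k-1$ in the domain of $d_{\min}$ with $d_{\min}\gamma=\alpha$ (so $\alpha$ is exact; for $k=0$ this means $\alpha=0$), such that moreover $\gamma\in H^1_{\min}$, $\gamma$ is coexact, i.e. $\gamma=\delta_{\min}\beta$ for some $\beta$ in the domain of $\delta_{\min}$, and $\gamma$ is smooth if $\alpha$ is smooth. In other words, the $L^2$ cohomology of $M$ twisted by $E$ vanishes. -/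

import Mathlib

open scoped Manifold ContDiff Topology
open Bundle MeasureTheory Filter

noncomputable section

namespace TwistedL2

section Volume

variable (n : ℕ) (M : Type*) [TopologicalSpace M] [ChartedSpace (EuclideanSpace ℝ (Fin n)) M]
  [IsManifold (𝓡 n) ∞ M] [RiemannianBundle (fun x : M => TangentSpace (𝓡 n) x)]

/-- The coordinate vector `∂ᵢ` at `p` for the preferred chart around `c`, where `p` is in the domain
of that chart: the trivialization of the tangent bundle at `c` is the one given by this chart. -/
def coordVector (c p : M) (i : Fin n) : TangentSpace (𝓡 n) p :=
  (trivializationAt (EuclideanSpace ℝ (Fin n)) (TangentSpace (𝓡 n)) c).symmL ℝ p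
    (EuclideanSpace.single i (1 : ℝ))

/-- The Gram matrix `g(∂ᵢ, ∂ⱼ)` of the Riemannian metric at the point `p` of the domain of the
preferred chart around `c`. -/
def gramMatrix (c p : M) : Matrix (Fin n) (Fin n) ℝ :=
  Matrix.of fun i j => inner ℝ (coordVector n M c p i) (coordVector n M c p j)

/-- The measure `√(det g) dy¹ ⋯ dyⁿ` on the domain of the preferred chart around `c`, seen as
a measure on `M`. -/
def chartVolume [MeasurableSpace M] (c : M) : Measure M :=
  ((volume.restrict (chartAt (EuclideanSpace ℝ (Fin n)) c).target).withDensity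
    fun y => ENNReal.ofReal (Real.sqrt (gramMatrix n M c ((chartAt (EuclideanSpace ℝ (Fin n)) c).symm y)).det)).map
      (chartAt (EuclideanSpace ℝ (Fin n)) c).symm

/-- The Riemannian volume measure. The measures `chartVolume` agree on overlaps of charts; the
Riemannian volume is the smallest measure that dominates all of them, i.e. the measure that
restricts to `chartVolume n M c` on the domain of the chart around `c`. -/
def riemannianVolume [MeasurableSpace M] : Measure M := ⨆ c : M, chartVolume n M c

end Volume

section Forms

variable {n : ℕ} {M : Type*} [TopologicalSpace M] [ChartedSpace (EuclideanSpace ℝ (Fin n)) M]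
  {F : Type*} [NormedAddCommGroup F] [NormedSpace ℝ F]
  {V : M → Type*} [TopologicalSpace (Bundle.TotalSpace F V)]
  [∀ x, NormedAddCommGroup (V x)] [∀ x, InnerProductSpace ℝ (V x)]
  [FiberBundle F V] [IsManifold (𝓡 n) ∞ M]

/-- A vector field is smooth. -/
def SmoothField (X : (x : M) → TangentSpace (𝓡 n) x) : Prop :=
  ContMDiff (𝓡 n) (𝓡 n).tangent ∞
    (fun x => (⟨x, X x⟩ : TangentBundle (𝓡 n) M))

variable (n F) in
/-- A section of the vector bundle `V` is smooth. -/
def SmoothSection (σ : (x : M) → V x) : Prop :=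
  ContMDiff (𝓡 n) ((𝓡 n).prod 𝓘(ℝ, F)) ∞
    (fun x => (⟨x, σ x⟩ : Bundle.TotalSpace F V))

variable (n V) in
/-- (Not necessarily continuous) `V`-valued differential forms of degree `k`, i.e. sections of
`Λᵏ T*M ⊗ V`. -/
abbrev Form (k : ℕ) : Type _ := (x : M) → (TangentSpace (𝓡 n) x) [⋀^Fin k]→L[ℝ] V x

variable (n V) in
/-- `V`-valued forms of mixed degree, i.e. sections of `Λ* T*M ⊗ V`: the component in each degree.
The components of degree `k > n` vanish automatically. -/
abbrev MixedForm : Type _ := (k : ℕ) → Form n V k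

variable (F) in
/-- A form is smooth if its values on smooth vector fields are smooth sections. -/
def SmoothForm {k : ℕ} (θ : Form n V k) : Prop :=
  ∀ X : Fin k → (x : M) → TangentSpace (𝓡 n) x, (∀ i, SmoothField (X i)) →
    SmoothSection n F (fun x => θ x (fun i => X i x))

variable (F) in
/-- A mixed form is smooth if all its components are. -/
def SmoothMixed (θ : MixedForm n V) : Prop := ∀ k, SmoothForm F (θ k)

variable (F) in
/-- Smooth forms of degree `k` with compact support. -/
def TestForm {k : ℕ} (θ : Form n V k) : Prop :=
  SmoothForm F θ ∧ IsCompact (closure {x | θ x ≠ 0})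

variable (F) in
/-- The space `C_c^∞` of smooth mixed forms with compact support. -/
def TestMixed (θ : MixedForm n V) : Prop := ∀ k, TestForm F (θ k)

/-- The mixed form `θ` is homogeneous of degree `d ∈ ℤ`; for `d < 0` this means `θ = 0`. -/
def HomogeneousOfDegree (d : ℤ) (θ : MixedForm n V) : Prop := ∀ k : ℕ, (k : ℤ) ≠ d → θ k = 0

/-! ### The connection and the twisted de Rham differential -/

/-- The connection `D` has vanishing curvature:
`D_X D_Y σ - D_Y D_X σ - D_{[X,Y]} σ = 0`. -/
def IsFlat (D : CovariantDerivative (𝓡 n) F V) : Prop :=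
  ∀ (X Y : (x : M) → TangentSpace (𝓡 n) x) (σ : (x : M) → V x),
    SmoothField X → SmoothField Y → SmoothSection n F σ → ∀ x,
      D (fun y => D σ y (Y y)) x (X x) - D (fun y => D σ y (X y)) x (Y x)
        - D σ x (VectorField.mlieBracket (𝓡 n) X Y x) = 0

/-- The term
`∑_{i<j} (-1)^(i+j) θ([Xᵢ,Xⱼ], X₀, …, X̂ᵢ, …, X̂ⱼ, …, X_k)` at `x` of the Koszul formula. In the
code the pair of positions is `(i, j + 1)` with `i ≤ j`, whence the additional minus sign. -/
def bracketTerm : (k : ℕ) → (θ : Form n V k) → (X : Fin (k + 1) → (x : M) → TangentSpace (𝓡 n) x) →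
    (x : M) → V x
  | 0, _, _, _ => 0
  | k + 1, θ, X, x =>
      - ∑ i : Fin (k + 1), ∑ j ∈ Finset.Ici i, (-1 : ℝ) ^ (i + j : ℕ) •
          θ x (Matrix.vecCons (VectorField.mlieBracket (𝓡 n) (X i.castSucc) (X j.succ) x)
            (j.removeNth (i.castSucc.removeNth (fun l => X l x))))

/-- `η = d_D θ` according to the Koszul formula
`η(X₀,…,X_k) = ∑ᵢ (-1)ⁱ D_{Xᵢ}(θ(X₀,…,X̂ᵢ,…,X_k))
  + ∑_{i<j} (-1)^(i+j) θ([Xᵢ,Xⱼ], X₀,…,X̂ᵢ,…,X̂ⱼ,…,X_k)`, for all smooth vector fields. -/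
def IsExtDeriv (D : CovariantDerivative (𝓡 n) F V) {k : ℕ} (θ : Form n V k)
    (η : Form n V (k + 1)) : Prop :=
  ∀ X : Fin (k + 1) → (x : M) → TangentSpace (𝓡 n) x, (∀ i, SmoothField (X i)) → ∀ x,
    η x (fun i => X i x) =
      ∑ i : Fin (k + 1), (-1 : ℝ) ^ (i : ℕ) •
        D (fun y => θ y (i.removeNth (fun j => X j y))) x (X i x)
      + bracketTerm k θ X x

open Classical in
/-- The twisted de Rham differential `d_D` on forms of degree `k`: the form given by the Koszul
formula, which exists and is unique for smooth `θ` (the only case of interest). -/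
def extDerivD (D : CovariantDerivative (𝓡 n) F V) {k : ℕ} (θ : Form n V k) : Form n V (k + 1) :=
  if h : ∃ η : Form n V (k + 1), IsExtDeriv D θ η then h.choose else 0

/-- The twisted de Rham differential `d_D` on mixed forms. -/
def dD (D : CovariantDerivative (𝓡 n) F V) (θ : MixedForm n V) : MixedForm n V
  | 0 => 0
  | k + 1 => extDerivD D (θ k)

/-! ### The `L²` structure -/

section L2

variable [RiemannianBundle (fun x : M => TangentSpace (𝓡 n) x)]

/-- The inner product on `Λᵏ T*ₓM ⊗ Vₓ` induced by the metrics: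
`⟨a, b⟩ = ∑_{i₁<⋯<i_k} ⟨a(e_{i₁},…,e_{i_k}), b(e_{i₁},…,e_{i_k})⟩` for any orthonormal basis `e` of
`TₓM`, written as `1/k!` times the sum over all multi-indices. -/
def formInner (x : M) {k : ℕ} (a b : (TangentSpace (𝓡 n) x) [⋀^Fin k]→L[ℝ] V x) : ℝ :=
  haveI : FiniteDimensional ℝ (TangentSpace (𝓡 n) x) :=
    inferInstanceAs (FiniteDimensional ℝ (EuclideanSpace ℝ (Fin n)))
  ((k.factorial : ℝ))⁻¹ *
    ∑ I : Fin k → Fin (Module.finrank ℝ (TangentSpace (𝓡 n) x)),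
      inner ℝ (a (fun j => stdOrthonormalBasis ℝ (TangentSpace (𝓡 n) x) (I j)))
        (b (fun j => stdOrthonormalBasis ℝ (TangentSpace (𝓡 n) x) (I j)))

/-- The pointwise inner product of mixed forms; distinct degrees are orthogonal. -/
def mixedInner (θ η : MixedForm n V) (x : M) : ℝ :=
  ∑ k ∈ Finset.range (n + 1), formInner x (θ k x) (η k x)

variable [MeasurableSpace M]

/-- The `L²` inner product of forms of degree `k`. -/
def l2FormInner {k : ℕ} (θ η : Form n V k) : ℝ :=
  ∫ x, formInner x (θ x) (η x) ∂(riemannianVolume n M)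

/-- The `L²` inner product of mixed forms. -/
def l2Inner (θ η : MixedForm n V) : ℝ := ∫ x, mixedInner θ η x ∂(riemannianVolume n M)

variable (F) in
/-- (Almost everywhere) measurability of a form, tested on smooth vector fields and sections. -/
def MeasurableForm {k : ℕ} (θ : Form n V k) : Prop :=
  ∀ (X : Fin k → (x : M) → TangentSpace (𝓡 n) x) (σ : (x : M) → V x),
    (∀ i, SmoothField (X i)) → SmoothSection n F σ →
      AEMeasurable (fun x => (inner ℝ (θ x (fun i => X i x)) (σ x) : ℝ)) (riemannianVolume n M)

variable (F) in
/-- Square-integrable mixed forms. Forms are not identified when they agree almost everywhere; all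
notions below are invariant under changes on null sets. -/
def MemL2 (θ : MixedForm n V) : Prop :=
  (∀ k, MeasurableForm F (θ k)) ∧ Integrable (mixedInner θ θ) (riemannianVolume n M)

/-- `η` is the value at `θ` of the formal adjoint of `d_D`: a smooth form with
`⟨d_D φ, θ⟩ = ⟨φ, η⟩` for all smooth compactly supported `φ`. -/
def IsFormalAdjointValue (D : CovariantDerivative (𝓡 n) F V) {k : ℕ} (θ : Form n V (k + 1))
    (η : Form n V k) : Prop :=
  SmoothForm F η ∧
    ∀ φ : Form n V k, TestForm F φ → l2FormInner (extDerivD D φ) θ = l2FormInner φ η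

open Classical in
/-- The formal adjoint `δ_D` of `d_D` on forms of degree `k + 1`; its value exists and is unique for
smooth `θ` (the only case of interest). -/
def coDerivD (D : CovariantDerivative (𝓡 n) F V) {k : ℕ} (θ : Form n V (k + 1)) : Form n V k :=
  if h : ∃ η : Form n V k, IsFormalAdjointValue D θ η then h.choose else 0

/-- The formal adjoint `δ_D` on mixed forms. -/
def deltaD (D : CovariantDerivative (𝓡 n) F V) (θ : MixedForm n V) : MixedForm n V :=
  fun k => coDerivD D (θ (k + 1))

/-- The operator `P = d_D + δ_D`. -/
def opP (D : CovariantDerivative (𝓡 n) F V) (θ : MixedForm n V) : MixedForm n V :=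
  dD D θ + deltaD D θ

variable (F) in
/-- The minimal extension (closure) in `L²` of an operator `A` with domain `C_c^∞`:
`u` is in its domain and is mapped to `v`. -/
def MinExt (A : MixedForm n V → MixedForm n V) (u v : MixedForm n V) : Prop :=
  MemL2 F u ∧ MemL2 F v ∧
    ∃ φ : ℕ → MixedForm n V, (∀ j, TestMixed F (φ j)) ∧
      Tendsto (fun j => l2Inner (φ j - u) (φ j - u)) atTop (𝓝 0) ∧
      Tendsto (fun j => l2Inner (A (φ j) - v) (A (φ j) - v)) atTop (𝓝 0)

variable (F) in
/-- The Hilbert space adjoint in `L²` of an operator `A` with domain `C_c^∞`: `u` is in its domain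
and is mapped to `v`. For the formal adjoint `B` of `A`, this is the maximal extension of `B`. -/
def Adj (A : MixedForm n V → MixedForm n V) (u v : MixedForm n V) : Prop :=
  MemL2 F u ∧ MemL2 F v ∧ ∀ φ : MixedForm n V, TestMixed F φ → l2Inner u (A φ) = l2Inner v φ

/-- `d_min u = v`. -/
def DMin (D : CovariantDerivative (𝓡 n) F V) (u v : MixedForm n V) : Prop := MinExt F (dD D) u v

/-- `d_max u = v`: the form `u` is in `L²` and has distributional differential `v` in `L²`. -/
def DMax (D : CovariantDerivative (𝓡 n) F V) (u v : MixedForm n V) : Prop := Adj F (deltaD D) u v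

/-- `δ_min u = v`. -/
def DeltaMin (D : CovariantDerivative (𝓡 n) F V) (u v : MixedForm n V) : Prop :=
  MinExt F (deltaD D) u v

/-- An `L²` form `α` is closed if `d_max α = 0`. -/
def IsClosedForm (D : CovariantDerivative (𝓡 n) F V) (α : MixedForm n V) : Prop := DMax D α 0

/-- An `L²` form is coexact if it is in the range of `δ_min`. -/
def IsCoexactForm (D : CovariantDerivative (𝓡 n) F V) (γ : MixedForm n V) : Prop :=
  ∃ β : MixedForm n V, DeltaMin D β γ

/-- The space `H¹_min`, the completion of `C_c^∞` in the graph norm of `P`, i.e. the domain of the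
closure of `P`. -/
def MemH1Min (D : CovariantDerivative (𝓡 n) F V) (u : MixedForm n V) : Prop :=
  ∃ v : MixedForm n V, MinExt F (opP D) u v

/-- `P`, with domain `C_c^∞`, is essentially self-adjoint: its closure is equal to its adjoint. -/
def IsEssentiallySelfAdjointP (D : CovariantDerivative (𝓡 n) F V) : Prop :=
  ∀ u v : MixedForm n V, MinExt F (opP D) u v ↔ Adj F (opP D) u v

/-- The inequality `(d_D + δ_D)² - 1 ≥ 0` on smooth compactly supported forms of degree `k`. -/
def SpectralBound (D : CovariantDerivative (𝓡 n) F V) (k : ℕ) : Prop :=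
  ∀ φ : MixedForm n V, TestMixed F φ → HomogeneousOfDegree k φ →
    0 ≤ l2Inner (opP D (opP D φ) - φ) φ

end L2

end Forms

end TwistedL2

end

/-!
Vanishing of twisted `L²` cohomology under a spectral gap.

The existence of the primitive is a Hodge argument in `L²`. Essential self-adjointness makes `P`
symmetric on test forms, and comparing degrees shows that `δ` is adjoint to `d` there
(`IsEssentiallySelfAdjointP.isAdjointPair`). Since `d² = 0` by flatness, the ranges of `d` and `δ`
on test forms are orthogonal, so that `‖P φ‖² = ‖d φ‖² + ‖δ φ‖²`, and the spectral bound becomes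
`‖φ‖ ≤ ‖P φ‖` for test forms of mixed degree (`IsAdjointPair.l2Inner_le_opP`). By essential
self-adjointness, a form orthogonal to the range of `P` lies in the kernel of the closure of `P`,
hence vanishes: the range of `P` is dense. A closed form `α` is therefore a limit of `P φⱼ`, the
bound shows that `φⱼ`, `d φⱼ` and `δ φⱼ` converge, and orthogonality to the range of `δ` forces
`d φⱼ → α` and `δ φⱼ → 0` (`exists_tendsto_of_orthogonal`, `exists_tendsto_l2FormInner`). The limit
`γ` of the `φⱼ` is the primitive. It is coclosed, and the same argument with `d` and `δ` exchanged
shows that it is coexact (`properties_of_tendsto`). To work with actual limits, forms are identified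
with a closed subspace of an `L²` space of vector-valued functions, by means of measurable
orthonormal frames (`isClosed_formSpace`).

If `α` is smooth, then `γ` solves `d γ = α`, `δ γ = 0` in the sense of distributions. In local
coordinates this is an overdetermined first-order system with smooth coefficients, whose symbol is
injective by exactness of the Koszul complex (`exists_eq_wedge`). Elliptic regularity for such
systems (`elliptic_regularity`) comes from the Gårding inequality, proved by Plancherel's theorem
for constant coefficients and by perturbation near a point (`NearConst.garding`). Applied to
mollifications, whose commutators with the coefficients are bounded (`commutator_bound`), it gives
one weak derivative in `L²`; bootstrapping gives all of them (`hs_of_weak`), and the Sobolev embedding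
gives smoothness (`exists_contDiff_of_hs`). The local smooth representatives are glued by
`exists_smooth_of_locally`.

The link between the invariant definitions and local coordinates is given by the local formula
`d + A ∧` for the twisted differential (`formRep_extDerivD`), from which its existence and `d² = 0`
follow, and by the formula for the Riemannian volume in a chart (`riemannianVolume_restrict`).
-/

open scoped Manifold ContDiff Topology
open Bundle MeasureTheory Filter

noncomputable section

namespace TwistedL2

set_option linter.unusedSectionVars false

section

variable {n : ℕ} {M : Type*} [TopologicalSpace M] [ChartedSpace (EuclideanSpace ℝ (Fin n)) M]
  [IsManifold (𝓡 n) ∞ M]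

/-- A shortcut for instance search. -/
theorem isManifold_one : IsManifold (𝓡 n) 1 M := inferInstance

/-- The topology of the tangent bundle, as a shortcut for instance search. -/
abbrev topologicalSpaceTangentBundle : TopologicalSpace
    (TotalSpace (EuclideanSpace ℝ (Fin n)) fun x : M => TangentSpace (𝓡 n) x) := inferInstance

end

attribute [local instance] isManifold_one topologicalSpaceTangentBundle

/-! ### The Gårding inequality for constant coefficients -/

/-- The Euclidean space in which the charts take their values. -/
abbrev Euc (n : ℕ) : Type := EuclideanSpace ℝ (Fin n)

/-- The partial derivative `∂ᵢ g`. -/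
def pd {n : ℕ} (i : Fin n) (g : Euc n → ℝ) (y : Euc n) : ℝ :=
  fderiv ℝ g y (EuclideanSpace.single i 1)

/-- A smooth compactly supported real function. -/
def IsTest {n : ℕ} (g : Euc n → ℝ) : Prop := ContDiff ℝ ∞ g ∧ HasCompactSupport g

section EuclideanAnalysis

variable {n : ℕ} {J L : Type*} [Fintype J] [Fintype L]

theorem IsTest.continuous {g : Euc n → ℝ} (hg : IsTest g) : Continuous g := hg.1.continuous

theorem IsTest.differentiable {g : Euc n → ℝ} (hg : IsTest g) : Differentiable ℝ g :=
  hg.1.differentiable (by simp)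

theorem contDiff_pd {g : Euc n → ℝ} (hg : ContDiff ℝ ∞ g) (i : Fin n) : ContDiff ℝ ∞ (pd i g) :=
  (hg.fderiv_right (m := ∞) (by simp)).clm_apply contDiff_const

theorem IsTest.pd {g : Euc n → ℝ} (hg : IsTest g) (i : Fin n) : IsTest (pd i g) :=
  ⟨contDiff_pd hg.1 i, by
    have := hg.2.fderiv (𝕜 := ℝ)
    exact this.comp_left (g := fun T : Euc n →L[ℝ] ℝ => T (EuclideanSpace.single i 1)) (by simp)⟩

theorem IsTest.memLp {g : Euc n → ℝ} (hg : IsTest g) (p : ENNReal) : MemLp g p volume :=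
  hg.continuous.memLp_of_hasCompactSupport hg.2

theorem IsTest.mul {f g : Euc n → ℝ} (hf : ContDiff ℝ ∞ f) (hg : IsTest g) :
    IsTest (fun y => f y * g y) := ⟨hf.mul hg.1, hg.2.mul_left⟩

theorem pd_mul {f g : Euc n → ℝ} {y : Euc n} (hf : DifferentiableAt ℝ f y)
    (hg : DifferentiableAt ℝ g y) (i : Fin n) :
    pd i (fun y => f y * g y) y = f y * pd i g y + pd i f y * g y := by
  simp [pd, fderiv_fun_mul hf hg]; ring

/-- Quantitative form of the injectivity of a symbol with constant coefficients. -/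
theorem exists_symbol_lower_bound (a : L → Fin n → J → ℝ)
    (ha : ∀ ξ : Euc n, ξ ≠ 0 → ∀ z : J → ℝ, (∀ l, ∑ i, ∑ j, a l i j * ξ i * z j = 0) → z = 0) :
    ∃ c : ℝ, 0 < c ∧ ∀ (ξ : Euc n) (z : J → ℝ),
      c * ‖ξ‖ ^ 2 * ∑ j, z j ^ 2 ≤ ∑ l, (∑ i, ∑ j, a l i j * ξ i * z j) ^ 2 := by
  let Q : Euc n × EuclideanSpace ℝ J → ℝ := fun p => ∑ l, (∑ i, ∑ j, a l i j * p.1 i * p.2 j) ^ 2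
  have hQ : Continuous Q := by
    refine continuous_finsetSum _ fun l _ => Continuous.pow (continuous_finsetSum _ fun i _ =>
      continuous_finsetSum _ fun j _ => ?_) 2
    fun_prop
  let S : Set (Euc n × EuclideanSpace ℝ J) := Metric.sphere 0 1 ×ˢ Metric.sphere 0 1
  have hS : IsCompact S := (isCompact_sphere _ _).prod (isCompact_sphere _ _)
  -- the constant is the minimum of the quadratic form over the product of the unit spheres;
  -- this product is empty in the degenerate dimensions
  obtain ⟨c, hc, hcS⟩ : ∃ c : ℝ, 0 < c ∧ ∀ p ∈ S, c ≤ Q p := by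
    rcases S.eq_empty_or_nonempty with h | h
    · exact ⟨1, one_pos, by simp [h]⟩
    · obtain ⟨p, hp, hmin⟩ := hS.exists_isMinOn h hQ.continuousOn
      refine ⟨Q p, ?_, fun q hq => hmin hq⟩
      refine lt_of_le_of_ne (Finset.sum_nonneg fun l _ => sq_nonneg _) fun h0 => ?_
      have h1 : ∀ l, ∑ i, ∑ j, a l i j * p.1 i * p.2 j = 0 := fun l => by
        have := (Finset.sum_eq_zero_iff_of_nonneg (fun l _ => sq_nonneg _)).1 h0.symm l
          (Finset.mem_univ l)
        simpa using this
      have hp1 : p.1 ≠ 0 := fun h => by simpa [h] using hp.1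
      have hp2 := ha p.1 hp1 (fun j => p.2 j) h1
      have : p.2 = 0 := by ext j; exact congrFun hp2 j
      simpa [this] using hp.2
  refine ⟨c, hc, fun ξ z => ?_⟩
  set w : EuclideanSpace ℝ J := WithLp.toLp 2 z with hw
  have hz : ∑ j, z j ^ 2 = ‖w‖ ^ 2 := by
    rw [EuclideanSpace.norm_eq, Real.sq_sqrt (Finset.sum_nonneg fun _ _ => sq_nonneg _)]
    simp [hw]
  rw [hz]
  by_cases h1 : ξ = 0
  · simp only [h1, norm_zero]; norm_num
  by_cases h2 : w = 0
  · simp only [h2, norm_zero]; norm_num; exact Finset.sum_nonneg fun l _ => sq_nonneg _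
  have h1' : ‖ξ‖ ≠ 0 := norm_ne_zero_iff.2 h1
  have h2' : ‖w‖ ≠ 0 := norm_ne_zero_iff.2 h2
  have h3 := hcS (‖ξ‖⁻¹ • ξ, ‖w‖⁻¹ • w) ⟨by simp [norm_smul, h1'], by simp [norm_smul, h2']⟩
  have h4 : Q (‖ξ‖⁻¹ • ξ, ‖w‖⁻¹ • w)
      = (‖ξ‖⁻¹ * ‖w‖⁻¹) ^ 2 * ∑ l, (∑ i, ∑ j, a l i j * ξ i * z j) ^ 2 := by
    simp only [Q, Finset.mul_sum]
    refine Finset.sum_congr rfl fun l _ => ?_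
    rw [← mul_pow, Finset.mul_sum]
    congr 1
    refine Finset.sum_congr rfl fun i _ => ?_
    rw [Finset.mul_sum]
    refine Finset.sum_congr rfl fun j _ => ?_
    simp [hw]; ring
  rw [h4] at h3
  have h5 := mul_le_mul_of_nonneg_left h3 (show 0 ≤ (‖ξ‖ * ‖w‖) ^ 2 by positivity)
  rw [← mul_assoc, ← mul_pow] at h5
  have h6 : ‖ξ‖ * ‖w‖ * (‖ξ‖⁻¹ * ‖w‖⁻¹) = 1 := by field_simp
  rw [h6] at h5
  calc c * ‖ξ‖ ^ 2 * ‖w‖ ^ 2 = (‖ξ‖ * ‖w‖) ^ 2 * c := by ring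
    _ ≤ _ := by simpa using h5

/-- A real test function as a complex Schwartz function. -/
def IsTest.toSchwartz {g : Euc n → ℝ} (hg : IsTest g) : SchwartzMap (Euc n) ℂ :=
  HasCompactSupport.toSchwartzMap (f := fun y => (g y : ℂ)) (hg.2.comp_left (g := Complex.ofReal) (by simp))
    (Complex.ofRealCLM.contDiff.comp hg.1)

open LineDeriv FourierTransform in
theorem IsTest.lineDeriv_toSchwartz {g : Euc n → ℝ} (hg : IsTest g) (i : Fin n) :
    ∂_{(EuclideanSpace.single i (1 : ℝ) : Euc n)} hg.toSchwartz = (hg.pd i).toSchwartz := by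
  ext y
  rw [SchwartzMap.lineDerivOp_apply_eq_fderiv]
  have : (⇑hg.toSchwartz) = Complex.ofRealCLM ∘ g := rfl
  rw [this, fderiv_comp y Complex.ofRealCLM.differentiableAt hg.differentiable.differentiableAt]
  simp
  rfl

open LineDeriv FourierTransform in
theorem IsTest.fourier_pd {g : Euc n → ℝ} (hg : IsTest g) (i : Fin n) (ξ : Euc n) :
    𝓕 (hg.pd i).toSchwartz ξ = (2 * Real.pi * Complex.I) * (ξ i) * 𝓕 hg.toSchwartz ξ := by
  rw [← hg.lineDeriv_toSchwartz i, SchwartzMap.fourier_lineDerivOp_eq]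
  have h : (fun x : Euc n => (inner ℝ x (EuclideanSpace.single i (1 : ℝ)) : ℝ)).HasTemperateGrowth := by fun_prop
  rw [smul_apply, SchwartzMap.smulLeftCLM_apply_apply h]
  simp [EuclideanSpace.inner_single_right, mul_assoc]

theorem IsTest.integral_sq {g : Euc n → ℝ} (hg : IsTest g) :
    ∫ y, g y ^ 2 = ∫ y, ‖hg.toSchwartz y‖ ^ 2 := by
  congr 1; ext y
  have : hg.toSchwartz y = (g y : ℂ) := rfl
  simp [this]

open FourierTransform in
/-- The Gårding inequality for an operator with constant coefficients and injective symbol,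
by Plancherel's theorem. -/
theorem garding_const (a : L → Fin n → J → ℝ) {c : ℝ}
    (hc : ∀ (ξ : Euc n) (z : J → ℝ),
      c * ‖ξ‖ ^ 2 * ∑ j, z j ^ 2 ≤ ∑ l, (∑ i, ∑ j, a l i j * ξ i * z j) ^ 2)
    (φ : J → Euc n → ℝ) (hφ : ∀ j, IsTest (φ j)) :
    c * ∑ j, ∑ i, ∫ y, pd i (φ j) y ^ 2 ≤
      ∑ l, ∫ y, (∑ i, ∑ j, a l i j * pd i (φ j) y) ^ 2 := by
  set Φ : J → SchwartzMap (Euc n) ℂ := fun j => (hφ j).toSchwartz with hΦ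
  set S : L → SchwartzMap (Euc n) ℂ := fun l =>
    ∑ i, ∑ j, (a l i j : ℂ) • ((hφ j).pd i).toSchwartz with hS
  have h1 : ∀ l, ∫ y, (∑ i, ∑ j, a l i j * pd i (φ j) y) ^ 2 = ∫ ξ, ‖𝓕 (S l) ξ‖ ^ 2 := by
    intro l
    rw [SchwartzMap.integral_norm_sq_fourier]
    congr 1; ext y
    have : S l y = ((∑ i, ∑ j, a l i j * pd i (φ j) y : ℝ) : ℂ) := by
      simp only [hS, sum_apply, smul_apply]
      push_cast
      rfl
    rw [this, Complex.norm_real, Real.norm_eq_abs, sq_abs]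
  have h2 : ∀ j i, ∫ y, pd i (φ j) y ^ 2 = ∫ ξ, ‖𝓕 ((hφ j).pd i).toSchwartz ξ‖ ^ 2 := by
    intro j i
    rw [SchwartzMap.integral_norm_sq_fourier, ((hφ j).pd i).integral_sq]
  have hint : ∀ f : SchwartzMap (Euc n) ℂ, Integrable (fun ξ => ‖f ξ‖ ^ 2) volume := fun f =>
    (memLp_two_iff_integrable_sq_norm f.continuous.aestronglyMeasurable).1 (f.memLp 2)
  simp_rw [h1, h2]
  rw [← integral_finsetSum _ (fun l _ => hint _)]
  simp_rw [← integral_finsetSum Finset.univ (fun (i : Fin n) _ => hint (𝓕 ((hφ _).pd i).toSchwartz))]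
  rw [← integral_finsetSum _ (fun j _ => integrable_finsetSum _ fun i _ => hint _),
    ← integral_const_mul]
  refine integral_mono ((integrable_finsetSum _ fun j _ => integrable_finsetSum _ fun i _ =>
    hint _).const_mul _) (integrable_finsetSum _ fun j _ => hint _) fun ξ => ?_
  -- it remains to compare the integrands, where `∂ᵢ` has become the factor `2πi ξᵢ`
  have h3 : ∀ l, 𝓕 (S l) ξ = (2 * Real.pi * Complex.I) *
      ∑ i, ∑ j, (a l i j : ℂ) * (ξ i) * 𝓕 (Φ j) ξ := by
    intro l
    have : 𝓕 (S l) = ∑ i, ∑ j, (a l i j : ℂ) • 𝓕 ((hφ j).pd i).toSchwartz := by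
      simp only [hS]
      change FourierTransform.fourierCLM ℂ _ _ = _
      simp only [map_sum, map_smul]
      rfl
    rw [this]
    simp only [sum_apply, smul_apply, Finset.mul_sum]
    refine Finset.sum_congr rfl fun i _ => Finset.sum_congr rfl fun j _ => ?_
    rw [(hφ j).fourier_pd i, smul_eq_mul]; ring
  simp only [h3, (hφ _).fourier_pd, norm_mul, mul_pow]
  set z : J → ℂ := fun j => 𝓕 (Φ j) ξ
  have hz : ∀ j, 𝓕 (hφ j).toSchwartz ξ = z j := fun _ => rfl
  have hz' : ∀ j, 𝓕 (Φ j) ξ = z j := fun _ => rfl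
  simp only [hz, hz']
  have hn : ∀ w : ℂ, ‖w‖ ^ 2 = w.re ^ 2 + w.im ^ 2 := fun w => by
    rw [← Complex.normSq_eq_norm_sq, Complex.normSq_apply]; ring
  have h4 : ∀ l, ‖∑ i, ∑ j, (a l i j : ℂ) * (ξ i) * z j‖ ^ 2 =
      (∑ i, ∑ j, a l i j * ξ i * (z j).re) ^ 2 + (∑ i, ∑ j, a l i j * ξ i * (z j).im) ^ 2 := by
    intro l
    rw [hn]
    simp [Complex.re_sum, Complex.im_sum, ← Complex.ofReal_mul]
  have h5 := add_le_add (hc ξ fun j => (z j).re) (hc ξ fun j => (z j).im)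
  simp only [h4]
  have h6 : ∑ i, ‖(ξ i : ℂ)‖ ^ 2 = ‖ξ‖ ^ 2 := by
    rw [EuclideanSpace.norm_eq, Real.sq_sqrt (Finset.sum_nonneg fun _ _ => sq_nonneg _)]
    simp
  set κ : ℝ := ‖(2 : ℂ)‖ ^ 2 * ‖(Real.pi : ℂ)‖ ^ 2 * ‖Complex.I‖ ^ 2 with hκ
  have hκ0 : 0 ≤ κ := by positivity
  calc c * ∑ j, ∑ i, κ * ‖(ξ i : ℂ)‖ ^ 2 * ‖z j‖ ^ 2
      = κ * (c * ‖ξ‖ ^ 2 * ∑ j, (z j).re ^ 2 + c * ‖ξ‖ ^ 2 * ∑ j, (z j).im ^ 2) := by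
        rw [← mul_add, ← Finset.sum_add_distrib, ← h6]
        simp only [Finset.mul_sum, Finset.sum_mul, hn (z _)]
        refine Finset.sum_congr rfl fun j _ => Finset.sum_congr rfl fun i _ => ?_
        ring
    _ ≤ κ * _ := mul_le_mul_of_nonneg_left h5 hκ0
    _ = _ := by rw [← Finset.sum_add_distrib, Finset.mul_sum]

theorem inner_toLp_eq {X : Type*} [MeasurableSpace X] {μ : Measure X} {f g : X → ℝ}
    (hf : MemLp f 2 μ) (hg : MemLp g 2 μ) :
    (inner ℝ (hf.toLp f) (hg.toLp g) : ℝ) = ∫ x, f x * g x ∂μ := by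
  rw [L2.inner_def]
  refine integral_congr_ae ?_
  filter_upwards [hf.coeFn_toLp, hg.coeFn_toLp] with x h1 h2
  rw [h1, h2]; simp [mul_comm]

theorem norm_toLp_sq {X : Type*} [MeasurableSpace X] {μ : Measure X} {f : X → ℝ}
    (hf : MemLp f 2 μ) : ‖hf.toLp f‖ ^ 2 = ∫ x, f x ^ 2 ∂μ := by
  rw [← real_inner_self_eq_norm_sq, inner_toLp_eq]
  simp [sq]

theorem abs_integral_mul_le {X : Type*} [MeasurableSpace X] {μ : Measure X} {f g : X → ℝ}
    (hf : MemLp f 2 μ) (hg : MemLp g 2 μ) :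
    |∫ x, f x * g x ∂μ| ≤ ‖hf.toLp f‖ * ‖hg.toLp g‖ := by
  rw [← inner_toLp_eq hf hg]
  exact abs_real_inner_le_norm _ _

/-- A linear functional bounded by a Hilbert space seminorm is an inner product. -/
theorem exists_riesz {X H : Type*} [AddCommGroup X] [Module ℝ X] [NormedAddCommGroup H]
    [InnerProductSpace ℝ H] [CompleteSpace H] (T : X →ₗ[ℝ] H) (f : X →ₗ[ℝ] ℝ) (C : ℝ)
    (hf : ∀ x, |f x| ≤ C * ‖T x‖) : ∃ h : H, ∀ x, f x = inner ℝ h (T x) := by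
  obtain ⟨s, hs⟩ := T.rangeRestrict.exists_rightInverse_of_surjective T.range_rangeRestrict
  have hs' : ∀ p : LinearMap.range T, T (s p) = p := fun p => by
    have := congrArg (fun q => (q p : H)) hs
    simpa using this
  let f' : StrongDual ℝ (LinearMap.range T) := (f ∘ₗ s).mkContinuous C fun p => by
    simpa [hs'] using hf (s p)
  obtain ⟨F, hF, -⟩ := exists_extension_norm_eq (LinearMap.range T) f'
  refine ⟨(InnerProductSpace.toDual ℝ H).symm F, fun x => ?_⟩
  rw [InnerProductSpace.toDual_symm_apply]
  have h1 := hF ⟨T x, LinearMap.mem_range_self T x⟩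
  simp only at h1
  rw [h1]
  have h2 : f (s ⟨T x, LinearMap.mem_range_self T x⟩ - x) = 0 := by
    have := hf (s ⟨T x, LinearMap.mem_range_self T x⟩ - x)
    rw [map_sub T, hs', sub_self, norm_zero, mul_zero] at this
    exact abs_nonpos_iff.1 this
  rw [map_sub, sub_eq_zero] at h2
  exact h2.symm

/-! ### Young's inequality and mollification -/

/-- Young's inequality for nonnegative functions, by Cauchy–Schwarz with respect to the measure
`k (x - y) dy` and Tonelli's theorem. -/
theorem lintegral_conv_sq_le {k f : Euc n → ENNReal} (hk : Measurable k)
    (hf : AEMeasurable f volume) :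
    ∫⁻ x, (∫⁻ y, k (x - y) * f y) ^ 2 ≤ (∫⁻ z, k z) ^ 2 * ∫⁻ y, f y ^ 2 := by
  have hm : ∀ x : Euc n, Measurable fun y => k (x - y) := fun x => by fun_prop
  have h1 : ∀ x : Euc n, (∫⁻ y, k (x - y) * f y) ^ 2
      ≤ (∫⁻ z, k z) * ∫⁻ y, k (x - y) * f y ^ 2 := by
    intro x
    have h2 := ENNReal.lintegral_mul_le_Lp_mul_Lq (volume : Measure (Euc n))
      Real.HolderConjugate.two_two (f := fun y => k (x - y) ^ (1 / 2 : ℝ))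
      (g := fun y => k (x - y) ^ (1 / 2 : ℝ) * f y)
      ((hm x).pow_const _).aemeasurable (((hm x).pow_const _).aemeasurable.mul hf)
    have h3 : ∀ t : ENNReal, t ^ (1 / 2 : ℝ) * t ^ (1 / 2 : ℝ) = t := fun t => by
      rw [← ENNReal.rpow_add_of_nonneg _ _ (by norm_num) (by norm_num)]; norm_num
    have h4 : ∀ t : ENNReal, (t ^ (1 / 2 : ℝ)) ^ (2 : ℝ) = t := fun t => by
      rw [← ENNReal.rpow_mul]; norm_num
    have h5 : ∀ t : ENNReal, (t ^ (1 / 2 : ℝ)) ^ 2 = t := fun t => by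
      rw [sq, h3]
    have e1 : (fun y => k (x - y) ^ (1 / 2 : ℝ)) * (fun y => k (x - y) ^ (1 / 2 : ℝ) * f y)
        = fun y => k (x - y) * f y := by
      funext y; simp only [Pi.mul_apply]; rw [← mul_assoc, h3]
    rw [e1] at h2
    simp only [h4, ENNReal.mul_rpow_of_nonneg _ _ (by norm_num : (0 : ℝ) ≤ 2),
      ENNReal.rpow_two] at h2
    rw [lintegral_sub_left_eq_self k x] at h2
    calc _ ≤ _ := pow_le_pow_left' h2 2
      _ = _ := by rw [mul_pow, h5, h5]
  calc _ ≤ ∫⁻ x, (∫⁻ z, k z) * ∫⁻ y, k (x - y) * f y ^ 2 := lintegral_mono h1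
    _ = (∫⁻ z, k z) * ∫⁻ x, ∫⁻ y, k (x - y) * f y ^ 2 := by
      have hm2 : AEMeasurable (fun p : Euc n × Euc n => k (p.1 - p.2) * f p.2 ^ 2)
          (volume.prod volume) := by
        refine AEMeasurable.mul (by fun_prop) ?_
        exact (hf.pow_const 2).comp_quasiMeasurePreserving Measure.quasiMeasurePreserving_snd
      rw [lintegral_const_mul'' _ hm2.lintegral_prod_right']
    _ = (∫⁻ z, k z) * ∫⁻ y, ∫⁻ x, k (x - y) * f y ^ 2 := by
      rw [lintegral_lintegral_swap]
      refine AEMeasurable.mul (by fun_prop) ?_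
      exact (hf.pow_const 2).comp_quasiMeasurePreserving Measure.quasiMeasurePreserving_snd
    _ = (∫⁻ z, k z) * ∫⁻ y, (∫⁻ z, k z) * f y ^ 2 := by
      congr 1
      refine lintegral_congr fun y => ?_
      rw [lintegral_mul_const _ (by fun_prop), lintegral_sub_right_eq_self k y]
    _ = _ := by
      rw [lintegral_const_mul'' _ (hf.pow_const 2), ← mul_assoc, sq]

theorem eLpNorm_two_sq {X E : Type*} [MeasurableSpace X] {μ : Measure X} [NormedAddCommGroup E]
    (f : X → E) : eLpNorm f 2 μ ^ 2 = ∫⁻ x, ‖f x‖ₑ ^ 2 ∂μ := by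
  rw [eLpNorm_eq_lintegral_rpow_enorm_toReal (by norm_num) (by norm_num)]
  simp only [ENNReal.toReal_ofNat, ENNReal.rpow_two]
  rw [← ENNReal.rpow_two, ← ENNReal.rpow_mul]
  norm_num

/-- Young's inequality `‖κ ⋆ w‖₂ ≤ ‖κ‖₁ ‖w‖₂`, for a function dominated by a convolution. -/
theorem eLpNorm_le_of_le_conv {κ T w : Euc n → ℝ} (hκ : Measurable κ)
    (hw : AEStronglyMeasurable w volume)
    (hT : ∀ x, |T x| ≤ ∫ y, |κ (x - y) * w y|) :
    eLpNorm T 2 volume ≤ (∫⁻ z, ‖κ z‖ₑ) * eLpNorm w 2 volume := by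
  have h1 : ∀ x, ‖T x‖ₑ ≤ ∫⁻ y, ‖κ (x - y)‖ₑ * ‖w y‖ₑ := by
    intro x
    have h2 : ‖T x‖ₑ ≤ ‖∫ y, |κ (x - y) * w y|‖ₑ := by
      rw [enorm_le_iff_norm_le, Real.norm_eq_abs, Real.norm_eq_abs]
      exact (hT x).trans (le_abs_self _)
    refine h2.trans ((enorm_integral_le_lintegral_enorm _).trans (le_of_eq ?_))
    refine lintegral_congr fun y => ?_
    rw [Real.enorm_abs, enorm_mul]
  refine (ENNReal.pow_right_strictMono two_ne_zero).le_iff_le.1 ?_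
  rw [mul_pow, eLpNorm_two_sq, eLpNorm_two_sq]
  refine (lintegral_mono fun x => pow_le_pow_left' (h1 x) 2).trans ?_
  exact lintegral_conv_sq_le hκ.enorm hw.enorm

/-- The convolution of real functions. -/
def conv (w g : Euc n → ℝ) (x : Euc n) : ℝ := ∫ t, w t * g (x - t)

theorem conv_eq (w g : Euc n → ℝ) :
    conv w g = MeasureTheory.convolution w g (ContinuousLinearMap.mul ℝ ℝ) volume := rfl

theorem contDiff_conv {w g : Euc n → ℝ} (hw : LocallyIntegrable w volume) (hg : IsTest g) :
    ContDiff ℝ ∞ (conv w g) := by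
  rw [conv_eq]
  exact hg.2.contDiff_convolution_right (n := (⊤ : ℕ∞)) _ hw hg.1

theorem pd_conv {w g : Euc n → ℝ} (hw : LocallyIntegrable w volume) (hg : IsTest g) (i : Fin n) :
    pd i (conv w g) = conv w (pd i g) := by
  funext x
  have h := hg.2.hasFDerivAt_convolution_right (ContinuousLinearMap.mul ℝ ℝ) hw
    (hg.1.of_le (by simp)) x
  rw [pd, conv_eq, h.fderiv, conv, convolution_def,
    ContinuousLinearMap.integral_apply]
  · rfl
  · have := (hg.2.fderiv (𝕜 := ℝ)).convolutionExists_right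
      ((ContinuousLinearMap.mul ℝ ℝ).precompR (Euc n)) hw (hg.1.continuous_fderiv (by simp))
    exact this x

theorem isTest_conv {w g : Euc n → ℝ} (hw : LocallyIntegrable w volume)
    (hw' : HasCompactSupport w) (hg : IsTest g) : IsTest (conv w g) :=
  ⟨contDiff_conv hw hg, by
    rw [conv_eq]; exact hw'.convolution _ hg.2⟩

/-- The dilation `z ↦ ε⁻ⁿ f(z/ε)`, which preserves integrals. -/
def dil (ε : ℝ) (f : Euc n → ℝ) (z : Euc n) : ℝ := ε⁻¹ ^ n * f (ε⁻¹ • z)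

theorem integral_comp_dil {ε : ℝ} (hε : 0 < ε) (f : Euc n → ℝ) :
    ∫ z, ε⁻¹ ^ n * f (ε⁻¹ • z) = ∫ z, f z := by
  rw [integral_const_mul, Measure.integral_comp_smul]
  simp only [finrank_euclideanSpace, Fintype.card_fin, smul_eq_mul]
  rw [abs_of_nonneg (by positivity), ← mul_assoc]
  rw [mul_inv_cancel₀ (by positivity), one_mul]

theorem isTest_dil {ε : ℝ} (hε : 0 < ε) {f : Euc n → ℝ} (hf : IsTest f) : IsTest (dil ε f) := by
  refine IsTest.mul contDiff_const ⟨hf.1.comp (contDiff_const_smul _), ?_⟩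
  exact hf.2.comp_homeomorph (Homeomorph.smulOfNeZero ε⁻¹ (by positivity))

theorem pd_dil {ε : ℝ} {f : Euc n → ℝ} (hf : IsTest f) (i : Fin n) (z : Euc n) :
    pd i (dil ε f) z = ε⁻¹ ^ n * (ε⁻¹ * pd i f (ε⁻¹ • z)) := by
  have h : HasFDerivAt (fun z : Euc n => f (ε⁻¹ • z))
      ((fderiv ℝ f (ε⁻¹ • z)).comp (ε⁻¹ • ContinuousLinearMap.id ℝ (Euc n))) z :=
    (hf.differentiable.differentiableAt (x := ε⁻¹ • z)).hasFDerivAt.comp z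
      ((hasFDerivAt_id z).const_smul ε⁻¹)
  have h2 := h.const_mul (ε⁻¹ ^ n)
  rw [pd]
  unfold dil
  rw [h2.fderiv]
  simp [pd]

variable (n) in
/-- A test function of integral one. -/
theorem exists_mollifier : ∃ ρ : Euc n → ℝ, IsTest ρ ∧ ∫ z, ρ z = 1 := by
  let b : ContDiffBump (0 : Euc n) := default
  exact ⟨b.normed volume, ⟨b.contDiff_normed, b.hasCompactSupport_normed⟩, b.integral_normed⟩

/-- Weak convergence of mollifications. -/
theorem tendsto_integral_conv {w ψ ρ : Euc n → ℝ} (hw : Integrable w volume)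
    (hψ : IsTest ψ) (hρ : IsTest ρ) (hρ1 : ∫ z, ρ z = 1) {ε : ℕ → ℝ} (hε : ∀ m, 0 < ε m)
    (hε0 : Tendsto ε atTop (𝓝 0)) :
    Tendsto (fun m => ∫ x, ψ x * conv w (dil (ε m) ρ) x) atTop (𝓝 (∫ x, ψ x * w x)) := by
  obtain ⟨C, hC⟩ := hψ.2.exists_bound_of_continuous hψ.continuous
  have hρi : Integrable ρ volume := hρ.continuous.integrable_of_hasCompactSupport hρ.2
  have h1 : ∀ m, ∫ x, ψ x * conv w (dil (ε m) ρ) x =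
      ∫ t, w t * ∫ u, ψ (t + ε m • u) * ρ u := by
    intro m
    have hd := isTest_dil (hε m) hρ
    obtain ⟨D, hD⟩ := hd.2.exists_bound_of_continuous hd.continuous
    have hint : Integrable (fun p : Euc n × Euc n => ψ p.1 * (w p.2 * dil (ε m) ρ (p.1 - p.2)))
        (volume.prod volume) := by
      have h2 : Integrable (fun p : Euc n × Euc n => ψ p.1 * w p.2) (volume.prod volume) :=
        (hψ.continuous.integrable_of_hasCompactSupport hψ.2).mul_prod hw
      have h3 := h2.bdd_mul (c := D) (f := fun p : Euc n × Euc n => dil (ε m) ρ (p.1 - p.2))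
        ((hd.continuous.comp (continuous_fst.sub continuous_snd)).aestronglyMeasurable)
        (Eventually.of_forall fun p => hD _)
      refine h3.congr (Eventually.of_forall fun p => ?_)
      simp only; ring
    calc ∫ x, ψ x * conv w (dil (ε m) ρ) x
        = ∫ x, ∫ t, ψ x * (w t * dil (ε m) ρ (x - t)) := by
          simp only [conv, integral_const_mul]
      _ = ∫ t, ∫ x, ψ x * (w t * dil (ε m) ρ (x - t)) := integral_integral_swap hint
      _ = _ := by
          congr 1; ext t
          rw [← integral_const_mul]
          rw [← integral_add_left_eq_self (fun x => ψ x * (w t * dil (ε m) ρ (x - t))) t]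
          rw [← integral_comp_dil (hε m) (fun u => w t * (ψ (t + ε m • u) * ρ u))]
          congr 1; ext x
          simp only [dil, add_sub_cancel_left, smul_smul, mul_inv_cancel₀ (hε m).ne', one_smul]
          ring
  simp_rw [h1]
  have h4 : ∀ t : Euc n, Tendsto (fun m => ∫ u, ψ (t + ε m • u) * ρ u) atTop (𝓝 (ψ t)) := by
    intro t
    have h5 : ψ t = ∫ u, ψ t * ρ u := by rw [integral_const_mul, hρ1, mul_one]
    rw [h5]
    refine tendsto_integral_of_dominated_convergence (fun u => C * |ρ u|) (fun m => ?_)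
      (hρi.abs.const_mul C) (fun m => Eventually.of_forall fun u => ?_)
      (Eventually.of_forall fun u => ?_)
    · exact ((hψ.continuous.comp (by fun_prop)).mul hρ.continuous).aestronglyMeasurable
    · rw [norm_mul]
      exact mul_le_mul_of_nonneg_right (hC _) (norm_nonneg _)
    · refine Tendsto.mul_const _ ((hψ.continuous.tendsto t).comp ?_)
      have := (hε0.smul_const u).const_add t
      simpa using this
  have h6 : ∫ x, ψ x * w x = ∫ t, w t * ψ t := by simp_rw [mul_comm]
  rw [h6]
  refine tendsto_integral_of_dominated_convergence (fun t => |w t| * (C * ∫ u, |ρ u|))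
    (fun m => ?_) (hw.abs.mul_const _) (fun m => Eventually.of_forall fun t => ?_)
    (Eventually.of_forall fun t => (h4 t).const_mul _)
  · refine hw.aestronglyMeasurable.mul ?_
    have : StronglyMeasurable (Function.uncurry fun t u : Euc n => ψ (t + ε m • u) * ρ u) :=
      Continuous.stronglyMeasurable (by
        have := hψ.continuous; have := hρ.continuous
        unfold Function.uncurry; fun_prop)
    exact this.integral_prod_right.aestronglyMeasurable
  · rw [norm_mul, Real.norm_eq_abs]
    refine mul_le_mul_of_nonneg_left ?_ (abs_nonneg _)
    rw [← integral_const_mul]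
    refine norm_integral_le_of_norm_le (hρi.abs.const_mul C) (Eventually.of_forall fun u => ?_)
    rw [norm_mul]
    exact mul_le_mul_of_nonneg_right (hC _) (norm_nonneg _)

/-! ### Weak derivatives of solutions of first-order systems -/

/-- `w'` is the weak partial derivative `∂ᵢ w`. -/
def WD (i : Fin n) (w w' : Euc n → ℝ) : Prop :=
  ∀ g, IsTest g → ∫ y, pd i g y * w y = - ∫ y, g y * w' y

/-- An `L²` function whose difference quotients are bounded in the weak sense has a weak
derivative in `L²`. -/
theorem exists_WD_of_bound {w : Euc n → ℝ} (hw : MemLp w 2 volume) (i : Fin n) (C : ℝ)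
    (h : ∀ g (hg : IsTest g), |∫ y, pd i g y * w y| ≤ C * ‖(hg.memLp 2).toLp g‖) :
    ∃ w', MemLp w' 2 volume ∧ WD i w w' := by
  -- `g ↦ ∫ ∂ᵢg · w` is bounded in the `L²` norm of `g`, hence represented by an element of `L²`
  let X : Submodule ℝ (Euc n → ℝ) :=
    { carrier := {g | IsTest g}
      add_mem' := fun {a b} ha hb => ⟨ha.1.add hb.1, ha.2.add hb.2⟩
      zero_mem' := ⟨contDiff_const, HasCompactSupport.zero⟩
      smul_mem' := fun c g hg => ⟨contDiff_const.smul hg.1, hg.2.smul_left (f := fun _ => c)⟩ }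
  let T : X →ₗ[ℝ] Lp ℝ 2 (volume : Measure (Euc n)) :=
    { toFun := fun g => (g.2.memLp 2).toLp g.1
      map_add' := fun _ _ => rfl
      map_smul' := fun _ _ => rfl }
  have hint : ∀ g : X, Integrable (fun y => pd i g.1 y * w y) volume := fun g =>
    ((g.2.pd i).memLp 2).integrable_mul hw
  let f : X →ₗ[ℝ] ℝ :=
    { toFun := fun g => ∫ y, pd i g.1 y * w y
      map_add' := fun a b => by
        rw [← integral_add (hint a) (hint b)]
        congr 1; ext y
        have : pd i (a + b : X).1 y = pd i a.1 y + pd i b.1 y := by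
          simp only [pd, Submodule.coe_add]
          rw [fderiv_add a.2.differentiable.differentiableAt b.2.differentiable.differentiableAt]
          rfl
        rw [this]; ring
      map_smul' := fun c a => by
        rw [RingHom.id_apply, smul_eq_mul, ← integral_const_mul]
        congr 1; ext y
        have : pd i (c • a : X).1 y = c * pd i a.1 y := by
          simp only [pd, Submodule.coe_smul]
          rw [fderiv_const_smul a.2.differentiable.differentiableAt]
          rfl
        rw [this]; ring }
  obtain ⟨v, hv⟩ := exists_riesz T f C fun g => h g.1 g.2
  refine ⟨fun y => - v y, (Lp.memLp v).neg, fun g hg => ?_⟩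
  have h1 := hv ⟨g, hg⟩
  have h2 : (inner ℝ v (T ⟨g, hg⟩) : ℝ) = ∫ y, v y * g y := by
    rw [← inner_toLp_eq (Lp.memLp v) (hg.memLp 2), Lp.toLp_coeFn]
    rfl
  rw [h2] at h1
  change ∫ y, pd i g y * w y = _ at h1
  rw [h1, ← integral_neg]
  congr 1; ext y; ring

/-- The coefficients of a first-order system, close to constant coefficients with
injective symbol. -/
structure NearConst (a : L → Fin n → J → Euc n → ℝ) : Prop where
  smooth : ∀ l i j, ContDiff ℝ ∞ (a l i j)
  near : ∃ (a₀ : L → Fin n → J → ℝ) (c : ℝ), 0 < c ∧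
    (∀ (ξ : Euc n) (z : J → ℝ),
      c * ‖ξ‖ ^ 2 * ∑ j, z j ^ 2 ≤ ∑ l, (∑ i, ∑ j, a₀ l i j * ξ i * z j) ^ 2) ∧
    (∀ l i j, HasCompactSupport fun y => a l i j y - a₀ l i j) ∧
    ∀ l y, 4 * Fintype.card L * (∑ i, ∑ j, (a l i j y - a₀ l i j) ^ 2) ≤ c

theorem hasCompactSupport_sum_mul_pd {φ : J → Euc n → ℝ} (hφ : ∀ j, IsTest (φ j))
    (b : Fin n → J → Euc n → ℝ) : HasCompactSupport fun y => ∑ i, ∑ j, b i j y * pd i (φ j) y := by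
  have h : ∀ (s : Finset (Fin n × J)), HasCompactSupport fun y =>
      ∑ p ∈ s, b p.1 p.2 y * pd p.1 (φ p.2) y := by
    intro s
    induction s using Finset.cons_induction with
    | empty =>
      simp only [Finset.sum_empty]
      exact HasCompactSupport.zero
    | cons p s hp ih =>
      simp only [Finset.sum_cons]
      exact HasCompactSupport.add (f := fun y => b p.1 p.2 y * pd p.1 (φ p.2) y)
        (((hφ p.2).pd p.1).2.mul_left) ih
  have := h Finset.univ
  simp only [Fintype.sum_prod_type] at this
  exact this

theorem integrable_sq_of_compact {g : Euc n → ℝ} (h : Continuous g) (h' : HasCompactSupport g) :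
    Integrable (fun y => g y ^ 2) volume :=
  (h.memLp_of_hasCompactSupport (p := 2) h').integrable_sq

theorem integrable_sum_mul_pd_sq {φ : J → Euc n → ℝ} (hφ : ∀ j, IsTest (φ j))
    {b : Fin n → J → Euc n → ℝ} (hb : ∀ i j, Continuous (b i j)) :
    Integrable (fun y => (∑ i, ∑ j, b i j y * pd i (φ j) y) ^ 2) volume :=
  integrable_sq_of_compact (continuous_finsetSum _ fun i _ => continuous_finsetSum _ fun j _ =>
      (hb i j).mul ((hφ j).pd i).continuous) (hasCompactSupport_sum_mul_pd hφ b)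

theorem integral_sum_mul_pd_sq_le {φ : J → Euc n → ℝ} (hφ : ∀ j, IsTest (φ j))
    {b b' : Fin n → J → Euc n → ℝ} (hb : ∀ i j, Continuous (b i j))
    (hb' : ∀ i j, Continuous (b' i j)) :
    ∫ y, (∑ i, ∑ j, b' i j y * pd i (φ j) y) ^ 2 ≤
      2 * (∫ y, (∑ i, ∑ j, b i j y * pd i (φ j) y) ^ 2) +
      2 * ∫ y, (∑ i, ∑ j, (b i j y - b' i j y) * pd i (φ j) y) ^ 2 := by
  have i1 := integrable_sum_mul_pd_sq hφ hb'
  have i2 := integrable_sum_mul_pd_sq hφ hb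
  have i3 := integrable_sum_mul_pd_sq hφ (b := fun i j y => b i j y - b' i j y)
    fun i j => (hb i j).sub (hb' i j)
  rw [← integral_const_mul, ← integral_const_mul,
    ← integral_add (i2.const_mul 2) (i3.const_mul 2)]
  refine integral_mono i1 ((i2.const_mul 2).add (i3.const_mul 2)) fun y => ?_
  have : ∑ i, ∑ j, b' i j y * pd i (φ j) y = (∑ i, ∑ j, b i j y * pd i (φ j) y)
      - ∑ i, ∑ j, (b i j y - b' i j y) * pd i (φ j) y := by
    simp only [← Finset.sum_sub_distrib]
    refine Finset.sum_congr rfl fun i _ => Finset.sum_congr rfl fun j _ => by ring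
  simp only [this]
  generalize ∑ i, ∑ j, b i j y * pd i (φ j) y = s
  generalize ∑ i, ∑ j, (b i j y - b' i j y) * pd i (φ j) y = t
  nlinarith [sq_nonneg (s + t)]

theorem mul_integral_sum_mul_pd_sq_le {φ : J → Euc n → ℝ} (hφ : ∀ j, IsTest (φ j))
    {b : Fin n → J → Euc n → ℝ} (hb : ∀ i j, Continuous (b i j)) {K c : ℝ} (hK : 0 ≤ K)
    (h : ∀ y, K * (∑ i, ∑ j, b i j y ^ 2) ≤ c) :
    K * ∫ y, (∑ i, ∑ j, b i j y * pd i (φ j) y) ^ 2 ≤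
      c * ∑ j, ∑ i, ∫ y, pd i (φ j) y ^ 2 := by
  have hi : ∀ j i, Integrable (fun y => pd i (φ j) y ^ 2) volume := fun j i =>
    integrable_sq_of_compact ((hφ j).pd i).continuous ((hφ j).pd i).2
  have e : ∑ j, ∑ i, ∫ y, pd i (φ j) y ^ 2 = ∫ y, ∑ j, ∑ i, pd i (φ j) y ^ 2 := by
    rw [integral_finsetSum _ (fun j _ => integrable_finsetSum _ fun i _ => hi j i)]
    exact Finset.sum_congr rfl fun j _ => (integral_finsetSum _ (fun i _ => hi j i)).symm
  rw [e, ← integral_const_mul, ← integral_const_mul]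
  refine integral_mono ((integrable_sum_mul_pd_sq hφ hb).const_mul _)
    ((integrable_finsetSum _ fun j _ => integrable_finsetSum _ fun i _ => hi j i).const_mul _)
    fun y => ?_
  have h3 : (∑ i, ∑ j, b i j y * pd i (φ j) y) ^ 2 ≤
      (∑ i, ∑ j, b i j y ^ 2) * ∑ j, ∑ i, pd i (φ j) y ^ 2 := by
    rw [Finset.sum_comm (f := fun j i => pd i (φ j) y ^ 2)]
    simp only [← Finset.sum_product']
    exact Finset.sum_mul_sq_le_sq_mul_sq _ _ _
  have h4 : 0 ≤ ∑ j, ∑ i, pd i (φ j) y ^ 2 :=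
    Finset.sum_nonneg fun _ _ => Finset.sum_nonneg fun _ _ => sq_nonneg _
  calc _ ≤ K * ((∑ i, ∑ j, b i j y ^ 2) * ∑ j, ∑ i, pd i (φ j) y ^ 2) :=
        mul_le_mul_of_nonneg_left h3 hK
    _ = (K * (∑ i, ∑ j, b i j y ^ 2)) * ∑ j, ∑ i, pd i (φ j) y ^ 2 := by ring
    _ ≤ _ := mul_le_mul_of_nonneg_right (h y) h4

/-- The Gårding inequality for nearly constant coefficients. -/
theorem NearConst.garding {a : L → Fin n → J → Euc n → ℝ} (ha : NearConst a) :
    ∃ C : ℝ, 0 ≤ C ∧ ∀ φ : J → Euc n → ℝ, (∀ j, IsTest (φ j)) →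
      ∑ j, ∑ i, ∫ y, pd i (φ j) y ^ 2 ≤
        C * ∑ l, ∫ y, (∑ i, ∑ j, a l i j y * pd i (φ j) y) ^ 2 := by
  obtain ⟨a₀, c, hc, hlow, -, hnear⟩ := ha.near
  -- `a₀ = a + (a₀ - a)`; by the smallness of `a - a₀`, the contribution of the difference is at most
  -- half of the left-hand side of the inequality for `a₀`
  refine ⟨4 / c, by positivity, fun φ hφ => ?_⟩
  have h1 := garding_const a₀ hlow φ hφ
  have hA := fun l => integral_sum_mul_pd_sq_le hφ (b := fun i j => a l i j)
    (b' := fun i j _ => a₀ l i j) (fun i j => (ha.smooth l i j).continuous)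
    (fun i j => continuous_const)
  have hB := fun l => mul_integral_sum_mul_pd_sq_le hφ (b := fun i j y => a l i j y - a₀ l i j)
    (fun i j => (ha.smooth l i j).continuous.sub continuous_const)
    (K := 4 * Fintype.card L) (by positivity) (hnear l)
  have hD0 : 0 ≤ ∑ j, ∑ i, ∫ y, pd i (φ j) y ^ 2 :=
    Finset.sum_nonneg fun _ _ => Finset.sum_nonneg fun _ _ => integral_nonneg fun _ => sq_nonneg _
  have hsum := Finset.sum_le_sum fun l (_ : l ∈ Finset.univ) => hA l
  rw [Finset.sum_add_distrib, ← Finset.mul_sum, ← Finset.mul_sum] at hsum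
  have hB' : 4 * ∑ l, ∫ y, (∑ i, ∑ j, (a l i j y - a₀ l i j) * pd i (φ j) y) ^ 2 ≤
      c * ∑ j, ∑ i, ∫ y, pd i (φ j) y ^ 2 := by
    rcases isEmpty_or_nonempty L with hL | hL
    · simp only [Finset.univ_eq_empty, Finset.sum_empty, mul_zero]
      positivity
    · have h5 := Finset.sum_le_sum fun l (_ : l ∈ Finset.univ) => hB l
      rw [← Finset.mul_sum, Finset.sum_const, Finset.card_univ, nsmul_eq_mul] at h5
      have hpos : (0 : ℝ) < Fintype.card L := by exact_mod_cast Fintype.card_pos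
      refine le_of_mul_le_mul_left ?_ hpos
      linarith
  rw [div_mul_eq_mul_div, le_div_iff₀ hc]
  linarith

theorem MemLp.locInt {w : Euc n → ℝ} (hw : MemLp w 2 volume) : LocallyIntegrable w volume :=
  hw.locallyIntegrable (by norm_num)

/-- The function `y ↦ g (x - y)`. -/
theorem IsTest.sub_left {g : Euc n → ℝ} (hg : IsTest g) (x : Euc n) : IsTest fun y => g (x - y) :=
  ⟨hg.1.comp (contDiff_const.sub contDiff_id), hg.2.comp_homeomorph (Homeomorph.subLeft x)⟩

theorem pd_sub_left {g : Euc n → ℝ} (hg : IsTest g) (x y : Euc n) (i : Fin n) :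
    pd i (fun y => g (x - y)) y = - pd i g (x - y) := by
  have h : HasFDerivAt (fun y : Euc n => g (x - y))
      ((fderiv ℝ g (x - y)).comp (-ContinuousLinearMap.id ℝ (Euc n))) y :=
    (hg.differentiable.differentiableAt (x := x - y)).hasFDerivAt.comp y
      ((hasFDerivAt_id y).const_sub x)
  rw [pd, h.fderiv]
  simp [pd]

/-- The function `κ(z) = ‖z‖ ∂ᵢρ(z)` is scaled like `ρ`, so that its `L¹` norm does not depend on
the scale. -/
theorem lintegral_norm_mul_pd_dil {ρ : Euc n → ℝ} (hρ : IsTest ρ) {ε : ℝ} (hε : 0 < ε)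
    (i : Fin n) (K : ℝ) : ∫⁻ z, ‖K * ‖z‖ * pd i (dil ε ρ) z‖ₑ = ∫⁻ z, ‖K * ‖z‖ * pd i ρ z‖ₑ := by
  have h1 : ∀ f : Euc n → ℝ, IsTest f → Integrable (fun z => K * ‖z‖ * pd i f z) volume :=
    fun f hf => ((continuous_const.mul continuous_norm).mul
      (hf.pd i).continuous).integrable_of_hasCompactSupport (hf.pd i).2.mul_left
  rw [← ofReal_integral_norm_eq_lintegral_enorm (h1 _ (isTest_dil hε hρ)),
    ← ofReal_integral_norm_eq_lintegral_enorm (h1 _ hρ)]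
  rw [← integral_comp_dil hε fun z => ‖K * ‖z‖ * pd i ρ z‖]
  congr 2; ext z
  rw [pd_dil hρ, norm_smul, Real.norm_of_nonneg (by positivity : 0 ≤ ε⁻¹)]
  rw [show K * ‖z‖ * (ε⁻¹ ^ n * (ε⁻¹ * pd i ρ (ε⁻¹ • z))) =
    ε⁻¹ ^ n * (K * (ε⁻¹ * ‖z‖) * pd i ρ (ε⁻¹ • z)) by ring, norm_mul,
    Real.norm_of_nonneg (by positivity : 0 ≤ ε⁻¹ ^ n)]

theorem lintegral_dil {ρ : Euc n → ℝ} (hρ : IsTest ρ) {ε : ℝ} (hε : 0 < ε) :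
    ∫⁻ z, ‖dil ε ρ z‖ₑ = ∫⁻ z, ‖ρ z‖ₑ := by
  have h1 : ∀ f : Euc n → ℝ, IsTest f → Integrable f volume :=
    fun f hf => hf.continuous.integrable_of_hasCompactSupport hf.2
  rw [← ofReal_integral_norm_eq_lintegral_enorm (h1 _ (isTest_dil hε hρ)),
    ← ofReal_integral_norm_eq_lintegral_enorm (h1 _ hρ)]
  rw [← integral_comp_dil hε fun z => ‖ρ z‖]
  congr 2; ext z
  rw [dil, norm_mul, Real.norm_of_nonneg (by positivity : 0 ≤ ε⁻¹ ^ n)]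

theorem integrable_mul_of_test {w g b : Euc n → ℝ} (hw : MemLp w 2 volume) (hb : Continuous b)
    (hg : Continuous g) (hg' : HasCompactSupport g) :
    Integrable (fun y => b y * g y * w y) volume :=
  ((hb.mul hg).memLp_of_hasCompactSupport (p := 2) hg'.mul_left).integrable_mul hw

theorem NearConst.lipschitz {a : L → Fin n → J → Euc n → ℝ} (ha : NearConst a) (l : L) (i : Fin n)
    (j : J) : ∃ K : ℝ, ∀ x y, |a l i j x - a l i j y| ≤ K * ‖x - y‖ := by
  obtain ⟨a₀, -, -, -, hcs, -⟩ := ha.near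
  obtain ⟨C, hC⟩ := ((ha.smooth l i j).sub contDiff_const).lipschitzWith_of_hasCompactSupport
    (hcs l i j) (by simp)
  refine ⟨C, fun x y => ?_⟩
  have := hC.norm_sub_le x y
  simpa using this

/-- The commutator of a mollification with the multiplication by a Lipschitz function is
bounded after one differentiation (Friedrichs). -/
theorem commutator_bound {w ρ b : Euc n → ℝ} (hw : MemLp w 2 volume) (hρ : IsTest ρ)
    (hb : Continuous b) {K : ℝ} (hK : ∀ x y, |b x - b y| ≤ K * ‖x - y‖) (i : Fin n) :
    eLpNorm (fun x => b x * pd i (conv w ρ) x - conv (fun t => b t * w t) (pd i ρ) x) 2 volume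
      ≤ (∫⁻ z, ‖K * ‖z‖ * pd i ρ z‖ₑ) * eLpNorm w 2 volume := by
  refine eLpNorm_le_of_le_conv (κ := fun z => K * ‖z‖ * pd i ρ z)
    ((continuous_const.mul continuous_norm).mul (hρ.pd i).continuous).measurable
    hw.aestronglyMeasurable fun x => ?_
  have ht := (hρ.pd i).sub_left x
  have i1 := integrable_mul_of_test hw (continuous_const (y := b x)) ht.continuous ht.2
  have i2 := integrable_mul_of_test hw hb ht.continuous ht.2
  have i3 := integrable_mul_of_test hw (b := fun y => K * ‖x - y‖) (by fun_prop) ht.continuous ht.2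
  have e : b x * pd i (conv w ρ) x - conv (fun t => b t * w t) (pd i ρ) x =
      ∫ y, (b x - b y) * pd i ρ (x - y) * w y := by
    rw [pd_conv (MemLp.locInt hw) hρ, conv, conv, ← integral_const_mul]
    rw [← integral_sub]
    · congr 1; ext y; ring
    · exact i1.congr (Eventually.of_forall fun y => by simp only; ring)
    · exact i2.congr (Eventually.of_forall fun y => by simp only; ring)
  rw [e, ← Real.norm_eq_abs]
  refine (norm_integral_le_of_norm_le i3.abs (Eventually.of_forall fun y => ?_))
  rw [Real.norm_eq_abs, abs_mul, abs_mul, abs_mul (K * ‖x - y‖ * _), abs_mul (K * ‖x - y‖)]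
  refine mul_le_mul_of_nonneg_right (mul_le_mul_of_nonneg_right ?_ (abs_nonneg _)) (abs_nonneg _)
  exact (hK x y).trans (le_abs_self _)

/-- Interior regularity of order one, in a global formulation: an `L²` solution of a first-order
elliptic system in divergence form with nearly constant coefficients has weak derivatives in `L²`. -/
theorem exists_WD_of_weak {a : L → Fin n → J → Euc n → ℝ} (ha : NearConst a)
    {w : J → Euc n → ℝ} {G : L → Euc n → ℝ} (hw : ∀ j, MemLp (w j) 2 volume)
    (hwc : ∀ j, HasCompactSupport (w j)) (hG : ∀ l, MemLp (G l) 2 volume)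
    (heq : ∀ l g, IsTest g →
      ∫ y, ∑ i, ∑ j, a l i j y * pd i g y * w j y = - ∫ y, g y * G l y) (j : J) (i : Fin n) :
    ∃ w', MemLp w' 2 volume ∧ WD i (w j) w' := by
  obtain ⟨ρ, hρ, hρ1⟩ := exists_mollifier n
  obtain ⟨C, hC0, hC⟩ := ha.garding
  choose K hK using ha.lipschitz
  have hac : ∀ l i j, Continuous (a l i j) := fun l i j => (ha.smooth l i j).continuous
  -- a bound for `aₗᵢⱼ ∂ᵢ(wⱼ ⋆ ρ_ε)` in `L²` that does not depend on `ε`: by the equation this function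
  -- is `Gₗ ⋆ ρ_ε` up to commutators
  let B : L → ENNReal := fun l => (∫⁻ z, ‖ρ z‖ₑ) * eLpNorm (G l) 2 volume +
    ∑ i, ∑ j, (∫⁻ z, ‖K l i j * ‖z‖ * pd i ρ z‖ₑ) * eLpNorm (w j) 2 volume
  have hB : ∀ l, B l < ⊤ := by
    intro l
    have h1 : ∀ {f : Euc n → ℝ}, Continuous f → HasCompactSupport f → ∫⁻ z, ‖f z‖ₑ < ⊤ :=
      fun h h' => (h.integrable_of_hasCompactSupport h').2
    refine ENNReal.add_lt_top.2 ⟨ENNReal.mul_lt_top (h1 hρ.continuous hρ.2) (hG l).2, ?_⟩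
    refine ENNReal.sum_lt_top.2 fun i _ => ENNReal.sum_lt_top.2 fun j _ =>
      ENNReal.mul_lt_top (h1 ?_ (hρ.pd i).2.mul_left) (hw j).2
    exact (continuous_const.mul continuous_norm).mul (hρ.pd i).continuous
  have key : ∀ ε : ℝ, 0 < ε → ∀ l, eLpNorm (fun x => ∑ i, ∑ j, a l i j x *
      pd i (conv (w j) (dil ε ρ)) x) 2 volume ≤ B l := by
    intro ε hε l
    have hd := isTest_dil hε hρ
    set T : Fin n → J → Euc n → ℝ := fun i j x => a l i j x * pd i (conv (w j) (dil ε ρ)) x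
      - conv (fun t => a l i j t * w j t) (pd i (dil ε ρ)) x with hT
    have haw : ∀ i j, LocallyIntegrable (fun t => a l i j t * w j t) volume := fun i j =>
      (MemLp.locInt (hw j)).smul_continuous (hac l i j) |>.congr
        (Eventually.of_forall fun t => mul_comm _ _)
    have hTm : ∀ i j, AEStronglyMeasurable (T i j) volume := fun i j =>
      (((hac l i j).mul ((isTest_conv (MemLp.locInt (hw j)) (hwc j) hd).pd i).continuous).sub
        (contDiff_conv (haw i j) (hd.pd i)).continuous).aestronglyMeasurable
    have e : (fun x => ∑ i, ∑ j, a l i j x * pd i (conv (w j) (dil ε ρ)) x) =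
        conv (G l) (dil ε ρ) + ∑ i, ∑ j, T i j := by
      funext x
      have h1 := heq l _ (hd.sub_left x)
      simp only [pd_sub_left hd] at h1
      have h2 : conv (G l) (dil ε ρ) x =
          ∑ i, ∑ j, conv (fun t => a l i j t * w j t) (pd i (dil ε ρ)) x := by
        have i2 := fun i j => integrable_mul_of_test (hw j) (hac l i j)
          ((hd.pd i).sub_left x).continuous ((hd.pd i).sub_left x).2
        have e1 : conv (G l) (dil ε ρ) x = ∫ y, dil ε ρ (x - y) * G l y := by
          simp only [conv, mul_comm]
        rw [e1, ← neg_inj, ← h1]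
        simp only [conv]
        have e2 : ∀ i j, ∫ t, a l i j t * w j t * pd i (dil ε ρ) (x - t) =
            ∫ t, a l i j t * pd i (dil ε ρ) (x - t) * w j t := fun i j => by
          congr 1; ext t; ring
        simp only [e2]
        simp_rw [← integral_finsetSum Finset.univ (fun j _ => i2 _ j)]
        rw [← integral_finsetSum Finset.univ
          (fun i _ => integrable_finsetSum _ fun j _ => i2 i j)]
        rw [← integral_neg]
        congr 1; ext y
        simp only [← Finset.sum_neg_distrib]
        refine Finset.sum_congr rfl fun i _ => Finset.sum_congr rfl fun j _ => by ring
      simp only [Pi.add_apply, Finset.sum_apply, hT]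
      rw [h2]
      simp only [Finset.sum_sub_distrib]
      ring
    rw [e]
    refine (eLpNorm_add_le ?_ ?_ (by norm_num)).trans (add_le_add ?_ ?_)
    · exact (contDiff_conv (MemLp.locInt (hG l)) hd).continuous.aestronglyMeasurable
    · exact Finset.aestronglyMeasurable_sum _ fun i _ =>
        Finset.aestronglyMeasurable_sum _ fun j _ => hTm i j
    · rw [← lintegral_dil hρ hε]
      refine eLpNorm_le_of_le_conv hd.continuous.measurable (hG l).aestronglyMeasurable fun x => ?_
      rw [conv, ← Real.norm_eq_abs]
      refine (norm_integral_le_integral_norm _).trans (le_of_eq ?_)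
      congr 1; ext y; rw [mul_comm, Real.norm_eq_abs]
    · refine (eLpNorm_sum_le (fun i _ => Finset.aestronglyMeasurable_sum _ fun j _ => hTm i j)
        (by norm_num)).trans (Finset.sum_le_sum fun i _ => ?_)
      refine (eLpNorm_sum_le (fun j _ => hTm i j) (by norm_num)).trans
        (Finset.sum_le_sum fun j _ => ?_)
      rw [← lintegral_norm_mul_pd_dil hρ hε]
      exact commutator_bound (hw j) hd (hac l i j) (hK l i j) i
  -- the Gårding inequality turns this into a uniform bound for all derivatives
  have key2 : ∀ ε : ℝ, 0 < ε → ∫ y, pd i (conv (w j) (dil ε ρ)) y ^ 2 ≤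
      C * ∑ l, (B l).toReal ^ 2 := by
    intro ε hε
    have hd := isTest_dil hε hρ
    have hφ : ∀ j, IsTest (conv (w j) (dil ε ρ)) := fun j =>
      isTest_conv (MemLp.locInt (hw j)) (hwc j) hd
    have h1 := hC _ hφ
    have h2 : ∫ y, pd i (conv (w j) (dil ε ρ)) y ^ 2 ≤
        ∑ j, ∑ i, ∫ y, pd i (conv (w j) (dil ε ρ)) y ^ 2 := by
      refine (Finset.single_le_sum (f := fun i => ∫ y, pd i (conv (w j) (dil ε ρ)) y ^ 2)
        (fun i _ => integral_nonneg fun y => sq_nonneg _) (Finset.mem_univ i)).trans ?_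
      exact Finset.single_le_sum (f := fun j => ∑ i, ∫ y, pd i (conv (w j) (dil ε ρ)) y ^ 2)
        (fun j _ => Finset.sum_nonneg fun i _ => integral_nonneg fun y => sq_nonneg _)
        (Finset.mem_univ j)
    refine h2.trans (h1.trans (mul_le_mul_of_nonneg_left (Finset.sum_le_sum fun l _ => ?_) hC0))
    have hS : MemLp (fun x => ∑ i, ∑ j, a l i j x * pd i (conv (w j) (dil ε ρ)) x) 2 volume :=
      Continuous.memLp_of_hasCompactSupport (continuous_finsetSum _ fun i _ =>
        continuous_finsetSum _ fun j _ => (hac l i j).mul ((hφ j).pd i).continuous)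
        (hasCompactSupport_sum_mul_pd hφ _)
    rw [← norm_toLp_sq hS, Lp.norm_toLp]
    gcongr
    · exact (hB l).ne
    · exact key ε hε l
  -- the bound passes to the limit `ε → 0` in the sense of distributions
  refine exists_WD_of_bound (hw j) i (Real.sqrt (C * ∑ l, (B l).toReal ^ 2)) fun g hg => ?_
  have hwi : Integrable (w j) volume :=
    memLp_one_iff_integrable.1 ((hw j).mono_exponent_of_measure_support_ne_top
      (s := tsupport (w j)) (fun x hx => image_eq_zero_of_notMem_tsupport hx)
      (hwc j).isCompact.measure_ne_top (by norm_num))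
  have hε : ∀ m : ℕ, (0 : ℝ) < 1 / ((m : ℝ) + 1) := fun m => Nat.one_div_pos_of_nat
  have hlim := tendsto_integral_conv hwi (hg.pd i) hρ hρ1 hε tendsto_one_div_add_atTop_nhds_zero_nat
  refine le_of_tendsto hlim.abs (Eventually.of_forall fun m => ?_)
  have hd := isTest_dil (hε m) hρ
  have hφ := isTest_conv (MemLp.locInt (hw j)) (hwc j) hd
  have hip : ∫ x, pd i g x * conv (w j) (dil (1 / ((m : ℝ) + 1)) ρ) x =
      - ∫ x, pd i (conv (w j) (dil (1 / ((m : ℝ) + 1)) ρ)) x * g x := by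
    have := integral_mul_fderiv_eq_neg_fderiv_mul_of_integrable (μ := (volume : Measure (Euc n)))
      (f := conv (w j) (dil (1 / ((m : ℝ) + 1)) ρ)) (g := g) (v := EuclideanSpace.single i 1)
      (((hφ.pd i).memLp 2).integrable_mul (hg.memLp 2))
      ((hφ.memLp 2).integrable_mul ((hg.pd i).memLp 2))
      ((hφ.memLp 2).integrable_mul (hg.memLp 2))
      (fun x _ => hφ.differentiable.differentiableAt) (fun x _ => hg.differentiable.differentiableAt)
    change ∫ x, conv (w j) (dil (1 / ((m : ℝ) + 1)) ρ) x * pd i g x =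
      - ∫ x, pd i (conv (w j) (dil (1 / ((m : ℝ) + 1)) ρ)) x * g x at this
    rw [← this]
    congr 1; ext x; ring
  rw [hip, abs_neg]
  refine (abs_integral_mul_le ((hφ.pd i).memLp 2) (hg.memLp 2)).trans ?_
  refine mul_le_mul_of_nonneg_right (Real.le_sqrt_of_sq_le ?_) (norm_nonneg _)
  rw [norm_toLp_sq]
  exact key2 _ (hε m)

/-! ### Sobolev regularity of compactly supported functions -/

/-- Compactly supported functions with `k` weak derivatives in `L²`. -/
def HS : ℕ → (Euc n → ℝ) → Prop
  | 0, w => MemLp w 2 volume ∧ HasCompactSupport w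
  | k + 1, w => (MemLp w 2 volume ∧ HasCompactSupport w) ∧ ∀ i, ∃ w', WD i w w' ∧ HS k w'

theorem HS.base {k : ℕ} {w : Euc n → ℝ} (h : HS k w) :
    MemLp w 2 volume ∧ HasCompactSupport w := by
  cases k with
  | zero => exact h
  | succ k => exact h.1

theorem HS.of_succ {k : ℕ} : ∀ {w : Euc n → ℝ}, HS (k + 1) w → HS k w := by
  induction k with
  | zero => exact fun h => h.1
  | succ k ih => exact fun h => ⟨h.1, fun i => let ⟨w', h1, h2⟩ := h.2 i; ⟨w', h1, ih h2⟩⟩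

theorem IsTest.integrable_mul {g w : Euc n → ℝ} (hg : IsTest g) (hw : MemLp w 2 volume) :
    Integrable (fun y => g y * w y) volume := (hg.memLp 2).integrable_mul hw

theorem IsTest.wd {g : Euc n → ℝ} (hg : IsTest g) (i : Fin n) : WD i g (TwistedL2.pd i g) := by
  intro f hf
  have := integral_mul_fderiv_eq_neg_fderiv_mul_of_integrable (μ := (volume : Measure (Euc n)))
    (f := f) (g := g) (v := EuclideanSpace.single i 1)
    ((hf.pd i).integrable_mul (hg.memLp 2)) (hf.integrable_mul ((hg.pd i).memLp 2))
    (hf.integrable_mul (hg.memLp 2))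
    (fun x _ => hf.differentiable.differentiableAt) (fun x _ => hg.differentiable.differentiableAt)
  change ∫ x, f x * TwistedL2.pd i g x = - ∫ x, TwistedL2.pd i f x * g x at this
  rw [this, neg_neg]

theorem IsTest.hs {g : Euc n → ℝ} (hg : IsTest g) (k : ℕ) : HS k g := by
  induction k generalizing g with
  | zero => exact ⟨hg.memLp 2, hg.2⟩
  | succ k ih => exact ⟨⟨hg.memLp 2, hg.2⟩, fun i => ⟨_, hg.wd i, ih (hg.pd i)⟩⟩

theorem WD.add {i : Fin n} {w₁ w₂ v₁ v₂ : Euc n → ℝ} (h₁ : WD i w₁ v₁) (h₂ : WD i w₂ v₂)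
    (m₁ : MemLp w₁ 2 volume) (m₂ : MemLp w₂ 2 volume) (m₁' : MemLp v₁ 2 volume)
    (m₂' : MemLp v₂ 2 volume) : WD i (w₁ + w₂) (v₁ + v₂) := by
  intro g hg
  simp only [Pi.add_apply, mul_add]
  rw [integral_add ((hg.pd i).integrable_mul m₁) ((hg.pd i).integrable_mul m₂),
    integral_add (hg.integrable_mul m₁') (hg.integrable_mul m₂'), h₁ g hg, h₂ g hg]
  ring

theorem HS.add {k : ℕ} : ∀ {v w : Euc n → ℝ}, HS k v → HS k w → HS k (v + w) := by
  induction k with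
  | zero => exact fun h1 h2 => ⟨h1.1.add h2.1, h1.2.add h2.2⟩
  | succ k ih =>
    refine fun h1 h2 => ⟨⟨h1.1.1.add h2.1.1, h1.1.2.add h2.1.2⟩, fun i => ?_⟩
    obtain ⟨v', a1, b1⟩ := h1.2 i
    obtain ⟨w', a2, b2⟩ := h2.2 i
    exact ⟨v' + w', a1.add a2 h1.1.1 h2.1.1 b1.base.1 b2.base.1, ih b1 b2⟩

theorem isTest_zero : IsTest (0 : Euc n → ℝ) := ⟨contDiff_const, HasCompactSupport.zero⟩

theorem HS.sum {ι : Type*} {k : ℕ} (s : Finset ι) {w : ι → Euc n → ℝ}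
    (h : ∀ m ∈ s, HS k (w m)) : HS k (∑ m ∈ s, w m) := by
  induction s using Finset.cons_induction with
  | empty => simpa using isTest_zero.hs k
  | cons m s hm ih =>
    rw [Finset.sum_cons]
    exact (h m (by simp)).add (ih fun m' hm' => h m' (by simp [hm']))

theorem memLp_mul_of_compact {m w : Euc n → ℝ} (hm : Continuous m) (hw : MemLp w 2 volume)
    (hc : HasCompactSupport w) : MemLp (fun y => m y * w y) 2 volume := by
  obtain ⟨C, hC⟩ := hc.isCompact.exists_bound_of_continuousOn hm.continuousOn
  refine hw.of_le_mul (c := C) (hm.aestronglyMeasurable.mul hw.aestronglyMeasurable)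
    (Eventually.of_forall fun y => ?_)
  rw [norm_mul]
  by_cases hy : y ∈ tsupport w
  · exact mul_le_mul_of_nonneg_right (hC y hy) (norm_nonneg _)
  · simp [image_eq_zero_of_notMem_tsupport hy]

theorem WD.mul {i : Fin n} {m w w' : Euc n → ℝ} (h : WD i w w') (hm : ContDiff ℝ ∞ m)
    (hw : MemLp w 2 volume) (hw' : MemLp w' 2 volume) :
    WD i (fun y => m y * w y) (fun y => m y * w' y + pd i m y * w y) := by
  intro g hg
  have hmg : IsTest fun y => m y * g y := IsTest.mul hm hg
  have hmg' : IsTest fun y => pd i m y * g y := IsTest.mul (contDiff_pd hm i) hg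
  have h1 := h _ hmg
  have e1 : ∀ y, pd i (fun y => m y * g y) y * w y =
      pd i g y * (m y * w y) + pd i m y * g y * w y := fun y => by
    rw [pd_mul (hm.differentiable (by simp)).differentiableAt hg.differentiable.differentiableAt]
    ring
  have i1 := (IsTest.mul hm (hg.pd i)).integrable_mul hw
  simp only [e1] at h1
  rw [integral_add (i1.congr (Eventually.of_forall fun y => by simp only; ring))
    (hmg'.integrable_mul hw)] at h1
  have e2 : ∀ y, g y * (m y * w' y + pd i m y * w y) =
      m y * g y * w' y + pd i m y * g y * w y := fun y => by ring
  simp only [e2]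
  rw [integral_add (hmg.integrable_mul hw') (hmg'.integrable_mul hw)]
  linarith

theorem HS.mul {k : ℕ} : ∀ {w m : Euc n → ℝ}, HS k w → ContDiff ℝ ∞ m →
    HS k (fun y => m y * w y) := by
  induction k with
  | zero => exact fun h hm => ⟨memLp_mul_of_compact hm.continuous h.1 h.2, h.2.mul_left⟩
  | succ k ih =>
    refine fun {w m} h hm =>
      ⟨⟨memLp_mul_of_compact hm.continuous h.1.1 h.1.2, h.1.2.mul_left⟩, fun i => ?_⟩
    obtain ⟨w', h1, h2⟩ := h.2 i
    exact ⟨_, h1.mul hm h.1.1 h2.base.1, (ih h2 hm).add (ih h.of_succ (contDiff_pd hm i))⟩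

/-- A cutoff function that is one on a neighbourhood of a compact set. -/
theorem exists_cutoff {K : Set (Euc n)} (hK : IsCompact K) :
    ∃ χ : Euc n → ℝ, IsTest χ ∧ ∀ y ∈ K, χ y = 1 ∧ ∀ i, pd i χ y = 0 := by
  obtain ⟨R, hR, hKR⟩ := hK.isBounded.subset_ball_lt 0 0
  let b : ContDiffBump (0 : Euc n) := ⟨R, R + 1, hR, by linarith⟩
  refine ⟨b, ⟨b.contDiff, b.hasCompactSupport⟩, fun y hy => ?_⟩
  have h1 : (b : Euc n → ℝ) =ᶠ[𝓝 y] fun _ => 1 := by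
    filter_upwards [Metric.isOpen_ball.mem_nhds (hKR hy)] with z hz
    exact b.one_of_mem_closedBall (Metric.ball_subset_closedBall hz)
  refine ⟨h1.self_of_nhds, fun i => ?_⟩
  rw [pd, h1.fderiv_eq]; simp

theorem WD.exists_compact {i : Fin n} {w w' : Euc n → ℝ} (h : WD i w w')
    (hw : HasCompactSupport w) (hw' : MemLp w' 2 volume) :
    ∃ v, WD i w v ∧ MemLp v 2 volume ∧ HasCompactSupport v := by
  obtain ⟨χ, hχ, hχ1⟩ := exists_cutoff hw.isCompact
  obtain ⟨C, hC⟩ := hχ.2.exists_bound_of_continuous hχ.continuous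
  refine ⟨fun y => χ y * w' y, fun g hg => ?_, ?_, hχ.2.mul_right⟩
  · have h1 := h _ (IsTest.mul hg.1 hχ)
    rw [show ∫ y, g y * (χ y * w' y) = ∫ y, g y * χ y * w' y by simp only [mul_assoc], ← h1]
    congr 1; ext y
    rw [pd_mul hg.differentiable.differentiableAt hχ.differentiable.differentiableAt]
    by_cases hy : y ∈ tsupport w
    · rw [(hχ1 y hy).1, (hχ1 y hy).2 i]; ring
    · simp [image_eq_zero_of_notMem_tsupport hy]
  · exact hw'.of_le_mul (c := C) (hχ.continuous.aestronglyMeasurable.mul hw'.aestronglyMeasurable)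
      (Eventually.of_forall fun y => by
        rw [norm_mul]; exact mul_le_mul_of_nonneg_right (hC y) (norm_nonneg _))

theorem pd_comm {g : Euc n → ℝ} (hg : ContDiff ℝ ∞ g) (i j : Fin n) (y : Euc n) :
    pd i (pd j g) y = pd j (pd i g) y := by
  have hd : DifferentiableAt ℝ (fderiv ℝ g) y :=
    ((hg.fderiv_right (m := ∞) (by simp)).differentiable (by simp)).differentiableAt
  have e : ∀ j : Fin n, ∀ v, fderiv ℝ (pd j g) y v =
      fderiv ℝ (fderiv ℝ g) y v (EuclideanSpace.single j 1) := fun j v => by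
    have := (hd.hasFDerivAt.clm_apply (hasFDerivAt_const (EuclideanSpace.single j (1 : ℝ)) y)).fderiv
    rw [show pd j g = fun y => fderiv ℝ g y (EuclideanSpace.single j 1) from rfl, this]
    simp
  rw [pd, e, pd, e]
  exact (hg.contDiffAt (x := y)).isSymmSndFDerivAt
    (by simp only [minSmoothness_of_isRCLikeNormedField]; exact WithTop.coe_le_coe.2 (le_top : (2 : ℕ∞) ≤ ⊤)) _ _

/-- Elliptic bootstrapping, in the global formulation. -/
theorem hs_of_weak {a : L → Fin n → J → Euc n → ℝ} (ha : NearConst a) (k : ℕ) :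
    ∀ {w : J → Euc n → ℝ} {G : L → Euc n → ℝ}, (∀ j, HS 0 (w j)) → (∀ l, HS k (G l)) →
    (∀ l g, IsTest g → ∫ y, ∑ i, ∑ j, a l i j y * pd i g y * w j y = - ∫ y, g y * G l y) →
    ∀ j, HS (k + 1) (w j) := by
  induction k with
  | zero =>
    intro w G hw hG heq j
    refine ⟨hw j, fun i => ?_⟩
    obtain ⟨w', h1, h2⟩ := exists_WD_of_weak ha (fun j => (hw j).1) (fun j => (hw j).2)
      (fun l => (hG l).1) heq j i
    obtain ⟨v, h3, h4, h5⟩ := h2.exists_compact (hw j).2 h1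
    exact ⟨v, h3, h4, h5⟩
  | succ k ih =>
    intro w G hw hG heq j₀
    have hw1 : ∀ j, HS (k + 1) (w j) := ih hw (fun l => (hG l).of_succ) heq
    refine ⟨hw j₀, fun i₀ => ?_⟩
    -- the derivatives `∂_{i₀} wⱼ` solve a system with the same coefficients, whose right-hand side
    -- `∂_{i₀} Gₗ - ∂ᵢ((∂_{i₀} aₗᵢⱼ) wⱼ)` has `k` weak derivatives
    choose w' hw' hwk' using fun j => (hw1 j).2 i₀
    choose G' hG' hGk' using fun l => (hG l).2 i₀
    choose h hh hhk using fun l i j => ((hw1 j).mul (contDiff_pd (ha.smooth l i j) i₀)).2 i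
    refine ⟨w' j₀, hw' j₀, ?_⟩
    have hneg : ∀ {f : Euc n → ℝ}, HS k f → HS k (fun y => (-1 : ℝ) * f y) := fun hf =>
      hf.mul contDiff_const
    refine ih (w := w') (G := fun l => G' l + ∑ i, ∑ j, fun y => (-1 : ℝ) * h l i j y)
      (fun j => (hwk' j).base) (fun l => (hGk' l).add (HS.sum _ fun i _ => HS.sum _ fun j _ =>
        hneg (hhk l i j))) (fun l g hg => ?_) j₀
    have t1 : ∀ i j, IsTest fun y => a l i j y * pd i g y := fun i j =>
      IsTest.mul (ha.smooth l i j) (hg.pd i)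
    have t2 : ∀ i j, IsTest fun y => a l i j y * pd i (pd i₀ g) y := fun i j =>
      IsTest.mul (ha.smooth l i j) ((hg.pd i₀).pd i)
    have t3 : ∀ i j, IsTest fun y => pd i₀ (a l i j) y * pd i g y := fun i j =>
      IsTest.mul (contDiff_pd (ha.smooth l i j) i₀) (hg.pd i)
    have s1 : ∀ i j, ∫ y, a l i j y * pd i g y * w' j y =
        -(∫ y, a l i j y * pd i (pd i₀ g) y * w j y) + ∫ y, g y * h l i j y := by
      intro i j
      have e1 := hw' j _ (t1 i j)
      have e2 := hh l i j g hg
      have e3 : ∀ y, pd i₀ (fun y => a l i j y * pd i g y) y * w j y =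
          a l i j y * pd i (pd i₀ g) y * w j y + pd i g y * (pd i₀ (a l i j) y * w j y) := by
        intro y
        rw [pd_mul ((ha.smooth l i j).differentiable (by simp)).differentiableAt
          (hg.pd i).differentiable.differentiableAt, pd_comm hg.1]
        ring
      simp only [e3] at e1
      rw [integral_add ((t2 i j).integrable_mul (hw j).1)
        (((t3 i j).integrable_mul (hw j).1).congr
          (Eventually.of_forall fun y => by simp only; ring))] at e1
      linarith
    have s2 := heq l _ (hg.pd i₀)
    have i1 := fun i j => (t1 i j).integrable_mul (hwk' j).base.1
    have i2 := fun i j => (t2 i j).integrable_mul (hw j).1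
    have s3 := hG' l g hg
    rw [integral_finsetSum _ fun i _ => integrable_finsetSum _ fun j _ => i2 i j] at s2
    simp_rw [integral_finsetSum Finset.univ fun j _ => i2 _ j] at s2
    rw [integral_finsetSum _ fun i _ => integrable_finsetSum _ fun j _ => i1 i j]
    simp_rw [integral_finsetSum Finset.univ fun j _ => i1 _ j, s1]
    have i3 := fun i j => hg.integrable_mul (hhk l i j).base.1
    have e4 : ∀ y, g y * (G' l + ∑ i, ∑ j, fun y => (-1 : ℝ) * h l i j y) y =
        g y * G' l y - ∑ i, ∑ j, g y * h l i j y := by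
      intro y
      simp only [Pi.add_apply, Finset.sum_apply, mul_add, Finset.mul_sum, sub_eq_add_neg,
        ← Finset.sum_neg_distrib]
      congr 1
      refine Finset.sum_congr rfl fun i _ => Finset.sum_congr rfl fun j _ => by ring
    simp only [e4]
    rw [integral_sub (hg.integrable_mul (hGk' l).base.1)
      (integrable_finsetSum _ fun i _ => integrable_finsetSum _ fun j _ => i3 i j),
      integral_finsetSum _ fun i _ => integrable_finsetSum _ fun j _ => i3 i j]
    simp_rw [integral_finsetSum Finset.univ fun j _ => i3 _ j]
    simp only [Finset.sum_add_distrib, Finset.sum_neg_distrib]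
    linarith

theorem HS.integrable {k : ℕ} {w : Euc n → ℝ} (h : HS k w) : Integrable w volume :=
  memLp_one_iff_integrable.1 (h.base.1.mono_exponent_of_measure_support_ne_top
    (s := tsupport w) (fun x hx => image_eq_zero_of_notMem_tsupport hx)
    h.base.2.isCompact.measure_ne_top (by norm_num))

/-- A weak derivative may be tested on smooth functions without compact support. -/
theorem WD.integral_mul {i : Fin n} {w w' : Euc n → ℝ} (h : WD i w w')
    (hw : HasCompactSupport w) (hw' : HasCompactSupport w') {m : Euc n → ℝ}
    (hm : ContDiff ℝ ∞ m) : ∫ y, pd i m y * w y = - ∫ y, m y * w' y := by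
  obtain ⟨χ, hχ, hχ1⟩ := exists_cutoff (hw.isCompact.union hw'.isCompact)
  have h1 := h _ (IsTest.mul hm hχ)
  have e1 : ∀ y, pd i (fun y => m y * χ y) y * w y = pd i m y * w y := fun y => by
    rw [pd_mul (hm.differentiable (by simp)).differentiableAt hχ.differentiable.differentiableAt]
    by_cases hy : y ∈ tsupport w
    · rw [(hχ1 y (Or.inl hy)).1, (hχ1 y (Or.inl hy)).2 i]; ring
    · simp [image_eq_zero_of_notMem_tsupport hy]
  have e2 : ∀ y, m y * χ y * w' y = m y * w' y := fun y => by
    by_cases hy : y ∈ tsupport w'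
    · rw [(hχ1 y (Or.inr hy)).1]; ring
    · simp [image_eq_zero_of_notMem_tsupport hy]
  simpa only [e1, e2] using h1

open FourierTransform Complex

theorem fourier_ofReal {w : Euc n → ℝ} (hw : Integrable w volume) (ξ : Euc n) :
    𝓕 (fun y => (w y : ℂ)) ξ = ((∫ y, Real.cos (2 * Real.pi * inner ℝ y ξ) * w y : ℝ) : ℂ)
      - Complex.I * ((∫ y, Real.sin (2 * Real.pi * inner ℝ y ξ) * w y : ℝ) : ℂ) := by
  have i1 : Integrable (fun y => Real.cos (2 * Real.pi * inner ℝ y ξ) * w y) volume :=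
    hw.bdd_mul (c := 1) (Continuous.aestronglyMeasurable (by fun_prop))
      (Eventually.of_forall fun y => Real.abs_cos_le_one _)
  have i2 : Integrable (fun y => Real.sin (2 * Real.pi * inner ℝ y ξ) * w y) volume :=
    hw.bdd_mul (c := 1) (Continuous.aestronglyMeasurable (by fun_prop))
      (Eventually.of_forall fun y => Real.abs_sin_le_one _)
  rw [Real.fourier_eq', ← integral_complex_ofReal, ← integral_complex_ofReal, ← integral_const_mul,
    ← integral_sub i1.ofReal (i2.ofReal.const_mul _)]
  congr 1; ext y
  rw [Complex.exp_mul_I, smul_eq_mul]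
  push_cast
  rw [show (-2 * (Real.pi : ℂ) * ((inner ℝ y ξ : ℝ) : ℂ)) =
    -(2 * (Real.pi : ℂ) * ((inner ℝ y ξ : ℝ) : ℂ)) by ring, Complex.cos_neg, Complex.sin_neg]
  ring

theorem pd_trig (ξ : Euc n) (i : Fin n) (y : Euc n) :
    pd i (fun y => Real.cos (2 * Real.pi * inner ℝ y ξ)) y =
      - (2 * Real.pi * ξ i) * Real.sin (2 * Real.pi * inner ℝ y ξ) ∧
    pd i (fun y => Real.sin (2 * Real.pi * inner ℝ y ξ)) y =
      (2 * Real.pi * ξ i) * Real.cos (2 * Real.pi * inner ℝ y ξ) := by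
  have h : HasFDerivAt (fun y : Euc n => 2 * Real.pi * inner ℝ y ξ)
      ((2 * Real.pi) • (innerSL ℝ ξ)) y := by
    have := ((innerSL ℝ ξ).hasFDerivAt (x := y)).const_mul (2 * Real.pi)
    refine this.congr_of_eventuallyEq (Eventually.of_forall fun z => ?_)
    simp [real_inner_comm]
  constructor
  · rw [pd, h.cos.fderiv]
    simp [EuclideanSpace.inner_single_right]; ring
  · rw [pd, h.sin.fderiv]
    simp [EuclideanSpace.inner_single_right]; ring

theorem WD.fourier {i : Fin n} {k : ℕ} {w w' : Euc n → ℝ} (h : WD i w w') (hw : HS k w)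
    (hw' : HS k w') (ξ : Euc n) :
    𝓕 (fun y => (w' y : ℂ)) ξ = 2 * Real.pi * ξ i * Complex.I * 𝓕 (fun y => (w y : ℂ)) ξ := by
  rw [fourier_ofReal hw.integrable, fourier_ofReal hw'.integrable]
  have hin : ContDiff ℝ ∞ fun y : Euc n => 2 * Real.pi * inner ℝ y ξ :=
    contDiff_const.mul (contDiff_id.inner ℝ contDiff_const)
  have h1 := h.integral_mul hw.base.2 hw'.base.2 hin.cos
  have h2 := h.integral_mul hw.base.2 hw'.base.2 hin.sin
  simp only [fun y => (pd_trig ξ i y).1, neg_mul] at h1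
  simp only [fun y => (pd_trig ξ i y).2] at h2
  rw [integral_neg] at h1
  have a1 : ∀ f : Euc n → ℝ, (∫ y, 2 * Real.pi * ξ i * f y * w y) =
      2 * Real.pi * ξ i * ∫ y, f y * w y := fun f => by
    rw [← integral_const_mul]; simp only [mul_assoc]
  rw [a1] at h1 h2
  have h1' := congrArg (fun t : ℝ => (t : ℂ)) h1
  have h2' := congrArg (fun t : ℝ => (t : ℂ)) h2
  simp only [Complex.ofReal_neg, Complex.ofReal_mul, Complex.ofReal_ofNat] at h1' h2'
  generalize ((∫ y, Real.cos (2 * Real.pi * inner ℝ y ξ) * w' y : ℝ) : ℂ) = c' at *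
  generalize ((∫ y, Real.sin (2 * Real.pi * inner ℝ y ξ) * w' y : ℝ) : ℂ) = s' at *
  generalize ((∫ y, Real.cos (2 * Real.pi * inner ℝ y ξ) * w y : ℝ) : ℂ) = c at *
  generalize ((∫ y, Real.sin (2 * Real.pi * inner ℝ y ξ) * w y : ℝ) : ℂ) = s at *
  have e : Complex.I * Complex.I = -1 := Complex.I_mul_I
  linear_combination h1' - Complex.I * h2' + (2 * Real.pi * ξ i * s) * e

theorem norm_le_sum_abs (ξ : Euc n) : ‖ξ‖ ≤ ∑ i, |ξ i| := by
  have h : ∑ i, ξ i • (EuclideanSpace.single i (1 : ℝ) : Euc n) = ξ := by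
    ext j; simp [Finset.sum_apply, Pi.single_apply]
  calc ‖ξ‖ = ‖∑ i, ξ i • (EuclideanSpace.single i (1 : ℝ) : Euc n)‖ := by rw [h]
    _ ≤ ∑ i, ‖ξ i • (EuclideanSpace.single i (1 : ℝ) : Euc n)‖ := norm_sum_le _ _
    _ = _ := by simp [norm_smul]

/-- The Fourier transform of a compactly supported function with `k` weak derivatives decays to order
`k`, since the weak derivatives are integrable. -/
theorem HS.fourier_decay {k : ℕ} : ∀ {w : Euc n → ℝ}, HS k w →
    ∃ C, 0 ≤ C ∧ ∀ ξ, ‖ξ‖ ^ k * ‖𝓕 (fun y => (w y : ℂ)) ξ‖ ≤ C := by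
  induction k with
  | zero =>
    refine fun {w} h => ⟨∫ y, ‖(w y : ℂ)‖, integral_nonneg fun _ => norm_nonneg _, fun ξ => ?_⟩
    rw [pow_zero, one_mul]
    exact VectorFourier.norm_fourierIntegral_le_integral_norm _ _ _ _ _
  | succ k ih =>
    intro w h
    choose w' h1 h2 using h.2
    choose C hC0 hC using fun i => ih (h2 i)
    refine ⟨∑ i, C i, Finset.sum_nonneg fun i _ => hC0 i, fun ξ => ?_⟩
    calc ‖ξ‖ ^ (k + 1) * ‖𝓕 (fun y => (w y : ℂ)) ξ‖
        = ‖ξ‖ * (‖ξ‖ ^ k * ‖𝓕 (fun y => (w y : ℂ)) ξ‖) := by ring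
      _ ≤ (∑ i, |ξ i|) * (‖ξ‖ ^ k * ‖𝓕 (fun y => (w y : ℂ)) ξ‖) :=
          mul_le_mul_of_nonneg_right (norm_le_sum_abs ξ) (by positivity)
      _ = ∑ i, ‖ξ‖ ^ k * (|ξ i| * ‖𝓕 (fun y => (w y : ℂ)) ξ‖) := by
          rw [Finset.sum_mul]; exact Finset.sum_congr rfl fun i _ => by ring
      _ ≤ ∑ i, C i := by
          refine Finset.sum_le_sum fun i _ => le_trans ?_ (hC i ξ)
          refine mul_le_mul_of_nonneg_left ?_ (by positivity)
          rw [(h1 i).fourier h.of_succ (h2 i)]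
          simp only [norm_mul, Complex.norm_I, Complex.norm_real, Real.norm_eq_abs,
            Complex.norm_ofNat, mul_one]
          refine mul_le_mul_of_nonneg_right ?_ (norm_nonneg _)
          rw [abs_of_pos Real.pi_pos]
          nlinarith [abs_nonneg (ξ i), Real.pi_gt_three]

theorem integrable_pow_mul_fourier {w : Euc n → ℝ} (h : ∀ k, HS k w) (m : ℕ) :
    Integrable (fun ξ => ‖ξ‖ ^ m * ‖𝓕 (fun y => (w y : ℂ)) ξ‖) volume := by
  have hcont : Continuous (𝓕 (fun y => (w y : ℂ))) := by
    refine (Real.contDiff_fourier (N := 0) fun k hk => ?_).continuous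
    have : k = 0 := by exact_mod_cast nonpos_iff_eq_zero.1 hk
    subst this
    simpa using (h 0).integrable.norm
  obtain ⟨C₁, hC₁0, hC₁⟩ := (h m).fourier_decay
  obtain ⟨C₂, hC₂0, hC₂⟩ := (h (m + (n + 1))).fourier_decay
  have hi : Integrable (fun ξ : Euc n => (2 ^ n * (C₁ + C₂)) * (1 + ‖ξ‖) ^ (-((n : ℝ) + 1))) volume :=
    (integrable_one_add_norm (by simp)).const_mul _
  refine hi.mono' ((continuous_norm.pow m).mul hcont.norm).aestronglyMeasurable
    (Eventually.of_forall fun ξ => ?_)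
  set t := ‖ξ‖ with ht
  set F := ‖𝓕 (fun y => (w y : ℂ)) ξ‖ with hF
  have ht0 : 0 ≤ t := norm_nonneg _
  have hF0 : 0 ≤ F := norm_nonneg _
  rw [Real.norm_of_nonneg (by positivity), Real.rpow_neg (by positivity), ← div_eq_mul_inv,
    le_div_iff₀ (by positivity)]
  have e : (1 + t) ^ ((n : ℝ) + 1) = (1 + t) ^ (n + 1) := by
    rw [← Real.rpow_natCast]; push_cast; rfl
  rw [e]
  have h1 : (1 + t) ^ (n + 1) ≤ 2 ^ n * (1 + t ^ (n + 1)) := by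
    have := add_pow_le zero_le_one ht0 (n + 1)
    simpa using this
  calc t ^ m * F * (1 + t) ^ (n + 1) ≤ t ^ m * F * (2 ^ n * (1 + t ^ (n + 1))) :=
        mul_le_mul_of_nonneg_left h1 (by positivity)
    _ = 2 ^ n * (t ^ m * F + t ^ (m + (n + 1)) * F) := by ring
    _ ≤ _ := mul_le_mul_of_nonneg_left (add_le_add (hC₁ ξ) (hC₂ ξ)) (by positivity)

theorem integral_fourier_mul_eq {f g : Euc n → ℂ} (hf : Integrable f volume)
    (hg : Integrable g volume) : ∫ ξ, 𝓕 f ξ * g ξ = ∫ y, f y * 𝓕 g y := by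
  have := VectorFourier.integral_fourierIntegral_smul_eq_flip (μ := (volume : Measure (Euc n)))
    (ν := (volume : Measure (Euc n))) (L := innerₗ (Euc n)) (f := f) (g := g)
    Real.continuous_fourierChar (by simpa using continuous_inner) hf hg
  simpa [Real.fourier_eq, VectorFourier.fourierIntegral, real_inner_comm] using this

/-- **Sobolev embedding**: a compactly supported function with weak derivatives of all orders in
`L²` agrees almost everywhere with a smooth function. -/
theorem exists_contDiff_of_hs {w : Euc n → ℝ} (h : ∀ k, HS k w) :
    ∃ v : Euc n → ℝ, ContDiff ℝ ∞ v ∧ ∀ᵐ y, w y = v y := by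
  set W : Euc n → ℂ := 𝓕 (fun y => (w y : ℂ)) with hW
  have hWi : Integrable W volume := by
    have := integrable_pow_mul_fourier h 0
    simp only [pow_zero, one_mul] at this
    refine (integrable_norm_iff ?_).1 this
    have hc : Continuous W := by
      refine (Real.contDiff_fourier (N := 0) fun k hk => ?_).continuous
      have : k = 0 := by exact_mod_cast nonpos_iff_eq_zero.1 hk
      subst this
      simpa using (h 0).integrable.norm
    exact hc.aestronglyMeasurable
  have hsm : ContDiff ℝ ∞ (𝓕 W) :=
    Real.contDiff_fourier (N := ⊤) fun k _ => integrable_pow_mul_fourier h k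
  have hsm2 : ContDiff ℝ ∞ fun x => 𝓕 W (-x) := hsm.comp contDiff_neg
  -- Fourier inversion, by duality with test functions
  have hae : ∀ᵐ y, (w y : ℂ) = 𝓕 W (-y) := by
    refine ae_eq_of_integral_contDiff_smul_eq (h 0).integrable.ofReal.locallyIntegrable
      hsm2.continuous.locallyIntegrable fun g hg hgc => ?_
    have hgt : IsTest g := ⟨hg, hgc⟩
    set Ψ : SchwartzMap (Euc n) ℂ := 𝓕⁻ hgt.toSchwartz with hΨ
    have e1 : ∀ y, 𝓕 (Ψ : Euc n → ℂ) y = g y := fun y => by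
      rw [← SchwartzMap.fourier_coe, hΨ, FourierTransform.fourier_fourierInv_eq]
      rfl
    have e2 : ∀ ξ, 𝓕 (fun y => (g (-y) : ℂ)) ξ = Ψ ξ := fun ξ => by
      rw [hΨ, SchwartzMap.fourierInv_coe, Real.fourierInv_eq_fourier_comp_neg]
      rfl
    calc ∫ y, g y • (w y : ℂ) = ∫ y, 𝓕 (Ψ : Euc n → ℂ) y * (w y : ℂ) := by
          simp only [e1, Complex.real_smul]
      _ = ∫ y, Ψ y * W y := integral_fourier_mul_eq Ψ.integrable (h 0).integrable.ofReal
      _ = ∫ y, 𝓕 (fun y => (g (-y) : ℂ)) y * W y := by simp only [e2]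
      _ = ∫ y, (g (-y) : ℂ) * 𝓕 W y := by
          refine integral_fourier_mul_eq ?_ hWi
          have : Integrable g volume := hgt.continuous.integrable_of_hasCompactSupport hgc
          exact this.comp_neg.ofReal
      _ = ∫ y, g y • 𝓕 W (-y) := by
          rw [← integral_neg_eq_self]
          simp
  refine ⟨fun x => (𝓕 W (-x)).re, Complex.reCLM.contDiff.comp hsm2, ?_⟩
  filter_upwards [hae] with y hy
  rw [← hy]; simp

/-! ### Local elliptic regularity -/

theorem IsTest.mul_on {O : Set (Euc n)} (hO : IsOpen O) {χ f : Euc n → ℝ} (hχ : IsTest χ)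
    (hs : tsupport χ ⊆ O) (hf : ContDiffOn ℝ ∞ f O) : IsTest fun y => χ y * f y := by
  refine ⟨contDiff_iff_contDiffAt.2 fun y => ?_, hχ.2.mul_right⟩
  by_cases hy : y ∈ tsupport χ
  · exact hχ.1.contDiffAt.mul (hf.contDiffAt (hO.mem_nhds (hs hy)))
  · refine (contDiffAt_const (c := (0 : ℝ))).congr_of_eventuallyEq ?_
    filter_upwards [(isClosed_tsupport χ).isOpen_compl.mem_nhds hy] with z hz
    rw [image_eq_zero_of_notMem_tsupport hz, zero_mul]

theorem tsupport_pd_subset (χ : Euc n → ℝ) (i : Fin n) : tsupport (pd i χ) ⊆ tsupport χ :=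
  closure_minimal (fun y hy => by
    by_contra h
    refine hy ?_
    have : χ =ᶠ[𝓝 y] fun _ => (0 : ℝ) := by
      filter_upwards [(isClosed_tsupport χ).isOpen_compl.mem_nhds h] with z hz
      exact image_eq_zero_of_notMem_tsupport hz
    rw [pd, this.fderiv_eq]; simp) (isClosed_tsupport χ)

theorem IsTest.memLp_mul_of_local {O : Set (Euc n)} {χ u : Euc n → ℝ} (hχ : IsTest χ)
    (hs : tsupport χ ⊆ O)
    (hu : ∀ K, IsCompact K → K ⊆ O → MemLp u 2 (volume.restrict K)) :
    HS 0 (fun y => χ y * u y) := by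
  refine ⟨?_, hχ.2.mul_right⟩
  have hK : IsCompact (tsupport χ) := hχ.2
  have h1 : MemLp ((tsupport χ).indicator u) 2 volume :=
    (memLp_indicator_iff_restrict hK.measurableSet).2 (hu _ hK hs)
  obtain ⟨C, hC⟩ := hχ.2.exists_bound_of_continuous hχ.continuous
  have h2 : (fun y => χ y * u y) = fun y => χ y * (tsupport χ).indicator u y := by
    ext y
    by_cases hy : y ∈ tsupport χ
    · simp [hy]
    · simp [image_eq_zero_of_notMem_tsupport hy]
  rw [h2]
  refine h1.of_le_mul (c := C) (hχ.continuous.aestronglyMeasurable.mul h1.aestronglyMeasurable)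
    (Eventually.of_forall fun y => ?_)
  rw [norm_mul]; exact mul_le_mul_of_nonneg_right (hC y) (norm_nonneg _)

/-- Localization of a first-order system: `(χ uⱼ)` solves a system with the same principal part
and a right-hand side that contains no derivatives of `u`. -/
theorem weak_eq_mul_cutoff {O : Set (Euc n)} (hO : IsOpen O)
    {a : L → Fin n → J → Euc n → ℝ} {b : L → J → Euc n → ℝ} {f : L → Euc n → ℝ}
    (ha : ∀ l i j, ContDiffOn ℝ ∞ (a l i j) O) (hb : ∀ l j, ContDiffOn ℝ ∞ (b l j) O)
    (hf : ∀ l, ContDiffOn ℝ ∞ (f l) O) {u : J → Euc n → ℝ}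
    (hu : ∀ j K, IsCompact K → K ⊆ O → MemLp (u j) 2 (volume.restrict K))
    (heq : ∀ l g, IsTest g → tsupport g ⊆ O →
      ∫ y, ∑ i, ∑ j, a l i j y * pd i g y * u j y =
        ∫ y, g y * (f l y + ∑ j, b l j y * u j y))
    {χ : Euc n → ℝ} (hχ : IsTest χ) (hs : tsupport χ ⊆ O) (l : L) {g : Euc n → ℝ}
    (hg : IsTest g) :
    ∫ y, ∑ i, ∑ j, a l i j y * pd i g y * (χ y * u j y) =
      - ∫ y, g y * ((∑ i, ∑ j, pd i χ y * a l i j y * u j y) - χ y * f l y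
        - ∑ j, χ y * b l j y * u j y) := by
  have hgχ : IsTest fun y => g y * χ y := IsTest.mul hg.1 hχ
  have hgχs : tsupport (fun y => g y * χ y) ⊆ O := (tsupport_mul_subset_right).trans hs
  have h := heq l _ hgχ hgχs
  have int : ∀ {m : Euc n → ℝ} (c : Euc n → ℝ) (j : J), IsTest m → tsupport m ⊆ O →
      ContDiffOn ℝ ∞ c O → Integrable (fun y => m y * c y * u j y) volume :=
    fun c j hm hms hc => ((hm.mul_on hO hms hc).memLp_mul_of_local
      ((tsupport_mul_subset_left).trans hms) (hu j)).integrable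
  have i1 : ∀ i j, Integrable (fun y => a l i j y * pd i (fun y => g y * χ y) y * u j y) volume :=
    fun i j => by
      refine (int (a l i j) j (hgχ.pd i) ((tsupport_pd_subset _ i).trans hgχs) (ha l i j)).congr
        (Eventually.of_forall fun y => ?_)
      simp only; ring
  have i2 : ∀ i j, Integrable (fun y => g y * (pd i χ y * a l i j y * u j y)) volume :=
    fun i j => by
      refine (int (a l i j) j (IsTest.mul hg.1 (hχ.pd i))
        ((tsupport_mul_subset_right).trans ((tsupport_pd_subset _ i).trans hs)) (ha l i j)).congr
        (Eventually.of_forall fun y => ?_)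
      simp only; ring
  have i3 : Integrable (fun y => g y * (χ y * f l y)) volume :=
    (IsTest.mul hg.1 (hχ.mul_on hO hs (hf l))).continuous.integrable_of_hasCompactSupport
      (IsTest.mul hg.1 (hχ.mul_on hO hs (hf l))).2
  have i4 : ∀ j, Integrable (fun y => g y * (χ y * b l j y * u j y)) volume := fun j => by
    refine (int (b l j) j hgχ hgχs (hb l j)).congr (Eventually.of_forall fun y => ?_)
    simp only; ring
  have e1 : ∀ y, ∑ i, ∑ j, a l i j y * pd i g y * (χ y * u j y) =
      (∑ i, ∑ j, a l i j y * pd i (fun y => g y * χ y) y * u j y)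
        - ∑ i, ∑ j, g y * (pd i χ y * a l i j y * u j y) := fun y => by
    rw [← Finset.sum_sub_distrib]
    refine Finset.sum_congr rfl fun i _ => ?_
    rw [← Finset.sum_sub_distrib]
    refine Finset.sum_congr rfl fun j _ => ?_
    rw [pd_mul hg.differentiable.differentiableAt hχ.differentiable.differentiableAt]
    ring
  have e2 : ∀ y, g y * χ y * (f l y + ∑ j, b l j y * u j y) =
      g y * (χ y * f l y) + ∑ j, g y * (χ y * b l j y * u j y) := fun y => by
    rw [mul_add, Finset.mul_sum, mul_assoc]
    congr 1; exact Finset.sum_congr rfl fun j _ => by ring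
  have e3 : ∀ y, g y * ((∑ i, ∑ j, pd i χ y * a l i j y * u j y) - χ y * f l y
        - ∑ j, χ y * b l j y * u j y) = (∑ i, ∑ j, g y * (pd i χ y * a l i j y * u j y))
        - (g y * (χ y * f l y) + ∑ j, g y * (χ y * b l j y * u j y)) := fun y => by
    rw [mul_sub, mul_sub, Finset.mul_sum, Finset.mul_sum]
    simp only [Finset.mul_sum]; ring
  have s1 := integrable_finsetSum Finset.univ fun i _ =>
    integrable_finsetSum Finset.univ fun j _ => i1 i j
  have s2 := integrable_finsetSum Finset.univ fun i _ =>
    integrable_finsetSum Finset.univ fun j _ => i2 i j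
  have s4 := integrable_finsetSum Finset.univ fun j _ => i4 j
  have s5 : Integrable (fun y => g y * (χ y * f l y) +
      ∑ j, g y * (χ y * b l j y * u j y)) volume := i3.add s4
  simp only [e1, e3]
  rw [integral_sub s1 s2, h, integral_sub s2 s5]
  simp only [e2]
  ring

/-- **Interior elliptic regularity** for overdetermined first-order systems
`-∂ᵢ(aₗᵢⱼ uⱼ) = fₗ + bₗⱼ uⱼ` with injective symbol, understood in the sense of distributions. -/
theorem elliptic_regularity {O : Set (Euc n)} (hO : IsOpen O) {x₀ : Euc n} (hx₀ : x₀ ∈ O)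
    {a : L → Fin n → J → Euc n → ℝ} {b : L → J → Euc n → ℝ} {f : L → Euc n → ℝ}
    (ha : ∀ l i j, ContDiffOn ℝ ∞ (a l i j) O) (hb : ∀ l j, ContDiffOn ℝ ∞ (b l j) O)
    (hf : ∀ l, ContDiffOn ℝ ∞ (f l) O)
    (hsymb : ∀ ξ : Euc n, ξ ≠ 0 → ∀ z : J → ℝ,
      (∀ l, ∑ i, ∑ j, a l i j x₀ * ξ i * z j = 0) → z = 0)
    {u : J → Euc n → ℝ}
    (hu : ∀ j K, IsCompact K → K ⊆ O → MemLp (u j) 2 (volume.restrict K))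
    (heq : ∀ l g, IsTest g → tsupport g ⊆ O →
      ∫ y, ∑ i, ∑ j, a l i j y * pd i g y * u j y =
        ∫ y, g y * (f l y + ∑ j, b l j y * u j y)) :
    ∃ U ∈ 𝓝 x₀, ∃ v : J → Euc n → ℝ, (∀ j, ContDiff ℝ ∞ (v j)) ∧
      ∀ᵐ y, y ∈ U → ∀ j, u j y = v j y := by
  obtain ⟨c, hc, hcs⟩ := exists_symbol_lower_bound (fun l i j => a l i j x₀) hsymb
  have hcont : ∀ l, ContinuousOn (fun y => 4 * (Fintype.card L : ℝ) *
      ∑ i, ∑ j, (a l i j y - a l i j x₀) ^ 2) O := fun l =>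
    continuousOn_const.mul (continuousOn_finsetSum _ fun i _ => continuousOn_finsetSum _ fun j _ =>
      ((ha l i j).continuousOn.sub continuousOn_const).pow 2)
  have hev : ∀ᶠ y in 𝓝 x₀, ∀ l, 4 * (Fintype.card L : ℝ) *
      (∑ i, ∑ j, (a l i j y - a l i j x₀) ^ 2) < c := by
    refine eventually_all.2 fun l => ?_
    refine ((hcont l).continuousAt (hO.mem_nhds hx₀)).eventually_lt_const ?_
    simpa using hc
  obtain ⟨r, hr, hball⟩ := Metric.mem_nhds_iff.1 (inter_mem (hO.mem_nhds hx₀) hev)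
  let ζ : ContDiffBump x₀ := ⟨r / 4, r / 2, by positivity, by linarith⟩
  have hζ : IsTest ζ := ⟨ζ.contDiff, ζ.hasCompactSupport⟩
  have hζs : tsupport ζ ⊆ Metric.ball x₀ r := by
    rw [ζ.tsupport_eq]; exact Metric.closedBall_subset_ball (by simp only [ζ]; linarith)
  have hζO : tsupport ζ ⊆ O := fun y hy => (hball (hζs hy)).1
  -- the coefficients, frozen outside a small ball
  let A : L → Fin n → J → Euc n → ℝ := fun l i j y =>
    a l i j x₀ + ζ y * (a l i j y - a l i j x₀)
  have hA : NearConst A := by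
    refine ⟨fun l i j => contDiff_const.add
      (hζ.mul_on hO hζO ((ha l i j).sub contDiffOn_const)).1, fun l i j => a l i j x₀, c, hc, hcs,
      fun l i j => ?_, fun l y => ?_⟩
    · simp only [A, add_sub_cancel_left]
      exact hζ.2.mul_right
    · simp only [A, add_sub_cancel_left]
      by_cases hy : y ∈ tsupport ζ
      · refine le_trans ?_ ((hball (hζs hy)).2 l).le
        refine mul_le_mul_of_nonneg_left (Finset.sum_le_sum fun i _ => Finset.sum_le_sum fun j _ =>
          ?_) (by positivity)
        rw [mul_pow]
        have h0 := ζ.nonneg' y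
        have h1 : ζ y ≤ 1 := ζ.le_one
        have : (ζ y) ^ 2 ≤ 1 := by nlinarith
        exact mul_le_of_le_one_left (sq_nonneg _) this
      · simp [image_eq_zero_of_notMem_tsupport hy, hc.le]
  have hAeq : ∀ y ∈ Metric.ball x₀ (r / 4), ∀ l i j, A l i j y = a l i j y := fun y hy l i j => by
    simp only [A]
    rw [ζ.one_of_mem_closedBall (Metric.ball_subset_closedBall hy)]; ring
  have hBO : Metric.ball x₀ (r / 4) ⊆ O := fun y hy =>
    (hball (Metric.ball_subset_ball (by linarith) hy)).1
  -- quantifying over all cutoff functions makes the induction work: the right-hand side of the system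
  -- for `χ u` contains products of `u` with derivatives of `χ`
  have key : ∀ k, ∀ χ : Euc n → ℝ, IsTest χ → tsupport χ ⊆ Metric.ball x₀ (r / 4) →
      ∀ j, HS k (fun y => χ y * u j y) := by
    intro k
    induction k with
    | zero => exact fun χ hχ hs j => hχ.memLp_mul_of_local (hs.trans hBO) (hu j)
    | succ k ih =>
      intro χ hχ hs
      have hsO := hs.trans hBO
      refine hs_of_weak hA k (G := fun l => (∑ i, ∑ j, fun y => pd i χ y * a l i j y * u j y) +
        ((fun y => -1 * (χ y * f l y)) + ∑ j, fun y => -1 * (χ y * b l j y * u j y)))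
        (fun j => hχ.memLp_mul_of_local hsO (hu j)) (fun l => ?_) (fun l g hg => ?_)
      · refine HS.add (HS.sum _ fun i _ => HS.sum _ fun j _ => ?_) (HS.add ?_ (HS.sum _ fun j _ => ?_))
        · exact ih _ ((hχ.pd i).mul_on hO ((tsupport_pd_subset _ i).trans hsO) (ha l i j))
            ((tsupport_mul_subset_left).trans ((tsupport_pd_subset _ i).trans hs)) j
        · exact ((hχ.mul_on hO hsO (hf l)).hs k).mul contDiff_const
        · exact (ih _ (hχ.mul_on hO hsO (hb l j))
            ((tsupport_mul_subset_left).trans hs) j).mul contDiff_const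
      · have e1 : ∀ y, ∑ i, ∑ j, A l i j y * pd i g y * (χ y * u j y) =
            ∑ i, ∑ j, a l i j y * pd i g y * (χ y * u j y) := fun y => by
          by_cases hy : y ∈ tsupport χ
          · simp only [hAeq y (hs hy)]
          · simp [image_eq_zero_of_notMem_tsupport hy]
        simp only [e1]
        rw [weak_eq_mul_cutoff hO ha hb hf hu heq hχ hsO l hg]
        congr 2; ext y
        simp only [Pi.add_apply, Finset.sum_apply, neg_one_mul, Finset.sum_neg_distrib]
        ring
  let χ : ContDiffBump x₀ := ⟨r / 16, r / 8, by positivity, by linarith⟩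
  have hχ : IsTest χ := ⟨χ.contDiff, χ.hasCompactSupport⟩
  have hχs : tsupport χ ⊆ Metric.ball x₀ (r / 4) := by
    rw [χ.tsupport_eq]; exact Metric.closedBall_subset_ball (by simp only [χ]; linarith)
  choose v hv hvae using fun j => exists_contDiff_of_hs fun k => key k χ hχ hχs j
  refine ⟨Metric.ball x₀ (r / 16), Metric.ball_mem_nhds _ (by positivity), v, hv, ?_⟩
  have : Countable J := Finite.to_countable
  filter_upwards [ae_all_iff.2 hvae] with y hy hyU j
  rw [← hy j, χ.one_of_mem_closedBall (Metric.ball_subset_closedBall hyU), one_mul]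

end EuclideanAnalysis

/-! ### Sections in local coordinates -/

section Charts

variable {n : ℕ} {M : Type*} [TopologicalSpace M] [ChartedSpace (Euc n) M]
  [IsManifold (𝓡 n) ∞ M]

section Functions

variable {G : Type*} [NormedAddCommGroup G] [NormedSpace ℝ G]

theorem contMDiffAt_chart {c x : M} (hx : x ∈ (chartAt (Euc n) c).source) :
    ContMDiffAt (𝓡 n) 𝓘(ℝ, Euc n) ∞ (chartAt (Euc n) c) x :=
  (contMDiffOn_chart x hx).contMDiffAt ((chartAt (Euc n) c).open_source.mem_nhds hx)

theorem contMDiffAt_chart_symm {c : M} {y : Euc n} (hy : y ∈ (chartAt (Euc n) c).target) :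
    ContMDiffAt 𝓘(ℝ, Euc n) (𝓡 n) ∞ (chartAt (Euc n) c).symm y :=
  (contMDiffOn_chart_symm y hy).contMDiffAt ((chartAt (Euc n) c).open_target.mem_nhds hy)

theorem contDiffAt_comp_chart_symm {f : M → G} {c : M} {y : Euc n}
    (hy : y ∈ (chartAt (Euc n) c).target)
    (hf : ContMDiffAt (𝓡 n) 𝓘(ℝ, G) ∞ f ((chartAt (Euc n) c).symm y)) :
    ContDiffAt ℝ ∞ (fun y => f ((chartAt (Euc n) c).symm y)) y :=
  contMDiffAt_iff_contDiffAt.1 (hf.comp y (contMDiffAt_chart_symm hy))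

theorem contMDiffAt_comp_chart {g : Euc n → G} {c x : M} (hx : x ∈ (chartAt (Euc n) c).source)
    (hg : ContDiffAt ℝ ∞ g (chartAt (Euc n) c x)) :
    ContMDiffAt (𝓡 n) 𝓘(ℝ, G) ∞ (fun x => g (chartAt (Euc n) c x)) x :=
  (contMDiffAt_iff_contDiffAt.2 hg).comp x (contMDiffAt_chart hx)

theorem contMDiffAt_iff_comp_chart_symm {f : M → G} {c : M} {y : Euc n}
    (hy : y ∈ (chartAt (Euc n) c).target) :
    ContMDiffAt (𝓡 n) 𝓘(ℝ, G) ∞ f ((chartAt (Euc n) c).symm y) ↔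
    ContDiffAt ℝ ∞ (fun y => f ((chartAt (Euc n) c).symm y)) y := by
  refine ⟨contDiffAt_comp_chart_symm hy, fun h => ?_⟩
  have hx := (chartAt (Euc n) c).map_target hy
  rw [← (chartAt (Euc n) c).right_inv hy] at h
  refine (contMDiffAt_comp_chart hx h).congr_of_eventuallyEq ?_
  filter_upwards [(chartAt (Euc n) c).open_source.mem_nhds hx] with z hz
  rw [(chartAt (Euc n) c).left_inv hz]

end Functions

section Sections

variable {G : Type*} [NormedAddCommGroup G] [NormedSpace ℝ G]
  {E : M → Type*} [TopologicalSpace (TotalSpace G E)] [∀ x, AddCommGroup (E x)]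
  [∀ x, Module ℝ (E x)] [∀ x, TopologicalSpace (E x)] [FiberBundle G E] [VectorBundle ℝ G E]

variable (n G E) in
/-- The part of the image of the chart around `c` over which the bundle is trivialized by the
preferred trivialization at `c`. -/
def coordDomain (c : M) : Set (Euc n) :=
  (chartAt (Euc n) c).target ∩
    (chartAt (Euc n) c).symm ⁻¹' (trivializationAt G E c).baseSet

theorem isOpen_coordDomain (c : M) : IsOpen (coordDomain n G E c) :=
  (chartAt (Euc n) c).symm.isOpen_inter_preimage (trivializationAt G E c).open_baseSet

theorem chart_mem_coordDomain {c x : M} (hx : x ∈ (chartAt (Euc n) c).source)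
    (hx' : x ∈ (trivializationAt G E c).baseSet) : chartAt (Euc n) c x ∈ coordDomain n G E c :=
  ⟨(chartAt (Euc n) c).map_source hx, by
    rw [Set.mem_preimage, (chartAt (Euc n) c).left_inv hx]; exact hx'⟩

variable (G) in
/-- A section in the chart around `c` and the preferred trivialization at `c`. -/
def secRep (c : M) (σ : (x : M) → E x) (y : Euc n) : G :=
  (trivializationAt G E c).continuousLinearMapAt ℝ ((chartAt (Euc n) c).symm y)
    (σ ((chartAt (Euc n) c).symm y))

/-- The section that is represented by the vector-valued function `g` in the chart around `c` and
the preferred trivialization at `c`; zero outside the domain of the trivialization. -/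
def secOf (E : M → Type*) [TopologicalSpace (TotalSpace G E)] [∀ x, AddCommGroup (E x)]
    [∀ x, Module ℝ (E x)] [∀ x, TopologicalSpace (E x)] [FiberBundle G E] [VectorBundle ℝ G E]
    (c : M) (g : Euc n → G) (x : M) : E x :=
  (trivializationAt G E c).symmL ℝ x (g (chartAt (Euc n) c x))

theorem secRep_secOf {c : M} {g : Euc n → G} {y : Euc n} (hy : y ∈ coordDomain n G E c) :
    secRep G c (secOf E c g) y = g y := by
  rw [secRep, secOf, Trivialization.continuousLinearMapAt_symmL _ hy.2,
    (chartAt (Euc n) c).right_inv hy.1]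

variable [ContMDiffVectorBundle ∞ G E (𝓡 n)]

theorem contMDiffAt_section_iff_secRep {σ : (x : M) → E x} {c : M} {y : Euc n}
    (hy : y ∈ coordDomain n G E c) :
    ContMDiffAt (𝓡 n) ((𝓡 n).prod 𝓘(ℝ, G)) ∞ (fun x => (⟨x, σ x⟩ : TotalSpace G E))
      ((chartAt (Euc n) c).symm y) ↔ ContDiffAt ℝ ∞ (secRep G c σ) y := by
  rw [(trivializationAt G E c).contMDiffAt_section_iff hy.2, contMDiffAt_iff_comp_chart_symm hy.1]
  have he : secRep G c σ =ᶠ[𝓝 y] fun y => ((trivializationAt G E c)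
      ⟨(chartAt (Euc n) c).symm y, σ ((chartAt (Euc n) c).symm y)⟩).2 := by
    filter_upwards [(isOpen_coordDomain (G := G) (E := E) c).mem_nhds hy] with z hz
    rw [secRep, Trivialization.continuousLinearMapAt_apply, Trivialization.coe_linearMapAt_of_mem _ hz.2]
  exact ⟨fun h => h.congr_of_eventuallyEq he, fun h => h.congr_of_eventuallyEq he.symm⟩

theorem contMDiffAt_secOf {c : M} {g : Euc n → G} {y : Euc n} (hy : y ∈ coordDomain n G E c)
    (hg : ContDiffAt ℝ ∞ g y) :
    ContMDiffAt (𝓡 n) ((𝓡 n).prod 𝓘(ℝ, G)) ∞ (fun x => (⟨x, secOf E c g x⟩ : TotalSpace G E))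
      ((chartAt (Euc n) c).symm y) := by
  refine (contMDiffAt_section_iff_secRep hy).2 (hg.congr_of_eventuallyEq ?_)
  filter_upwards [(isOpen_coordDomain (G := G) (E := E) c).mem_nhds hy] with z hz
  exact secRep_secOf hz

variable [T2Space M]

/-- Local sections extend to global ones, after shrinking. -/
theorem exists_global_section {σ : (x : M) → E x} {U : Set M} (hU : IsOpen U) {x₀ : M}
    (hx₀ : x₀ ∈ U)
    (hσ : ContMDiffOn (𝓡 n) ((𝓡 n).prod 𝓘(ℝ, G)) ∞ (fun x => (⟨x, σ x⟩ : TotalSpace G E)) U) :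
    ∃ τ : (x : M) → E x,
      ContMDiff (𝓡 n) ((𝓡 n).prod 𝓘(ℝ, G)) ∞ (fun x => (⟨x, τ x⟩ : TotalSpace G E)) ∧
      ∀ᶠ x in 𝓝 x₀, τ x = σ x := by
  obtain ⟨χ, -, hχ⟩ := (SmoothBumpFunction.nhds_basis_tsupport (I := 𝓡 n) x₀).mem_iff.1
    (hU.mem_nhds hx₀)
  refine ⟨fun x => χ x • σ x,
    ContMDiffOn.smul_section_of_tsupport χ.contMDiff.contMDiffOn hU hχ hσ, ?_⟩
  filter_upwards [χ.eventuallyEq_one] with x hx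
  rw [hx]; simp

theorem exists_global_secOf (E : M → Type*) [TopologicalSpace (TotalSpace G E)]
    [∀ x, AddCommGroup (E x)] [∀ x, Module ℝ (E x)] [∀ x, TopologicalSpace (E x)] [FiberBundle G E]
    [VectorBundle ℝ G E] [ContMDiffVectorBundle ∞ G E (𝓡 n)]
    {c : M} {g : Euc n → G} (hg : ContDiffOn ℝ ∞ g (coordDomain n G E c)) {y : Euc n}
    (hy : y ∈ coordDomain n G E c) :
    ∃ τ : (x : M) → E x,
      ContMDiff (𝓡 n) ((𝓡 n).prod 𝓘(ℝ, G)) ∞ (fun x => (⟨x, τ x⟩ : TotalSpace G E)) ∧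
      ∀ᶠ x in 𝓝 ((chartAt (Euc n) c).symm y), τ x = secOf E c g x := by
  refine exists_global_section (U := (chartAt (Euc n) c).source ∩ (trivializationAt G E c).baseSet)
    ((chartAt (Euc n) c).open_source.inter (trivializationAt G E c).open_baseSet)
    ⟨(chartAt (Euc n) c).map_target hy.1, hy.2⟩ fun x hx => ?_
  have hd := chart_mem_coordDomain (G := G) (E := E) hx.1 hx.2
  have := contMDiffAt_secOf hd
    ((hg _ hd).contDiffAt ((isOpen_coordDomain (G := G) (E := E) c).mem_nhds hd))
  rw [(chartAt (Euc n) c).left_inv hx.1] at this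
  exact this.contMDiffWithinAt

end Sections

/-! ### Vector fields in local coordinates -/

theorem coordDomain_tangent (c : M) :
    coordDomain n (Euc n) (TangentSpace (𝓡 n) : M → Type _) c = (chartAt (Euc n) c).target := by
  ext y
  refine ⟨fun h => h.1, fun h => ⟨h, ?_⟩⟩
  exact (chartAt (Euc n) c).map_target h

theorem mdifferentiableAt_chart_symm {c : M} {y : Euc n} (hy : y ∈ (chartAt (Euc n) c).target) :
    MDifferentiableAt 𝓘(ℝ, Euc n) (𝓡 n) (chartAt (Euc n) c).symm y :=
  (contMDiffAt_chart_symm hy).mdifferentiableAt (by simp)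

theorem symmL_eq_mfderiv {c : M} {y : Euc n} (hy : y ∈ (chartAt (Euc n) c).target) :
    (trivializationAt (Euc n) (TangentSpace (𝓡 n)) c).symmL ℝ ((chartAt (Euc n) c).symm y) =
      mfderiv 𝓘(ℝ, Euc n) (𝓡 n) (chartAt (Euc n) c).symm y := by
  rw [TangentBundle.symmL_trivializationAt ((chartAt (Euc n) c).map_target hy)]
  have := (chartAt (Euc n) c).right_inv hy
  simp only [mfld_simps, mfderivWithin_univ]
  rw [this]

end Charts

/-! ### Differential forms in local coordinates -/

section Alternating

variable {n k : ℕ} {F : Type*} [NormedAddCommGroup F] [NormedSpace ℝ F]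

/-- The coefficients of a form with respect to the standard basis. -/
def altCoeff (n k : ℕ) (F : Type*) [NormedAddCommGroup F] [NormedSpace ℝ F] :
    (Euc n [⋀^Fin k]→L[ℝ] F) →L[ℝ] ((Fin k → Fin n) → F) :=
  ContinuousLinearMap.pi fun I =>
    ContinuousAlternatingMap.apply ℝ (Euc n) F fun m => EuclideanSpace.single (I m) (1 : ℝ)

theorem altCoeff_apply (w : Euc n [⋀^Fin k]→L[ℝ] F) (I : Fin k → Fin n) :
    altCoeff n k F w I = w fun m => EuclideanSpace.single (I m) (1 : ℝ) := rfl

theorem altCoeff_injective : Function.Injective (altCoeff n k F) := by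
  intro w η h
  have : w.toContinuousMultilinearMap.toMultilinearMap =
      η.toContinuousMultilinearMap.toMultilinearMap :=
    Module.Basis.ext_multilinear (fun _ => (EuclideanSpace.basisFun (Fin n) ℝ).toBasis)
      fun I => by simpa [altCoeff_apply] using congrFun h I
  ext v
  exact congrArg (fun f : MultilinearMap ℝ (fun _ : Fin k => Euc n) F => f v) this

variable [FiniteDimensional ℝ F]

instance finiteDimensional_alt : FiniteDimensional ℝ (Euc n [⋀^Fin k]→L[ℝ] F) :=
  FiniteDimensional.of_injective (altCoeff n k F).toLinearMap altCoeff_injective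

/-- Smoothness of a function with values in the alternating maps can be tested on constant
arguments. -/
theorem contDiffAt_alt {X : Type*} [NormedAddCommGroup X] [NormedSpace ℝ X]
    {f : X → Euc n [⋀^Fin k]→L[ℝ] F} {x : X}
    (h : ∀ v, ContDiffAt ℝ ∞ (fun x => f x v) x) : ContDiffAt ℝ ∞ f x := by
  obtain ⟨g, hg⟩ := (altCoeff n k F).toLinearMap.exists_leftInverse_of_injective
    (LinearMap.ker_eq_bot.2 altCoeff_injective)
  have hc : ContDiffAt ℝ ∞ (fun x => altCoeff n k F (f x)) x :=
    contDiffAt_pi.2 fun I => h _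
  have := (LinearMap.toContinuousLinearMap g).contDiff.contDiffAt.comp x hc
  refine this.congr_of_eventuallyEq (Eventually.of_forall fun z => ?_)
  exact (LinearMap.congr_fun hg (f z)).symm

theorem ContDiffAt.alt_apply {X : Type*} [NormedAddCommGroup X] [NormedSpace ℝ X]
    {f : X → Euc n [⋀^Fin k]→L[ℝ] F} {v : Fin k → X → Euc n} {x : X}
    (hf : ContDiffAt ℝ ∞ f x) (hv : ∀ i, ContDiffAt ℝ ∞ (v i) x) :
    ContDiffAt ℝ ∞ (fun x => f x (fun i => v i x)) x := by
  have hexp : ∀ x, f x (fun i => v i x) =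
      ∑ I : Fin k → Fin n, (∏ m, v m x (I m)) • altCoeff n k F (f x) I := fun x => by
    have : ∀ i, v i x = ∑ j, v i x j • (EuclideanSpace.single j (1 : ℝ) : Euc n) := fun i => by
      ext j; simp [Finset.sum_apply, Pi.single_apply]
    conv_lhs => rw [show (fun i => v i x) = fun i => ∑ j, v i x j •
      (EuclideanSpace.single j (1 : ℝ) : Euc n) from funext this]
    have h := (f x).toContinuousMultilinearMap.toMultilinearMap.map_sum
      (fun i j => v i x j • (EuclideanSpace.single j (1 : ℝ) : Euc n))
    refine h.trans (Finset.sum_congr rfl fun I _ => ?_)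
    exact (f x).toContinuousMultilinearMap.map_smul_univ _ _
  simp only [hexp]
  refine ContDiffAt.sum fun I _ => ContDiffAt.smul (contDiffAt_prod fun m _ => ?_) ?_
  · exact ((EuclideanSpace.proj (I m) : Euc n →L[ℝ] ℝ).contDiff.contDiffAt.comp x (hv m))
  · exact (contDiffAt_pi.1 ((altCoeff n k F).contDiff.contDiffAt.comp x hf)) I

end Alternating

section FormRep

variable {n : ℕ} {M : Type*} [TopologicalSpace M] [ChartedSpace (EuclideanSpace ℝ (Fin n)) M]
  [IsManifold (𝓡 n) ∞ M]
  {F : Type*} [NormedAddCommGroup F] [NormedSpace ℝ F]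
  {V : M → Type*} [TopologicalSpace (Bundle.TotalSpace F V)]
  [∀ x, NormedAddCommGroup (V x)] [∀ x, InnerProductSpace ℝ (V x)]
  [FiberBundle F V] [VectorBundle ℝ F V]

/-- A form in the chart around `c` and the preferred trivialization of the bundle at `c`. -/
def formRep (F : Type*) [NormedAddCommGroup F] [NormedSpace ℝ F]
    {V : M → Type*} [TopologicalSpace (Bundle.TotalSpace F V)]
    [∀ x, NormedAddCommGroup (V x)] [∀ x, InnerProductSpace ℝ (V x)]
    [FiberBundle F V] [VectorBundle ℝ F V] (c : M) {k : ℕ} (θ : Form n V k) (y : Euc n) :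
    Euc n [⋀^Fin k]→L[ℝ] F :=
  (((trivializationAt F V c).continuousLinearMapAt ℝ
    ((chartAt (Euc n) c).symm y)).compContinuousAlternatingMap
      (θ ((chartAt (Euc n) c).symm y))).compContinuousLinearMap
    ((trivializationAt (Euc n) (TangentSpace (𝓡 n)) c).symmL ℝ ((chartAt (Euc n) c).symm y))

/-- The form that is represented by `w` in the chart around `c`; zero outside the domain. -/
def formOf (V : M → Type*) [TopologicalSpace (Bundle.TotalSpace F V)]
    [∀ x, NormedAddCommGroup (V x)] [∀ x, InnerProductSpace ℝ (V x)]
    [FiberBundle F V] [VectorBundle ℝ F V] (c : M) {k : ℕ}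
    (w : Euc n → Euc n [⋀^Fin k]→L[ℝ] F) : Form n V k := fun x =>
  (((trivializationAt F V c).symmL ℝ x).compContinuousAlternatingMap
      (w (chartAt (Euc n) c x))).compContinuousLinearMap
    ((trivializationAt (Euc n) (TangentSpace (𝓡 n)) c).continuousLinearMapAt ℝ x)

theorem mem_tangent_baseSet {c : M} {y : Euc n} (hy : y ∈ (chartAt (Euc n) c).target) :
    (chartAt (Euc n) c).symm y ∈
      (trivializationAt (Euc n) (TangentSpace (𝓡 n) : M → Type _) c).baseSet :=
  (chartAt (Euc n) c).map_target hy

theorem formRep_formOf {c : M} {k : ℕ} {w : Euc n → Euc n [⋀^Fin k]→L[ℝ] F} {y : Euc n}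
    (hy : y ∈ coordDomain n F V c) : formRep F c (formOf V c w) y = w y := by
  ext v
  simp only [formRep, formOf, ContinuousAlternatingMap.compContinuousLinearMap_apply,
    ContinuousLinearMap.compContinuousAlternatingMap_coe, Function.comp_def]
  rw [Trivialization.continuousLinearMapAt_symmL _ hy.2, (chartAt (Euc n) c).right_inv hy.1]
  simp only [Trivialization.continuousLinearMapAt_symmL _ (mem_tangent_baseSet hy.1)]

/-- The value of a form in terms of its representation. -/
theorem apply_eq_formRep {c : M} {k : ℕ} (θ : Form n V k) {y : Euc n}
    (hy : y ∈ coordDomain n F V c)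
    (v : Fin k → TangentSpace (𝓡 n) ((chartAt (Euc n) c).symm y)) :
    θ ((chartAt (Euc n) c).symm y) v =
      (trivializationAt F V c).symmL ℝ ((chartAt (Euc n) c).symm y) (formRep F c θ y fun i =>
        (trivializationAt (Euc n) (TangentSpace (𝓡 n)) c).continuousLinearMapAt ℝ
          ((chartAt (Euc n) c).symm y) (v i)) := by
  simp only [formRep, ContinuousAlternatingMap.compContinuousLinearMap_apply,
    ContinuousLinearMap.compContinuousAlternatingMap_coe, Function.comp_def]
  rw [Trivialization.symmL_continuousLinearMapAt _ hy.2]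
  simp only [Trivialization.symmL_continuousLinearMapAt _ (mem_tangent_baseSet hy.1)]

theorem eq_of_formRep_eq {c : M} {k : ℕ} {θ η : Form n V k} {y : Euc n}
    (hy : y ∈ coordDomain n F V c) (h : formRep F c θ y = formRep F c η y) :
    θ ((chartAt (Euc n) c).symm y) = η ((chartAt (Euc n) c).symm y) := by
  ext v; rw [apply_eq_formRep θ hy, apply_eq_formRep η hy, h]

theorem secRep_form_apply {c : M} {k : ℕ} (θ : Form n V k)
    (X : Fin k → (x : M) → TangentSpace (𝓡 n) x) {y : Euc n} (hy : y ∈ (chartAt (Euc n) c).target) :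
    secRep F c (fun x => θ x fun i => X i x) y =
      formRep F c θ y fun i => secRep (Euc n) c (X i) y := by
  simp only [secRep, formRep, ContinuousAlternatingMap.compContinuousLinearMap_apply,
    ContinuousLinearMap.compContinuousAlternatingMap_coe, Function.comp_def]
  simp only [Trivialization.symmL_continuousLinearMapAt _ (mem_tangent_baseSet hy)]

theorem formRep_congr {c : M} {k : ℕ} {θ η : Form n V k} {y : Euc n}
    (h : θ ((chartAt (Euc n) c).symm y) = η ((chartAt (Euc n) c).symm y)) :
    formRep F c θ y = formRep F c η y := by
  rw [formRep, formRep, h]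

theorem formRep_sub {c : M} {k : ℕ} (θ η : Form n V k) (y : Euc n) :
    formRep F c (θ - η) y = formRep F c θ y - formRep F c η y := by
  ext v; simp [formRep]

theorem formRep_zero {c : M} {k : ℕ} (y : Euc n) :
    formRep F c (0 : Form n V k) y = 0 := by
  ext v; simp [formRep]

end FormRep

section FormSmooth

variable {n : ℕ} {M : Type*} [TopologicalSpace M] [ChartedSpace (EuclideanSpace ℝ (Fin n)) M]
  [IsManifold (𝓡 n) ∞ M] [T2Space M]
  {F : Type*} [NormedAddCommGroup F] [NormedSpace ℝ F] [FiniteDimensional ℝ F]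
  {V : M → Type*} [TopologicalSpace (Bundle.TotalSpace F V)]
  [∀ x, NormedAddCommGroup (V x)] [∀ x, InnerProductSpace ℝ (V x)]
  [FiberBundle F V] [VectorBundle ℝ F V] [ContMDiffVectorBundle ∞ F V (𝓡 n)]

theorem mem_tangent_coordDomain {c : M} {y : Euc n} (hy : y ∈ (chartAt (Euc n) c).target) :
    y ∈ coordDomain n (Euc n) (TangentSpace (𝓡 n) : M → Type _) c := by
  rw [coordDomain_tangent]; exact hy

theorem SmoothField.contDiffAt_secRep {X : (x : M) → TangentSpace (𝓡 n) x} (hX : SmoothField X)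
    {c : M} {y : Euc n} (hy : y ∈ (chartAt (Euc n) c).target) :
    ContDiffAt ℝ ∞ (secRep (Euc n) c X) y :=
  (contMDiffAt_section_iff_secRep (mem_tangent_coordDomain hy)).1 (hX _)

theorem SmoothSection.contDiffAt_secRep {σ : (x : M) → V x} (hσ : SmoothSection n F σ)
    {c : M} {y : Euc n} (hy : y ∈ coordDomain n F V c) : ContDiffAt ℝ ∞ (secRep F c σ) y :=
  (contMDiffAt_section_iff_secRep hy).1 (hσ _)

/-- Every smooth vector-valued function on the image of a chart is, near a given point, the
representation of a smooth vector field. -/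
theorem exists_field (c : M) {g : Euc n → Euc n} (hg : ContDiff ℝ ∞ g) {y : Euc n}
    (hy : y ∈ (chartAt (Euc n) c).target) :
    ∃ X : (x : M) → TangentSpace (𝓡 n) x, SmoothField X ∧
      ∀ᶠ z in 𝓝 y, secRep (Euc n) c X z = g z := by
  obtain ⟨X, hX, hXe⟩ := exists_global_secOf (TangentSpace (𝓡 n) : M → Type _) (c := c)
    hg.contDiffOn (mem_tangent_coordDomain hy)
  refine ⟨X, hX, ?_⟩
  filter_upwards [((chartAt (Euc n) c).continuousAt_symm hy).eventually hXe,
    (chartAt (Euc n) c).open_target.mem_nhds hy] with z hz hzt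
  rw [← secRep_secOf (E := (TangentSpace (𝓡 n) : M → Type _)) (g := g)
    (mem_tangent_coordDomain hzt), secRep, secRep, hz]

/-- Every smooth vector-valued function on the coordinate domain is, near a given point, the
representation of a smooth section. -/
theorem exists_section (V : M → Type*) [TopologicalSpace (Bundle.TotalSpace F V)]
    [∀ x, NormedAddCommGroup (V x)] [∀ x, InnerProductSpace ℝ (V x)]
    [FiberBundle F V] [VectorBundle ℝ F V] [ContMDiffVectorBundle ∞ F V (𝓡 n)]
    (c : M) {g : Euc n → F} (hg : ContDiff ℝ ∞ g) {y : Euc n}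
    (hy : y ∈ coordDomain n F V c) :
    ∃ σ : (x : M) → V x, SmoothSection n F σ ∧ ∀ᶠ z in 𝓝 y, secRep F c σ z = g z := by
  obtain ⟨X, hX, hXe⟩ := exists_global_secOf V (c := c) hg.contDiffOn hy
  refine ⟨X, hX, ?_⟩
  filter_upwards [((chartAt (Euc n) c).continuousAt_symm hy.1).eventually hXe,
    (isOpen_coordDomain (G := F) (E := V) c).mem_nhds hy] with z hz hzt
  rw [← secRep_secOf (E := V) (g := g) hzt, secRep, secRep, hz]

theorem SmoothForm.contDiffAt_formRep {k : ℕ} {θ : Form n V k} (hθ : SmoothForm F θ) {c : M}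
    {y : Euc n} (hy : y ∈ coordDomain n F V c) : ContDiffAt ℝ ∞ (formRep F c θ) y := by
  refine contDiffAt_alt fun v => ?_
  choose X hX hXe using fun i => exists_field c (contDiff_const (c := v i)) hy.1
  refine (SmoothSection.contDiffAt_secRep (hθ X hX) hy).congr_of_eventuallyEq ?_
  filter_upwards [eventually_all.2 hXe, (chartAt (Euc n) c).open_target.mem_nhds hy.1]
    with z hz hzt
  rw [secRep_form_apply θ X hzt]
  simp only [hz]

/-- Smoothness of a form, tested in local coordinates around each point. -/
theorem smoothForm_of_formRep {k : ℕ} {θ : Form n V k}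
    (h : ∀ x : M, ∃ c, x ∈ (chartAt (Euc n) c).source ∧ x ∈ (trivializationAt F V c).baseSet ∧
      ContDiffAt ℝ ∞ (formRep F c θ) (chartAt (Euc n) c x)) : SmoothForm F θ := by
  intro X hX x
  obtain ⟨c, hx, hx', hc⟩ := h x
  have hy := chart_mem_coordDomain (G := F) (E := V) hx hx'
  rw [← (chartAt (Euc n) c).left_inv hx]
  refine (contMDiffAt_section_iff_secRep hy).2 ?_
  refine (ContDiffAt.alt_apply hc fun i => (hX i).contDiffAt_secRep hy.1).congr_of_eventuallyEq ?_
  filter_upwards [(chartAt (Euc n) c).open_target.mem_nhds hy.1] with z hzt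
  rw [secRep_form_apply θ X hzt]

/-! ### The Lie bracket in local coordinates -/

theorem mpullback_chart_symm {c : M} {y : Euc n} (hy : y ∈ (chartAt (Euc n) c).target)
    (X : (x : M) → TangentSpace (𝓡 n) x) :
    VectorField.mpullback 𝓘(ℝ, Euc n) (𝓡 n) (chartAt (Euc n) c).symm X y =
      secRep (Euc n) c X y := by
  have hb := mem_tangent_baseSet (c := c) hy
  have key : ((trivializationAt (Euc n) (TangentSpace (𝓡 n) : M → Type _) c).symmL ℝ
      ((chartAt (Euc n) c).symm y)).inverse =
      (trivializationAt (Euc n) (TangentSpace (𝓡 n) : M → Type _) c).continuousLinearMapAt ℝ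
        ((chartAt (Euc n) c).symm y) := by
    have := ContinuousLinearMap.inverse_equiv
      ((trivializationAt (Euc n) (TangentSpace (𝓡 n) : M → Type _) c).continuousLinearEquivAt ℝ
        _ hb).symm
    rwa [Trivialization.symm_continuousLinearEquivAt_eq', ContinuousLinearEquiv.symm_symm,
      Trivialization.coe_continuousLinearEquivAt_eq'] at this
  rw [symmL_eq_mfderiv hy] at key
  exact congrArg (fun L : TangentSpace (𝓡 n) ((chartAt (Euc n) c).symm y) →L[ℝ] Euc n =>
    L (X ((chartAt (Euc n) c).symm y))) key

/-- The Lie bracket of vector fields is computed in coordinates. -/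
theorem secRep_mlieBracket {X Y : (x : M) → TangentSpace (𝓡 n) x} (hX : SmoothField X)
    (hY : SmoothField Y) {c : M} {y : Euc n} (hy : y ∈ (chartAt (Euc n) c).target) :
    secRep (Euc n) c (VectorField.mlieBracket (𝓡 n) X Y) y =
      VectorField.lieBracket ℝ (secRep (Euc n) c X) (secRep (Euc n) c Y) y := by
  have h2 : (2 : ℕ∞ω) ≤ ∞ := WithTop.coe_le_coe.2 (le_top : (2 : ℕ∞) ≤ ⊤)
  have : IsManifold (𝓡 n) (minSmoothness ℝ 2) M := by
    rw [minSmoothness_of_isRCLikeNormedField]; exact IsManifold.of_le h2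
  rw [← mpullback_chart_symm hy, VectorField.mpullback_mlieBracket
    ((hX _).mdifferentiableAt (by simp)) ((hY _).mdifferentiableAt (by simp))
    (contMDiffAt_chart_symm hy) (by
      rw [minSmoothness_of_isRCLikeNormedField]; exact h2)]
  have e : ∀ X : (x : M) → TangentSpace (𝓡 n) x,
      VectorField.mpullback 𝓘(ℝ, Euc n) (𝓡 n) (chartAt (Euc n) c).symm X =ᶠ[𝓝 y]
      secRep (Euc n) c X := fun X => by
    filter_upwards [(chartAt (Euc n) c).open_target.mem_nhds hy] with z hz
    exact mpullback_chart_symm hz X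
  rw [Filter.EventuallyEq.mlieBracket_vectorField_eq (e X) (e Y)]
  have h3 : ∀ V W : (x : Euc n) → TangentSpace 𝓘(ℝ, Euc n) x,
      VectorField.mlieBracket 𝓘(ℝ, Euc n) V W = VectorField.lieBracket ℝ V W := fun V W => by
    rw [← VectorField.mlieBracketWithin_univ, VectorField.mlieBracketWithin_eq_lieBracketWithin]
    exact VectorField.lieBracketWithin_univ
  exact congrFun (h3 _ _) y

end FormSmooth

/-! ### The connection in local coordinates -/

theorem contDiffAt_clm {X G H : Type*} [NormedAddCommGroup X] [NormedSpace ℝ X]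
    [NormedAddCommGroup G] [NormedSpace ℝ G] [NormedAddCommGroup H] [NormedSpace ℝ H]
    [FiniteDimensional ℝ G] {f : X → G →L[ℝ] H} {x : X}
    (h : ∀ v, ContDiffAt ℝ ∞ (fun x => f x v) x) : ContDiffAt ℝ ∞ f x := by
  let d := Module.finrank ℝ G
  have hd : d = Module.finrank ℝ (Fin d → ℝ) := (Module.finrank_fin_fun ℝ).symm
  let e₁ := ContinuousLinearEquiv.ofFinrankEq hd
  let e₂ := (e₁.arrowCongr (1 : H ≃L[ℝ] H)).trans (ContinuousLinearEquiv.piRing (Fin d))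
  rw [← Function.id_comp f, ← e₂.symm_comp_self]
  exact e₂.symm.contDiff.contDiffAt.comp x (contDiffAt_pi.mpr fun i => h _)

section Connection

variable {n : ℕ} {M : Type*} [TopologicalSpace M] [ChartedSpace (EuclideanSpace ℝ (Fin n)) M]
  [IsManifold (𝓡 n) ∞ M]
  {F : Type*} [NormedAddCommGroup F] [NormedSpace ℝ F] [FiniteDimensional ℝ F]
  {V : M → Type*} [TopologicalSpace (Bundle.TotalSpace F V)]
  [∀ x, NormedAddCommGroup (V x)] [∀ x, InnerProductSpace ℝ (V x)]
  [FiberBundle F V] [VectorBundle ℝ F V]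

/-- The derivatives of the sections that are constant in the preferred trivialization at `c`. -/
def connCol (D : CovariantDerivative (𝓡 n) F V) (c : M) (f : F) (y : Euc n) : Euc n →L[ℝ] F :=
  ((trivializationAt F V c).continuousLinearMapAt ℝ ((chartAt (Euc n) c).symm y)).comp
    ((D (secOf V c fun _ : Euc n => f) ((chartAt (Euc n) c).symm y)).comp
      ((trivializationAt (Euc n) (TangentSpace (𝓡 n)) c).symmL ℝ ((chartAt (Euc n) c).symm y)))

/-- The connection form of `D` in the chart around `c` and the preferred trivialization at `c`. -/
def connForm (D : CovariantDerivative (𝓡 n) F V) (c : M) (y : Euc n) : Euc n →L[ℝ] F →L[ℝ] F :=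
  ∑ a, (ContinuousLinearMap.smulRightL ℝ F F
    (LinearMap.toContinuousLinearMap ((Module.finBasis ℝ F).coord a))).comp
      (connCol D c (Module.finBasis ℝ F a) y)

theorem connForm_apply (D : CovariantDerivative (𝓡 n) F V) (c : M) (y v : Euc n) (f : F) :
    connForm D c y v f = ∑ a, (Module.finBasis ℝ F).coord a f •
      connCol D c (Module.finBasis ℝ F a) y v := by
  simp [connForm]

variable [T2Space M] [ContMDiffVectorBundle ∞ F V (𝓡 n)]

theorem SmoothSection.mdifferentiableAt {σ : (x : M) → V x} (hσ : SmoothSection n F σ) (x : M) :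
    MDifferentiableAt (𝓡 n) ((𝓡 n).prod 𝓘(ℝ, F))
      (fun x => (⟨x, σ x⟩ : Bundle.TotalSpace F V)) x := (hσ x).mdifferentiableAt (by simp)

theorem mdifferentiableAt_secOf {c : M} {g : Euc n → F} (hg : ContDiff ℝ ∞ g) {y : Euc n}
    (hy : y ∈ coordDomain n F V c) : MDifferentiableAt (𝓡 n) ((𝓡 n).prod 𝓘(ℝ, F))
      (fun x => (⟨x, secOf V c g x⟩ : Bundle.TotalSpace F V)) ((chartAt (Euc n) c).symm y) :=
  (contMDiffAt_secOf hy hg.contDiffAt).mdifferentiableAt (by simp)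

theorem smoothSection_conn (D : CovariantDerivative (𝓡 n) F V) [D.ContMDiffCovariantDerivative ∞]
    {σ : (x : M) → V x} (hσ : SmoothSection n F σ) {X : (x : M) → TangentSpace (𝓡 n) x}
    (hX : SmoothField X) : SmoothSection n F fun x => D σ x (X x) := by
  have h := (CovariantDerivative.ContMDiffCovariantDerivative.contMDiff
    (cov := D) (k := ∞)).contMDiff (σ := σ) (by simpa using hσ.contMDiffOn)
  exact ContMDiff.clm_bundle_apply (contMDiffOn_univ.1 h) hX

theorem contDiffAt_connCol (D : CovariantDerivative (𝓡 n) F V) [D.ContMDiffCovariantDerivative ∞]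
    (c : M) (f : F) {y : Euc n} (hy : y ∈ coordDomain n F V c) :
    ContDiffAt ℝ ∞ (connCol D c f) y := by
  refine contDiffAt_clm fun v => ?_
  obtain ⟨τ, hτ, hτe⟩ := exists_global_secOf V (c := c) (g := fun _ => f) contDiffOn_const hy
  obtain ⟨X, hX, hXe⟩ := exists_field c (contDiff_const (c := v)) hy.1
  refine (SmoothSection.contDiffAt_secRep (smoothSection_conn D hτ hX) hy).congr_of_eventuallyEq ?_
  filter_upwards [((chartAt (Euc n) c).continuousAt_symm hy.1).eventually
    (eventually_eventually_nhds.2 hτe), hXe,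
    (isOpen_coordDomain (G := F) (E := V) c).mem_nhds hy] with z hz hXz hzd
  have h1 : D τ ((chartAt (Euc n) c).symm z) =
      D (secOf V c fun _ : Euc n => f) ((chartAt (Euc n) c).symm z) :=
    D.isCovariantDerivativeOnUniv.congr_of_eventuallyEq (SmoothSection.mdifferentiableAt hτ _)
      (mdifferentiableAt_secOf contDiff_const hzd) Filter.univ_mem hz
  have h2 : (trivializationAt (Euc n) (TangentSpace (𝓡 n)) c).symmL ℝ
      ((chartAt (Euc n) c).symm z) v = X ((chartAt (Euc n) c).symm z) := by
    rw [← hXz, secRep, Trivialization.symmL_continuousLinearMapAt _ (mem_tangent_baseSet hzd.1)]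
  simp only [connCol, secRep, ContinuousLinearMap.comp_apply, h2, h1]

theorem contDiffAt_connForm (D : CovariantDerivative (𝓡 n) F V) [D.ContMDiffCovariantDerivative ∞]
    (c : M) {y : Euc n} (hy : y ∈ coordDomain n F V c) : ContDiffAt ℝ ∞ (connForm D c) y :=
  ContDiffAt.sum fun _ _ => contDiffAt_const.clm_comp (contDiffAt_connCol D c _ hy)

theorem conn_sum (D : CovariantDerivative (𝓡 n) F V) {ι : Type*} (s : Finset ι)
    {σ : ι → (x : M) → V x} {x : M}
    (hσ : ∀ a ∈ s, MDifferentiableAt (𝓡 n) ((𝓡 n).prod 𝓘(ℝ, F))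
      (fun x => (⟨x, σ a x⟩ : Bundle.TotalSpace F V)) x) :
    D (fun x => ∑ a ∈ s, σ a x) x = ∑ a ∈ s, D (σ a) x := by
  induction s using Finset.cons_induction with
  | empty =>
    simp only [Finset.sum_empty]
    exact congrFun D.zero x
  | cons a s ha ih =>
    simp only [Finset.sum_cons]
    have h1 := hσ a (by simp)
    have h2 := MDifferentiableAt.sum_section (s := s) fun b hb => hσ b (by simp [hb])
    rw [← ih fun b hb => hσ b (by simp [hb])]
    exact D.isCovariantDerivativeOnUniv.add h1 h2

/-- The connection in local coordinates is `d + A`, with the connection form `A`. -/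
theorem secRep_conn (D : CovariantDerivative (𝓡 n) F V) {σ : (x : M) → V x}
    (hσ : SmoothSection n F σ) {X : (x : M) → TangentSpace (𝓡 n) x} {c : M} {y : Euc n}
    (hy : y ∈ coordDomain n F V c) :
    secRep F c (fun x => D σ x (X x)) y = fderiv ℝ (secRep F c σ) y (secRep (Euc n) c X y)
      + connForm D c y (secRep (Euc n) c X y) (secRep F c σ y) := by
  set φ := chartAt (Euc n) c with hφ
  set x := φ.symm y with hx
  set b := Module.finBasis ℝ F
  let q : Fin (Module.finrank ℝ F) → M → ℝ := fun a x' => b.coord a (secRep F c σ (φ x'))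
  have hxs : x ∈ φ.source := φ.map_target hy.1
  have hφx : φ x = y := φ.right_inv hy.1
  have hs := hσ.contDiffAt_secRep hy
  have hcoord : ∀ a, ContDiff ℝ ∞ fun f => b.coord a f := fun a =>
    (LinearMap.toContinuousLinearMap (b.coord a)).contDiff
  have hq : ∀ a, ContMDiffAt (𝓡 n) 𝓘(ℝ, ℝ) ∞ (q a) x := fun a =>
    contMDiffAt_comp_chart (g := fun z => b.coord a (secRep F c σ z)) hxs (by
      rw [← hφ, hφx]; exact (hcoord a).contDiffAt.comp y hs)
  have hsec : ∀ a, MDifferentiableAt (𝓡 n) ((𝓡 n).prod 𝓘(ℝ, F))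
      (fun x => (⟨x, secOf V c (fun _ : Euc n => b a) x⟩ : Bundle.TotalSpace F V)) x := fun a =>
    mdifferentiableAt_secOf contDiff_const hy
  have hqs : ∀ a, MDifferentiableAt (𝓡 n) ((𝓡 n).prod 𝓘(ℝ, F))
      (fun x => (⟨x, q a x • secOf V c (fun _ : Euc n => b a) x⟩ : Bundle.TotalSpace F V)) x :=
    fun a => ((hq a).mdifferentiableAt (by simp)).smul_section (hsec a)
  have heq : ∀ᶠ x' in 𝓝 x, σ x' = ∑ a, q a x' • secOf V c (fun _ : Euc n => b a) x' := by
    filter_upwards [φ.open_source.mem_nhds hxs,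
      (trivializationAt F V c).open_baseSet.mem_nhds hy.2] with x' h1 h2
    simp only [secOf, ← map_smul, ← map_sum, q, Module.Basis.coord_apply, b.sum_repr]
    rw [secRep, ← hφ, φ.left_inv h1, Trivialization.symmL_continuousLinearMapAt _ h2]
  have hD : D σ x = ∑ a, (q a x • D (secOf V c fun _ : Euc n => b a) x +
      (mvfderiv (𝓡 n) (q a) x).smulRight (secOf V c (fun _ : Euc n => b a) x)) := by
    rw [D.isCovariantDerivativeOnUniv.congr_of_eventuallyEq (hσ.mdifferentiableAt x)
      (MDifferentiableAt.sum_section (s := Finset.univ) fun a _ => hqs a) Filter.univ_mem heq,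
      conn_sum D _ fun a _ => hqs a]
    exact Finset.sum_congr rfl fun a _ => D.isCovariantDerivativeOnUniv.leibniz (hsec a)
      ((hq a).mdifferentiableAt (by simp))
  set v := secRep (Euc n) c X y with hv
  have hXv : X x = (trivializationAt (Euc n) (TangentSpace (𝓡 n)) c).symmL ℝ x v := by
    rw [hv, secRep, Trivialization.symmL_continuousLinearMapAt _ (mem_tangent_baseSet hy.1)]
  have hdq : ∀ a, mvfderiv (𝓡 n) (q a) x (X x) = b.coord a (fderiv ℝ (secRep F c σ) y v) := by
    intro a
    have h1 : HasMFDerivAt 𝓘(ℝ, Euc n) 𝓘(ℝ, ℝ) (q a ∘ φ.symm) y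
        ((mfderiv (𝓡 n) 𝓘(ℝ, ℝ) (q a) x).comp (mfderiv 𝓘(ℝ, Euc n) (𝓡 n) φ.symm y)) :=
      ((hq a).mdifferentiableAt (by simp)).hasMFDerivAt.comp y
        (mdifferentiableAt_chart_symm hy.1).hasMFDerivAt
    have h2 : HasFDerivAt (q a ∘ φ.symm)
        ((LinearMap.toContinuousLinearMap (b.coord a)).comp (fderiv ℝ (secRep F c σ) y)) y := by
      refine ((LinearMap.toContinuousLinearMap (b.coord a)).hasFDerivAt.comp y
        (hs.differentiableAt (by simp)).hasFDerivAt).congr_of_eventuallyEq ?_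
      filter_upwards [φ.open_target.mem_nhds hy.1] with z hz
      simp [q, φ.right_inv hz]
    have h3 := hasMFDerivAt_unique h1 h2.hasMFDerivAt
    rw [← symmL_eq_mfderiv hy.1] at h3
    rw [hXv]
    exact congrArg (fun L : Euc n →L[ℝ] ℝ => L v) h3
  rw [secRep, ← hφ, ← hx, hD]
  simp only [sum_apply, add_apply,
    smul_apply, ContinuousLinearMap.smulRight_apply, hdq, map_sum, map_add,
    map_smul, Finset.sum_add_distrib]
  rw [add_comm]
  congr 1
  · rw [← b.sum_repr (fderiv ℝ (secRep F c σ) y v)]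
    refine Finset.sum_congr rfl fun a _ => ?_
    rw [b.sum_repr, Module.Basis.coord_apply]
    congr 1
    rw [secOf, Trivialization.continuousLinearMapAt_symmL _ hy.2]
  · rw [connForm_apply]
    refine Finset.sum_congr rfl fun a _ => ?_
    simp only [q, hφx, connCol, ContinuousLinearMap.comp_apply, hXv]
    rfl

end Connection

/-! ### The twisted differential in local coordinates -/

theorem zsmul_neg_one_pow {G : Type*} [AddCommGroup G] [Module ℝ G] (m : ℕ) (v : G) :
    ((-1 : ℤ) ^ m) • v = ((-1 : ℝ) ^ m) • v := by
  rw [← Int.cast_smul_eq_zsmul ℝ]; simp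

section LocalDifferential

variable {n k : ℕ} {F : Type*} [NormedAddCommGroup F] [NormedSpace ℝ F]

open ContinuousAlternatingMap

set_option synthInstance.maxHeartbeats 200000

instance : NormedAddCommGroup (Euc n →L[ℝ] Euc n [⋀^Fin k]→L[ℝ] F) :=
  ContinuousLinearMap.toNormedAddCommGroup

instance : NormedSpace ℝ (Euc n →L[ℝ] Euc n [⋀^Fin k]→L[ℝ] F) :=
  ContinuousLinearMap.toNormedSpace

instance : NormedAddCommGroup (Euc n →L[ℝ] F →L[ℝ] F) :=
  ContinuousLinearMap.toNormedAddCommGroup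

instance : NormedSpace ℝ (Euc n →L[ℝ] F →L[ℝ] F) :=
  ContinuousLinearMap.toNormedSpace

variable (F k) in
/-- Composition of vector-valued alternating maps with endomorphisms of the vector space. -/
def compAlt (n : ℕ) : (F →L[ℝ] F) →L[ℝ] (Euc n [⋀^Fin k]→L[ℝ] F) →L[ℝ] Euc n [⋀^Fin k]→L[ℝ] F :=
  ContinuousLinearMap.compContinuousAlternatingMapCLM ℝ (Euc n) F F (Fin k)

/-- The operator `v ↦ A(v) ∘ w` on vector-valued forms. -/
def connTerm (A : Euc n →L[ℝ] F →L[ℝ] F) (w : Euc n [⋀^Fin k]→L[ℝ] F) :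
    Euc n →L[ℝ] Euc n [⋀^Fin k]→L[ℝ] F :=
  ((compAlt k F n).flip w).comp A

theorem connTerm_apply (A : Euc n →L[ℝ] F →L[ℝ] F) (w : Euc n [⋀^Fin k]→L[ℝ] F) (v : Euc n)
    (u : Fin k → Euc n) : connTerm A w v u = A v (w u) := rfl

/-- The exterior differential twisted by the connection `d + A`. -/
def twistedD (A : Euc n → Euc n →L[ℝ] F →L[ℝ] F) (w : Euc n → Euc n [⋀^Fin k]→L[ℝ] F)
    (y : Euc n) : Euc n [⋀^Fin (k + 1)]→L[ℝ] F :=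
  alternatizeUncurryFin (fderiv ℝ w y + connTerm (A y) (w y))

theorem twistedD_apply (A : Euc n → Euc n →L[ℝ] F →L[ℝ] F)
    (w : Euc n → Euc n [⋀^Fin k]→L[ℝ] F) (y : Euc n) (v : Fin (k + 1) → Euc n) :
    twistedD A w y v = extDeriv w y v +
      ∑ i : Fin (k + 1), (-1 : ℝ) ^ (i : ℕ) • A y (v i) (w y (i.removeNth v)) := by
  rw [twistedD, alternatizeUncurryFin_add, extDeriv, ContinuousAlternatingMap.add_apply]
  congr 1
  rw [alternatizeUncurryFin_apply]
  simp only [zsmul_neg_one_pow, connTerm_apply]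

theorem twistedD_congr {A : Euc n → Euc n →L[ℝ] F →L[ℝ] F}
    {w w' : Euc n → Euc n [⋀^Fin k]→L[ℝ] F} {y : Euc n} (h : w =ᶠ[𝓝 y] w') :
    twistedD A w y = twistedD A w' y := by
  rw [twistedD, twistedD, h.fderiv_eq, h.self_of_nhds]

theorem twistedD_apply' (A : Euc n → Euc n →L[ℝ] F →L[ℝ] F)
    {w : Euc n → Euc n [⋀^Fin k]→L[ℝ] F} {y : Euc n} (hw : DifferentiableAt ℝ w y)
    (v : Fin (k + 1) → Euc n) :
    twistedD A w y v = ∑ i : Fin (k + 1), (-1 : ℝ) ^ (i : ℕ) •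
      (fderiv ℝ (fun z => w z (i.removeNth v)) y (v i) + A y (v i) (w y (i.removeNth v))) := by
  rw [twistedD_apply, extDeriv_apply hw]
  simp only [smul_add, Finset.sum_add_distrib, zsmul_neg_one_pow]

variable [FiniteDimensional ℝ F]

theorem contDiffAt_twistedD {A : Euc n → Euc n →L[ℝ] F →L[ℝ] F}
    {w : Euc n → Euc n [⋀^Fin k]→L[ℝ] F} {y : Euc n} (hA : ContDiffAt ℝ ∞ A y)
    (hw : ContDiffAt ℝ ∞ w y) : ContDiffAt ℝ ∞ (twistedD A w) y := by
  refine contDiffAt_alt fun v => ?_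
  have hwv : ∀ u, ContDiffAt ℝ ∞ (fun z => w z u) y := fun u =>
    ContDiffAt.alt_apply hw fun _ => contDiffAt_const
  have hev : ∀ᶠ z in 𝓝 y, twistedD A w z v = ∑ i : Fin (k + 1), (-1 : ℝ) ^ (i : ℕ) •
      (fderiv ℝ (fun z => w z (i.removeNth v)) z (v i) + A z (v i) (w z (i.removeNth v))) := by
    filter_upwards [(hw.of_le (m := 1) (by simp)).eventually (by simp)] with z hz
    exact twistedD_apply' A (hz.differentiableAt (by simp)) v
  refine ContDiffAt.congr_of_eventuallyEq ?_ hev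
  refine ContDiffAt.sum fun i _ => ContDiffAt.smul contDiffAt_const (ContDiffAt.add ?_ ?_)
  · exact ((hwv _).fderiv_right (m := ∞) (by simp)).clm_apply contDiffAt_const
  · exact (hA.clm_apply contDiffAt_const).clm_apply (hwv _)

/-- The derivative of the covariant derivative, seen as a function with values in the linear maps
into the alternating maps. -/
theorem hasFDerivAt_fderiv_add_connTerm {A : Euc n → Euc n →L[ℝ] F →L[ℝ] F}
    {w : Euc n → Euc n [⋀^Fin k]→L[ℝ] F} {y : Euc n} (hA : ContDiffAt ℝ ∞ A y)
    (hw : ContDiffAt ℝ ∞ w y) :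
    HasFDerivAt (fun y => fderiv ℝ w y + connTerm (A y) (w y))
      (fderiv ℝ (fun y => fderiv ℝ w y + connTerm (A y) (w y)) y) y := by
  refine DifferentiableAt.hasFDerivAt (ContDiffAt.differentiableAt (n := ∞) ?_ (by simp))
  refine contDiffAt_clm fun v => contDiffAt_alt fun u => ?_
  have hwv : ContDiffAt ℝ ∞ (fun z => w z u) y := ContDiffAt.alt_apply hw fun _ => contDiffAt_const
  have h1 : ContDiffAt ℝ ∞ (fun z => fderiv ℝ w z v) y :=
    (hw.fderiv_right (m := ∞) (by simp)).clm_apply contDiffAt_const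
  exact (ContDiffAt.alt_apply h1 fun _ => contDiffAt_const).add
    ((hA.clm_apply contDiffAt_const).clm_apply hwv)

/-- For a flat connection, the twisted differential has square zero. -/
theorem twistedD_twistedD {A : Euc n → Euc n →L[ℝ] F →L[ℝ] F}
    {w : Euc n → Euc n [⋀^Fin k]→L[ℝ] F} {y : Euc n} (hA : ContDiffAt ℝ ∞ A y)
    (hw : ContDiffAt ℝ ∞ w y)
    (hflat : ∀ u v f, fderiv ℝ A y u v f + A y u (A y v f) =
      fderiv ℝ A y v u f + A y v (A y u f)) :
    twistedD A (twistedD A w) y = 0 := by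
  have hA1 := (hA.differentiableAt (by simp)).hasFDerivAt
  have hw1 := (hw.differentiableAt (by simp)).hasFDerivAt
  have hw2 := ((hw.fderiv_right (m := ∞) (by simp)).differentiableAt (by simp)).hasFDerivAt
  set B : Euc n → Euc n →L[ℝ] Euc n [⋀^Fin k]→L[ℝ] F :=
    fun y => fderiv ℝ w y + connTerm (A y) (w y) with hBdef
  have hB : HasFDerivAt B (fderiv ℝ B y) y := hasFDerivAt_fderiv_add_connTerm hA hw
  have hBd : ∀ u v x, fderiv ℝ B y u v x = fderiv ℝ (fderiv ℝ w) y u v x +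
      (fderiv ℝ A y u v (w y x) + A y v (fderiv ℝ w y u x)) := by
    intro u v x
    let ev : (Euc n [⋀^Fin k]→L[ℝ] F) →L[ℝ] F := ContinuousAlternatingMap.apply ℝ (Euc n) F x
    have h1 : HasFDerivAt (fun z => ev (B z v)) _ y :=
      ev.hasFDerivAt.comp y (hB.clm_apply (hasFDerivAt_const v y))
    have h2 : HasFDerivAt (fun z => ev (fderiv ℝ w z v) + A z v (ev (w z))) _ y :=
      (ev.hasFDerivAt.comp y (hw2.clm_apply (hasFDerivAt_const v y))).add
        ((hA1.clm_apply (hasFDerivAt_const v y)).clm_apply (ev.hasFDerivAt.comp y hw1))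
    have h3 := congrArg (fun L : Euc n →L[ℝ] F => L u) (h1.unique h2)
    simp only [ContinuousLinearMap.comp_apply, _root_.add_apply, ContinuousLinearMap.flip_apply,
      ContinuousLinearMap.comp_zero, zero_add, ev] at h3
    rw [add_comm (fderiv ℝ A y u v (w y x))]
    exact h3
  have hd : ∀ u x, fderiv ℝ (twistedD A w) y u x = alternatizeUncurryFin (fderiv ℝ B y u) x := by
    intro u x
    let ev : ∀ {m : ℕ}, (Fin m → Euc n) → (Euc n [⋀^Fin m]→L[ℝ] F) →L[ℝ] F :=
      fun x => ContinuousAlternatingMap.apply ℝ (Euc n) F x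
    have h1 : HasFDerivAt (fun z => ev x (twistedD A w z)) _ y :=
      (ev x).hasFDerivAt.comp y ((contDiffAt_twistedD hA hw).differentiableAt (by simp)).hasFDerivAt
    have h2 : ∀ i : Fin (k + 1), HasFDerivAt (fun z => ev (i.removeNth x) (B z (x i))) _ y :=
      fun i => (ev _).hasFDerivAt.comp y (hB.clm_apply (hasFDerivAt_const (x i) y))
    have h4 := HasFDerivAt.fun_sum (u := Finset.univ) fun (i : Fin (k + 1)) _ =>
      (h2 i).const_smul ((-1 : ℝ) ^ (i : ℕ))
    have h12 : (fun z => ev x (twistedD A w z)) = fun z => ∑ i : Fin (k + 1),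
        ((-1 : ℝ) ^ (i : ℕ) • fun z => ev (i.removeNth x) (B z (x i))) z := by
      funext z
      refine (alternatizeUncurryFin_apply (B z) x).trans (Finset.sum_congr rfl fun i _ => ?_)
      rw [zsmul_neg_one_pow]; rfl
    rw [h12] at h1
    have h3 := congrArg (fun L : Euc n →L[ℝ] F => L u) (h1.unique h4)
    rw [alternatizeUncurryFin_apply]
    simp only [zsmul_neg_one_pow]
    simpa [_root_.sum_apply, ev] using h3
  -- the bilinear form whose double alternation is the square of the differential
  let Q : Euc n →L[ℝ] Euc n →L[ℝ] Euc n [⋀^Fin k]→L[ℝ] F :=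
    fderiv ℝ B y + (ContinuousLinearMap.precomp (Euc n [⋀^Fin k]→L[ℝ] F) (B y)).comp
      ((compAlt k F n).comp (A y))
  have hQ : ∀ u v x, Q u v x = fderiv ℝ (fderiv ℝ w) y u v x +
      (fderiv ℝ A y u v (w y x) + A y v (fderiv ℝ w y u x)) +
      A y u (fderiv ℝ w y v x + A y v (w y x)) := fun u v x => by
    rw [← hBd]; rfl
  have hkey : twistedD A (twistedD A w) y =
      alternatizeUncurryFin (alternatizeUncurryFinCLM (n := k) ℝ (Euc n) F ∘L Q) := by
    ext x
    have h1 : ∀ u x, (alternatizeUncurryFinCLM ℝ (Euc n) F ∘L Q) u x =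
        alternatizeUncurryFin (fderiv ℝ B y u) x +
        alternatizeUncurryFin ((compAlt k F n (A y u)).comp (B y)) x := fun u x => by
      rw [← ContinuousAlternatingMap.add_apply, ← alternatizeUncurryFin_add]; rfl
    rw [twistedD, alternatizeUncurryFin_apply, alternatizeUncurryFin_apply]
    refine Finset.sum_congr rfl fun i _ => ?_
    rw [h1, _root_.add_apply, ContinuousAlternatingMap.add_apply, hd, connTerm_apply, twistedD]
    congr 2
    rw [alternatizeUncurryFin_apply, alternatizeUncurryFin_apply, _root_.map_sum]
    refine Finset.sum_congr rfl fun i _ => ?_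
    rw [map_zsmul]
    rfl
  rw [hkey]
  refine alternatizeUncurryFin_alternatizeUncurryFinCLM_comp_of_symmetric fun u v => ?_
  have hsymm : fderiv ℝ (fderiv ℝ w) y u v = fderiv ℝ (fderiv ℝ w) y v u :=
    (hw.isSymmSndFDerivAt (by
      simp only [minSmoothness_of_isRCLikeNormedField]
      exact WithTop.coe_le_coe.2 (le_top : (2 : ℕ∞) ≤ ⊤))) u v
  ext x
  rw [hQ, hQ, hsymm, map_add, map_add]
  have := hflat u v (w y x)
  calc _ = fderiv ℝ (fderiv ℝ w) y v u x + (fderiv ℝ A y u v (w y x) + A y u (A y v (w y x)))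
        + (A y v (fderiv ℝ w y u x) + A y u (fderiv ℝ w y v x)) := by abel
    _ = _ := by rw [this]; abel

end LocalDifferential

/-! ### The twisted differential on the manifold -/

section ExtDeriv

variable {n : ℕ} {M : Type*} [TopologicalSpace M] [ChartedSpace (EuclideanSpace ℝ (Fin n)) M]
  [IsManifold (𝓡 n) ∞ M]
  {F : Type*} [NormedAddCommGroup F] [NormedSpace ℝ F]
  {V : M → Type*} [TopologicalSpace (Bundle.TotalSpace F V)]
  [∀ x, NormedAddCommGroup (V x)] [∀ x, InnerProductSpace ℝ (V x)]
  [FiberBundle F V] [VectorBundle ℝ F V]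

theorem secRep_chart {G : Type*} [NormedAddCommGroup G] [NormedSpace ℝ G]
    {E : M → Type*} [TopologicalSpace (TotalSpace G E)] [∀ x, AddCommGroup (E x)]
    [∀ x, Module ℝ (E x)] [∀ x, TopologicalSpace (E x)] [FiberBundle G E] [VectorBundle ℝ G E]
    {c x : M} (hx : x ∈ (chartAt (Euc n) c).source) (σ : (x : M) → E x) :
    secRep G c σ (chartAt (Euc n) c x) =
      (trivializationAt G E c).continuousLinearMapAt ℝ x (σ x) := by
  have : ∀ p, p = x → (trivializationAt G E c).continuousLinearMapAt ℝ p (σ p) =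
      (trivializationAt G E c).continuousLinearMapAt ℝ x (σ x) := by rintro _ rfl; rfl
  exact this _ ((chartAt (Euc n) c).left_inv hx)

theorem eq_symmL_secRep {c x : M} (hx : x ∈ (chartAt (Euc n) c).source)
    (hx' : x ∈ (trivializationAt F V c).baseSet) (σ : (x : M) → V x) :
    σ x = (trivializationAt F V c).symmL ℝ x (secRep F c σ (chartAt (Euc n) c x)) := by
  rw [secRep_chart hx, Trivialization.symmL_continuousLinearMapAt _ hx']

theorem eq_zero_of_formRep_eq_zero {c x : M} (hx : x ∈ (chartAt (Euc n) c).source)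
    (hx' : x ∈ (trivializationAt F V c).baseSet) {k : ℕ} {θ : Form n V k}
    (h : formRep F c θ (chartAt (Euc n) c x) = 0) : θ x = 0 := by
  have h1 := eq_of_formRep_eq (θ := θ) (η := 0) (chart_mem_coordDomain hx hx')
    (by rw [h, formRep_zero])
  rwa [(chartAt (Euc n) c).left_inv hx] at h1

theorem eq_of_formRep_chart_eq {c x : M} (hx : x ∈ (chartAt (Euc n) c).source)
    (hx' : x ∈ (trivializationAt F V c).baseSet) {k : ℕ} {θ η : Form n V k}
    (h : formRep F c θ (chartAt (Euc n) c x) = formRep F c η (chartAt (Euc n) c x)) :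
    θ x = η x := by
  have h1 := eq_of_formRep_eq (θ := θ) (η := η) (chart_mem_coordDomain hx hx') h
  rwa [(chartAt (Euc n) c).left_inv hx] at h1

/-- The right-hand side of the Koszul formula. -/
def koszul (D : CovariantDerivative (𝓡 n) F V) {k : ℕ} (θ : Form n V k)
    (X : Fin (k + 1) → (x : M) → TangentSpace (𝓡 n) x) (x : M) : V x :=
  ∑ i : Fin (k + 1), (-1 : ℝ) ^ (i : ℕ) •
    D (fun y => θ y (i.removeNth (fun j => X j y))) x (X i x) + bracketTerm k θ X x

theorem secRep_bracketTerm {k : ℕ} (θ : Form n V (k + 1))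
    {X : Fin (k + 2) → (x : M) → TangentSpace (𝓡 n) x} [T2Space M] (hX : ∀ i, SmoothField (X i))
    {c : M} {y : Euc n} (hy : y ∈ coordDomain n F V c) :
    secRep F c (bracketTerm (k + 1) θ X) y = - ∑ i : Fin (k + 1), ∑ j ∈ Finset.Ici i,
      (-1 : ℝ) ^ (i + j : ℕ) • formRep F c θ y (Matrix.vecCons
        (VectorField.lieBracket ℝ (secRep (Euc n) c (X i.castSucc)) (secRep (Euc n) c (X j.succ)) y)
          (j.removeNth (i.castSucc.removeNth (fun l => secRep (Euc n) c (X l) y)))) := by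
  have h : ∀ i j : Fin (k + 1), secRep F c (fun x => θ x
      (Matrix.vecCons (VectorField.mlieBracket (𝓡 n) (X i.castSucc) (X j.succ) x)
            (j.removeNth (i.castSucc.removeNth (fun l => X l x))))) y = formRep F c θ y
      (Matrix.vecCons
        (VectorField.lieBracket ℝ (secRep (Euc n) c (X i.castSucc)) (secRep (Euc n) c (X j.succ)) y)
          (j.removeNth (i.castSucc.removeNth (fun l => secRep (Euc n) c (X l) y)))) := by
    intro i j
    let Z : Fin (k + 1) → (x : M) → TangentSpace (𝓡 n) x := fun m x =>
      Matrix.vecCons (VectorField.mlieBracket (𝓡 n) (X i.castSucc) (X j.succ) x)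
            (j.removeNth (i.castSucc.removeNth (fun l => X l x))) m
    refine (secRep_form_apply θ Z hy.1).trans ?_
    congr 1
    funext m
    refine Fin.cases ?_ (fun m => ?_) m
    · exact secRep_mlieBracket (hX _) (hX _) hy.1
    · rfl
  simp only [← h]
  simp only [secRep, bracketTerm, map_neg, map_sum, map_smul]

variable [T2Space M] [FiniteDimensional ℝ F] [ContMDiffVectorBundle ∞ F V (𝓡 n)]

/-- The Koszul formula in local coordinates. -/
theorem secRep_koszul (D : CovariantDerivative (𝓡 n) F V) {k : ℕ} {θ : Form n V k}
    (hθ : SmoothForm F θ) {X : Fin (k + 1) → (x : M) → TangentSpace (𝓡 n) x}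
    (hX : ∀ i, SmoothField (X i)) {c : M} {y : Euc n} (hy : y ∈ coordDomain n F V c) :
    secRep F c (koszul D θ X) y = twistedD (connForm D c) (formRep F c θ) y
      fun i => secRep (Euc n) c (X i) y := by
  have hw := (hθ.contDiffAt_formRep hy).differentiableAt (by simp)
  have h1 : ∀ i : Fin (k + 1),
      secRep F c (fun x => D (fun y => θ y (i.removeNth (fun j => X j y))) x (X i x)) y =
      fderiv ℝ (fun z => formRep F c θ z (i.removeNth (fun j => secRep (Euc n) c (X j) z))) y
        (secRep (Euc n) c (X i) y) + connForm D c y (secRep (Euc n) c (X i) y)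
          (formRep F c θ y (i.removeNth (fun j => secRep (Euc n) c (X j) y))) := by
    intro i
    refine (secRep_conn D (hθ (fun j => X (i.succAbove j)) fun j => hX _) (X := X i) hy).trans ?_
    have he : secRep F c (fun x => θ x (fun j => X (i.succAbove j) x)) =ᶠ[𝓝 y]
        fun z => formRep F c θ z (i.removeNth (fun j => secRep (Euc n) c (X j) z)) := by
      filter_upwards [(isOpen_coordDomain (G := F) (E := V) c).mem_nhds hy] with z hz
      exact secRep_form_apply θ _ hz.1
    rw [he.fderiv_eq, he.self_of_nhds]
  have h2 : secRep F c (koszul D θ X) y = ∑ i : Fin (k + 1), (-1 : ℝ) ^ (i : ℕ) •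
      secRep F c (fun x => D (fun y => θ y (i.removeNth (fun j => X j y))) x (X i x)) y +
      secRep F c (bracketTerm k θ X) y := by
    simp only [secRep, koszul, map_add, map_sum, map_smul]
  rw [h2]
  simp only [h1]
  match k with
  | 0 =>
    rw [twistedD_apply' _ hw]
    have h3 : secRep F c (bracketTerm 0 θ X) y = 0 := by
      simp only [secRep, bracketTerm, map_zero]
    rw [h3, add_zero]
    refine Finset.sum_congr rfl fun i _ => ?_
    have h4 : ∀ z : Euc n, (i.removeNth fun j => secRep (Euc n) c (X j) z) =
      i.removeNth fun j => secRep (Euc n) c (X j) y := fun z : Euc n => Subsingleton.elim _ _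
    simp only [h4]
  | k + 1 =>
    rw [twistedD_apply, secRep_bracketTerm θ hX hy,
      extDeriv_apply_vectorField hw fun i => ((hX i).contDiffAt_secRep hy.1).differentiableAt
        (by simp)]
    simp only [smul_add, Finset.sum_add_distrib, zsmul_neg_one_pow]
    abel

variable (D : CovariantDerivative (𝓡 n) F V)

/-- A smooth form has a twisted differential. -/
theorem exists_isExtDeriv {k : ℕ} {θ : Form n V k} (hθ : SmoothForm F θ) :
    ∃ η : Form n V (k + 1), IsExtDeriv D θ η := by
  refine ⟨fun x => formOf V x (twistedD (connForm D x) (formRep F x θ)) x, fun X hX x => ?_⟩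
  have hx := mem_chart_source (Euc n) x
  have hx' : x ∈ (trivializationAt F V x).baseSet := FiberBundle.mem_baseSet_trivializationAt F V x
  have h := eq_symmL_secRep (F := F) hx hx' (koszul D θ X)
  refine Eq.trans ?_ h.symm
  rw [secRep_koszul D hθ hX (chart_mem_coordDomain hx hx')]
  simp only [secRep_chart hx]
  rfl

theorem isExtDeriv_extDerivD {k : ℕ} {θ : Form n V k} (hθ : SmoothForm F θ) :
    IsExtDeriv D θ (extDerivD D θ) := by
  have h := exists_isExtDeriv D hθ
  rw [extDerivD, dif_pos h]
  exact h.choose_spec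

theorem formRep_extDerivD {k : ℕ} {θ : Form n V k} (hθ : SmoothForm F θ) {c : M} {y : Euc n}
    (hy : y ∈ coordDomain n F V c) :
    formRep F c (extDerivD D θ) y = twistedD (connForm D c) (formRep F c θ) y := by
  ext v
  choose X hX hXv using fun i => exists_field c (contDiff_const (c := v i)) hy.1
  have h1 := secRep_form_apply (F := F) (extDerivD D θ) X hy.1
  have h2 : (fun x => extDerivD D θ x fun i => X i x) = koszul D θ X :=
    funext fun x => isExtDeriv_extDerivD D hθ X hX x
  rw [h2, secRep_koszul D hθ hX hy] at h1
  have h3 : (fun i => secRep (Euc n) c (X i) y) = v := funext fun i => (hXv i).self_of_nhds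
  rw [h3] at h1
  exact h1.symm

theorem formRep_extDerivD_eventuallyEq {k : ℕ} {θ : Form n V k} (hθ : SmoothForm F θ) {c : M}
    {y : Euc n} (hy : y ∈ coordDomain n F V c) :
    formRep F c (extDerivD D θ) =ᶠ[𝓝 y] twistedD (connForm D c) (formRep F c θ) := by
  filter_upwards [(isOpen_coordDomain (G := F) (E := V) c).mem_nhds hy] with z hz
  exact formRep_extDerivD D hθ hz

theorem SmoothForm.extDerivD [D.ContMDiffCovariantDerivative ∞] {k : ℕ} {θ : Form n V k}
    (hθ : SmoothForm F θ) : SmoothForm F (extDerivD D θ) := by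
  refine smoothForm_of_formRep fun x => ⟨x, mem_chart_source (Euc n) x,
    FiberBundle.mem_baseSet_trivializationAt F V x, ?_⟩
  have hy : chartAt (Euc n) x x ∈ coordDomain n F V x := chart_mem_coordDomain
    (mem_chart_source (Euc n) x) (FiberBundle.mem_baseSet_trivializationAt F V x)
  exact (contDiffAt_twistedD (contDiffAt_connForm D x hy)
    (hθ.contDiffAt_formRep hy)).congr_of_eventuallyEq (formRep_extDerivD_eventuallyEq D hθ hy)

set_option synthInstance.maxHeartbeats 200000 in
variable {D} in
/-- In coordinates, the flatness of the connection `d + A` is the equation `dA + A ∧ A = 0`. -/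
theorem IsFlat.connForm [D.ContMDiffCovariantDerivative ∞] (hD : IsFlat D) {c : M} {y : Euc n}
    (hy : y ∈ coordDomain n F V c) (u v : Euc n) (f : F) :
    fderiv ℝ (connForm D c) y u v f + connForm D c y u (connForm D c y v f) =
      fderiv ℝ (connForm D c) y v u f + connForm D c y v (connForm D c y u f) := by
  -- evaluate the curvature on coordinate vector fields, whose bracket vanishes, and on a section
  -- which is constant in the trivialization
  obtain ⟨X, hX, hXu⟩ := exists_field c (contDiff_const (c := u)) hy.1
  obtain ⟨Y, hY, hYv⟩ := exists_field c (contDiff_const (c := v)) hy.1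
  obtain ⟨σ, hσ, hσf⟩ := exists_section V c (contDiff_const (c := f)) hy
  have hA := (contDiffAt_connForm D c hy).differentiableAt (by simp)
  have key : ∀ {X Y : (x : M) → TangentSpace (𝓡 n) x} {u v : Euc n}, SmoothField Y →
      (∀ᶠ z in 𝓝 y, secRep (Euc n) c X z = u) → (∀ᶠ z in 𝓝 y, secRep (Euc n) c Y z = v) →
      secRep F c (fun x => D (fun y => D σ y (Y y)) x (X x)) y =
        fderiv ℝ (TwistedL2.connForm D c) y u v f +
          TwistedL2.connForm D c y u (TwistedL2.connForm D c y v f) := by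
    intro X Y u v hY hXu hYv
    rw [secRep_conn D (smoothSection_conn D hσ hY) hy, hXu.self_of_nhds]
    have he : secRep F c (fun y => D σ y (Y y)) =ᶠ[𝓝 y]
        fun z => TwistedL2.connForm D c z v f := by
      filter_upwards [(isOpen_coordDomain (G := F) (E := V) c).mem_nhds hy, hYv,
        eventually_eventually_nhds.2 hσf] with z hz hz1 hz2
      rw [secRep_conn D hσ hz, hz1, EventuallyEq.fderiv_eq (f := fun _ => f) hz2,
        hz2.self_of_nhds]
      simp
    rw [he.fderiv_eq, he.self_of_nhds]
    congr 1
    rw [fderiv_clm_apply (hA.clm_apply (differentiableAt_const v)) (differentiableAt_const f),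
      fderiv_clm_apply hA (differentiableAt_const v)]
    simp
  have h0 : secRep (Euc n) c (VectorField.mlieBracket (𝓡 n) X Y) y = 0 := by
    rw [secRep_mlieBracket hX hY hy.1, VectorField.lieBracket,
      EventuallyEq.fderiv_eq (f := fun _ => u) hXu, EventuallyEq.fderiv_eq (f := fun _ => v) hYv]
    simp
  have h1 : secRep F c (fun x => D σ x (VectorField.mlieBracket (𝓡 n) X Y x)) y = 0 := by
    rw [secRep_conn D hσ hy, h0]; simp
  have h2 := hD X Y σ hX hY hσ ((chartAt (Euc n) c).symm y)
  have h3 := congrArg ((trivializationAt F V c).continuousLinearMapAt ℝ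
    ((chartAt (Euc n) c).symm y)) h2
  rw [map_sub, map_sub, map_zero] at h3
  have h4 := (key hY hXu hYv).symm
  have h5 := (key hX hYv hXu).symm
  rw [h4, h5]
  simp only [secRep] at h1 ⊢
  rw [h1, sub_zero, sub_eq_zero] at h3
  exact h3

variable {D} in
theorem extDerivD_extDerivD [D.ContMDiffCovariantDerivative ∞] (hD : IsFlat D) {k : ℕ}
    {θ : Form n V k} (hθ : SmoothForm F θ) : extDerivD D (extDerivD D θ) = 0 := by
  funext x
  have hx := mem_chart_source (Euc n) x
  have hx' : x ∈ (trivializationAt F V x).baseSet := FiberBundle.mem_baseSet_trivializationAt F V x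
  have hy := chart_mem_coordDomain hx hx'
  refine eq_zero_of_formRep_eq_zero hx hx' ?_
  rw [formRep_extDerivD D (hθ.extDerivD D) hy,
    twistedD_congr (formRep_extDerivD_eventuallyEq D hθ hy)]
  exact twistedD_twistedD (contDiffAt_connForm D x hy) (hθ.contDiffAt_formRep hy) (hD.connForm hy)

theorem extDerivD_sub {k : ℕ} {θ η : Form n V k} (hθ : SmoothForm F θ) (hη : SmoothForm F η)
    (hs : SmoothForm F (θ - η)) : extDerivD D (θ - η) = extDerivD D θ - extDerivD D η := by
  funext x
  have hx := mem_chart_source (Euc n) x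
  have hx' : x ∈ (trivializationAt F V x).baseSet := FiberBundle.mem_baseSet_trivializationAt F V x
  have hy := chart_mem_coordDomain hx hx'
  refine eq_of_formRep_chart_eq hx hx' ?_
  rw [formRep_sub, formRep_extDerivD D hs hy, formRep_extDerivD D hθ hy, formRep_extDerivD D hη hy]
  have h1 := (hθ.contDiffAt_formRep hy).differentiableAt (by simp)
  have h2 := (hη.contDiffAt_formRep hy).differentiableAt (by simp)
  have h3 : formRep F x (θ - η) = formRep F x θ - formRep F x η := funext (formRep_sub θ η)
  have hev : ∀ {w : Euc n → Euc n [⋀^Fin k]→L[ℝ] F} {y : Euc n} (_ : DifferentiableAt ℝ w y) u,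
      DifferentiableAt ℝ (fun z => w z u) y := fun hw u =>
    ((ContinuousAlternatingMap.apply ℝ (Euc n) F u).hasFDerivAt.comp _
      hw.hasFDerivAt).differentiableAt
  ext v
  rw [ContinuousAlternatingMap.sub_apply, h3, twistedD_apply' _ (h1.sub h2), twistedD_apply' _ h1,
    twistedD_apply' _ h2, ← Finset.sum_sub_distrib]
  refine Finset.sum_congr rfl fun i _ => ?_
  simp only [Pi.sub_apply, ContinuousAlternatingMap.sub_apply]
  rw [fderiv_fun_sub (hev h1 _) (hev h2 _), _root_.sub_apply, map_sub, ← smul_sub]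
  congr 1
  abel

theorem extDerivD_eq_of_eventuallyEq {k : ℕ} {θ η : Form n V k} (hθ : SmoothForm F θ)
    (hη : SmoothForm F η) {x : M} (h : ∀ᶠ z in 𝓝 x, θ z = η z) :
    extDerivD D θ x = extDerivD D η x := by
  have hx := mem_chart_source (Euc n) x
  have hx' : x ∈ (trivializationAt F V x).baseSet := FiberBundle.mem_baseSet_trivializationAt F V x
  have hy := chart_mem_coordDomain hx hx'
  refine eq_of_formRep_chart_eq hx hx' ?_
  rw [formRep_extDerivD D hθ hy, formRep_extDerivD D hη hy]
  refine twistedD_congr ?_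
  have h1 : Tendsto (chartAt (Euc n) x).symm (𝓝 (chartAt (Euc n) x x)) (𝓝 x) := by
    have := (chartAt (Euc n) x).continuousAt_symm hy.1
    rwa [ContinuousAt, (chartAt (Euc n) x).left_inv hx] at this
  filter_upwards [h1.eventually h] with z hz
  exact formRep_congr hz

theorem smoothForm_zero {k : ℕ} : SmoothForm F (0 : Form n V k) :=
  smoothForm_of_formRep fun x => ⟨x, mem_chart_source (Euc n) x,
    FiberBundle.mem_baseSet_trivializationAt F V x, by
      rw [show formRep F x (0 : Form n V k) = fun _ => 0 from funext formRep_zero]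
      exact contDiffAt_const⟩

theorem SmoothForm.sub {k : ℕ} {θ η : Form n V k} (hθ : SmoothForm F θ) (hη : SmoothForm F η) :
    SmoothForm F (θ - η) :=
  smoothForm_of_formRep fun x => ⟨x, mem_chart_source (Euc n) x,
    FiberBundle.mem_baseSet_trivializationAt F V x, by
      have hy : chartAt (Euc n) x x ∈ coordDomain n F V x := chart_mem_coordDomain
        (mem_chart_source (Euc n) x) (FiberBundle.mem_baseSet_trivializationAt F V x)
      rw [show formRep F x (θ - η) = fun y => formRep F x θ y - formRep F x η y from
        funext (formRep_sub θ η)]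
      exact (hθ.contDiffAt_formRep hy).sub (hη.contDiffAt_formRep hy)⟩

theorem extDerivD_zero {k : ℕ} : extDerivD D (0 : Form n V k) = 0 := by
  have h := extDerivD_sub D (smoothForm_zero (F := F) (V := V) (k := k)) smoothForm_zero
    (smoothForm_zero.sub smoothForm_zero)
  rwa [sub_self, sub_self] at h

/-- The closed support of a form. -/
def formSupport {k : ℕ} (θ : Form n V k) : Set M := closure {x | θ x ≠ 0}

theorem eq_zero_of_notMem_formSupport {k : ℕ} {θ : Form n V k} {x : M} (hx : x ∉ formSupport θ) :
    θ x = 0 := by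
  by_contra h; exact hx (subset_closure h)

theorem eventually_eq_zero_of_notMem_formSupport {k : ℕ} {θ : Form n V k} {x : M}
    (hx : x ∉ formSupport θ) : ∀ᶠ z in 𝓝 x, θ z = 0 := by
  filter_upwards [isClosed_closure.isOpen_compl.mem_nhds hx] with z hz
  exact eq_zero_of_notMem_formSupport hz

theorem formSupport_extDerivD_subset {k : ℕ} {θ : Form n V k} (hθ : SmoothForm F θ) :
    formSupport (extDerivD D θ) ⊆ formSupport θ := by
  refine closure_minimal (fun x hx => ?_) isClosed_closure
  by_contra h
  refine hx ?_
  rw [extDerivD_eq_of_eventuallyEq D hθ smoothForm_zero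
    (eventually_eq_zero_of_notMem_formSupport h), extDerivD_zero, Pi.zero_apply]

theorem TestForm.extDerivD [D.ContMDiffCovariantDerivative ∞] {k : ℕ} {θ : Form n V k}
    (hθ : TestForm F θ) : TestForm F (extDerivD D θ) :=
  ⟨hθ.1.extDerivD D, hθ.2.of_isClosed_subset isClosed_closure
    (formSupport_extDerivD_subset D hθ.1)⟩

theorem testForm_zero {k : ℕ} : TestForm F (0 : Form n V k) := ⟨smoothForm_zero, by simp⟩

theorem TestForm.sub {k : ℕ} {θ η : Form n V k} (hθ : TestForm F θ) (hη : TestForm F η) :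
    TestForm F (θ - η) := by
  refine ⟨hθ.1.sub hη.1, (hθ.2.union hη.2).of_isClosed_subset isClosed_closure
    (closure_minimal (fun x hx => ?_) (isClosed_closure.union isClosed_closure))⟩
  by_contra h
  rw [Set.mem_union, not_or] at h
  refine hx ?_
  rw [Pi.sub_apply, eq_zero_of_notMem_formSupport h.1, eq_zero_of_notMem_formSupport h.2, sub_self]

theorem TestForm.add {k : ℕ} {θ η : Form n V k} (hθ : TestForm F θ) (hη : TestForm F η) :
    TestForm F (θ + η) := by
  have h := hθ.sub (testForm_zero.sub hη)
  rwa [zero_sub, sub_neg_eq_add] at h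

end ExtDeriv

/-! ### Test forms -/

section TestForms

variable {n : ℕ} {M : Type*} [TopologicalSpace M] [ChartedSpace (EuclideanSpace ℝ (Fin n)) M]
  [IsManifold (𝓡 n) ∞ M] [T2Space M]
  {F : Type*} [NormedAddCommGroup F] [NormedSpace ℝ F] [FiniteDimensional ℝ F]
  {V : M → Type*} [TopologicalSpace (Bundle.TotalSpace F V)]
  [∀ x, NormedAddCommGroup (V x)] [∀ x, InnerProductSpace ℝ (V x)]
  [FiberBundle F V] [VectorBundle ℝ F V] [ContMDiffVectorBundle ∞ F V (𝓡 n)]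

/-- The product of a form with a function. -/
def fnSmul (f : M → ℝ) {k : ℕ} (θ : Form n V k) : Form n V k := fun x => f x • θ x

theorem formRep_fnSmul (f : M → ℝ) {k : ℕ} (θ : Form n V k) (c : M) (y : Euc n) :
    formRep F c (fnSmul f θ) y = f ((chartAt (Euc n) c).symm y) • formRep F c θ y := by
  ext v; simp [formRep, fnSmul]

theorem SmoothForm.fnSmul {f : M → ℝ} (hf : ContMDiff (𝓡 n) 𝓘(ℝ, ℝ) ∞ f) {k : ℕ}
    {θ : Form n V k} (hθ : SmoothForm F θ) : SmoothForm F (fnSmul f θ) :=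
  smoothForm_of_formRep fun x => ⟨x, mem_chart_source (Euc n) x,
    FiberBundle.mem_baseSet_trivializationAt F V x, by
      have hy : chartAt (Euc n) x x ∈ coordDomain n F V x := chart_mem_coordDomain
        (mem_chart_source (Euc n) x) (FiberBundle.mem_baseSet_trivializationAt F V x)
      rw [show formRep F x (TwistedL2.fnSmul f θ) = fun y => f ((chartAt (Euc n) x).symm y) •
        formRep F x θ y from funext (formRep_fnSmul f θ x)]
      exact (contDiffAt_comp_chart_symm hy.1 (hf _)).smul (hθ.contDiffAt_formRep hy)⟩

theorem SmoothForm.const_smul (r : ℝ) {k : ℕ} {θ : Form n V k} (hθ : SmoothForm F θ) :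
    SmoothForm F (r • θ) := hθ.fnSmul (f := fun _ => r) contMDiff_const

theorem formSupport_fnSmul_subset_left (f : M → ℝ) {k : ℕ} (θ : Form n V k) :
    formSupport (fnSmul f θ) ⊆ tsupport f := by
  refine closure_mono fun x hx => ?_
  intro h
  exact hx (by simp [fnSmul, h])

theorem formSupport_fnSmul_subset_right (f : M → ℝ) {k : ℕ} (θ : Form n V k) :
    formSupport (fnSmul f θ) ⊆ formSupport θ := by
  refine closure_mono fun x hx => ?_
  intro h
  exact hx (by simp [fnSmul, h])

theorem SmoothForm.testForm_fnSmul {f : M → ℝ} (hf : ContMDiff (𝓡 n) 𝓘(ℝ, ℝ) ∞ f)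
    (hc : HasCompactSupport f) {k : ℕ} {θ : Form n V k} (hθ : SmoothForm F θ) :
    TestForm F (TwistedL2.fnSmul f θ) :=
  ⟨hθ.fnSmul hf, hc.isCompact.of_isClosed_subset isClosed_closure
    (formSupport_fnSmul_subset_left f θ)⟩

theorem TestForm.const_smul (r : ℝ) {k : ℕ} {θ : Form n V k} (hθ : TestForm F θ) :
    TestForm F (r • θ) :=
  ⟨hθ.1.const_smul r, hθ.2.of_isClosed_subset isClosed_closure
    (formSupport_fnSmul_subset_right (fun _ => r) θ)⟩

open Classical in
/-- The form that is represented by `w` in the chart around `c` and vanishes outside the domain of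
this chart. -/
def formIn (V : M → Type*) [TopologicalSpace (Bundle.TotalSpace F V)]
    [∀ x, NormedAddCommGroup (V x)] [∀ x, InnerProductSpace ℝ (V x)]
    [FiberBundle F V] [VectorBundle ℝ F V] (c : M) {k : ℕ}
    (w : Euc n → Euc n [⋀^Fin k]→L[ℝ] F) : Form n V k := fun x =>
  if x ∈ (chartAt (Euc n) c).source then formOf V c w x else 0

theorem formRep_formIn {c : M} {k : ℕ} {w : Euc n → Euc n [⋀^Fin k]→L[ℝ] F} {y : Euc n}
    (hy : y ∈ coordDomain n F V c) : formRep F c (formIn V c w) y = w y := by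
  rw [← formRep_formOf (V := V) (w := w) hy]
  exact formRep_congr (if_pos ((chartAt (Euc n) c).map_target hy.1))

theorem formIn_eq_zero {c : M} {k : ℕ} {w : Euc n → Euc n [⋀^Fin k]→L[ℝ] F} {x : M}
    (hx : x ∉ (chartAt (Euc n) c).symm '' tsupport w) : formIn V c w x = 0 := by
  rw [formIn]
  split_ifs with h
  · have : w (chartAt (Euc n) c x) = 0 := by
      by_contra h1
      exact hx ⟨_, subset_tsupport w h1, (chartAt (Euc n) c).left_inv h⟩
    ext v
    simp [formOf, this]
  · rfl

theorem formSupport_formIn_subset {c : M} {k : ℕ} {w : Euc n → Euc n [⋀^Fin k]→L[ℝ] F}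
    (hc : HasCompactSupport w) (hs : tsupport w ⊆ coordDomain n F V c) :
    formSupport (formIn V c w) ⊆ (chartAt (Euc n) c).symm '' tsupport w := by
  have hK : IsCompact ((chartAt (Euc n) c).symm '' tsupport w) := hc.isCompact.image_of_continuousOn
    ((chartAt (Euc n) c).continuousOn_symm.mono fun y hy => (hs hy).1)
  refine closure_minimal (fun x hx => ?_) hK.isClosed
  by_contra h
  exact hx (formIn_eq_zero h)

theorem testForm_formIn {c : M} {k : ℕ} {w : Euc n → Euc n [⋀^Fin k]→L[ℝ] F}
    (hw : ContDiff ℝ ∞ w) (hc : HasCompactSupport w) (hs : tsupport w ⊆ coordDomain n F V c) :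
    TestForm F (formIn V c w) := by
  have hK : IsCompact ((chartAt (Euc n) c).symm '' tsupport w) := hc.isCompact.image_of_continuousOn
    ((chartAt (Euc n) c).continuousOn_symm.mono fun y hy => (hs hy).1)
  refine ⟨smoothForm_of_formRep fun x => ?_, hK.of_isClosed_subset isClosed_closure
    (formSupport_formIn_subset hc hs)⟩
  by_cases hx : x ∈ (chartAt (Euc n) c).symm '' tsupport w
  · obtain ⟨y, hy, rfl⟩ := hx
    refine ⟨c, (chartAt (Euc n) c).map_target (hs hy).1, (hs hy).2, ?_⟩
    rw [(chartAt (Euc n) c).right_inv (hs hy).1]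
    refine hw.contDiffAt.congr_of_eventuallyEq ?_
    filter_upwards [(isOpen_coordDomain (G := F) (E := V) c).mem_nhds (hs hy)] with z hz
    exact formRep_formIn hz
  · refine ⟨x, mem_chart_source (Euc n) x, FiberBundle.mem_baseSet_trivializationAt F V x, ?_⟩
    refine (contDiffAt_const (c := 0)).congr_of_eventuallyEq ?_
    have h1 : Tendsto (chartAt (Euc n) x).symm (𝓝 (chartAt (Euc n) x x)) (𝓝 x) := by
      have := (chartAt (Euc n) x).continuousAt_symm (mem_chart_target (Euc n) x)
      rwa [ContinuousAt, (chartAt (Euc n) x).left_inv (mem_chart_source _ x)] at this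
    filter_upwards [h1.eventually (hK.isClosed.isOpen_compl.mem_nhds hx)] with z hz
    rw [formRep_congr (η := 0) (formIn_eq_zero hz), formRep_zero]

end TestForms

/-! ### The Riemannian volume in charts -/

theorem det_gram_comp {n : ℕ} {W : Type*} [NormedAddCommGroup W] [InnerProductSpace ℝ W]
    (S : Euc n →ₗ[ℝ] W) (L : Euc n →ₗ[ℝ] Euc n) :
    (Matrix.of fun i j => (inner ℝ (S (L (EuclideanSpace.single i (1 : ℝ))))
      (S (L (EuclideanSpace.single j (1 : ℝ)))) : ℝ)).det =
    (LinearMap.det L) ^ 2 * (Matrix.of fun i j => (inner ℝ (S (EuclideanSpace.single i (1 : ℝ)))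
      (S (EuclideanSpace.single j (1 : ℝ))) : ℝ)).det := by
  let b := (EuclideanSpace.basisFun (Fin n) ℝ).toBasis
  have hb : ∀ i, b i = EuclideanSpace.single i (1 : ℝ) := fun i => by simp [b]
  let J := LinearMap.toMatrix b b L
  have hL : ∀ i, L (EuclideanSpace.single i (1 : ℝ)) =
      ∑ k, J k i • (EuclideanSpace.single k (1 : ℝ) : Euc n) := fun i => by
    rw [← hb]
    conv_lhs => rw [← b.sum_repr (L (b i))]
    simp only [J, LinearMap.toMatrix_apply, hb]
  have h : (Matrix.of fun i j => (inner ℝ (S (L (EuclideanSpace.single i (1 : ℝ))))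
      (S (L (EuclideanSpace.single j (1 : ℝ)))) : ℝ)) = J.transpose *
      (Matrix.of fun i j => (inner ℝ (S (EuclideanSpace.single i (1 : ℝ)))
      (S (EuclideanSpace.single j (1 : ℝ))) : ℝ)) * J := by
    ext i j
    simp only [Matrix.of_apply, hL, map_sum, map_smul, sum_inner, inner_sum, inner_smul_left,
      inner_smul_right, Matrix.mul_apply, Matrix.transpose_apply, Finset.sum_mul, Finset.mul_sum]
    refine Finset.sum_congr rfl fun k _ => Finset.sum_congr rfl fun l _ => ?_
    simp only [RCLike.conj_to_real]
    ring
  rw [h, Matrix.det_mul, Matrix.det_mul, Matrix.det_transpose, LinearMap.det_toMatrix]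
  ring

theorem det_gram_pos {n : ℕ} {W : Type*} [NormedAddCommGroup W] [InnerProductSpace ℝ W]
    {v : Fin n → W} (h : LinearIndependent ℝ v) :
    0 < (Matrix.of fun i j => (inner ℝ (v i) (v j) : ℝ)).det :=
  (Matrix.posDef_gram_of_linearIndependent h).det_pos

section Volume

variable {n : ℕ} {M : Type*} [TopologicalSpace M] [ChartedSpace (EuclideanSpace ℝ (Fin n)) M]
  [IsManifold (𝓡 n) ∞ M]

theorem hasFDerivAt_transition {c c' : M} {y : Euc n} (hy : y ∈ (chartAt (Euc n) c).target)
    (hy' : (chartAt (Euc n) c).symm y ∈ (chartAt (Euc n) c').source) :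
    HasFDerivAt (fun z => chartAt (Euc n) c' ((chartAt (Euc n) c).symm z))
      (((trivializationAt (Euc n) (TangentSpace (𝓡 n) : M → Type _) c').continuousLinearMapAt ℝ
        ((chartAt (Euc n) c).symm y)).comp
        ((trivializationAt (Euc n) (TangentSpace (𝓡 n) : M → Type _) c).symmL ℝ
          ((chartAt (Euc n) c).symm y)) : Euc n →L[ℝ] Euc n) y := by
  rw [TangentBundle.continuousLinearMapAt_trivializationAt hy', symmL_eq_mfderiv hy]
  have h1 := (mdifferentiableAt_chart_symm hy).hasMFDerivAt
  have h2 := ((contMDiffAt_chart (n := n) hy').mdifferentiableAt (by simp)).hasMFDerivAt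
  have h3 := (HasMFDerivAt.comp y h2 h1).hasFDerivAt
  have h4 : (extChartAt (𝓡 n) c' : M → Euc n) = chartAt (Euc n) c' := by
    ext1 z; simp [mfld_simps]
  rw [h4]
  exact h3

variable [RiemannianBundle (fun x : M => TangentSpace (𝓡 n) x)]

/-- The density `√(det g)` of the Riemannian volume in the chart around `c`. -/
def volumeDensity (c : M) (y : Euc n) : ℝ :=
  Real.sqrt (gramMatrix n M c ((chartAt (Euc n) c).symm y)).det

theorem linearIndependent_coordVector {c p : M} (hp : p ∈ (chartAt (Euc n) c).source) :
    LinearIndependent ℝ (coordVector n M c p) := by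
  have h1 : p ∈ (trivializationAt (Euc n) (TangentSpace (𝓡 n) : M → Type _) c).baseSet := hp
  have h2 : LinearIndependent ℝ fun i : Fin n => (EuclideanSpace.single i (1 : ℝ) : Euc n) := by
    convert! (EuclideanSpace.basisFun (Fin n) ℝ).toBasis.linearIndependent using 1
    ext1 i; simp
  refine h2.map' (((trivializationAt (Euc n) (TangentSpace (𝓡 n) : M → Type _) c).symmL ℝ p :
    Euc n →L[ℝ] TangentSpace (𝓡 n) p) : Euc n →ₗ[ℝ] TangentSpace (𝓡 n) p) ?_
  refine LinearMap.ker_eq_bot_of_inverse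
    (g := (((trivializationAt (Euc n) (TangentSpace (𝓡 n) : M → Type _) c).continuousLinearMapAt ℝ
      p : TangentSpace (𝓡 n) p →L[ℝ] Euc n) : TangentSpace (𝓡 n) p →ₗ[ℝ] Euc n)) ?_
  ext1 v
  exact Trivialization.continuousLinearMapAt_symmL _ h1 v

theorem det_gramMatrix_pos {c p : M} (hp : p ∈ (chartAt (Euc n) c).source) :
    0 < (gramMatrix n M c p).det := by
  exact det_gram_pos (linearIndependent_coordVector hp)

theorem volumeDensity_pos {c : M} {y : Euc n} (hy : y ∈ (chartAt (Euc n) c).target) :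
    0 < volumeDensity c y :=
  Real.sqrt_pos.2 (det_gramMatrix_pos ((chartAt (Euc n) c).map_target hy))

/-- The transformation rule `√(det g) = |det J| √(det g')` under changes of charts. -/
theorem volumeDensity_transition {c c' : M} {y : Euc n}
    (hy' : (chartAt (Euc n) c).symm y ∈ (chartAt (Euc n) c').source) :
    volumeDensity c y = |(((trivializationAt (Euc n) (TangentSpace (𝓡 n) : M → Type _)
      c').continuousLinearMapAt ℝ ((chartAt (Euc n) c).symm y)).comp
        ((trivializationAt (Euc n) (TangentSpace (𝓡 n) : M → Type _) c).symmL ℝ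
          ((chartAt (Euc n) c).symm y)) : Euc n →L[ℝ] Euc n).det| *
      volumeDensity c' (chartAt (Euc n) c' ((chartAt (Euc n) c).symm y)) := by
  set p := (chartAt (Euc n) c).symm y
  let S : Euc n →ₗ[ℝ] TangentSpace (𝓡 n) p :=
    ((trivializationAt (Euc n) (TangentSpace (𝓡 n) : M → Type _) c').symmL ℝ p :
    Euc n →L[ℝ] TangentSpace (𝓡 n) p)
  let L : Euc n →L[ℝ] Euc n := ((trivializationAt (Euc n) (TangentSpace (𝓡 n) : M → Type _)
      c').continuousLinearMapAt ℝ p).comp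
        ((trivializationAt (Euc n) (TangentSpace (𝓡 n) : M → Type _) c).symmL ℝ p)
  have h := det_gram_comp S L.toLinearMap
  have h1 : ∀ v, S (L v) =
      (trivializationAt (Euc n) (TangentSpace (𝓡 n) : M → Type _) c).symmL ℝ p v := fun v =>
    Trivialization.symmL_continuousLinearMapAt (R := ℝ)
      (trivializationAt (Euc n) (TangentSpace (𝓡 n) : M → Type _) c') hy' _
  have h2 : (gramMatrix n M c p).det = L.det ^ 2 * (gramMatrix n M c' p).det := by
    refine Eq.trans ?_ h
    congr 1
    ext i j
    simp only [gramMatrix, Matrix.of_apply, coordVector]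
    erw [h1, h1]
  rw [volumeDensity, volumeDensity, (chartAt (Euc n) c').left_inv hy']
  change Real.sqrt (gramMatrix n M c p).det = |L.det| * Real.sqrt (gramMatrix n M c' p).det
  rw [h2, Real.sqrt_mul (sq_nonneg _), Real.sqrt_sq_eq_abs]

variable [MeasurableSpace M] [BorelSpace M]

theorem measurableSet_target_inter (c : M) {A : Set M} (hA : MeasurableSet A) :
    MeasurableSet ((chartAt (Euc n) c).target ∩ (chartAt (Euc n) c).symm ⁻¹' A) := by
  have h1 : Measurable ((chartAt (Euc n) c).target.domRestrict (chartAt (Euc n) c).symm) :=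
    (continuousOn_iff_continuous_domRestrict.1 (chartAt (Euc n) c).continuousOn_symm).measurable
  have h2 := ((chartAt (Euc n) c).open_target.measurableSet).subtype_image (h1 hA)
  convert h2 using 1
  ext y
  simp [and_comm]

theorem aemeasurable_chart_symm (c : M) : AEMeasurable (chartAt (Euc n) c).symm
    (volume.restrict (chartAt (Euc n) c).target) :=
  (chartAt (Euc n) c).continuousOn_symm.aemeasurable (chartAt (Euc n) c).open_target.measurableSet

theorem chartVolume_apply (c : M) {A : Set M} (hA : MeasurableSet A) :
    chartVolume n M c A = ∫⁻ y in (chartAt (Euc n) c).target ∩ (chartAt (Euc n) c).symm ⁻¹' A,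
      ENNReal.ofReal (volumeDensity c y) := by
  rw [chartVolume, Measure.map_apply_of_aemeasurable ((aemeasurable_chart_symm c).mono_ac
    (withDensity_absolutelyContinuous _ _)) hA, withDensity_apply',
    Measure.restrict_restrict' (chartAt (Euc n) c).open_target.measurableSet, Set.inter_comm]
  rfl

theorem chartVolume_eq_of_subset {c c' : M} {A : Set M} (hA : MeasurableSet A)
    (h : A ⊆ (chartAt (Euc n) c).source) (h' : A ⊆ (chartAt (Euc n) c').source) :
    chartVolume n M c A = chartVolume n M c' A := by
  rw [chartVolume_apply c hA, chartVolume_apply c' hA]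
  set T := (chartAt (Euc n) c).target ∩ (chartAt (Euc n) c).symm ⁻¹' A
  have hT : (chartAt (Euc n) c').target ∩ (chartAt (Euc n) c').symm ⁻¹' A =
      (fun z => chartAt (Euc n) c' ((chartAt (Euc n) c).symm z)) '' T := by
    ext z
    constructor
    · rintro ⟨h1, h2⟩
      refine ⟨chartAt (Euc n) c ((chartAt (Euc n) c').symm z),
        ⟨(chartAt (Euc n) c).map_source (h h2), ?_⟩, ?_⟩
      · rw [Set.mem_preimage, (chartAt (Euc n) c).left_inv (h h2)]; exact h2
      · simp only
        rw [(chartAt (Euc n) c).left_inv (h h2), (chartAt (Euc n) c').right_inv h1]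
    · rintro ⟨y, ⟨h1, h2⟩, rfl⟩
      refine ⟨(chartAt (Euc n) c').map_source (h' h2), ?_⟩
      rw [Set.mem_preimage, (chartAt (Euc n) c').left_inv (h' h2)]; exact h2
  rw [hT, lintegral_image_eq_lintegral_abs_det_fderiv_mul volume (measurableSet_target_inter c hA)
    (fun y hy => (hasFDerivAt_transition hy.1 (h' hy.2)).hasFDerivWithinAt)
    (fun y hy z hz hyz => by
      have := congrArg (chartAt (Euc n) c').symm hyz
      simp only [(chartAt (Euc n) c').left_inv (h' hy.2),
        (chartAt (Euc n) c').left_inv (h' hz.2)] at this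
      rw [← (chartAt (Euc n) c).right_inv hy.1, this, (chartAt (Euc n) c).right_inv hz.1])]
  refine setLIntegral_congr_fun (measurableSet_target_inter c hA) fun y hy => ?_
  simp only
  rw [volumeDensity_transition (h' hy.2), ENNReal.ofReal_mul (abs_nonneg _)]

theorem chartVolume_compl_source (c : M) :
    chartVolume n M c (chartAt (Euc n) c).sourceᶜ = 0 := by
  rw [chartVolume_apply c (chartAt (Euc n) c).open_source.measurableSet.compl]
  have : (chartAt (Euc n) c).target ∩ (chartAt (Euc n) c).symm ⁻¹' (chartAt (Euc n) c).sourceᶜ = ∅ := by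
    ext y
    simp only [Set.mem_inter_iff, Set.mem_preimage, Set.mem_compl_iff, Set.mem_empty_iff_false,
      iff_false, not_and, not_not]
    exact fun h => (chartAt (Euc n) c).map_target h
  rw [this]; simp

/-- A measure that is at least as large as the volume of each chart, with equality in the
given chart. -/
theorem exists_measure_ge_chartVolume [SecondCountableTopology M] (c₀ : M) :
    ∃ ν : Measure M, (∀ c, chartVolume n M c ≤ ν) ∧
      ∀ A, MeasurableSet A → A ⊆ (chartAt (Euc n) c₀).source → ν A = chartVolume n M c₀ A := by
  obtain ⟨S, hS, hcov⟩ := TopologicalSpace.countable_cover_nhds fun c : M =>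
    (chartAt (Euc n) c).open_source.mem_nhds (mem_chart_source (Euc n) c)
  have hne : S.Nonempty := by
    have : c₀ ∈ ⋃ x ∈ S, (chartAt (Euc n) x).source := by rw [hcov]; trivial
    obtain ⟨x, hx, -⟩ := Set.mem_iUnion₂.1 this
    exact ⟨x, hx⟩
  obtain ⟨e, rfl⟩ := hS.exists_eq_range hne
  let U : ℕ → Set M := fun j => (chartAt (Euc n) (e j)).source
  have hU : ∀ j, MeasurableSet (U j) := fun j => (chartAt (Euc n) (e j)).open_source.measurableSet
  have hB : ∀ j, MeasurableSet (disjointed U j) := fun j => MeasurableSet.disjointed hU j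
  have hBU : ⋃ j, disjointed U j = Set.univ := by
    rw [iUnion_disjointed, ← hcov, Set.biUnion_range]
  have hsum : ∀ (m : Measure M) (A : Set M), MeasurableSet A →
      m A = ∑' j, m (A ∩ disjointed U j) := fun m A hA => by
    rw [← measure_iUnion (fun i j hij => ((disjoint_disjointed U) hij).mono Set.inter_subset_right
      Set.inter_subset_right) (fun j => hA.inter (hB j)), ← Set.inter_iUnion, hBU, Set.inter_univ]
  -- glue the chart volumes along a partition into measurable subsets of chart domains
  let ν : Measure M := Measure.sum fun j => (chartVolume n M (e j)).restrict (disjointed U j)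
  have hν : ∀ A, MeasurableSet A → ν A = ∑' j, chartVolume n M (e j) (A ∩ disjointed U j) :=
    fun A hA => by
      rw [Measure.sum_apply _ hA]
      exact tsum_congr fun j => Measure.restrict_apply hA
  refine ⟨ν, fun c => Measure.le_iff.2 fun A hA => ?_, fun A hA hAc => ?_⟩
  · rw [hν A hA, hsum _ A hA]
    refine ENNReal.tsum_le_tsum fun j => ?_
    have hs := (chartAt (Euc n) c).open_source.measurableSet
    rw [← measure_inter_add_sdiff (A ∩ disjointed U j) hs]
    have h0 : chartVolume n M c ((A ∩ disjointed U j) \ (chartAt (Euc n) c).source) = 0 :=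
      measure_mono_null (fun x hx => hx.2) (chartVolume_compl_source c)
    rw [h0, add_zero, chartVolume_eq_of_subset (c' := e j) ((hA.inter (hB j)).inter hs)
      Set.inter_subset_right fun x hx => disjointed_subset U j hx.1.2]
    exact measure_mono Set.inter_subset_left
  · rw [hν A hA, hsum _ A hA]
    exact tsum_congr fun j => chartVolume_eq_of_subset (hA.inter (hB j))
      (fun x hx => disjointed_subset U j hx.2) fun x hx => hAc hx.1

variable [SecondCountableTopology M]

theorem riemannianVolume_apply (c : M) {A : Set M} (hA : MeasurableSet A)
    (h : A ⊆ (chartAt (Euc n) c).source) : riemannianVolume n M A = chartVolume n M c A := by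
  obtain ⟨ν, h1, h2⟩ := exists_measure_ge_chartVolume (n := n) c
  refine le_antisymm ?_ (le_iSup (chartVolume n M) c A)
  rw [← h2 A hA h]
  exact (iSup_le h1 : riemannianVolume n M ≤ ν) A

/-- The Riemannian volume on the domain of a chart. -/
theorem riemannianVolume_restrict (c : M) :
    (riemannianVolume n M).restrict (chartAt (Euc n) c).source = chartVolume n M c := by
  have hs := (chartAt (Euc n) c).open_source.measurableSet
  ext A hA
  have h0 : chartVolume n M c (A \ (chartAt (Euc n) c).source) = 0 :=
    measure_mono_null (fun x hx => hx.2) (chartVolume_compl_source c)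
  have h1 := measure_inter_add_sdiff A hs (μ := chartVolume n M c)
  rw [h0, add_zero] at h1
  rw [Measure.restrict_apply hA, riemannianVolume_apply c (hA.inter hs) Set.inter_subset_right, h1]

end Volume

section VolumeCalculus

variable {n : ℕ} {M : Type*} [TopologicalSpace M] [ChartedSpace (EuclideanSpace ℝ (Fin n)) M]
  [IsManifold (𝓡 n) ∞ M] [RiemannianBundle (fun x : M => TangentSpace (𝓡 n) x)]
  [IsContMDiffRiemannianBundle (𝓡 n) ∞ (EuclideanSpace ℝ (Fin n))
      (fun x : M => TangentSpace (𝓡 n) x)]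

theorem contDiffAt_volumeDensity {c : M} {y : Euc n} (hy : y ∈ (chartAt (Euc n) c).target) :
    ContDiffAt ℝ ∞ (volumeDensity c) y := by
  have h1 : ∀ i, ContMDiffAt (𝓡 n) ((𝓡 n).prod 𝓘(ℝ, Euc n)) ∞
      (fun x => (⟨x, coordVector n M c x i⟩ : TotalSpace (Euc n) (TangentSpace (𝓡 n) : M → Type _)))
      ((chartAt (Euc n) c).symm y) := fun i =>
    contMDiffAt_secOf (E := (TangentSpace (𝓡 n) : M → Type _))
      (g := fun _ => EuclideanSpace.single i (1 : ℝ))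
      ((coordDomain_tangent (n := n) c).symm ▸ hy) contDiffAt_const
  have h2 : ∀ i j, ContDiffAt ℝ ∞
      (fun y => gramMatrix n M c ((chartAt (Euc n) c).symm y) i j) y := fun i j =>
    contDiffAt_comp_chart_symm (f := fun x => gramMatrix n M c x i j) hy
      (ContMDiffAt.inner_bundle (h1 i) (h1 j))
  have h3 : ContDiffAt ℝ ∞ (fun y => (gramMatrix n M c ((chartAt (Euc n) c).symm y)).det) y := by
    simp only [Matrix.det_apply]
    refine ContDiffAt.sum fun σ _ => ?_
    exact ContDiffAt.const_smul _ (contDiffAt_prod fun i _ => h2 _ _)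
  exact h3.sqrt (det_gramMatrix_pos ((chartAt (Euc n) c).map_target hy)).ne'

theorem volumeDensity_nonneg (c : M) (y : Euc n) : 0 ≤ volumeDensity c y := Real.sqrt_nonneg _

theorem continuousOn_volumeDensity (c : M) :
    ContinuousOn (volumeDensity c) (chartAt (Euc n) c).target := fun _ hy =>
  (contDiffAt_volumeDensity hy).continuousAt.continuousWithinAt

theorem aemeasurable_volumeDensity (c : M) : AEMeasurable
    (fun y => ENNReal.ofReal (volumeDensity c y)) (volume.restrict (chartAt (Euc n) c).target) :=
  ((continuousOn_volumeDensity c).aemeasurable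
    (chartAt (Euc n) c).open_target.measurableSet).ennreal_ofReal

variable [SecondCountableTopology M] [MeasurableSpace M] [BorelSpace M]

theorem chartVolume_eq (c : M) : chartVolume n M c =
    ((volume.restrict (chartAt (Euc n) c).target).withDensity
      fun y => ENNReal.ofReal (volumeDensity c y)).map (chartAt (Euc n) c).symm := rfl

/-- Null sets of the Riemannian volume are null sets in each chart. -/
theorem map_chart_symm_absolutelyContinuous (c : M) :
    (volume.restrict (chartAt (Euc n) c).target).map (chartAt (Euc n) c).symm ≪
      riemannianVolume n M := by
  refine Measure.AbsolutelyContinuous.mk fun A hA h => ?_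
  have h1 : chartVolume n M c A = 0 := le_antisymm ((le_iSup (chartVolume n M) c A).trans h.le) bot_le
  rw [chartVolume_eq, Measure.map_apply_of_aemeasurable ((aemeasurable_chart_symm c).mono_ac
    (withDensity_absolutelyContinuous _ _)) hA] at h1
  rw [Measure.map_apply_of_aemeasurable (aemeasurable_chart_symm c) hA]
  refine withDensity_absolutelyContinuous' (aemeasurable_volumeDensity c) ?_ h1
  refine (ae_restrict_iff' (chartAt (Euc n) c).open_target.measurableSet).2
    (Eventually.of_forall fun y hy => ?_)
  exact (ENNReal.ofReal_pos.2 (volumeDensity_pos hy)).ne'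

theorem aestronglyMeasurable_comp_chart_symm {G : Type*} [TopologicalSpace G] (c : M) {f : M → G}
    (hf : AEStronglyMeasurable f (riemannianVolume n M)) :
    AEStronglyMeasurable (fun y => f ((chartAt (Euc n) c).symm y))
      (volume.restrict (chartAt (Euc n) c).target) :=
  (hf.mono_ac (map_chart_symm_absolutelyContinuous c)).comp_aemeasurable (aemeasurable_chart_symm c)

theorem integral_eq_integral_chart (c : M) {f : M → ℝ}
    (hf : AEStronglyMeasurable f (riemannianVolume n M))
    (h0 : ∀ x, x ∉ (chartAt (Euc n) c).source → f x = 0) :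
    ∫ x, f x ∂(riemannianVolume n M) =
      ∫ y in (chartAt (Euc n) c).target, volumeDensity c y * f ((chartAt (Euc n) c).symm y) := by
  rw [← setIntegral_eq_integral_of_forall_compl_eq_zero h0, riemannianVolume_restrict,
    chartVolume_eq, integral_map ((aemeasurable_chart_symm c).mono_ac
      (withDensity_absolutelyContinuous _ _)),
    integral_withDensity_eq_integral_toReal_smul₀ (aemeasurable_volumeDensity c)
      (Eventually.of_forall fun _ => ENNReal.ofReal_lt_top)]
  · refine integral_congr_ae (Eventually.of_forall fun y => ?_)
    simp only [smul_eq_mul]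
    rw [ENNReal.toReal_ofReal (volumeDensity_nonneg c y)]
  · rw [← chartVolume_eq, ← riemannianVolume_restrict]
    exact hf.restrict

theorem integrableOn_chart (c : M) {f : M → ℝ} (hf : Integrable f (riemannianVolume n M)) :
    IntegrableOn (fun y => volumeDensity c y * f ((chartAt (Euc n) c).symm y))
      (chartAt (Euc n) c).target := by
  have h1 := hf.restrict (s := (chartAt (Euc n) c).source)
  rw [riemannianVolume_restrict, chartVolume_eq] at h1
  have h2 := h1.comp_aemeasurable ((aemeasurable_chart_symm c).mono_ac
      (withDensity_absolutelyContinuous _ _))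
  rw [integrable_withDensity_iff_integrable_smul₀' (aemeasurable_volumeDensity c)
      (Eventually.of_forall fun _ => ENNReal.ofReal_lt_top)] at h2
  refine h2.congr (Eventually.of_forall fun y => ?_)
  simp only [smul_eq_mul, Function.comp]
  rw [ENNReal.toReal_ofReal (volumeDensity_nonneg c y)]

theorem setIntegral_chart_le (c : M) {f : M → ℝ} (hf : Integrable f (riemannianVolume n M))
    (h0 : ∀ x, 0 ≤ f x) :
    ∫ y in (chartAt (Euc n) c).target, volumeDensity c y * f ((chartAt (Euc n) c).symm y) ≤
      ∫ x, f x ∂(riemannianVolume n M) := by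
  have hs := (chartAt (Euc n) c).open_source.measurableSet
  have h1 := integral_eq_integral_chart c (f := (chartAt (Euc n) c).source.indicator f)
    (hf.aestronglyMeasurable.indicator hs) fun x hx => Set.indicator_of_notMem hx f
  rw [integral_indicator hs] at h1
  refine le_of_eq_of_le ?_ (setIntegral_le_integral hf (Eventually.of_forall h0)
    (s := (chartAt (Euc n) c).source))
  rw [h1]
  refine setIntegral_congr_fun (chartAt (Euc n) c).open_target.measurableSet fun y hy => ?_
  rw [Set.indicator_of_mem ((chartAt (Euc n) c).map_target hy)]

instance : Measure.IsOpenPosMeasure (riemannianVolume n M) := by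
  refine ⟨fun U hU ⟨x, hx⟩ h => ?_⟩
  have h1 := map_chart_symm_absolutelyContinuous x h
  rw [Measure.map_apply_of_aemeasurable (aemeasurable_chart_symm x) hU.measurableSet,
    Measure.restrict_apply' (chartAt (Euc n) x).open_target.measurableSet, Set.inter_comm] at h1
  refine ((chartAt (Euc n) x).symm.isOpen_inter_preimage hU).measure_ne_zero volume
    ⟨chartAt (Euc n) x x, mem_chart_target _ x, ?_⟩ h1
  rw [Set.mem_preimage, (chartAt (Euc n) x).left_inv (mem_chart_source _ x)]
  exact hx

instance : IsLocallyFiniteMeasure (riemannianVolume n M) := by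
  refine ⟨fun x => ?_⟩
  have hT := (chartAt (Euc n) x).open_target
  have hy := mem_chart_target (Euc n) x
  obtain ⟨r, hr, hball⟩ := Metric.nhds_basis_closedBall.mem_iff.1 (hT.mem_nhds hy)
  obtain ⟨C, hC⟩ := (isCompact_closedBall (chartAt (Euc n) x x) r).bddAbove_image
    ((continuousOn_volumeDensity x).mono hball)
  let U := (chartAt (Euc n) x).source ∩ chartAt (Euc n) x ⁻¹' Metric.ball (chartAt (Euc n) x x) r
  have hU : IsOpen U := (chartAt (Euc n) x).isOpen_inter_preimage Metric.isOpen_ball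
  refine ⟨U, hU.mem_nhds ⟨mem_chart_source _ x, Metric.mem_ball_self hr⟩, ?_⟩
  rw [riemannianVolume_apply x hU.measurableSet Set.inter_subset_left,
    chartVolume_apply x hU.measurableSet]
  have hsub : (chartAt (Euc n) x).target ∩ (chartAt (Euc n) x).symm ⁻¹' U ⊆
      Metric.closedBall (chartAt (Euc n) x x) r := fun y hy => by
    have := hy.2.2
    rw [Set.mem_preimage, (chartAt (Euc n) x).right_inv hy.1] at this
    exact Metric.ball_subset_closedBall this
  calc _ ≤ ∫⁻ _ in (chartAt (Euc n) x).target ∩ (chartAt (Euc n) x).symm ⁻¹' U,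
        ENNReal.ofReal C := by
        refine setLIntegral_mono measurable_const fun y hy => ENNReal.ofReal_le_ofReal ?_
        exact hC ⟨y, hsub hy, rfl⟩
    _ ≤ ∫⁻ _ in Metric.closedBall (chartAt (Euc n) x x) r, ENNReal.ofReal C :=
        lintegral_mono_set hsub
    _ < ⊤ := by
        rw [setLIntegral_const]
        exact ENNReal.mul_lt_top ENNReal.ofReal_lt_top
          (isCompact_closedBall _ _).measure_lt_top

end VolumeCalculus

/-! ### Orthonormal frames -/

section Frames

open InnerProductSpace

variable {n : ℕ} {M : Type*} [TopologicalSpace M] [ChartedSpace (EuclideanSpace ℝ (Fin n)) M]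
  [IsManifold (𝓡 n) ∞ M] [T2Space M]
  {G : Type*} [NormedAddCommGroup G] [NormedSpace ℝ G] [FiniteDimensional ℝ G]
  {E : M → Type*} [TopologicalSpace (Bundle.TotalSpace G E)]
  [∀ x, NormedAddCommGroup (E x)] [∀ x, InnerProductSpace ℝ (E x)]
  [FiberBundle G E] [VectorBundle ℝ G E] [ContMDiffVectorBundle ∞ G E (𝓡 n)]
  [IsContMDiffRiemannianBundle (𝓡 n) ∞ G E]

theorem contMDiffOn_gramSchmidt {U : Set M} {d : ℕ} {f : Fin d → (x : M) → E x}
    (hf : ∀ i, ContMDiffOn (𝓡 n) ((𝓡 n).prod 𝓘(ℝ, G)) ∞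
      (fun x => (⟨x, f i x⟩ : TotalSpace G E)) U)
    (hli : ∀ x ∈ U, LinearIndependent ℝ fun i => f i x) (i : Fin d) :
    ContMDiffOn (𝓡 n) ((𝓡 n).prod 𝓘(ℝ, G)) ∞
      (fun x => (⟨x, gramSchmidt ℝ (fun i => f i x) i⟩ : TotalSpace G E)) U := by
  induction i using WellFoundedLT.induction with
  | _ i ih =>
  have h1 : ∀ j ∈ Finset.Iio i, ContMDiffOn (𝓡 n) ((𝓡 n).prod 𝓘(ℝ, G)) ∞ (fun x => (⟨x,
      ((inner ℝ (gramSchmidt ℝ (fun i => f i x) j) (f i x) : ℝ) /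
        (inner ℝ (gramSchmidt ℝ (fun i => f i x) j) (gramSchmidt ℝ (fun i => f i x) j) : ℝ)) •
          gramSchmidt ℝ (fun i => f i x) j⟩ : TotalSpace G E)) U := by
    intro j hj
    have hj' := ih j (Finset.mem_Iio.1 hj)
    refine ContMDiffOn.smul_section (f := fun x =>
      (inner ℝ (gramSchmidt ℝ (fun i => f i x) j) (f i x) : ℝ) /
        (inner ℝ (gramSchmidt ℝ (fun i => f i x) j) (gramSchmidt ℝ (fun i => f i x) j) : ℝ)) ?_ hj'
    refine ContMDiffOn.div₀ (hj'.inner_bundle (hf i)) (hj'.inner_bundle hj') fun x hx => ?_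
    rw [inner_self_ne_zero]
    exact gramSchmidt_ne_zero j (hli x hx)
  have h2 := (hf i).sub_section (ContMDiffOn.sum_section h1)
  refine h2.congr fun x hx => ?_
  congr 1
  have h3 := gramSchmidt_def'' ℝ (fun i => f i x) i
  simp only [Pi.sub_apply]
  refine eq_sub_of_add_eq ?_
  refine Eq.trans ?_ h3.symm
  congr 1
  refine Finset.sum_congr rfl fun j _ => ?_
  rw [real_inner_self_eq_norm_sq]
  rfl

/-- Around every point there are smooth sections that form an orthonormal basis of each fibre. -/
theorem exists_orthonormal_frame (x₀ : M) : ∃ (W : Set M)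
    (e : Fin (Module.finrank ℝ G) → (x : M) → E x), IsOpen W ∧ x₀ ∈ W ∧
    (∀ i, ContMDiff (𝓡 n) ((𝓡 n).prod 𝓘(ℝ, G)) ∞ (fun x => (⟨x, e i x⟩ : TotalSpace G E))) ∧
    ∀ x ∈ W, ∃ b : OrthonormalBasis (Fin (Module.finrank ℝ G)) ℝ (E x), ∀ i, b i = e i x := by
  let d := Module.finrank ℝ G
  let f : Fin d → (x : M) → E x := fun i => secOf E x₀ fun _ : Euc n => Module.finBasis ℝ G i
  let U : Set M := (chartAt (Euc n) x₀).source ∩ (trivializationAt G E x₀).baseSet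
  have hU : IsOpen U := (chartAt (Euc n) x₀).open_source.inter (trivializationAt G E x₀).open_baseSet
  have hx₀ : x₀ ∈ U := ⟨mem_chart_source _ x₀, FiberBundle.mem_baseSet_trivializationAt G E x₀⟩
  have hf : ∀ i, ContMDiffOn (𝓡 n) ((𝓡 n).prod 𝓘(ℝ, G)) ∞
      (fun x => (⟨x, f i x⟩ : TotalSpace G E)) U := fun i x hx => by
    have h := contMDiffAt_secOf (n := n) (E := E) (g := fun _ : Euc n => Module.finBasis ℝ G i)
      (chart_mem_coordDomain hx.1 hx.2) contDiffAt_const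
    rw [(chartAt (Euc n) x₀).left_inv hx.1] at h
    exact h.contMDiffWithinAt
  have hli : ∀ x ∈ U, LinearIndependent ℝ fun i => f i x := fun x hx => by
    let L := (trivializationAt G E x₀).continuousLinearEquivAt ℝ x hx.2
    have h1 : (fun i => f i x) = L.symm.toLinearEquiv.toLinearMap ∘ Module.finBasis ℝ G := by
      funext i
      exact (congrFun ((trivializationAt G E x₀).symm_continuousLinearEquivAt_eq hx.2)
        (Module.finBasis ℝ G i)).symm
    rw [h1]
    exact (Module.finBasis ℝ G).linearIndependent.map' _ (LinearEquiv.ker _)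
  -- apply the Gram–Schmidt process to the frame given by the trivialization
  have hg := fun i => contMDiffOn_gramSchmidt hf hli i
  have hn : ∀ i, ContMDiffOn (𝓡 n) ((𝓡 n).prod 𝓘(ℝ, G)) ∞
      (fun x => (⟨x, gramSchmidtNormed ℝ (fun i => f i x) i⟩ : TotalSpace G E)) U := fun i => by
    have hq : ∀ x ∈ U, 0 < (inner ℝ (gramSchmidt ℝ (fun i => f i x) i)
        (gramSchmidt ℝ (fun i => f i x) i) : ℝ) := fun x hx =>
      real_inner_self_pos.2 (gramSchmidt_ne_zero i (hli x hx))
    have h1 : ContMDiffOn (𝓡 n) 𝓘(ℝ, ℝ) ∞ (fun x => (Real.sqrt (inner ℝ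
        (gramSchmidt ℝ (fun i => f i x) i) (gramSchmidt ℝ (fun i => f i x) i) : ℝ))⁻¹) U := by
      intro x hx
      have h2 : ContDiffAt ℝ ∞ (fun t : ℝ => (Real.sqrt t)⁻¹) (inner ℝ
        (gramSchmidt ℝ (fun i => f i x) i) (gramSchmidt ℝ (fun i => f i x) i) : ℝ) :=
        (Real.contDiffAt_sqrt (hq x hx).ne').inv (Real.sqrt_pos.2 (hq x hx)).ne'
      exact ContMDiffAt.comp_contMDiffWithinAt (g := fun t : ℝ => (Real.sqrt t)⁻¹) x
        h2.contMDiffAt ((hg i).inner_bundle (hg i) x hx)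
    refine (ContMDiffOn.smul_section h1 (hg i)).congr fun x hx => ?_
    congr 1
    rw [gramSchmidtNormed, norm_eq_sqrt_real_inner]
    rfl
  choose e he hee using fun i => exists_global_section hU hx₀ (hn i)
  have hev : ∀ᶠ x in 𝓝 x₀, x ∈ U ∧ ∀ i, e i x = gramSchmidtNormed ℝ (fun i => f i x) i :=
    (show ∀ᶠ x in 𝓝 x₀, x ∈ U from hU.mem_nhds hx₀).and (eventually_all.2 hee)
  obtain ⟨W, hW, hWo, hxW⟩ := eventually_nhds_iff.1 hev
  refine ⟨W, e, hWo, hxW, he, fun x hx => ?_⟩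
  obtain ⟨h1, h2⟩ := hW x hx
  let L := ((trivializationAt G E x₀).continuousLinearEquivAt ℝ x h1.2).toLinearEquiv
  have : FiniteDimensional ℝ (E x) := L.symm.finiteDimensional
  refine ⟨gramSchmidtOrthonormalBasis (by rw [L.finrank_eq, Fintype.card_fin]) fun i => f i x,
    fun i => ?_⟩
  rw [h2, gramSchmidtOrthonormalBasis_apply]
  intro h0
  have := gramSchmidtNormed_unit_length i (hli x h1)
  rw [h0] at this
  simp at this

end Frames

/-! ### The inner product of forms -/

section MultilinearExpansion

variable {k : ℕ} {W Z : Type*} [NormedAddCommGroup W] [InnerProductSpace ℝ W]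
  {ι ι' : Type*} [Fintype ι] [Fintype ι']

theorem alt_eq_sum_orthonormal [NormedAddCommGroup Z] [NormedSpace ℝ Z] (a : W [⋀^Fin k]→L[ℝ] Z)
    (e : OrthonormalBasis ι ℝ W) (v : Fin k → W) :
    a v = ∑ I : Fin k → ι, (∏ m, (inner ℝ (e (I m)) (v m) : ℝ)) • a fun m => e (I m) := by
  classical
  have hv : v = fun m => ∑ i, (inner ℝ (e i) (v m) : ℝ) • e i := by
    funext m; exact (e.sum_repr' (v m)).symm
  conv_lhs => rw [hv]
  refine (a.toContinuousMultilinearMap.toMultilinearMap.map_sum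
    fun m i => (inner ℝ (e i) (v m) : ℝ) • e i).trans (Finset.sum_congr rfl fun I _ => ?_)
  exact a.toContinuousMultilinearMap.toMultilinearMap.map_smul_univ _ _

/-- The inner product of alternating maps does not depend on the orthonormal basis. -/
theorem sum_inner_orthonormal [NormedAddCommGroup Z] [InnerProductSpace ℝ Z]
    (a b : W [⋀^Fin k]→L[ℝ] Z) (e : OrthonormalBasis ι ℝ W) (e' : OrthonormalBasis ι' ℝ W) :
    ∑ I : Fin k → ι, (inner ℝ (a fun m => e (I m)) (b fun m => e (I m)) : ℝ) =
      ∑ J : Fin k → ι', (inner ℝ (a fun m => e' (J m)) (b fun m => e' (J m)) : ℝ) := by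
  classical
  have h1 : ∀ I : Fin k → ι, (inner ℝ (a fun m => e (I m)) (b fun m => e (I m)) : ℝ) =
      ∑ J : Fin k → ι', ∑ J' : Fin k → ι', (∏ m, ((inner ℝ (e' (J m)) (e (I m)) : ℝ) *
        (inner ℝ (e (I m)) (e' (J' m)) : ℝ))) *
        (inner ℝ (a fun m => e' (J m)) (b fun m => e' (J' m)) : ℝ) := fun I => by
    rw [alt_eq_sum_orthonormal a e' fun m => e (I m), alt_eq_sum_orthonormal b e' fun m => e (I m),
      sum_inner]
    refine Finset.sum_congr rfl fun J _ => ?_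
    rw [inner_sum]
    refine Finset.sum_congr rfl fun J' _ => ?_
    rw [inner_smul_left, inner_smul_right, RCLike.conj_to_real, ← mul_assoc,
      ← Finset.prod_mul_distrib]
    congr 1
    exact Finset.prod_congr rfl fun m _ => by rw [real_inner_comm (e (I m)) (e' (J' m))]
  -- Parseval's identity in each argument
  have h2 : ∀ J J' : Fin k → ι', ∑ I : Fin k → ι, ∏ m, ((inner ℝ (e' (J m)) (e (I m)) : ℝ) *
        (inner ℝ (e (I m)) (e' (J' m)) : ℝ)) = if J = J' then 1 else 0 := fun J J' => by
    have h3 := Finset.prod_univ_sum (fun _ : Fin k => (Finset.univ : Finset ι))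
      (fun m i => (inner ℝ (e' (J m)) (e i) : ℝ) * (inner ℝ (e i) (e' (J' m)) : ℝ))
    rw [Fintype.piFinset_univ] at h3
    rw [← h3]
    simp only [e.sum_inner_mul_inner, orthonormal_iff_ite.1 e'.orthonormal]
    by_cases h : J = J'
    · subst h; simp
    · rw [if_neg h]
      obtain ⟨m, hm⟩ := Function.ne_iff.1 h
      exact Finset.prod_eq_zero (Finset.mem_univ m) (if_neg hm)
  simp only [h1]
  rw [Finset.sum_comm]
  refine Finset.sum_congr rfl fun J _ => ?_
  rw [Finset.sum_comm]
  simp only [← Finset.sum_mul, h2]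
  simp

end MultilinearExpansion

section FormInner

variable {n : ℕ} {M : Type*} [TopologicalSpace M] [ChartedSpace (EuclideanSpace ℝ (Fin n)) M]
  [IsManifold (𝓡 n) ∞ M] [RiemannianBundle (fun x : M => TangentSpace (𝓡 n) x)]
  {F : Type*} [NormedAddCommGroup F] [NormedSpace ℝ F]
  {V : M → Type*} [TopologicalSpace (Bundle.TotalSpace F V)]
  [∀ x, NormedAddCommGroup (V x)] [∀ x, InnerProductSpace ℝ (V x)]
  [FiberBundle F V]

/-- The inner product of forms in terms of an arbitrary orthonormal basis. -/
theorem formInner_eq_sum (x : M) {k : ℕ} (a b : (TangentSpace (𝓡 n) x) [⋀^Fin k]→L[ℝ] V x)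
    {ι : Type*} [Fintype ι] (e : OrthonormalBasis ι ℝ (TangentSpace (𝓡 n) x)) :
    formInner x a b = ((k.factorial : ℝ))⁻¹ *
      ∑ I : Fin k → ι, (inner ℝ (a fun m => e (I m)) (b fun m => e (I m)) : ℝ) := by
  rw [formInner]
  congr 1
  exact sum_inner_orthonormal a b _ e

/-- There are no forms of degree larger than the dimension. -/
theorem form_eq_zero_of_lt {k : ℕ} (hk : n < k) (θ : Form n V k) : θ = 0 := by
  funext x
  ext v
  have : FiniteDimensional ℝ (TangentSpace (𝓡 n) x) :=
    inferInstanceAs (FiniteDimensional ℝ (Euc n))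
  have h1 : ¬ LinearIndependent ℝ v := fun h => by
    have h2 := h.fintype_card_le_finrank
    have h3 : Module.finrank ℝ (TangentSpace (𝓡 n) x) = n := finrank_euclideanSpace_fin (𝕜 := ℝ)
    rw [h3, Fintype.card_fin] at h2
    omega
  exact (θ x).toAlternatingMap.map_linearDependent v h1

end FormInner

/-! ### Square-integrable forms -/

section OrthoFrames

variable {n : ℕ} {M : Type*} [TopologicalSpace M] [ChartedSpace (EuclideanSpace ℝ (Fin n)) M]
  [IsManifold (𝓡 n) ∞ M] [RiemannianBundle (fun x : M => TangentSpace (𝓡 n) x)]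
  [IsContMDiffRiemannianBundle (𝓡 n) ∞ (EuclideanSpace ℝ (Fin n))
      (fun x : M => TangentSpace (𝓡 n) x)]
  {F : Type*} [NormedAddCommGroup F] [NormedSpace ℝ F]
  {V : M → Type*} [TopologicalSpace (Bundle.TotalSpace F V)]
  [∀ x, NormedAddCommGroup (V x)] [∀ x, InnerProductSpace ℝ (V x)]
  [FiberBundle F V]

/-- Index set for a frame of the tangent bundle. -/
abbrev TanIdx (n : ℕ) : Type := Fin (Module.finrank ℝ (Euc n))

/-- Index set for a frame of the bundle of coefficients. -/
abbrev FibIdx (F : Type*) [NormedAddCommGroup F] [NormedSpace ℝ F] : Type := Fin (Module.finrank ℝ F)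

variable (n M F V) in
/-- Global smooth vector fields and sections which form orthonormal bases of the fibres of `TM` and
`V` over an open set. -/
structure OrthoFrame where
  /-- The open set over which the frame is orthonormal. -/
  dom : Set M
  /-- The vector fields. -/
  fld : TanIdx n → (x : M) → TangentSpace (𝓡 n) x
  /-- The sections. -/
  sec : FibIdx F → (x : M) → V x
  isOpen_dom : IsOpen dom
  smooth_fld : ∀ i, SmoothField (fld i)
  smooth_sec : ∀ i, SmoothSection n F (sec i)
  exists_fld : ∀ x ∈ dom, ∃ b : OrthonormalBasis (TanIdx n) ℝ (TangentSpace (𝓡 n) x),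
    ∀ i, b i = fld i x
  exists_sec : ∀ x ∈ dom, ∃ b : OrthonormalBasis (FibIdx F) ℝ (V x), ∀ i, b i = sec i x

namespace OrthoFrame

variable (Φ : OrthoFrame n M F V)

/-- A coefficient of a form with respect to an orthonormal frame. -/
def coef {k : ℕ} (θ : Form n V k) (I : Fin k → TanIdx n) (a : FibIdx F) (x : M) : ℝ :=
  inner ℝ (θ x fun m => Φ.fld (I m) x) (Φ.sec a x)

theorem coef_add {k : ℕ} (θ η : Form n V k) (I : Fin k → TanIdx n) (a : FibIdx F) (x : M) :
    Φ.coef (θ + η) I a x = Φ.coef θ I a x + Φ.coef η I a x := by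
  simp [coef, inner_add_left]

theorem coef_smul {k : ℕ} (r : ℝ) (θ : Form n V k) (I : Fin k → TanIdx n) (a : FibIdx F) (x : M) :
    Φ.coef (r • θ) I a x = r * Φ.coef θ I a x := by
  simp [coef, inner_smul_left]

variable {Φ} in
theorem formInner_eq {x : M} (hx : x ∈ Φ.dom) {k : ℕ} (θ η : Form n V k) :
    formInner x (θ x) (η x) = ((k.factorial : ℝ))⁻¹ *
      ∑ I : Fin k → TanIdx n, ∑ a : FibIdx F, Φ.coef θ I a x * Φ.coef η I a x := by
  obtain ⟨b, hb⟩ := Φ.exists_fld x hx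
  obtain ⟨s, hs⟩ := Φ.exists_sec x hx
  rw [formInner_eq_sum x _ _ b]
  simp only [hb]
  congr 1
  refine Finset.sum_congr rfl fun I _ => ?_
  rw [← s.sum_inner_mul_inner]
  refine Finset.sum_congr rfl fun a _ => ?_
  rw [hs, coef, coef, real_inner_comm (η x _)]

variable {Φ} in
/-- A form is determined by its coefficients. -/
theorem inner_apply_eq {x : M} (hx : x ∈ Φ.dom) {k : ℕ} (θ : Form n V k)
    (v : Fin k → TangentSpace (𝓡 n) x) (σ : V x) :
    (inner ℝ (θ x v) σ : ℝ) = ∑ I : Fin k → TanIdx n, ∑ a : FibIdx F,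
      (∏ m, (inner ℝ (Φ.fld (I m) x) (v m) : ℝ)) * (inner ℝ (Φ.sec a x) σ : ℝ) *
        Φ.coef θ I a x := by
  obtain ⟨b, hb⟩ := Φ.exists_fld x hx
  obtain ⟨s, hs⟩ := Φ.exists_sec x hx
  rw [alt_eq_sum_orthonormal (θ x) b v, sum_inner]
  simp only [hb]
  refine Finset.sum_congr rfl fun I _ => ?_
  rw [inner_smul_left, ← s.sum_inner_mul_inner, Finset.mul_sum]
  refine Finset.sum_congr rfl fun a _ => ?_
  rw [hs, coef, RCLike.conj_to_real]
  ring

theorem contMDiff_coef [VectorBundle ℝ F V] [ContMDiffVectorBundle ∞ F V (𝓡 n)]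
    [IsContMDiffRiemannianBundle (𝓡 n) ∞ F V] {k : ℕ} {θ : Form n V k} (hθ : SmoothForm F θ)
    (I : Fin k → TanIdx n) (a : FibIdx F) : ContMDiff (𝓡 n) 𝓘(ℝ, ℝ) ∞ (Φ.coef θ I a) :=
  ContMDiff.inner_bundle (hθ (fun m => Φ.fld (I m)) fun _ => Φ.smooth_fld _) (Φ.smooth_sec a)

theorem aemeasurable_coef [MeasurableSpace M] {k : ℕ} {θ : Form n V k} (hθ : MeasurableForm F θ)
    (I : Fin k → TanIdx n) (a : FibIdx F) : AEMeasurable (Φ.coef θ I a) (riemannianVolume n M) :=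
  hθ (fun m => Φ.fld (I m)) _ (fun _ => Φ.smooth_fld _) (Φ.smooth_sec a)

end OrthoFrame

variable [T2Space M] [FiniteDimensional ℝ F] [VectorBundle ℝ F V] [ContMDiffVectorBundle ∞ F V (𝓡 n)]
  [IsContMDiffRiemannianBundle (𝓡 n) ∞ F V]

variable (n F V) in
theorem exists_orthoFrame (x : M) : ∃ Φ : OrthoFrame n M F V, x ∈ Φ.dom := by
  obtain ⟨W, e, hW, hx, he, hb⟩ :=
    exists_orthonormal_frame (n := n) (G := Euc n) (E := (TangentSpace (𝓡 n) : M → Type _)) x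
  obtain ⟨W', s, hW', hx', hs, hb'⟩ := exists_orthonormal_frame (n := n) (G := F) (E := V) x
  exact ⟨⟨W ∩ W', e, s, hW.inter hW', he, hs, fun x hx => hb x hx.1, fun x hx => hb' x hx.2⟩,
    ⟨hx, hx'⟩⟩

instance : Inhabited (OrthoFrame n M F V) :=
  ⟨⟨∅, fun _ => 0, fun _ => 0, isOpen_empty, fun _ => contMDiff_zeroSection ℝ _,
    fun _ => contMDiff_zeroSection ℝ _, fun _ h => h.elim, fun _ h => h.elim⟩⟩

variable (n F V) in
theorem exists_orthoFrame_cover [SecondCountableTopology M] :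
    ∃ Φ : ℕ → OrthoFrame n M F V, ∀ x, ∃ j, x ∈ (Φ j).dom := by
  choose Φ hΦ using exists_orthoFrame (n := n) (M := M) F V
  obtain ⟨S, hS, hcov⟩ := TopologicalSpace.countable_cover_nhds fun x : M =>
    (Φ x).isOpen_dom.mem_nhds (hΦ x)
  obtain ⟨e, he⟩ := ((hS.image Φ).insert default).exists_eq_range (Set.insert_nonempty _ _)
  refine ⟨e, fun x => ?_⟩
  have : x ∈ ⋃ x ∈ S, (Φ x).dom := by rw [hcov]; trivial
  obtain ⟨y, hy, hxy⟩ := Set.mem_iUnion₂.1 this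
  have h1 : Φ y ∈ Set.range e := by rw [← he]; exact Set.mem_insert_of_mem _ ⟨y, hy, rfl⟩
  obtain ⟨j, hj⟩ := h1
  exact ⟨j, by rw [hj]; exact hxy⟩

theorem contMDiff_formInner {k : ℕ} {θ η : Form n V k} (hθ : SmoothForm F θ)
    (hη : SmoothForm F η) : ContMDiff (𝓡 n) 𝓘(ℝ, ℝ) ∞ fun x => formInner x (θ x) (η x) := by
  intro x
  obtain ⟨Φ, hx⟩ := exists_orthoFrame n F V x
  have h1 : (fun x => formInner x (θ x) (η x)) =ᶠ[𝓝 x] fun x => ((k.factorial : ℝ))⁻¹ *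
      ∑ I : Fin k → TanIdx n, ∑ a : FibIdx F, Φ.coef θ I a x * Φ.coef η I a x := by
    filter_upwards [Φ.isOpen_dom.mem_nhds hx] with z hz
    exact OrthoFrame.formInner_eq hz θ η
  refine ContMDiffAt.congr_of_eventuallyEq ?_ h1
  refine contMDiffAt_const.mul (contMDiffAt_finsetSum fun I _ => contMDiffAt_finsetSum fun a _ => ?_)
  exact (Φ.contMDiff_coef hθ I a x).mul (Φ.contMDiff_coef hη I a x)

theorem formInner_self_nonneg (x : M) {k : ℕ} (θ : Form n V k) : 0 ≤ formInner x (θ x) (θ x) := by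
  rw [formInner]
  exact mul_nonneg (by positivity) (Finset.sum_nonneg fun I _ => real_inner_self_nonneg)

theorem eq_zero_of_formInner_self_eq_zero (x : M) {k : ℕ} (θ : Form n V k)
    (h : formInner x (θ x) (θ x) = 0) : θ x = 0 := by
  have : FiniteDimensional ℝ (TangentSpace (𝓡 n) x) :=
    inferInstanceAs (FiniteDimensional ℝ (Euc n))
  let b := stdOrthonormalBasis ℝ (TangentSpace (𝓡 n) x)
  rw [formInner_eq_sum x _ _ b, mul_eq_zero] at h
  have h1 := h.resolve_left (by positivity)
  have h2 : ∀ I : Fin k → Fin (Module.finrank ℝ (TangentSpace (𝓡 n) x)),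
      θ x (fun m => b (I m)) = 0 := fun I => by
    simpa using (Finset.sum_eq_zero_iff_of_nonneg fun I _ => real_inner_self_nonneg).1 h1 I
      (Finset.mem_univ _)
  ext v
  rw [alt_eq_sum_orthonormal (θ x) b v]
  simp [h2]

end OrthoFrames

section L2Space

variable {n : ℕ} {M : Type*} [TopologicalSpace M] [T2Space M] [SecondCountableTopology M]
  [ChartedSpace (EuclideanSpace ℝ (Fin n)) M]
  [IsManifold (𝓡 n) ∞ M] [RiemannianBundle (fun x : M => TangentSpace (𝓡 n) x)]
  [IsContMDiffRiemannianBundle (𝓡 n) ∞ (EuclideanSpace ℝ (Fin n))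
      (fun x : M => TangentSpace (𝓡 n) x)]
  {F : Type*} [NormedAddCommGroup F] [NormedSpace ℝ F] [FiniteDimensional ℝ F]
  {V : M → Type*} [TopologicalSpace (Bundle.TotalSpace F V)]
  [∀ x, NormedAddCommGroup (V x)] [∀ x, InnerProductSpace ℝ (V x)]
  [FiberBundle F V] [VectorBundle ℝ F V] [ContMDiffVectorBundle ∞ F V (𝓡 n)]
  [IsContMDiffRiemannianBundle (𝓡 n) ∞ F V]

variable (n M F V) in
/-- A sequence of orthonormal frames whose domains cover the manifold. -/
def frameSeq : ℕ → OrthoFrame n M F V := (exists_orthoFrame_cover n F V).choose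

variable (n F V) in
theorem exists_mem_frameSeq (x : M) : ∃ j, x ∈ (frameSeq n M F V j).dom :=
  (exists_orthoFrame_cover n F V).choose_spec x

open Classical in
variable (n F V) in
/-- The first frame of the sequence which is defined at the given point. -/
def frameIdx (x : M) : ℕ := Nat.find (exists_mem_frameSeq n F V x)

theorem mem_frameIdx (x : M) : x ∈ (frameSeq n M F V (frameIdx n F V x)).dom := by
  classical exact Nat.find_spec (exists_mem_frameSeq n F V x)

variable (n) in
/-- The Euclidean space that contains the coefficients of mixed forms at a point. -/
abbrev CoefSpace (F : Type*) [NormedAddCommGroup F] [NormedSpace ℝ F] : Type :=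
  EuclideanSpace ℝ (Σ k : Fin (n + 1), (Fin k → TanIdx n) × FibIdx F)

variable (F) in
/-- The normalized coefficients of mixed forms with respect to measurable orthonormal frames. This
is a fibrewise isometric embedding, which turns square-integrable forms into square-integrable
functions with values in a Euclidean space. -/
def coefMap : MixedForm n V →ₗ[ℝ] (M → CoefSpace n F) where
  toFun θ x := WithLp.toLp 2 fun i => (Real.sqrt ((i.1 : ℕ).factorial : ℝ))⁻¹ *
    (frameSeq n M F V (frameIdx n F V x)).coef (θ i.1) i.2.1 i.2.2 x
  map_add' θ η := by
    funext x
    ext i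
    simp only [Pi.add_apply, PiLp.add_apply, OrthoFrame.coef_add, mul_add]
  map_smul' r θ := by
    funext x
    ext i
    simp only [Pi.smul_apply, PiLp.smul_apply, OrthoFrame.coef_smul, RingHom.id_apply, smul_eq_mul]
    ring

theorem coefMap_apply (θ : MixedForm n V) (x : M)
    (i : Σ k : Fin (n + 1), (Fin k → TanIdx n) × FibIdx F) :
    coefMap F θ x i = (Real.sqrt ((i.1 : ℕ).factorial : ℝ))⁻¹ *
      (frameSeq n M F V (frameIdx n F V x)).coef (θ i.1) i.2.1 i.2.2 x := rfl

variable (F) in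
theorem inner_coefMap (θ η : MixedForm n V) (x : M) :
    (inner ℝ (coefMap F θ x) (coefMap F η x) : ℝ) = mixedInner θ η x := by
  rw [mixedInner, Finset.sum_range, PiLp.inner_apply, Fintype.sum_sigma]
  refine Finset.sum_congr rfl fun k _ => ?_
  rw [OrthoFrame.formInner_eq (mem_frameIdx (F := F) (V := V) x), Fintype.sum_prod_type,
    Finset.mul_sum]
  refine Finset.sum_congr rfl fun I _ => ?_
  rw [Finset.mul_sum]
  refine Finset.sum_congr rfl fun a _ => ?_
  have h : (Real.sqrt ((k : ℕ).factorial : ℝ))⁻¹ * (Real.sqrt ((k : ℕ).factorial : ℝ))⁻¹ =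
      (((k : ℕ).factorial : ℝ))⁻¹ := by
    rw [← mul_inv, Real.mul_self_sqrt (by positivity)]
  rw [coefMap_apply, coefMap_apply, ← h]
  simp only [RCLike.inner_apply, conj_trivial]
  ring

theorem coefMap_congr {θ η : MixedForm n V} {x : M} (h : ∀ k ≤ n, θ k x = η k x) :
    coefMap F θ x = coefMap F η x := by
  ext i
  rw [coefMap_apply, coefMap_apply, OrthoFrame.coef, OrthoFrame.coef,
    h i.1 (Nat.lt_succ_iff.1 i.1.2)]

variable [MeasurableSpace M] [BorelSpace M]

theorem measurableSet_frameIdx (m : ℕ) : MeasurableSet {x : M | frameIdx n F V x = m} := by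
  classical
  have h : {x : M | frameIdx n F V x = m} = (frameSeq n M F V m).dom ∩
      ⋂ j ∈ Set.Iio m, ((frameSeq n M F V j).dom)ᶜ := by
    ext x
    simp only [Set.mem_ofPred_eq, frameIdx, Nat.find_eq_iff, Set.mem_inter_iff, Set.mem_iInter,
      Set.mem_Iio, Set.mem_compl_iff]
  rw [h]
  exact (frameSeq n M F V m).isOpen_dom.measurableSet.inter
    (MeasurableSet.biInter (Set.to_countable _) fun j _ =>
      (frameSeq n M F V j).isOpen_dom.measurableSet.compl)

variable (n F V) in
theorem iUnion_frameIdx : ⋃ m, {x : M | frameIdx n F V x = m} = Set.univ := by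
  ext x; simp

variable (n F V) in
theorem aemeasurable_of_frameIdx {f : M → ℝ} {μ : Measure M}
    (h : ∀ m, AEMeasurable f (μ.restrict {x : M | frameIdx n F V x = m})) : AEMeasurable f μ := by
  rw [← Measure.restrict_univ (μ := μ), ← iUnion_frameIdx n F V]
  exact aemeasurable_iUnion_iff.2 h

theorem aestronglyMeasurable_coefMap {θ : MixedForm n V} (hθ : ∀ k, MeasurableForm F (θ k)) :
    AEStronglyMeasurable (coefMap F θ) (riemannianVolume n M) := by
  refine AEMeasurable.aestronglyMeasurable ?_
  have h1 : AEMeasurable (fun x => (coefMap F θ x).ofLp) (riemannianVolume n M) := by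
    refine aemeasurable_pi_lambda _ fun i => aemeasurable_of_frameIdx n F V fun m => ?_
    have h2 := ((frameSeq n M F V m).aemeasurable_coef (hθ i.1) i.2.1 i.2.2).const_mul
      (Real.sqrt ((i.1 : ℕ).factorial : ℝ))⁻¹
    refine (h2.restrict (s := {x | frameIdx n F V x = m})).congr ?_
    refine (ae_restrict_iff' (measurableSet_frameIdx m)).2 (Eventually.of_forall fun x hx => ?_)
    have hx' : frameIdx n F V x = m := hx
    simp only [coefMap_apply, hx']
  exact (WithLp.measurable_toLp 2 _).comp_aemeasurable h1

theorem measurableForm_of_coefMap {θ : MixedForm n V}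
    (hθ : AEStronglyMeasurable (coefMap F θ) (riemannianVolume n M)) (k : ℕ) :
    MeasurableForm F (θ k) := by
  intro X σ hX hσ
  by_cases hk : n < k
  · rw [form_eq_zero_of_lt hk (θ k)]
    simp
  let k' : Fin (n + 1) := ⟨k, by omega⟩
  refine aemeasurable_of_frameIdx n F V fun m => ?_
  let Φ := frameSeq n M F V m
  have h1 : ∀ I a, AEMeasurable (fun x => coefMap F θ x ⟨k', I, a⟩) (riemannianVolume n M) :=
    fun I a => (EuclideanSpace.proj (𝕜 := ℝ)
      (⟨k', I, a⟩ : Σ k : Fin (n + 1), (Fin k → TanIdx n) × FibIdx F)).continuous.measurable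
        |>.comp_aemeasurable hθ.aemeasurable
  have h2 : AEMeasurable (fun x => ∑ I : Fin k → TanIdx n, ∑ a : FibIdx F,
      (∏ m, (inner ℝ (Φ.fld (I m) x) (X m x) : ℝ)) * (inner ℝ (Φ.sec a x) (σ x) : ℝ) *
        (Real.sqrt (k.factorial : ℝ) * coefMap F θ x ⟨k', I, a⟩)) (riemannianVolume n M) := by
    refine Finset.aemeasurable_fun_sum _ fun I _ => Finset.aemeasurable_fun_sum _ fun a _ => ?_
    refine AEMeasurable.mul (AEMeasurable.mul ?_ ?_) ((h1 I a).const_mul _)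
    · refine Finset.aemeasurable_fun_prod _ fun m _ => ?_
      exact (ContMDiff.inner_bundle (Φ.smooth_fld (I m)) (hX m)).continuous.aemeasurable
    · exact (ContMDiff.inner_bundle (Φ.smooth_sec a) hσ).continuous.aemeasurable
  refine (h2.restrict (s := {x | frameIdx n F V x = m})).congr ?_
  refine (ae_restrict_iff' (measurableSet_frameIdx m)).2 (Eventually.of_forall fun x hx => ?_)
  have hx' : frameIdx n F V x = m := hx
  have hxd : x ∈ Φ.dom := by
    have := mem_frameIdx (F := F) (V := V) (n := n) x
    rwa [hx'] at this
  simp only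
  rw [OrthoFrame.inner_apply_eq hxd]
  refine Finset.sum_congr rfl fun I _ => Finset.sum_congr rfl fun a _ => ?_
  congr 1
  rw [coefMap_apply, hx', ← mul_assoc, mul_inv_cancel₀ (by positivity), one_mul]

theorem memL2_iff {θ : MixedForm n V} :
    MemL2 F θ ↔ MemLp (coefMap F θ) 2 (riemannianVolume n M) := by
  have h : (fun x => ‖coefMap F θ x‖ ^ 2) = mixedInner θ θ := funext fun x => by
    rw [← real_inner_self_eq_norm_sq, inner_coefMap]
  constructor
  · rintro ⟨h1, h2⟩
    rw [memLp_two_iff_integrable_sq_norm (aestronglyMeasurable_coefMap h1), h]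
    exact h2
  · intro h1
    refine ⟨measurableForm_of_coefMap h1.1, ?_⟩
    rw [← h]
    exact (memLp_two_iff_integrable_sq_norm h1.1).1 h1

variable (F) in
theorem l2Inner_eq_integral (θ η : MixedForm n V) : l2Inner θ η =
    ∫ x, (inner ℝ (coefMap F θ x) (coefMap F η x) : ℝ) ∂(riemannianVolume n M) := by
  simp only [inner_coefMap]; rfl

theorem MemL2.memLp {θ : MixedForm n V} (h : MemL2 F θ) :
    MemLp (coefMap F θ) 2 (riemannianVolume n M) := memL2_iff.1 h

theorem MemL2.sub {θ η : MixedForm n V} (hθ : MemL2 F θ) (hη : MemL2 F η) : MemL2 F (θ - η) :=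
  memL2_iff.2 (by rw [map_sub]; exact hθ.memLp.sub hη.memLp)

theorem MemL2.add {θ η : MixedForm n V} (hθ : MemL2 F θ) (hη : MemL2 F η) : MemL2 F (θ + η) :=
  memL2_iff.2 (by rw [map_add]; exact hθ.memLp.add hη.memLp)

theorem MemL2.const_smul (r : ℝ) {θ : MixedForm n V} (hθ : MemL2 F θ) : MemL2 F (r • θ) :=
  memL2_iff.2 (by rw [map_smul]; exact hθ.memLp.const_smul r)

theorem memL2_zero : MemL2 F (0 : MixedForm n V) :=
  memL2_iff.2 (by rw [map_zero]; exact MemLp.zero)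

/-- The class in `L²` of a square-integrable form. -/
def MemL2.toL2 {θ : MixedForm n V} (h : MemL2 F θ) : Lp (CoefSpace n F) 2 (riemannianVolume n M) :=
  h.memLp.toLp _

theorem inner_toL2 {θ η : MixedForm n V} (hθ : MemL2 F θ) (hη : MemL2 F η) :
    (inner ℝ hθ.toL2 hη.toL2 : ℝ) = l2Inner θ η := by
  rw [L2.inner_def, l2Inner_eq_integral F]
  refine integral_congr_ae ?_
  filter_upwards [hθ.memLp.coeFn_toLp, hη.memLp.coeFn_toLp] with x h1 h2
  rw [MemL2.toL2, MemL2.toL2, h1, h2]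

theorem toL2_sub {θ η : MixedForm n V} (hθ : MemL2 F θ) (hη : MemL2 F η) :
    (hθ.sub hη).toL2 = hθ.toL2 - hη.toL2 := by
  rw [MemL2.toL2, MemL2.toL2, MemL2.toL2, ← MemLp.toLp_sub]
  exact MemLp.toLp_congr _ _ (by rw [map_sub])

theorem norm_toL2_sub_sq {θ η : MixedForm n V} (hθ : MemL2 F θ) (hη : MemL2 F η) :
    ‖hθ.toL2 - hη.toL2‖ ^ 2 = l2Inner (θ - η) (θ - η) := by
  rw [← toL2_sub, ← real_inner_self_eq_norm_sq, inner_toL2]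

theorem tendsto_toL2_iff {θ : ℕ → MixedForm n V} {η : MixedForm n V} (hθ : ∀ j, MemL2 F (θ j))
    (hη : MemL2 F η) : Tendsto (fun j => (hθ j).toL2) atTop (𝓝 hη.toL2) ↔
      Tendsto (fun j => l2Inner (θ j - η) (θ j - η)) atTop (𝓝 0) := by
  rw [tendsto_iff_norm_sub_tendsto_zero]
  simp only [← norm_toL2_sub_sq (hθ _) hη]
  constructor
  · intro h; simpa using h.pow 2
  · intro h
    have := h.sqrt
    simpa using this

variable (n M F V) in
/-- The closed subspace of `L²` which consists of the classes of square-integrable forms. -/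
def formSpace : Submodule ℝ (Lp (CoefSpace n F) 2 (riemannianVolume n M)) where
  carrier := {f | ∃ θ : MixedForm n V, ∃ h : MemL2 F θ, h.toL2 = f}
  zero_mem' := ⟨0, memL2_zero, by
    rw [MemL2.toL2, ← MemLp.toLp_zero (MemLp.zero (ε := CoefSpace n F))]
    exact MemLp.toLp_congr _ _ (by rw [map_zero])⟩
  add_mem' := by
    rintro _ _ ⟨θ, hθ, rfl⟩ ⟨η, hη, rfl⟩
    refine ⟨θ + η, hθ.add hη, ?_⟩
    rw [MemL2.toL2, MemL2.toL2, MemL2.toL2, ← MemLp.toLp_add]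
    exact MemLp.toLp_congr _ _ (by rw [map_add])
  smul_mem' := by
    rintro r _ ⟨θ, hθ, rfl⟩
    refine ⟨r • θ, hθ.const_smul r, ?_⟩
    rw [MemL2.toL2, MemL2.toL2, ← MemLp.toLp_const_smul]
    exact MemLp.toLp_congr _ _ (by rw [map_smul])

/-- Limits of square-integrable forms are forms: almost everywhere, a subsequence of the coefficients
converges, and the fibrewise range of `coefMap` is closed, since it is finite-dimensional. -/
theorem isClosed_formSpace : IsClosed (formSpace n M F V : Set (Lp (CoefSpace n F) 2
    (riemannianVolume n M))) := by
  refine IsSeqClosed.isClosed fun f g hf hfg => ?_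
  choose θ hθ hθf using hf
  -- a subsequence converges almost everywhere
  have h1 : TendstoInMeasure (riemannianVolume n M) (fun j => f j) atTop g :=
    tendstoInMeasure_of_tendsto_Lp hfg
  obtain ⟨ns, -, h2⟩ := h1.exists_seq_tendsto_ae
  have h3 : ∀ᵐ x ∂(riemannianVolume n M), ∀ j, f j x = coefMap F (θ j) x := by
    refine ae_all_iff.2 fun j => ?_
    rw [← hθf j]
    exact (hθ j).memLp.coeFn_toLp
  let R : M → Submodule ℝ (CoefSpace n F) := fun x =>
    LinearMap.range ((LinearMap.proj x).comp (coefMap (V := V) F))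
  have h4 : ∀ᵐ x ∂(riemannianVolume n M), g x ∈ R x := by
    filter_upwards [h2, h3] with x hx hx'
    refine (Submodule.closed_of_finiteDimensional (R x)).mem_of_tendsto hx
      (Eventually.of_forall fun j => ?_)
    rw [hx']
    exact ⟨θ (ns j), rfl⟩
  have h5 : ∀ x, ∃ η : MixedForm n V, g x ∈ R x → coefMap F η x = g x := fun x => by
    by_cases hx : g x ∈ R x
    · obtain ⟨η, hη⟩ := hx
      exact ⟨η, fun _ => hη⟩
    · exact ⟨0, fun h => absurd h hx⟩
  choose η hη using h5
  have h6 : coefMap F (fun k x => η x k x : MixedForm n V) =ᵐ[riemannianVolume n M] g := by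
    filter_upwards [h4] with x hx
    rw [← hη x hx]
    exact coefMap_congr fun k _ => rfl
  have h7 : MemL2 F (fun k x => η x k x : MixedForm n V) :=
    memL2_iff.2 ((memLp_congr_ae h6).2 (Lp.memLp g))
  refine ⟨_, h7, ?_⟩
  rw [MemL2.toL2]
  exact (MemLp.toLp_congr _ (Lp.memLp g) h6).trans (Lp.toLp_coeFn g _)

end L2Space

/-! ### Test forms and the formal adjoint -/

section TestForms

variable {n : ℕ} {M : Type*} [TopologicalSpace M] [T2Space M] [SecondCountableTopology M]
  [ChartedSpace (EuclideanSpace ℝ (Fin n)) M]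
  [IsManifold (𝓡 n) ∞ M] [RiemannianBundle (fun x : M => TangentSpace (𝓡 n) x)]
  [IsContMDiffRiemannianBundle (𝓡 n) ∞ (EuclideanSpace ℝ (Fin n))
      (fun x : M => TangentSpace (𝓡 n) x)]
  {F : Type*} [NormedAddCommGroup F] [NormedSpace ℝ F] [FiniteDimensional ℝ F]
  {V : M → Type*} [TopologicalSpace (Bundle.TotalSpace F V)]
  [∀ x, NormedAddCommGroup (V x)] [∀ x, InnerProductSpace ℝ (V x)]
  [FiberBundle F V] [VectorBundle ℝ F V] [ContMDiffVectorBundle ∞ F V (𝓡 n)]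
  [IsContMDiffRiemannianBundle (𝓡 n) ∞ F V]

theorem formInner_comm (x : M) {k : ℕ} (a b : (TangentSpace (𝓡 n) x) [⋀^Fin k]→L[ℝ] V x) :
    formInner x a b = formInner x b a := by
  simp only [formInner, real_inner_comm]

theorem formInner_zero_right (x : M) {k : ℕ} (a : (TangentSpace (𝓡 n) x) [⋀^Fin k]→L[ℝ] V x) :
    formInner x a 0 = 0 := by
  simp [formInner]

theorem formInner_zero_left (x : M) {k : ℕ} (a : (TangentSpace (𝓡 n) x) [⋀^Fin k]→L[ℝ] V x) :
    formInner x 0 a = 0 := by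
  simp [formInner]

theorem formInner_smul_left (x : M) {k : ℕ} (r : ℝ)
    (a b : (TangentSpace (𝓡 n) x) [⋀^Fin k]→L[ℝ] V x) :
    formInner x (r • a) b = r * formInner x a b := by
  simp only [formInner, ContinuousAlternatingMap.smul_apply, real_inner_smul_left, ← Finset.mul_sum]
  ring

theorem formInner_add_left (x : M) {k : ℕ}
    (a b c : (TangentSpace (𝓡 n) x) [⋀^Fin k]→L[ℝ] V x) :
    formInner x (a + b) c = formInner x a c + formInner x b c := by
  simp only [formInner, ContinuousAlternatingMap.add_apply, inner_add_left, Finset.sum_add_distrib]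
  ring

variable [MeasurableSpace M] [BorelSpace M]

theorem SmoothForm.measurableForm {k : ℕ} {θ : Form n V k} (hθ : SmoothForm F θ) :
    MeasurableForm F θ := fun X _ hX hσ =>
  (ContMDiff.inner_bundle (hθ X hX) hσ).continuous.aemeasurable

theorem TestForm.hasCompactSupport_formInner {k : ℕ} {θ : Form n V k} (hθ : TestForm F θ)
    (η : Form n V k) : HasCompactSupport fun x => formInner x (θ x) (η x) :=
  hθ.2.of_isClosed_subset isClosed_closure (closure_mono fun x hx h => hx (by
    simp only [h, formInner_zero_left]))

theorem TestForm.integrable_formInner {k : ℕ} {θ η : Form n V k} (hθ : TestForm F θ)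
    (hη : SmoothForm F η) :
    Integrable (fun x => formInner x (θ x) (η x)) (riemannianVolume n M) :=
  (contMDiff_formInner hθ.1 hη).continuous.integrable_of_hasCompactSupport
    (hθ.hasCompactSupport_formInner η)

theorem l2FormInner_comm {k : ℕ} (θ η : Form n V k) : l2FormInner θ η = l2FormInner η θ := by
  simp only [l2FormInner, formInner_comm]

theorem l2FormInner_zero_right {k : ℕ} (θ : Form n V k) : l2FormInner θ 0 = 0 := by
  simp [l2FormInner, formInner_zero_right]

theorem l2FormInner_zero_left {k : ℕ} (θ : Form n V k) : l2FormInner 0 θ = 0 := by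
  simp [l2FormInner, formInner_zero_left]

theorem l2FormInner_self_nonneg {k : ℕ} (θ : Form n V k) : 0 ≤ l2FormInner θ θ :=
  integral_nonneg fun x => formInner_self_nonneg x θ

/-- A smooth form which is orthogonal to all test forms supported in an open set vanishes on this
set. -/
theorem eq_zero_of_l2FormInner_eq_zero {k : ℕ} {η : Form n V k} (hη : SmoothForm F η) {O : Set M}
    (hO : IsOpen O) (h : ∀ φ : Form n V k, TestForm F φ → formSupport φ ⊆ O → l2FormInner φ η = 0)
    {x : M} (hx : x ∈ O) : η x = 0 := by
  obtain ⟨f, hf, hfs⟩ := ((SmoothBumpFunction.nhds_basis_tsupport (I := 𝓡 n) x).mem_iff).1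
    (hO.mem_nhds hx)
  have hφ : TestForm F (fnSmul f η) := hη.testForm_fnSmul f.contMDiff f.hasCompactSupport
  have h1 := h _ hφ ((formSupport_fnSmul_subset_left f η).trans hfs)
  by_contra h2
  have h3 := (contMDiff_formInner hφ.1 hη).continuous.integral_pos_of_hasCompactSupport_nonneg_nonzero
    (μ := riemannianVolume n M) (x := x) (hφ.hasCompactSupport_formInner η) (fun z => ?_) ?_
  · exact h3.ne' h1
  · rw [fnSmul, formInner_smul_left]
    exact mul_nonneg f.nonneg (formInner_self_nonneg z η)
  · rw [fnSmul, formInner_smul_left, f.eq_one, one_mul]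
    exact fun h4 => h2 (eq_zero_of_formInner_self_eq_zero x η h4)

theorem eq_of_l2FormInner_eq {k : ℕ} {η η' : Form n V k} (hη : SmoothForm F η)
    (hη' : SmoothForm F η') (h : ∀ φ : Form n V k, TestForm F φ →
      l2FormInner φ η = l2FormInner φ η') : η = η' := by
  have h1 : ∀ φ : Form n V k, TestForm F φ → l2FormInner φ (η - η') = 0 := fun φ hφ => by
    have h2 : l2FormInner φ (η - η') = l2FormInner φ η - l2FormInner φ η' := by
      rw [l2FormInner, l2FormInner, l2FormInner, ← integral_sub (hφ.integrable_formInner hη)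
        (hφ.integrable_formInner hη')]
      refine integral_congr_ae (Eventually.of_forall fun x => ?_)
      simp only [Pi.sub_apply]
      rw [sub_eq_add_neg, ← neg_one_smul ℝ (η' x), formInner_comm, formInner_add_left,
        formInner_smul_left, formInner_comm, formInner_comm x (η' x)]
      ring
    rw [h2, h φ hφ, sub_self]
  have h2 := fun x => eq_zero_of_l2FormInner_eq_zero (hη.sub hη') isOpen_univ
    (fun φ hφ _ => h1 φ hφ) (Set.mem_univ x)
  exact sub_eq_zero.1 (funext h2)

section Adjoint

variable (D : CovariantDerivative (𝓡 n) F V) [D.ContMDiffCovariantDerivative ∞]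

/-- If the formal adjoint exists at a test form, its value is supported in the support of the form,
as one sees by testing with forms supported elsewhere. -/
theorem TestForm.coDerivD {k : ℕ} {ψ : Form n V (k + 1)} (hψ : TestForm F ψ) :
    TestForm F (coDerivD D ψ) := by
  rw [TwistedL2.coDerivD]
  split_ifs with h
  · obtain ⟨h1, h2⟩ := h.choose_spec
    refine ⟨h1, hψ.2.of_isClosed_subset isClosed_closure (closure_minimal (fun x hx => ?_)
      isClosed_closure)⟩
    by_contra hxψ
    refine hx (eq_zero_of_l2FormInner_eq_zero h1 (O := (formSupport ψ)ᶜ)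
      isClosed_closure.isOpen_compl (fun φ hφ hs => ?_) hxψ)
    rw [← h2 φ hφ, l2FormInner]
    refine integral_eq_zero_of_ae (Eventually.of_forall fun z => ?_)
    by_cases hz : z ∈ formSupport ψ
    · have : TwistedL2.extDerivD D φ z = 0 := eq_zero_of_notMem_formSupport fun hz' =>
        hs (formSupport_extDerivD_subset D hφ.1 hz') hz
      simp only [this, formInner_zero_left, Pi.zero_apply]
    · simp only [eq_zero_of_notMem_formSupport hz, formInner_zero_right, Pi.zero_apply]
  · exact testForm_zero

theorem coDerivD_zero {k : ℕ} : coDerivD D (0 : Form n V (k + 1)) = 0 := by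
  rw [coDerivD]
  split_ifs with h
  · obtain ⟨h1, h2⟩ := h.choose_spec
    refine eq_of_l2FormInner_eq h1 smoothForm_zero fun φ hφ => ?_
    rw [← h2 φ hφ, l2FormInner_zero_right, l2FormInner_zero_right]
  · rfl

end Adjoint

/-! ### Mixed test forms -/

theorem TestMixed.add {θ η : MixedForm n V} (hθ : TestMixed F θ) (hη : TestMixed F η) :
    TestMixed F (θ + η) := fun k => (hθ k).add (hη k)

theorem testMixed_zero : TestMixed F (0 : MixedForm n V) := fun _ => testForm_zero

theorem TestMixed.const_smul (r : ℝ) {θ : MixedForm n V} (hθ : TestMixed F θ) :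
    TestMixed F (r • θ) := fun k => (hθ k).const_smul r

theorem TestForm.single {k : ℕ} {θ : Form n V k} (hθ : TestForm F θ) :
    TestMixed F (Pi.single k θ : MixedForm n V) := fun j => by
  by_cases h : j = k
  · subst h; simpa using hθ
  · rw [Pi.single_eq_of_ne h]; exact testForm_zero

theorem integrable_mixedInner {θ η : MixedForm n V} (hθ : TestMixed F θ) (hη : TestMixed F η) :
    Integrable (mixedInner θ η) (riemannianVolume n M) :=
  integrable_finsetSum _ fun k _ => (hθ k).integrable_formInner (hη k).1

theorem TestMixed.memL2 {θ : MixedForm n V} (hθ : TestMixed F θ) : MemL2 F θ :=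
  ⟨fun k => (hθ k).1.measurableForm, integrable_mixedInner hθ hθ⟩

theorem l2Inner_eq_sum {θ η : MixedForm n V} (hθ : TestMixed F θ) (hη : TestMixed F η) :
    l2Inner θ η = ∑ k ∈ Finset.range (n + 1), l2FormInner (θ k) (η k) :=
  integral_finsetSum _ fun k _ => (hθ k).integrable_formInner (hη k).1

theorem mixedInner_single (θ : MixedForm n V) {k : ℕ} (η : Form n V k) (x : M) :
    mixedInner θ (Pi.single k η) x = formInner x (θ k x) (η x) := by
  have h : ∀ j, j ≠ k → formInner x (θ j x) ((Pi.single k η : MixedForm n V) j x) = 0 :=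
    fun j hj => by rw [Pi.single_eq_of_ne hj, Pi.zero_apply, formInner_zero_right]
  rw [mixedInner]
  by_cases hk : k < n + 1
  · rw [Finset.sum_eq_single_of_mem k (Finset.mem_range.2 hk) fun j _ hj => h j hj,
      Pi.single_eq_same]
  · rw [form_eq_zero_of_lt (by omega) η, Pi.zero_apply, formInner_zero_right]
    exact Finset.sum_eq_zero fun j hj => by
      rw [Pi.single_zero, Pi.zero_apply, Pi.zero_apply, formInner_zero_right]

theorem l2Inner_single (θ : MixedForm n V) {k : ℕ} (η : Form n V k) :
    l2Inner θ (Pi.single k η) = l2FormInner (θ k) η := by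
  simp only [l2Inner, mixedInner_single, l2FormInner]

theorem l2Inner_comm (θ η : MixedForm n V) : l2Inner θ η = l2Inner η θ := by
  simp only [l2Inner, mixedInner, formInner_comm]

end TestForms

/-! ### Symmetry and the spectral bound on test forms -/

section Symmetry

variable {n : ℕ} {M : Type*} [TopologicalSpace M] [T2Space M] [SecondCountableTopology M]
  [ChartedSpace (EuclideanSpace ℝ (Fin n)) M]
  [IsManifold (𝓡 n) ∞ M] [RiemannianBundle (fun x : M => TangentSpace (𝓡 n) x)]
  [IsContMDiffRiemannianBundle (𝓡 n) ∞ (EuclideanSpace ℝ (Fin n))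
      (fun x : M => TangentSpace (𝓡 n) x)]
  [MeasurableSpace M] [BorelSpace M]
  {F : Type*} [NormedAddCommGroup F] [NormedSpace ℝ F] [FiniteDimensional ℝ F]
  {V : M → Type*} [TopologicalSpace (Bundle.TotalSpace F V)]
  [∀ x, NormedAddCommGroup (V x)] [∀ x, InnerProductSpace ℝ (V x)]
  [FiberBundle F V] [VectorBundle ℝ F V] [ContMDiffVectorBundle ∞ F V (𝓡 n)]
  [IsContMDiffRiemannianBundle (𝓡 n) ∞ F V]
  (D : CovariantDerivative (𝓡 n) F V) [D.ContMDiffCovariantDerivative ∞]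

theorem TestMixed.dD {θ : MixedForm n V} (hθ : TestMixed F θ) : TestMixed F (dD D θ) := fun k => by
  cases k with
  | zero => exact testForm_zero
  | succ k => exact (hθ k).extDerivD D

theorem TestMixed.deltaD {θ : MixedForm n V} (hθ : TestMixed F θ) : TestMixed F (deltaD D θ) :=
  fun k => (hθ (k + 1)).coDerivD D

theorem TestMixed.opP {θ : MixedForm n V} (hθ : TestMixed F θ) : TestMixed F (opP D θ) :=
  (hθ.dD D).add (hθ.deltaD D)

theorem dD_single {k : ℕ} (θ : Form n V k) :
    dD D (Pi.single k θ) = Pi.single (k + 1) (extDerivD D θ) := by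
  funext j
  cases j with
  | zero => rw [Pi.single_eq_of_ne (by omega)]; rfl
  | succ j =>
    show extDerivD D ((Pi.single k θ : MixedForm n V) j) = _
    by_cases h : j = k
    · subst h; simp
    · rw [Pi.single_eq_of_ne h, Pi.single_eq_of_ne (by omega), extDerivD_zero]

theorem deltaD_single {k : ℕ} (θ : Form n V (k + 1)) :
    deltaD D (Pi.single (k + 1) θ) = Pi.single k (coDerivD D θ) := by
  funext j
  show coDerivD D ((Pi.single (k + 1) θ : MixedForm n V) (j + 1)) = _
  by_cases h : j = k
  · subst h; simp
  · rw [Pi.single_eq_of_ne h, Pi.single_eq_of_ne (by omega), coDerivD_zero]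

theorem deltaD_single_zero (θ : Form n V 0) : deltaD D (Pi.single 0 θ) = 0 := by
  funext j
  show coDerivD D ((Pi.single 0 θ : MixedForm n V) (j + 1)) = _
  rw [Pi.single_eq_of_ne (by omega), coDerivD_zero]; rfl

theorem opP_single {k : ℕ} (θ : Form n V (k + 1)) : opP D (Pi.single (k + 1) θ) =
    Pi.single (k + 2) (extDerivD D θ) + Pi.single k (coDerivD D θ) := by
  rw [opP, dD_single, deltaD_single]

/-- `δ_D` is formally adjoint to `d_D` on test forms. This is not automatic, since `coDerivD` is
zero by definition where the formal adjoint does not exist. -/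
def IsAdjointPair : Prop := ∀ (k : ℕ) (φ : Form n V k) (ψ : Form n V (k + 1)), TestForm F φ →
  TestForm F ψ → l2FormInner (extDerivD D φ) ψ = l2FormInner φ (coDerivD D ψ)

theorem minExt_self {A : MixedForm n V → MixedForm n V} {φ : MixedForm n V} (hφ : TestMixed F φ)
    (hA : TestMixed F (A φ)) : MinExt F A φ (A φ) :=
  ⟨hφ.memL2, hA.memL2, fun _ => φ, fun _ => hφ, by simp [l2Inner, mixedInner, formInner_zero_left],
    by simp [l2Inner, mixedInner, formInner_zero_left]⟩

variable {D}

/-- Essential self-adjointness implies that `P` is symmetric on test forms; comparing degrees, the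
two summands of `P` are adjoint to each other. -/
theorem IsEssentiallySelfAdjointP.isAdjointPair (h : IsEssentiallySelfAdjointP D) :
    IsAdjointPair D := by
  intro k φ ψ hφ hψ
  have h1 := ((h _ _).1 (minExt_self hφ.single (hφ.single.opP D))).2.2 _ hψ.single
  rw [l2Inner_comm, l2Inner_single, l2Inner_single, opP_single] at h1
  have h2 : opP D (Pi.single k φ) (k + 1) = extDerivD D φ := by
    rw [opP, dD_single, Pi.add_apply, Pi.single_eq_same]
    have : deltaD D (Pi.single k φ) (k + 1) = 0 := by
      show coDerivD D ((Pi.single k φ : MixedForm n V) (k + 1 + 1)) = _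
      rw [Pi.single_eq_of_ne (by omega), coDerivD_zero]
    rw [this, add_zero]
  rw [h2, Pi.add_apply, Pi.single_eq_of_ne (by omega), zero_add, Pi.single_eq_same] at h1
  rw [← h1, l2FormInner_comm]

theorem IsAdjointPair.dD_deltaD (h : IsAdjointPair D) {φ ψ : MixedForm n V} (hφ : TestMixed F φ)
    (hψ : TestMixed F ψ) : l2Inner (dD D φ) ψ = l2Inner φ (deltaD D ψ) := by
  rw [l2Inner_eq_sum (hφ.dD D) hψ, l2Inner_eq_sum hφ (hψ.deltaD D), Finset.sum_range_succ',
    Finset.sum_range_succ]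
  congr 1
  · exact Finset.sum_congr rfl fun k _ => h k _ _ (hφ k) (hψ (k + 1))
  · show l2FormInner 0 _ = l2FormInner _ (coDerivD D (ψ (n + 1)))
    rw [form_eq_zero_of_lt (by omega) (ψ (n + 1)), coDerivD_zero, l2FormInner_zero_left,
      l2FormInner_zero_right]

theorem l2Inner_add_left {φ φ' ψ : MixedForm n V} (hφ : MemL2 F φ) (hφ' : MemL2 F φ')
    (hψ : MemL2 F ψ) : l2Inner (φ + φ') ψ = l2Inner φ ψ + l2Inner φ' ψ := by
  rw [← inner_toL2 (hφ.add hφ') hψ, ← inner_toL2 hφ hψ, ← inner_toL2 hφ' hψ, ← inner_add_left]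
  congr 1
  rw [MemL2.toL2, MemL2.toL2, MemL2.toL2, ← MemLp.toLp_add]
  exact MemLp.toLp_congr _ _ (by rw [map_add])

theorem l2Inner_add_right {φ φ' ψ : MixedForm n V} (hφ : MemL2 F φ) (hφ' : MemL2 F φ')
    (hψ : MemL2 F ψ) : l2Inner ψ (φ + φ') = l2Inner ψ φ + l2Inner ψ φ' := by
  rw [l2Inner_comm, l2Inner_add_left hφ hφ' hψ, l2Inner_comm φ, l2Inner_comm φ']

theorem l2Inner_sub_left {φ φ' ψ : MixedForm n V} (hφ : MemL2 F φ) (hφ' : MemL2 F φ')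
    (hψ : MemL2 F ψ) : l2Inner (φ - φ') ψ = l2Inner φ ψ - l2Inner φ' ψ := by
  rw [← inner_toL2 (hφ.sub hφ') hψ, ← inner_toL2 hφ hψ, ← inner_toL2 hφ' hψ, ← inner_sub_left,
    toL2_sub]

theorem l2Inner_smul_left (r : ℝ) (φ ψ : MixedForm n V) :
    l2Inner (r • φ) ψ = r * l2Inner φ ψ := by
  simp only [l2Inner, mixedInner, Pi.smul_apply, formInner_smul_left, ← Finset.mul_sum,
    integral_const_mul]

theorem l2Inner_self_nonneg (φ : MixedForm n V) : 0 ≤ l2Inner φ φ :=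
  integral_nonneg fun x => Finset.sum_nonneg fun _ _ => formInner_self_nonneg x _

theorem IsAdjointPair.opP (h : IsAdjointPair D) {φ ψ : MixedForm n V} (hφ : TestMixed F φ)
    (hψ : TestMixed F ψ) : l2Inner (opP D φ) ψ = l2Inner φ (opP D ψ) := by
  rw [TwistedL2.opP, TwistedL2.opP, l2Inner_add_left (hφ.dD D).memL2 (hφ.deltaD D).memL2 hψ.memL2,
    l2Inner_add_right (hψ.dD D).memL2 (hψ.deltaD D).memL2 hφ.memL2, h.dD_deltaD hφ hψ,
    l2Inner_comm (deltaD D φ), ← h.dD_deltaD hψ hφ, l2Inner_comm φ (dD D ψ), add_comm]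

theorem dD_dD (hD : IsFlat D) {φ : MixedForm n V} (hφ : TestMixed F φ) : dD D (dD D φ) = 0 := by
  funext k
  cases k with
  | zero => rfl
  | succ k =>
    cases k with
    | zero => exact extDerivD_zero D
    | succ k => exact extDerivD_extDerivD hD (hφ k).1

theorem IsAdjointPair.inner_dD_deltaD_eq_zero (h : IsAdjointPair D) (hD : IsFlat D)
    {φ ψ : MixedForm n V} (hφ : TestMixed F φ) (hψ : TestMixed F ψ) :
    l2Inner (dD D φ) (deltaD D ψ) = 0 := by
  rw [← h.dD_deltaD (hφ.dD D) hψ, dD_dD hD hφ]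
  simp [l2Inner, mixedInner, formInner_zero_left]

theorem IsAdjointPair.l2Inner_opP_self (h : IsAdjointPair D) (hD : IsFlat D)
    {φ : MixedForm n V} (hφ : TestMixed F φ) : l2Inner (TwistedL2.opP D φ) (TwistedL2.opP D φ) =
      l2Inner (dD D φ) (dD D φ) + l2Inner (deltaD D φ) (deltaD D φ) := by
  have h1 := hφ.dD D
  have h2 := hφ.deltaD D
  rw [TwistedL2.opP, l2Inner_add_left h1.memL2 h2.memL2 (h1.add h2).memL2,
    l2Inner_add_right h1.memL2 h2.memL2 h1.memL2, l2Inner_add_right h1.memL2 h2.memL2 h2.memL2,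
    l2Inner_comm (deltaD D φ) (dD D φ), h.inner_dD_deltaD_eq_zero hD hφ hφ]
  ring

theorem homogeneousOfDegree_single {k : ℕ} (θ : Form n V k) :
    HomogeneousOfDegree k (Pi.single k θ : MixedForm n V) := fun j hj =>
  Pi.single_eq_of_ne (by exact_mod_cast hj) _

theorem IsAdjointPair.l2Inner_le_of_single (h : IsAdjointPair D) (hD : IsFlat D) {k : ℕ}
    (hb : SpectralBound D k) {θ : Form n V k} (hθ : TestForm F θ) :
    l2FormInner θ θ ≤ l2FormInner (extDerivD D θ) (extDerivD D θ) +
      l2Inner (deltaD D (Pi.single k θ)) (deltaD D (Pi.single k θ)) := by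
  have h1 := hb _ hθ.single (homogeneousOfDegree_single θ)
  have h2 := hθ.single.opP D
  rw [l2Inner_sub_left (h2.opP D).memL2 hθ.single.memL2 hθ.single.memL2, h.opP h2 hθ.single,
    h.l2Inner_opP_self hD hθ.single, dD_single, l2Inner_single, l2Inner_single, Pi.single_eq_same,
    Pi.single_eq_same] at h1
  linarith

/-- The spectral bound on homogeneous forms adds up, since `‖P φ‖² = ‖d φ‖² + ‖δ φ‖²` and both terms
split according to degrees. -/
theorem IsAdjointPair.l2Inner_le_opP (h : IsAdjointPair D) (hD : IsFlat D)
    (hb : ∀ k ≤ n, SpectralBound D k) {φ : MixedForm n V} (hφ : TestMixed F φ) :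
    l2Inner φ φ ≤ l2Inner (TwistedL2.opP D φ) (TwistedL2.opP D φ) := by
  rw [h.l2Inner_opP_self hD hφ, l2Inner_eq_sum hφ hφ, l2Inner_eq_sum (hφ.dD D) (hφ.dD D),
    l2Inner_eq_sum (hφ.deltaD D) (hφ.deltaD D)]
  have h1 : ∀ k ∈ Finset.range (n + 1), l2FormInner (φ k) (φ k) ≤
      l2FormInner (extDerivD D (φ k)) (extDerivD D (φ k)) +
        l2Inner (deltaD D (Pi.single k (φ k))) (deltaD D (Pi.single k (φ k))) := fun k hk =>
    h.l2Inner_le_of_single hD (hb k (by simpa [Nat.lt_succ_iff] using hk)) (hφ k)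
  refine (Finset.sum_le_sum h1).trans ?_
  rw [Finset.sum_add_distrib]
  refine add_le_add ?_ ?_
  · rw [Finset.sum_range_succ, Finset.sum_range_succ', form_eq_zero_of_lt (by omega)
      (extDerivD D (φ n)), l2FormInner_zero_left]
    exact (add_le_add_iff_left _).2 (l2FormInner_self_nonneg _)
  · rw [Finset.sum_range_succ', Finset.sum_range_succ, deltaD_single_zero]
    refine add_le_add (Finset.sum_le_sum fun k _ => ?_) ?_
    · rw [deltaD_single, l2Inner_single, Pi.single_eq_same]; exact le_rfl
    · rw [show l2Inner (0 : MixedForm n V) 0 = 0 by simp [l2Inner, mixedInner, formInner_zero_left]]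
      exact l2FormInner_self_nonneg _

/-! ### Linearity on test forms -/

theorem eq_of_l2Inner_eq {η η' : MixedForm n V} (hη : TestMixed F η)
    (hη' : TestMixed F η') (h : ∀ φ : MixedForm n V, TestMixed F φ →
      l2Inner η φ = l2Inner η' φ) : η = η' := by
  funext k
  refine eq_of_l2FormInner_eq (hη k).1 (hη' k).1 fun φ hφ => ?_
  have := h _ hφ.single
  rwa [l2Inner_single, l2Inner_single, l2FormInner_comm, l2FormInner_comm (η' k)] at this

/-- Adjoint operators are linear. -/
theorem map_add_smul_of_adjoint {A B : MixedForm n V → MixedForm n V}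
    (hA : ∀ φ, TestMixed F φ → TestMixed F (A φ)) (hB : ∀ φ, TestMixed F φ → TestMixed F (B φ))
    (hAB : ∀ φ ψ, TestMixed F φ → TestMixed F ψ → l2Inner (A φ) ψ = l2Inner φ (B ψ)) :
    (∀ φ ψ, TestMixed F φ → TestMixed F ψ → A (φ + ψ) = A φ + A ψ) ∧
      ∀ (r : ℝ) φ, TestMixed F φ → A (r • φ) = r • A φ := by
  refine ⟨fun φ ψ hφ hψ => ?_, fun r φ hφ => ?_⟩
  · refine eq_of_l2Inner_eq (hA _ (hφ.add hψ)) ((hA _ hφ).add (hA _ hψ)) fun χ hχ => ?_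
    rw [hAB _ _ (hφ.add hψ) hχ, l2Inner_add_left hφ.memL2 hψ.memL2 (hB _ hχ).memL2,
      l2Inner_add_left (hA _ hφ).memL2 (hA _ hψ).memL2 hχ.memL2, hAB _ _ hφ hχ, hAB _ _ hψ hχ]
  · refine eq_of_l2Inner_eq (hA _ (hφ.const_smul r)) ((hA _ hφ).const_smul r) fun χ hχ => ?_
    rw [hAB _ _ (hφ.const_smul r) hχ, l2Inner_smul_left, l2Inner_smul_left, hAB _ _ hφ hχ]

end Symmetry

/-! ### The Hodge argument in Hilbert space -/

section Hodge

/-- Let `a` and `b` be operators on a space of test vectors with orthogonal ranges, such that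
`a + b` is bounded below and has no vectors orthogonal to its range. Then every vector orthogonal
to the range of `b` is in the range of the closure of `a`, with a preimage which is killed by the
closure of `b`. -/
theorem exists_tendsto_of_orthogonal {T H : Type*} [AddCommGroup T] [Module ℝ T]
    [NormedAddCommGroup H] [InnerProductSpace ℝ H] [CompleteSpace H] (ι : T →ₗ[ℝ] H)
    (a b : T →ₗ[ℝ] T) (horth : ∀ φ ψ, (inner ℝ (ι (a φ)) (ι (b ψ)) : ℝ) = 0)
    (hbound : ∀ φ, ‖ι φ‖ ≤ ‖ι (a φ + b φ)‖) (S : Submodule ℝ H) (hS : IsClosed (S : Set H))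
    (hι : ∀ φ, ι φ ∈ S)
    (hker : ∀ w ∈ S, (∀ φ, (inner ℝ w (ι (a φ + b φ)) : ℝ) = 0) → w = 0)
    {α : H} (hα : α ∈ S) (hαb : ∀ φ, (inner ℝ α (ι (b φ)) : ℝ) = 0) :
    ∃ φ : ℕ → T, ∃ u ∈ S, Tendsto (fun j => ι (a (φ j))) atTop (𝓝 α) ∧
      Tendsto (fun j => ι (b (φ j))) atTop (𝓝 0) ∧ Tendsto (fun j => ι (φ j)) atTop (𝓝 u) := by
  let P : T →ₗ[ℝ] H := ι ∘ₗ (a + b)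
  have hP : ∀ φ, P φ = ι (a φ) + ι (b φ) := fun φ => by simp [P]
  let K := (LinearMap.range P).topologicalClosure
  have hKc : IsClosed (K : Set H) := Submodule.isClosed_topologicalClosure _
  have hKS : K ≤ S := Submodule.topologicalClosure_minimal _ (by rintro _ ⟨φ, rfl⟩; exact hι _) hS
  have : CompleteSpace K := hKc.completeSpace_coe
  -- the closure of the range of `P` is all of `S`, since its orthogonal complement in `S` is trivial
  have hαK : α ∈ K := by
    have h1 : α - K.starProjection α = 0 := by
      refine hker _ (S.sub_mem hα (hKS (Submodule.starProjection_apply_mem _ _))) fun φ => ?_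
      have h2 := Submodule.sub_starProjection_mem_orthogonal (K := K) α
      rw [real_inner_comm]
      exact h2 _ (Submodule.le_topologicalClosure _ ⟨φ, rfl⟩)
    rw [sub_eq_zero.1 h1]
    exact Submodule.starProjection_apply_mem _ _
  obtain ⟨p, hp, hpα⟩ := mem_closure_iff_seq_limit.1 (show α ∈ closure (LinearMap.range P : Set H)
    from hαK)
  choose φ hφ using hp
  have hPα : Tendsto (fun j => P (φ j)) atTop (𝓝 α) := by simpa only [hφ] using hpα
  -- every operator dominated by `P` maps the sequence to a convergent one
  have hdom : ∀ L : T →ₗ[ℝ] H, (∀ ψ, ‖L ψ‖ ≤ ‖P ψ‖) →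
      ∃ l, Tendsto (fun j => L (φ j)) atTop (𝓝 l) := fun L hL => by
    refine cauchySeq_tendsto_of_complete ?_
    rw [Metric.cauchySeq_iff]
    intro ε hε
    obtain ⟨N, hN⟩ := Metric.cauchySeq_iff.1 hPα.cauchySeq ε hε
    refine ⟨N, fun i hi j hj => ?_⟩
    have h1 := hL (φ i - φ j)
    rw [map_sub, map_sub, ← dist_eq_norm, ← dist_eq_norm] at h1
    exact h1.trans_lt (hN i hi j hj)
  have hpyth : ∀ ψ, ‖P ψ‖ ^ 2 = ‖ι (a ψ)‖ ^ 2 + ‖ι (b ψ)‖ ^ 2 := fun ψ => by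
    rw [hP, sq, sq, sq]
    exact norm_add_sq_eq_norm_sq_add_norm_sq_real (horth ψ ψ)
  obtain ⟨la, hla⟩ := hdom (ι ∘ₗ a) fun ψ => (sq_le_sq₀ (norm_nonneg _) (norm_nonneg _)).1 (by
    rw [hpyth]; exact le_add_of_nonneg_right (sq_nonneg _))
  obtain ⟨lb, hlb⟩ := hdom (ι ∘ₗ b) fun ψ => (sq_le_sq₀ (norm_nonneg _) (norm_nonneg _)).1 (by
    rw [hpyth]; exact le_add_of_nonneg_left (sq_nonneg _))
  obtain ⟨u, hu⟩ := hdom ι fun ψ => by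
    have := hbound ψ
    rwa [map_add, ← hP] at this
  have hsum : la + lb = α := tendsto_nhds_unique (hla.add hlb)
    (by simpa only [hP, LinearMap.comp_apply] using hPα)
  have hla0 : ∀ ψ, (inner ℝ la (ι (b ψ)) : ℝ) = 0 := fun ψ =>
    tendsto_nhds_unique ((hla.inner tendsto_const_nhds)) (by
      simpa only [LinearMap.comp_apply, horth] using tendsto_const_nhds)
  have hlb0 : ∀ ψ, (inner ℝ lb (ι (a ψ)) : ℝ) = 0 := fun ψ =>
    tendsto_nhds_unique ((hlb.inner tendsto_const_nhds)) (by
      simpa only [LinearMap.comp_apply, real_inner_comm, horth] using tendsto_const_nhds)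
  -- `lb = α - la` is orthogonal to the range of `b` and, as a limit of `b φⱼ`, to the range of `a`
  have hb0 : lb = 0 := by
    refine hker _ (hS.mem_of_tendsto hlb (Eventually.of_forall fun j => hι _)) fun ψ => ?_
    rw [map_add, inner_add_right, hlb0, zero_add, eq_sub_of_add_eq' hsum, inner_sub_left, hαb, hla0,
      sub_zero]
  rw [hb0, add_zero] at hsum
  exact ⟨φ, u, hS.mem_of_tendsto hu (Eventually.of_forall fun j => hι _), hsum ▸ hla, hb0 ▸ hlb, hu⟩

end Hodge

/-! ### Primitives of closed forms as limits of test forms -/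

section Primitive

variable {n : ℕ} {M : Type*} [TopologicalSpace M] [T2Space M] [SecondCountableTopology M]
  [ChartedSpace (EuclideanSpace ℝ (Fin n)) M]
  [IsManifold (𝓡 n) ∞ M] [RiemannianBundle (fun x : M => TangentSpace (𝓡 n) x)]
  [IsContMDiffRiemannianBundle (𝓡 n) ∞ (EuclideanSpace ℝ (Fin n))
      (fun x : M => TangentSpace (𝓡 n) x)]
  [MeasurableSpace M] [BorelSpace M]
  {F : Type*} [NormedAddCommGroup F] [NormedSpace ℝ F] [FiniteDimensional ℝ F]
  {V : M → Type*} [TopologicalSpace (Bundle.TotalSpace F V)]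
  [∀ x, NormedAddCommGroup (V x)] [∀ x, InnerProductSpace ℝ (V x)]
  [FiberBundle F V] [VectorBundle ℝ F V] [ContMDiffVectorBundle ∞ F V (𝓡 n)]
  [IsContMDiffRiemannianBundle (𝓡 n) ∞ F V]

variable (n M F V) in
/-- The space `C_c^∞` as a vector space. -/
def testSpace : Submodule ℝ (MixedForm n V) where
  carrier := {φ | TestMixed F φ}
  zero_mem' := testMixed_zero
  add_mem' := TestMixed.add
  smul_mem' r _ := TestMixed.const_smul r

variable (n M F V) in
/-- The inclusion of `C_c^∞` into `L²`. -/
def testToL2 : testSpace n M F V →ₗ[ℝ] Lp (CoefSpace n F) 2 (riemannianVolume n M) where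
  toFun φ := MemL2.toL2 (TestMixed.memL2 φ.2)
  map_add' φ ψ := by
    rw [MemL2.toL2, MemL2.toL2, MemL2.toL2, ← MemLp.toLp_add]
    exact MemLp.toLp_congr _ _ (by rw [Submodule.coe_add, map_add])
  map_smul' r φ := by
    rw [MemL2.toL2, MemL2.toL2, RingHom.id_apply, ← MemLp.toLp_const_smul]
    exact MemLp.toLp_congr _ _ (by rw [Submodule.coe_smul, map_smul])

/-- An operator on `C_c^∞` which has an adjoint, as a linear map. -/
def testOp (A B : MixedForm n V → MixedForm n V)
    (hA : ∀ φ, TestMixed F φ → TestMixed F (A φ)) (hB : ∀ φ, TestMixed F φ → TestMixed F (B φ))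
    (hAB : ∀ φ ψ, TestMixed F φ → TestMixed F ψ → l2Inner (A φ) ψ = l2Inner φ (B ψ)) :
    testSpace n M F V →ₗ[ℝ] testSpace n M F V where
  toFun φ := ⟨A φ.1, hA φ.1 φ.2⟩
  map_add' φ ψ := Subtype.ext ((map_add_smul_of_adjoint hA hB hAB).1 _ _ φ.2 ψ.2)
  map_smul' r φ := Subtype.ext ((map_add_smul_of_adjoint hA hB hAB).2 r _ φ.2)

variable {D : CovariantDerivative (𝓡 n) F V} [D.ContMDiffCovariantDerivative ∞]

theorem toL2_zero : (memL2_zero (n := n) (F := F) (V := V)).toL2 = 0 := by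
  refine inner_self_eq_zero (𝕜 := ℝ) |>.1 ?_
  rw [inner_toL2]
  simp [l2Inner, mixedInner, formInner_zero_left]

/-- The range of `P` on test forms is dense in `L²`. -/
theorem toL2_eq_zero_of_forall_opP (hD : IsFlat D) (hb : ∀ k ≤ n, SpectralBound D k)
    (hesa : IsEssentiallySelfAdjointP D) {θ : MixedForm n V} (hθ : MemL2 F θ)
    (h : ∀ φ, TestMixed F φ → l2Inner θ (opP D φ) = 0) : hθ.toL2 = 0 := by
  have hadj := hesa.isAdjointPair
  -- `θ` is in the kernel of the adjoint of `P`, hence of its closure; but the closure is bounded below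
  have h0 : Adj F (opP D) θ 0 := ⟨hθ, memL2_zero, fun φ hφ => by
    rw [h φ hφ]; simp [l2Inner, mixedInner, formInner_zero_left]⟩
  obtain ⟨-, -, φ, hφ, h1, h2⟩ := (hesa θ 0).2 h0
  have hφ2 : ∀ j, MemL2 F (φ j) := fun j => (hφ j).memL2
  have h3 : Tendsto (fun j => l2Inner (φ j) (φ j)) atTop (𝓝 0) := by
    refine squeeze_zero (fun j => l2Inner_self_nonneg _) (fun j => hadj.l2Inner_le_opP hD hb (hφ j))
      ?_
    simpa only [sub_zero] using h2
  have h4 : Tendsto (fun j => (hφ2 j).toL2) atTop (𝓝 (memL2_zero (F := F) (V := V)).toL2) := by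
    rw [tendsto_toL2_iff]
    simpa only [sub_zero] using h3
  rw [← toL2_zero (n := n) (F := F) (V := V)]
  exact tendsto_nhds_unique ((tendsto_toL2_iff hφ2 hθ).2 h1) h4

/-- The Hodge argument, both for `(A, B) = (d, δ)` and for `(A, B) = (δ, d)`. -/
theorem exists_tendsto_l2Inner (hD : IsFlat D) (hb : ∀ k ≤ n, SpectralBound D k)
    (hesa : IsEssentiallySelfAdjointP D) {A B : MixedForm n V → MixedForm n V}
    (hAB : (A = dD D ∧ B = deltaD D) ∨ (A = deltaD D ∧ B = dD D)) {α : MixedForm n V}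
    (hα : MemL2 F α) (hαB : ∀ φ, TestMixed F φ → l2Inner α (B φ) = 0) :
    ∃ φ : ℕ → MixedForm n V, (∀ j, TestMixed F (φ j)) ∧ ∃ u, MemL2 F u ∧
      Tendsto (fun j => l2Inner (A (φ j) - α) (A (φ j) - α)) atTop (𝓝 0) ∧
      Tendsto (fun j => l2Inner (B (φ j)) (B (φ j))) atTop (𝓝 0) ∧
      Tendsto (fun j => l2Inner (φ j - u) (φ j - u)) atTop (𝓝 0) := by
  have hadj := hesa.isAdjointPair
  have hA : ∀ φ, TestMixed F φ → TestMixed F (A φ) := by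
    rcases hAB with ⟨rfl, rfl⟩ | ⟨rfl, rfl⟩
    exacts [fun φ hφ => hφ.dD D, fun φ hφ => hφ.deltaD D]
  have hB : ∀ φ, TestMixed F φ → TestMixed F (B φ) := by
    rcases hAB with ⟨rfl, rfl⟩ | ⟨rfl, rfl⟩
    exacts [fun φ hφ => hφ.deltaD D, fun φ hφ => hφ.dD D]
  have hadjAB : ∀ φ ψ, TestMixed F φ → TestMixed F ψ → l2Inner (A φ) ψ = l2Inner φ (B ψ) := by
    rcases hAB with ⟨rfl, rfl⟩ | ⟨rfl, rfl⟩
    · exact fun φ ψ hφ hψ => hadj.dD_deltaD hφ hψ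
    · exact fun φ ψ hφ hψ => by rw [l2Inner_comm, ← hadj.dD_deltaD hψ hφ, l2Inner_comm]
  have horth : ∀ φ ψ, TestMixed F φ → TestMixed F ψ → l2Inner (A φ) (B ψ) = 0 := by
    rcases hAB with ⟨rfl, rfl⟩ | ⟨rfl, rfl⟩
    · exact fun φ ψ hφ hψ => hadj.inner_dD_deltaD_eq_zero hD hφ hψ
    · exact fun φ ψ hφ hψ => by rw [l2Inner_comm, hadj.inner_dD_deltaD_eq_zero hD hψ hφ]
  have hP : ∀ φ, A φ + B φ = opP D φ := by
    rcases hAB with ⟨rfl, rfl⟩ | ⟨rfl, rfl⟩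
    exacts [fun φ => rfl, fun φ => add_comm _ _]
  let a := testOp A B hA hB hadjAB
  let b := testOp B A hB hA fun φ ψ hφ hψ => by
    rw [l2Inner_comm, ← hadjAB _ _ hψ hφ, l2Inner_comm]
  have hι : ∀ (θ : MixedForm n V) (hθ : MemL2 F θ) (φ : testSpace n M F V),
      (inner ℝ hθ.toL2 (testToL2 n M F V φ) : ℝ) = l2Inner θ φ.1 := fun θ hθ φ =>
    inner_toL2 hθ (TestMixed.memL2 φ.2)
  have hab : ∀ φ : testSpace n M F V, a φ + b φ =
      ⟨opP D φ.1, TestMixed.opP D φ.2⟩ := fun φ => Subtype.ext (hP φ.1)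
  have hn : ∀ φ : testSpace n M F V, ‖testToL2 n M F V φ‖ ^ 2 = l2Inner φ.1 φ.1 :=
    fun φ => by
      rw [← real_inner_self_eq_norm_sq]
      exact inner_toL2 (TestMixed.memL2 φ.2) (TestMixed.memL2 φ.2)
  obtain ⟨φ, u, ⟨u', hu', rfl⟩, h1, h2, h3⟩ := exists_tendsto_of_orthogonal (testToL2 n M F V) a b
    (fun φ ψ => (hι _ (TestMixed.memL2 (a φ).2) _).trans (horth _ _ φ.2 ψ.2))
    (fun φ => by
      refine (sq_le_sq₀ (norm_nonneg _) (norm_nonneg _)).1 ?_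
      rw [hn, hn, hab]
      exact hadj.l2Inner_le_opP hD hb φ.2)
    (formSpace n M F V) isClosed_formSpace (fun φ => ⟨φ.1, TestMixed.memL2 φ.2, rfl⟩)
    (by
      rintro _ ⟨θ, hθ, rfl⟩ h
      refine toL2_eq_zero_of_forall_opP hD hb hesa hθ fun φ hφ => ?_
      have := h ⟨φ, hφ⟩
      rwa [hι, hab] at this)
    ⟨α, hα, rfl⟩ (fun φ => by rw [hι]; exact hαB φ.1 φ.2)
  refine ⟨fun j => (φ j).1, fun j => (φ j).2, u', hu', ?_, ?_, ?_⟩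
  · exact (tendsto_toL2_iff (fun j => (hA _ (φ j).2).memL2) hα).1 h1
  · have h4 := (h2.norm).pow 2
    simp only [hn, norm_zero, ne_eq, OfNat.ofNat_ne_zero, not_false_eq_true, zero_pow] at h4
    exact h4
  · exact (tendsto_toL2_iff (fun j => (φ j).2.memL2) hu').1 h3

end Primitive

section HomogeneousPrimitive

variable {n : ℕ} {M : Type*} [TopologicalSpace M] [T2Space M] [SecondCountableTopology M]
  [ChartedSpace (EuclideanSpace ℝ (Fin n)) M]
  [IsManifold (𝓡 n) ∞ M] [RiemannianBundle (fun x : M => TangentSpace (𝓡 n) x)]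
  [IsContMDiffRiemannianBundle (𝓡 n) ∞ (EuclideanSpace ℝ (Fin n))
      (fun x : M => TangentSpace (𝓡 n) x)]
  [MeasurableSpace M] [BorelSpace M]
  {F : Type*} [NormedAddCommGroup F] [NormedSpace ℝ F] [FiniteDimensional ℝ F]
  {V : M → Type*} [TopologicalSpace (Bundle.TotalSpace F V)]
  [∀ x, NormedAddCommGroup (V x)] [∀ x, InnerProductSpace ℝ (V x)]
  [FiberBundle F V] [VectorBundle ℝ F V] [ContMDiffVectorBundle ∞ F V (𝓡 n)]
  [IsContMDiffRiemannianBundle (𝓡 n) ∞ F V]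
  {D : CovariantDerivative (𝓡 n) F V} [D.ContMDiffCovariantDerivative ∞]

theorem formInner_le_mixedInner (θ : MixedForm n V) (k : ℕ) (x : M) :
    formInner x (θ k x) (θ k x) ≤ mixedInner θ θ x := by
  by_cases hk : k < n + 1
  · exact Finset.single_le_sum (f := fun k => formInner x (θ k x) (θ k x))
      (fun j _ => formInner_self_nonneg x (θ j)) (Finset.mem_range.2 hk)
  · rw [form_eq_zero_of_lt (by omega) (θ k), Pi.zero_apply, formInner_zero_left]
    exact Finset.sum_nonneg fun j _ => formInner_self_nonneg x (θ j)

theorem l2FormInner_le_l2Inner {θ : MixedForm n V} (hθ : MemL2 F θ) (k : ℕ) :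
    l2FormInner (θ k) (θ k) ≤ l2Inner θ θ :=
  integral_mono_of_nonneg (Eventually.of_forall fun x => formInner_self_nonneg x (θ k)) hθ.2
    (Eventually.of_forall fun x => formInner_le_mixedInner θ k x)

theorem measurableForm_zero {k : ℕ} : MeasurableForm F (0 : Form n V k) :=
  smoothForm_zero.measurableForm

theorem MemL2.single {θ : MixedForm n V} (hθ : MemL2 F θ) (k : ℕ) :
    MemL2 F (Pi.single k (θ k) : MixedForm n V) := by
  have h : ∀ j, MeasurableForm F ((Pi.single k (θ k) : MixedForm n V) j) := fun j => by
    by_cases hj : j = k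
    · subst hj; simpa using hθ.1 j
    · rw [Pi.single_eq_of_ne hj]; exact measurableForm_zero
  refine ⟨h, hθ.2.mono ?_ (Eventually.of_forall fun x => ?_)⟩
  · rw [← funext (inner_coefMap F (Pi.single k (θ k)) (Pi.single k (θ k)))]
    exact (aestronglyMeasurable_coefMap h).inner (aestronglyMeasurable_coefMap h)
  · rw [mixedInner_single, Pi.single_eq_same, Real.norm_of_nonneg (formInner_self_nonneg x _)]
    exact (formInner_le_mixedInner θ k x).trans (le_abs_self _)

theorem l2Inner_single_self {k : ℕ} (θ : Form n V k) :
    l2Inner (Pi.single k θ) (Pi.single k θ) = l2FormInner θ θ := by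
  rw [l2Inner_single, Pi.single_eq_same]

/-- A closed form of positive degree is a limit of differentials of test forms, where the test
forms converge as well and their codifferentials tend to zero. -/
theorem exists_tendsto_l2FormInner (hD : IsFlat D) (hb : ∀ k ≤ n, SpectralBound D k)
    (hesa : IsEssentiallySelfAdjointP D) {m : ℕ} {α : Form n V (m + 1)}
    (hα : MemL2 F (Pi.single (m + 1) α : MixedForm n V))
    (hclosed : ∀ φ, TestMixed F φ → l2Inner (Pi.single (m + 1) α) (deltaD D φ) = 0) :
    ∃ θ : ℕ → Form n V m, (∀ j, TestForm F (θ j)) ∧ ∃ u : Form n V m,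
      MemL2 F (Pi.single m u : MixedForm n V) ∧
      Tendsto (fun j => l2FormInner (extDerivD D (θ j) - α) (extDerivD D (θ j) - α)) atTop (𝓝 0) ∧
      Tendsto (fun j => l2Inner (deltaD D (Pi.single m (θ j))) (deltaD D (Pi.single m (θ j))))
        atTop (𝓝 0) ∧
      Tendsto (fun j => l2FormInner (θ j - u) (θ j - u)) atTop (𝓝 0) := by
  obtain ⟨φ, hφ, u, hu, h1, h2, h3⟩ :=
    exists_tendsto_l2Inner hD hb hesa (Or.inl ⟨rfl, rfl⟩) hα hclosed
  refine ⟨fun j => φ j m, fun j => hφ j m, u m, hu.single m, ?_, ?_, ?_⟩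
  · refine squeeze_zero (fun j => l2FormInner_self_nonneg _) (fun j => ?_) h1
    have := l2FormInner_le_l2Inner (((hφ j).dD D).memL2.sub hα) (m + 1)
    rwa [Pi.sub_apply, Pi.single_eq_same] at this
  · refine squeeze_zero (fun j => l2Inner_self_nonneg _) (fun j => ?_) h2
    cases m with
    | zero =>
      rw [deltaD_single_zero, show l2Inner (0 : MixedForm n V) 0 = 0 by
        simp [l2Inner, mixedInner, formInner_zero_left]]
      exact l2Inner_self_nonneg _
    | succ m =>
      rw [deltaD_single, l2Inner_single_self]
      exact l2FormInner_le_l2Inner ((hφ j).deltaD D).memL2 m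
  · refine squeeze_zero (fun j => l2FormInner_self_nonneg _) (fun j => ?_) h3
    exact l2FormInner_le_l2Inner ((hφ j).memL2.sub hu) m

theorem tendsto_l2Inner_const {θ : ℕ → MixedForm n V} {u ψ : MixedForm n V}
    (hθ : ∀ j, MemL2 F (θ j)) (hu : MemL2 F u) (hψ : MemL2 F ψ)
    (h : Tendsto (fun j => l2Inner (θ j - u) (θ j - u)) atTop (𝓝 0)) :
    Tendsto (fun j => l2Inner (θ j) ψ) atTop (𝓝 (l2Inner u ψ)) := by
  have h1 := ((tendsto_toL2_iff hθ hu).2 h).inner (𝕜 := ℝ) (tendsto_const_nhds (x := hψ.toL2))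
  simpa only [inner_toL2] using h1

theorem tendsto_l2Inner_sub_add {θ η : ℕ → MixedForm n V} {u v : MixedForm n V}
    (hθ : ∀ j, MemL2 F (θ j)) (hη : ∀ j, MemL2 F (η j)) (hu : MemL2 F u) (hv : MemL2 F v)
    (h1 : Tendsto (fun j => l2Inner (θ j - u) (θ j - u)) atTop (𝓝 0))
    (h2 : Tendsto (fun j => l2Inner (η j - v) (η j - v)) atTop (𝓝 0)) :
    Tendsto (fun j => l2Inner (θ j + η j - (u + v)) (θ j + η j - (u + v))) atTop (𝓝 0) := by
  have h3 := ((tendsto_toL2_iff hθ hu).2 h1).sub_const hu.toL2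
  have h4 := ((tendsto_toL2_iff hη hv).2 h2).sub_const hv.toL2
  have h5 := ((h3.add h4).norm).pow 2
  simp only [sub_self, add_zero, norm_zero, ne_eq, OfNat.ofNat_ne_zero, not_false_eq_true,
    zero_pow] at h5
  refine h5.congr fun j => ?_
  have h6 : ((hθ j).sub hu).toL2 + ((hη j).sub hv).toL2 =
      (((hθ j).sub hu).add ((hη j).sub hv)).toL2 := by
    rw [MemL2.toL2, MemL2.toL2, MemL2.toL2, ← MemLp.toLp_add]
    exact MemLp.toLp_congr _ _ (by rw [map_add])
  rw [← toL2_sub, ← toL2_sub, h6, ← real_inner_self_eq_norm_sq, inner_toL2, add_sub_add_comm]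

/-- The limit of test forms whose codifferentials tend to zero is coclosed. -/
theorem l2Inner_dD_eq_zero_of_tendsto (hadj : IsAdjointPair D) {m : ℕ}
    {θ : ℕ → Form n V m} (hθ : ∀ j, TestForm F (θ j)) {u : Form n V m}
    (hu : MemL2 F (Pi.single m u : MixedForm n V))
    (h2 : Tendsto (fun j => l2Inner (deltaD D (Pi.single m (θ j))) (deltaD D (Pi.single m (θ j))))
      atTop (𝓝 0))
    (h3 : Tendsto (fun j => l2FormInner (θ j - u) (θ j - u)) atTop (𝓝 0))
    {φ : MixedForm n V} (hφ : TestMixed F φ) : l2Inner (Pi.single m u) (dD D φ) = 0 := by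
  have hθ' : ∀ j, TestMixed F (Pi.single m (θ j) : MixedForm n V) := fun j => (hθ j).single
  have h3' : Tendsto (fun j => l2Inner (Pi.single m (θ j) - Pi.single m u : MixedForm n V)
      (Pi.single m (θ j) - Pi.single m u)) atTop (𝓝 0) := by
    simpa only [← Pi.single_sub, l2Inner_single_self] using h3
  have h2' : Tendsto (fun j => l2Inner (deltaD D (Pi.single m (θ j)) - 0)
      (deltaD D (Pi.single m (θ j)) - 0)) atTop (𝓝 0) := by
    simpa only [sub_zero] using h2
  refine tendsto_nhds_unique (tendsto_l2Inner_const (fun j => (hθ' j).memL2) hu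
    (hφ.dD D).memL2 h3') ?_
  have h5 := tendsto_l2Inner_const (fun j => ((hθ' j).deltaD D).memL2) memL2_zero hφ.memL2 h2'
  rw [show l2Inner 0 φ = 0 by simp [l2Inner, mixedInner, formInner_zero_left]] at h5
  refine h5.congr fun j => ?_
  rw [l2Inner_comm, ← hadj.dD_deltaD hφ (hθ' j), l2Inner_comm]

/-- The limit of the test forms is a primitive with all required properties except smoothness; it is
coexact since the Hodge argument applies to it with the roles of `d` and `δ` exchanged. -/
theorem properties_of_tendsto (hD : IsFlat D) (hb : ∀ k ≤ n, SpectralBound D k)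
    (hesa : IsEssentiallySelfAdjointP D) {m : ℕ} {α : Form n V (m + 1)}
    (hα : MemL2 F (Pi.single (m + 1) α : MixedForm n V))
    {θ : ℕ → Form n V m} (hθ : ∀ j, TestForm F (θ j)) {u : Form n V m}
    (hu : MemL2 F (Pi.single m u : MixedForm n V))
    (h1 : Tendsto (fun j => l2FormInner (extDerivD D (θ j) - α) (extDerivD D (θ j) - α))
      atTop (𝓝 0))
    (h2 : Tendsto (fun j => l2Inner (deltaD D (Pi.single m (θ j))) (deltaD D (Pi.single m (θ j))))
      atTop (𝓝 0))
    (h3 : Tendsto (fun j => l2FormInner (θ j - u) (θ j - u)) atTop (𝓝 0)) :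
    DMin D (Pi.single m u) (Pi.single (m + 1) α) ∧ MemH1Min D (Pi.single m u) ∧
      IsCoexactForm D (Pi.single m u) := by
  have hθ' : ∀ j, TestMixed F (Pi.single m (θ j) : MixedForm n V) := fun j => (hθ j).single
  have h1' : Tendsto (fun j => l2Inner (dD D (Pi.single m (θ j)) - Pi.single (m + 1) α)
      (dD D (Pi.single m (θ j)) - Pi.single (m + 1) α)) atTop (𝓝 0) := by
    simpa only [dD_single, ← Pi.single_sub, l2Inner_single_self] using h1
  have h2' : Tendsto (fun j => l2Inner (deltaD D (Pi.single m (θ j)) - 0)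
      (deltaD D (Pi.single m (θ j)) - 0)) atTop (𝓝 0) := by
    simpa only [sub_zero] using h2
  have h3' : Tendsto (fun j => l2Inner (Pi.single m (θ j) - Pi.single m u : MixedForm n V)
      (Pi.single m (θ j) - Pi.single m u)) atTop (𝓝 0) := by
    simpa only [← Pi.single_sub, l2Inner_single_self] using h3
  refine ⟨⟨hu, hα, _, hθ', h3', h1'⟩, ⟨Pi.single (m + 1) α + 0, hu, hα.add memL2_zero, _, hθ', h3',
    tendsto_l2Inner_sub_add (fun j => ((hθ' j).dD D).memL2) (fun j => ((hθ' j).deltaD D).memL2) hα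
      memL2_zero h1' h2'⟩, ?_⟩
  -- `u` is orthogonal to the range of `d`, so the Hodge argument applies with `d` and `δ` exchanged
  have h4 : ∀ φ, TestMixed F φ → l2Inner (Pi.single m u) (dD D φ) = 0 := fun φ hφ =>
    l2Inner_dD_eq_zero_of_tendsto hesa.isAdjointPair hθ hu h2 h3 hφ
  obtain ⟨φ, hφ, β, hβ, h6, -, h7⟩ :=
    exists_tendsto_l2Inner hD hb hesa (Or.inr ⟨rfl, rfl⟩) hu h4
  exact ⟨β, hβ, hu, φ, hφ, h7, h6⟩

/-- A closed form of degree zero vanishes almost everywhere, since it is a limit of differentials,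
which have no component of degree zero. -/
theorem l2FormInner_self_eq_zero_of_isClosed (hD : IsFlat D) (hb : ∀ k ≤ n, SpectralBound D k)
    (hesa : IsEssentiallySelfAdjointP D) {α : Form n V 0}
    (hα : MemL2 F (Pi.single 0 α : MixedForm n V))
    (hclosed : ∀ φ, TestMixed F φ → l2Inner (Pi.single 0 α) (deltaD D φ) = 0) :
    l2FormInner α α = 0 := by
  obtain ⟨φ, hφ, -, -, h1, -, -⟩ :=
    exists_tendsto_l2Inner hD hb hesa (Or.inl ⟨rfl, rfl⟩) hα hclosed
  have h2 := tendsto_l2Inner_const (fun j => ((hφ j).dD D).memL2) hα hα h1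
  rw [l2Inner_single_self] at h2
  refine tendsto_nhds_unique h2 ?_
  simp only [l2Inner_single]
  exact tendsto_const_nhds.congr fun j => (l2FormInner_zero_left α).symm

end HomogeneousPrimitive

/-! ### Elliptic regularity for vector-valued functions -/

section VectorRegularity

variable {n : ℕ}

/-- The gradient of a function on Euclidean space. -/
def grad (g : Euc n → ℝ) (y : Euc n) : Euc n := WithLp.toLp 2 fun i => pd i g y

theorem grad_eq_sum (g : Euc n → ℝ) (y : Euc n) :
    grad g y = ∑ i, pd i g y • (EuclideanSpace.single i (1 : ℝ) : Euc n) := by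
  ext j; simp [grad, Finset.sum_apply, Pi.single_apply]

theorem inner_grad (g : Euc n → ℝ) (y v : Euc n) :
    (inner ℝ (grad g y) v : ℝ) = fderiv ℝ g y v := by
  have h : v = ∑ i, v i • (EuclideanSpace.single i (1 : ℝ) : Euc n) := by
    ext j; simp [Finset.sum_apply, Pi.single_apply]
  conv_rhs => rw [h, map_sum]
  rw [PiLp.inner_apply]
  refine Finset.sum_congr rfl fun i _ => ?_
  rw [map_smul, smul_eq_mul]
  simp [grad, pd]

theorem grad_eq_zero_of_notMem {g : Euc n → ℝ} {y : Euc n} (hy : y ∉ tsupport g) :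
    grad g y = 0 := by
  ext i
  have h : y ∉ tsupport (pd i g) := fun h => hy (tsupport_pd_subset g i h)
  simpa [grad] using image_eq_zero_of_notMem_tsupport h

/-- `elliptic_regularity` without reference to bases. -/
theorem elliptic_regularity_vector {L W : Type*} [Fintype L] [NormedAddCommGroup W]
    [NormedSpace ℝ W] [FiniteDimensional ℝ W] {O : Set (Euc n)} (hO : IsOpen O) {x₀ : Euc n}
    (hx₀ : x₀ ∈ O) {a : L → Euc n → Euc n →ₗ[ℝ] W →ₗ[ℝ] ℝ} {b : L → Euc n → W →ₗ[ℝ] ℝ}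
    {f : L → Euc n → ℝ} (ha : ∀ l ξ w, ContDiffOn ℝ ∞ (fun y => a l y ξ w) O)
    (hb : ∀ l w, ContDiffOn ℝ ∞ (fun y => b l y w) O) (hf : ∀ l, ContDiffOn ℝ ∞ (f l) O)
    (hsymb : ∀ ξ : Euc n, ξ ≠ 0 → ∀ w : W, (∀ l, a l x₀ ξ w = 0) → w = 0) {u : Euc n → W}
    (hu : ∀ K, IsCompact K → K ⊆ O → MemLp u 2 (volume.restrict K))
    (heq : ∀ l g, IsTest g → tsupport g ⊆ O →
      ∫ y, a l y (grad g y) (u y) = ∫ y, g y * (f l y + b l y (u y))) :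
    ∃ U ∈ 𝓝 x₀, ∃ v : Euc n → W, ContDiff ℝ ∞ v ∧ ∀ᵐ y, y ∈ U → u y = v y := by
  let bs := Module.finBasis ℝ W
  have hexp : ∀ w : W, w = ∑ j, bs.repr w j • bs j := fun w => (bs.sum_repr w).symm
  have ha' : ∀ l y (g : Euc n → ℝ) (w : W), ∑ i, ∑ j,
      a l y (EuclideanSpace.single i 1) (bs j) * pd i g y * bs.repr w j = a l y (grad g y) w := by
    intro l y g w
    conv_rhs => rw [grad_eq_sum, hexp w]
    simp only [map_sum, map_smul, LinearMap.sum_apply, LinearMap.smul_apply, smul_eq_mul]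
    rw [Finset.sum_comm]
    refine Finset.sum_congr rfl fun j _ => ?_
    rw [Finset.mul_sum]
    exact Finset.sum_congr rfl fun i _ => by ring
  have hb' : ∀ l y (w : W), ∑ j, b l y (bs j) * bs.repr w j = b l y w := by
    intro l y w
    conv_rhs => rw [hexp w]
    simp only [map_sum, map_smul, smul_eq_mul, mul_comm]
  obtain ⟨U, hU, v, hv, huv⟩ := elliptic_regularity hO hx₀
    (a := fun l i j y => a l y (EuclideanSpace.single i 1) (bs j)) (b := fun l j y => b l y (bs j))
    (f := f) (fun l i j => ha l _ _) (fun l j => hb l _) hf (fun ξ hξ z hz => by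
      have h1 := hsymb ξ hξ (∑ j, z j • bs j) fun l => by
        rw [← hz l]
        have hξe : ξ = ∑ i, ξ i • (EuclideanSpace.single i (1 : ℝ) : Euc n) := by
          ext j; simp [Finset.sum_apply, Pi.single_apply]
        conv_lhs => rw [hξe]
        simp only [map_sum, map_smul, LinearMap.sum_apply, LinearMap.smul_apply, smul_eq_mul]
        rw [Finset.sum_comm]
        refine Finset.sum_congr rfl fun j _ => ?_
        rw [Finset.mul_sum]
        exact Finset.sum_congr rfl fun i _ => by ring
      funext j
      have h2 := congrArg (fun w => bs.repr w j) h1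
      simpa [Finsupp.single_apply] using h2)
    (u := fun j y => bs.repr (u y) j) (fun j K hK hKO =>
      (hu K hK hKO).continuousLinearMap_comp (LinearMap.toContinuousLinearMap (bs.coord j)))
    (fun l g hg hgO => by
      simp only [ha', hb']
      exact heq l g hg hgO)
  refine ⟨U, hU, fun y => ∑ j, v j y • bs j, ContDiff.sum fun j _ => (hv j).smul contDiff_const, ?_⟩
  filter_upwards [huv] with y hy hyU
  conv_lhs => rw [hexp (u y)]
  exact Finset.sum_congr rfl fun j _ => by rw [← hy hyU j]

end VectorRegularity

/-! ### The symbol of the twisted differential -/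

section Wedge

open ContinuousAlternatingMap

variable {n k : ℕ} {F : Type*} [NormedAddCommGroup F] [NormedSpace ℝ F]

set_option synthInstance.maxHeartbeats 200000

/-- The exterior product of the covector `⟨ξ, ·⟩` with a form. -/
def wedge (ξ : Euc n) (w : Euc n [⋀^Fin k]→L[ℝ] F) : Euc n [⋀^Fin (k + 1)]→L[ℝ] F :=
  alternatizeUncurryFin ((innerSL ℝ ξ).smulRight w)

theorem wedge_apply (ξ : Euc n) (w : Euc n [⋀^Fin k]→L[ℝ] F) (v : Fin (k + 1) → Euc n) :
    wedge ξ w v = ∑ i : Fin (k + 1), (-1 : ℝ) ^ (i : ℕ) •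
      ((inner ℝ ξ (v i) : ℝ) • w (i.removeNth v)) := by
  rw [wedge, alternatizeUncurryFin_apply]
  simp only [zsmul_neg_one_pow]
  rfl

theorem wedge_add_left (ξ ξ' : Euc n) (w : Euc n [⋀^Fin k]→L[ℝ] F) :
    wedge (ξ + ξ') w = wedge ξ w + wedge ξ' w := by
  ext v
  simp only [wedge_apply, ContinuousAlternatingMap.add_apply, inner_add_left, add_smul, smul_add,
    Finset.sum_add_distrib]

theorem wedge_smul_left (r : ℝ) (ξ : Euc n) (w : Euc n [⋀^Fin k]→L[ℝ] F) :
    wedge (r • ξ) w = r • wedge ξ w := by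
  ext v
  simp only [wedge_apply, ContinuousAlternatingMap.smul_apply, real_inner_smul_left, mul_smul,
    Finset.smul_sum, smul_comm r]

theorem wedge_add_right (ξ : Euc n) (w w' : Euc n [⋀^Fin k]→L[ℝ] F) :
    wedge ξ (w + w') = wedge ξ w + wedge ξ w' := by
  ext v
  simp only [wedge_apply, ContinuousAlternatingMap.add_apply, smul_add, Finset.sum_add_distrib]

theorem wedge_smul_right (r : ℝ) (ξ : Euc n) (w : Euc n [⋀^Fin k]→L[ℝ] F) :
    wedge ξ (r • w) = r • wedge ξ w := by
  ext v
  simp only [wedge_apply, ContinuousAlternatingMap.smul_apply, Finset.smul_sum, smul_comm r]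

/-- The exterior product vanishes only on multiples of the covector (in degree zero). -/
theorem eq_zero_of_wedge_eq_zero {ξ : Euc n} (hξ : ξ ≠ 0) {w : Euc n [⋀^Fin 0]→L[ℝ] F}
    (h : wedge ξ w = 0) : w = 0 := by
  have h1 : wedge ξ w (fun _ => ξ) = 0 := by rw [h]; rfl
  rw [wedge_apply, Fin.sum_univ_succ, Finset.univ_eq_empty, Finset.sum_empty, add_zero,
    Fin.val_zero, pow_zero, one_smul, smul_eq_zero, inner_self_eq_zero] at h1
  ext v
  show w v = 0
  rw [← h1.resolve_left hξ]
  exact congrArg w (Subsingleton.elim _ _)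

/-- Exactness of the Koszul complex. -/
theorem exists_eq_wedge {ξ : Euc n} (hξ : ξ ≠ 0) {w : Euc n [⋀^Fin (k + 1)]→L[ℝ] F}
    (h : wedge ξ w = 0) : ∃ w' : Euc n [⋀^Fin k]→L[ℝ] F, w = wedge ξ w' := by
  -- `w' = |ξ|⁻² ι_ξ w`, since `ι_ξ (ξ ∧ w) = |ξ|² w - ξ ∧ ι_ξ w`
  have h0 : (inner ℝ ξ ξ : ℝ) ≠ 0 := inner_self_ne_zero.2 hξ
  refine ⟨(inner ℝ ξ ξ : ℝ)⁻¹ • w.curryLeft ξ, ?_⟩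
  rw [wedge_smul_right, eq_inv_smul_iff₀ h0]
  ext v
  have h1 : wedge ξ w (Matrix.vecCons ξ v) = 0 := by rw [h]; rfl
  rw [wedge_apply, Fin.sum_univ_succ] at h1
  simp only [Fin.val_zero, pow_zero, one_smul, Matrix.cons_val_zero, Fin.val_succ,
    Matrix.cons_val_succ] at h1
  rw [ContinuousAlternatingMap.smul_apply, wedge_apply]
  have h2 : (0 : Fin (k + 2)).removeNth (Matrix.vecCons ξ v) = v := by
    funext j; simp [Fin.removeNth]
  have h3 : ∀ i : Fin (k + 1), (i.succ).removeNth (Matrix.vecCons ξ v) =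
      Matrix.vecCons ξ (i.removeNth v) := fun i => by
    funext j
    refine Fin.cases ?_ (fun j => ?_) j
    · simp [Fin.removeNth]
    · simp [Fin.removeNth]
  rw [h2] at h1
  simp only [h3] at h1
  rw [eq_neg_of_add_eq_zero_left h1, ← Finset.sum_neg_distrib]
  refine Finset.sum_congr rfl fun i _ => ?_
  rw [pow_succ, mul_neg_one, neg_smul, neg_neg]
  rfl

/-- The zeroth-order part of the twisted differential. -/
def connWedge (A : Euc n →L[ℝ] F →L[ℝ] F) (w : Euc n [⋀^Fin k]→L[ℝ] F) :
    Euc n [⋀^Fin (k + 1)]→L[ℝ] F :=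
  alternatizeUncurryFin (connTerm A w)

theorem connWedge_apply (A : Euc n →L[ℝ] F →L[ℝ] F) (w : Euc n [⋀^Fin k]→L[ℝ] F)
    (v : Fin (k + 1) → Euc n) : connWedge A w v =
      ∑ i : Fin (k + 1), (-1 : ℝ) ^ (i : ℕ) • A (v i) (w (i.removeNth v)) := by
  rw [connWedge, alternatizeUncurryFin_apply]
  simp only [zsmul_neg_one_pow, connTerm_apply]

theorem connWedge_add (A : Euc n →L[ℝ] F →L[ℝ] F) (w w' : Euc n [⋀^Fin k]→L[ℝ] F) :
    connWedge A (w + w') = connWedge A w + connWedge A w' := by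
  ext v
  simp only [connWedge_apply, ContinuousAlternatingMap.add_apply, map_add, smul_add,
    Finset.sum_add_distrib]

theorem connWedge_smul (A : Euc n →L[ℝ] F →L[ℝ] F) (r : ℝ) (w : Euc n [⋀^Fin k]→L[ℝ] F) :
    connWedge A (r • w) = r • connWedge A w := by
  ext v
  simp only [connWedge_apply, ContinuousAlternatingMap.smul_apply, map_smul, Finset.smul_sum,
    smul_comm r]

theorem twistedD_smul_const (A : Euc n → Euc n →L[ℝ] F →L[ℝ] F) {g : Euc n → ℝ} {y : Euc n}
    (hg : DifferentiableAt ℝ g y) (w : Euc n [⋀^Fin k]→L[ℝ] F) :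
    twistedD A (fun z => g z • w) y = wedge (grad g y) w + g y • connWedge (A y) w := by
  ext v
  rw [twistedD_apply' A (hg.smul_const w), ContinuousAlternatingMap.add_apply,
    ContinuousAlternatingMap.smul_apply, wedge_apply, connWedge_apply, Finset.smul_sum,
    ← Finset.sum_add_distrib]
  refine Finset.sum_congr rfl fun i _ => ?_
  have h : fderiv ℝ (fun z => (g z • w) (i.removeNth v)) y (v i) =
      fderiv ℝ g y (v i) • w (i.removeNth v) := by
    simp only [ContinuousAlternatingMap.smul_apply]
    rw [fderiv_smul_const hg]; rfl
  rw [h, inner_grad, ContinuousAlternatingMap.smul_apply, map_smul, smul_add, smul_comm (g y)]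

theorem IsTest.integral_fderiv {ψ : Euc n → ℝ} (hψ : IsTest ψ) (v : Euc n) :
    ∫ y, fderiv ℝ ψ y v = 0 := by
  have h1 : Continuous fun y => fderiv ℝ ψ y v :=
    (hψ.1.continuous_fderiv (by simp)).clm_apply continuous_const
  have h2 : HasCompactSupport fun y => fderiv ℝ ψ y v := hψ.2.fderiv_apply (𝕜 := ℝ) v
  have h := integral_mul_fderiv_eq_neg_fderiv_mul_of_integrable (μ := (volume : Measure (Euc n)))
    (f := fun _ : Euc n => (1 : ℝ)) (g := ψ) (v := v) (by simp)
    (by simpa using h1.integrable_of_hasCompactSupport h2)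
    (by simpa using hψ.continuous.integrable_of_hasCompactSupport hψ.2)
    (fun x _ => differentiableAt_const _) fun x _ => hψ.differentiable x
  simpa using h

/-- The twisted differential in the sense of distributions: integration by parts. -/
theorem integral_wedge_add (A : Euc n → Euc n →L[ℝ] F →L[ℝ] F) {O : Set (Euc n)} (hO : IsOpen O)
    {w : Euc n → Euc n [⋀^Fin k]→L[ℝ] F} (hw : ∀ y ∈ O, ContDiffAt ℝ ∞ w y) {g : Euc n → ℝ}
    (hg : IsTest g) (hgO : tsupport g ⊆ O) (ℓ : F →L[ℝ] ℝ) (v : Fin (k + 1) → Euc n) :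
    ∫ y, (ℓ (wedge (grad g y) (w y) v) +
      g y * (ℓ (twistedD A w y v) - ℓ (connWedge (A y) (w y) v))) = 0 := by
  let h : Fin (k + 1) → Euc n → ℝ := fun i z => ℓ (w z (i.removeNth v))
  have hh : ∀ i, ∀ y ∈ O, ContDiffAt ℝ ∞ (h i) y := fun i y hy =>
    ℓ.contDiff.contDiffAt.comp y
      ((ContinuousAlternatingMap.apply ℝ (Euc n) F (i.removeNth v)).contDiff.contDiffAt.comp y
        (hw y hy))
  have hψ : ∀ i, IsTest fun y => g y * h i y := fun i =>
    hg.mul_on hO hgO fun y hy => (hh i y hy).contDiffWithinAt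
  have hpt : ∀ y, ℓ (wedge (grad g y) (w y) v) +
      g y * (ℓ (twistedD A w y v) - ℓ (connWedge (A y) (w y) v)) =
        ∑ i : Fin (k + 1), (-1 : ℝ) ^ (i : ℕ) * fderiv ℝ (fun z => g z * h i z) y (v i) := by
    intro y
    by_cases hy : y ∈ tsupport g
    · have hwy := hw y (hgO hy)
      rw [twistedD_apply' A (hwy.differentiableAt (by simp)), connWedge_apply, wedge_apply,
        ← map_sub, ← Finset.sum_sub_distrib, _root_.map_sum, _root_.map_sum, Finset.mul_sum,
        ← Finset.sum_add_distrib]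
      refine Finset.sum_congr rfl fun i _ => ?_
      have h1 : fderiv ℝ (h i) y (v i) =
          ℓ (fderiv ℝ (fun z => w z (i.removeNth v)) y (v i)) := by
        have hd : DifferentiableAt ℝ (fun z => w z (i.removeNth v)) y :=
          (ContinuousAlternatingMap.apply ℝ (Euc n) F (i.removeNth v)).differentiableAt.comp y
            (hwy.differentiableAt (by simp))
        have := (ℓ.hasFDerivAt.comp y hd.hasFDerivAt).fderiv
        exact congrArg (fun T : Euc n →L[ℝ] ℝ => T (v i)) this
      rw [fderiv_fun_mul (hg.differentiable y) ((hh i y (hgO hy)).differentiableAt (by simp))]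
      simp only [_root_.add_apply, _root_.smul_apply, h1, inner_grad, map_smul, map_sub, map_add,
        smul_eq_mul, smul_add, h]
      ring
    · rw [grad_eq_zero_of_notMem hy, image_eq_zero_of_notMem_tsupport hy, zero_mul, add_zero]
      have h0 : ∀ i, fderiv ℝ (fun z => g z * h i z) y = 0 := fun i => by
        have : (fun z => g z * h i z) =ᶠ[𝓝 y] fun _ => 0 := by
          filter_upwards [(isClosed_tsupport g).isOpen_compl.mem_nhds hy] with z hz
          rw [image_eq_zero_of_notMem_tsupport hz, zero_mul]
        rw [this.fderiv_eq]; simp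
      rw [wedge_apply]
      simp [h0]
  simp only [hpt]
  rw [integral_finsetSum]
  · exact Finset.sum_eq_zero fun i _ => by
      rw [integral_const_mul, (hψ i).integral_fderiv, mul_zero]
  · intro i _
    refine Integrable.const_mul ?_ _
    exact (((hψ i).1.continuous_fderiv (by simp)).clm_apply
      continuous_const).integrable_of_hasCompactSupport ((hψ i).2.fderiv_apply (𝕜 := ℝ) _)

end Wedge

theorem tendsto_integral_zero_of_sq {X : Type*} [MeasurableSpace X] {μ : Measure X}
    [IsFiniteMeasure μ] {h s : ℕ → X → ℝ} (hs : ∀ j, MemLp (s j) 2 μ) {C : ℝ}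
    (hle : ∀ j, ∀ᵐ x ∂μ, |h j x| ≤ C * s j x)
    (hlim : Tendsto (fun j => ∫ x, s j x ^ 2 ∂μ) atTop (𝓝 0)) :
    Tendsto (fun j => ∫ x, h j x ∂μ) atTop (𝓝 0) := by
  have hC : MemLp (fun _ : X => C) 2 μ := memLp_const C
  have h1 : Tendsto (fun j => ‖hC.toLp _‖ * ‖(hs j).toLp (s j)‖) atTop (𝓝 0) := by
    have h2 : Tendsto (fun j => ‖(hs j).toLp (s j)‖) atTop (𝓝 0) := by
      simp only [← norm_toLp_sq (hs _)] at hlim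
      have := hlim.sqrt
      simpa using this
    simpa using h2.const_mul ‖hC.toLp _‖
  refine squeeze_zero_norm (fun j => ?_) h1
  refine le_trans ?_ ((le_abs_self _).trans (abs_integral_mul_le hC (hs j)))
  refine (norm_integral_le_integral_norm _).trans ?_
  exact integral_mono_of_nonneg (Eventually.of_forall fun x => norm_nonneg _)
    (((hs j).integrable (by norm_num)).const_mul C) (hle j)

/-! ### The metric on forms in local coordinates -/

section MetricRep

variable {n : ℕ} {M : Type*} [TopologicalSpace M] [T2Space M] [SecondCountableTopology M]
  [ChartedSpace (EuclideanSpace ℝ (Fin n)) M]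
  [IsManifold (𝓡 n) ∞ M] [RiemannianBundle (fun x : M => TangentSpace (𝓡 n) x)]
  [IsContMDiffRiemannianBundle (𝓡 n) ∞ (EuclideanSpace ℝ (Fin n))
      (fun x : M => TangentSpace (𝓡 n) x)]
  {F : Type*} [NormedAddCommGroup F] [NormedSpace ℝ F] [FiniteDimensional ℝ F]
  {V : M → Type*} [TopologicalSpace (Bundle.TotalSpace F V)]
  [∀ x, NormedAddCommGroup (V x)] [∀ x, InnerProductSpace ℝ (V x)]
  [FiberBundle F V] [VectorBundle ℝ F V] [ContMDiffVectorBundle ∞ F V (𝓡 n)]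
  [IsContMDiffRiemannianBundle (𝓡 n) ∞ F V]

theorem formInner_add_right (x : M) {k : ℕ}
    (a b c : (TangentSpace (𝓡 n) x) [⋀^Fin k]→L[ℝ] V x) :
    formInner x a (b + c) = formInner x a b + formInner x a c := by
  rw [formInner_comm, formInner_add_left, formInner_comm x b, formInner_comm x c]

theorem formInner_smul_right (x : M) {k : ℕ} (r : ℝ)
    (a b : (TangentSpace (𝓡 n) x) [⋀^Fin k]→L[ℝ] V x) :
    formInner x a (r • b) = r * formInner x a b := by
  rw [formInner_comm, formInner_smul_left, formInner_comm]

variable (V) in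
/-- The inner product of forms at a point, multiplied by the volume density, in terms of the
representation of the forms in the chart around `c`. -/
def metricRep (c : M) {k : ℕ} (y : Euc n) :
    (Euc n [⋀^Fin k]→L[ℝ] F) →ₗ[ℝ] (Euc n [⋀^Fin k]→L[ℝ] F) →ₗ[ℝ] ℝ :=
  LinearMap.mk₂ ℝ (fun w w' => volumeDensity c y * formInner ((chartAt (Euc n) c).symm y)
      (formOf V c (fun _ => w) ((chartAt (Euc n) c).symm y))
      (formOf V c (fun _ => w') ((chartAt (Euc n) c).symm y)))
    (fun w₁ w₂ w' => by
      rw [show formOf V c (fun _ => w₁ + w₂) ((chartAt (Euc n) c).symm y) =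
        formOf V c (fun _ => w₁) ((chartAt (Euc n) c).symm y) +
        formOf V c (fun _ => w₂) ((chartAt (Euc n) c).symm y) by ext v; simp [formOf],
        formInner_add_left, mul_add])
    (fun r w w' => by
      rw [show formOf V c (fun _ => r • w) ((chartAt (Euc n) c).symm y) =
        r • formOf V c (fun _ => w) ((chartAt (Euc n) c).symm y) by ext v; simp [formOf],
        formInner_smul_left, smul_eq_mul, mul_left_comm])
    (fun w' w₁ w₂ => by
      rw [show formOf V c (fun _ => w₁ + w₂) ((chartAt (Euc n) c).symm y) =
        formOf V c (fun _ => w₁) ((chartAt (Euc n) c).symm y) +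
        formOf V c (fun _ => w₂) ((chartAt (Euc n) c).symm y) by ext v; simp [formOf],
        formInner_add_right, mul_add])
    (fun r w' w => by
      rw [show formOf V c (fun _ => r • w) ((chartAt (Euc n) c).symm y) =
        r • formOf V c (fun _ => w) ((chartAt (Euc n) c).symm y) by ext v; simp [formOf],
        formInner_smul_right, smul_eq_mul, mul_left_comm])

theorem metricRep_apply (c : M) {k : ℕ} (y : Euc n) (w w' : Euc n [⋀^Fin k]→L[ℝ] F) :
    metricRep V c y w w' = volumeDensity c y * formInner ((chartAt (Euc n) c).symm y)
      (formOf V c (fun _ => w) ((chartAt (Euc n) c).symm y))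
      (formOf V c (fun _ => w') ((chartAt (Euc n) c).symm y)) := rfl

theorem formOf_formRep {c : M} {k : ℕ} {y : Euc n} (hy : y ∈ coordDomain n F V c)
    (θ : Form n V k) : formOf V c (fun _ => formRep F c θ y) ((chartAt (Euc n) c).symm y) =
      θ ((chartAt (Euc n) c).symm y) :=
  eq_of_formRep_eq hy (formRep_formOf hy)

theorem metricRep_formRep {c : M} {k : ℕ} {y : Euc n} (hy : y ∈ coordDomain n F V c)
    (θ η : Form n V k) : metricRep V c y (formRep F c θ y) (formRep F c η y) =
      volumeDensity c y * formInner ((chartAt (Euc n) c).symm y)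
        (θ ((chartAt (Euc n) c).symm y)) (η ((chartAt (Euc n) c).symm y)) := by
  rw [metricRep_apply, formOf_formRep hy, formOf_formRep hy]

theorem exists_smoothForm_formRep_eq {c : M} {k : ℕ} {y : Euc n} (hy : y ∈ coordDomain n F V c)
    (w : Euc n [⋀^Fin k]→L[ℝ] F) : ∃ θ : Form n V k, SmoothForm F θ ∧
      ∀ᶠ z in 𝓝 y, formRep F c θ z = w := by
  obtain ⟨r, hr, hball⟩ := Metric.nhds_basis_closedBall.mem_iff.1
    ((isOpen_coordDomain (G := F) (E := V) c).mem_nhds hy)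
  let χ : ContDiffBump y := ⟨r / 2, r, by positivity, by linarith⟩
  have hs : tsupport (fun z => χ z • w) ⊆ Metric.closedBall y r := by
    refine (tsupport_smul_subset_left _ _).trans ?_
    rw [χ.tsupport_eq]
  have hc : HasCompactSupport fun z => χ z • w := χ.hasCompactSupport.smul_right
  have hχ : ContDiff ℝ ∞ (χ : Euc n → ℝ) := χ.contDiff
  have hd : ContDiff ℝ ∞ fun z => χ z • w := hχ.smul contDiff_const
  refine ⟨formIn V c fun z => χ z • w, (testForm_formIn hd hc (hs.trans hball)).1, ?_⟩
  filter_upwards [(isOpen_coordDomain (G := F) (E := V) c).mem_nhds hy,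
    Metric.closedBall_mem_nhds y (half_pos hr)] with z hz hz'
  rw [formRep_formIn hz, χ.one_of_mem_closedBall hz', one_smul]

theorem contDiffAt_metricRep {c : M} {k : ℕ} {y : Euc n} (hy : y ∈ coordDomain n F V c)
    (w w' : Euc n [⋀^Fin k]→L[ℝ] F) : ContDiffAt ℝ ∞ (fun z => metricRep V c z w w') y := by
  obtain ⟨θ, hθ, hθw⟩ := exists_smoothForm_formRep_eq hy w
  obtain ⟨η, hη, hηw⟩ := exists_smoothForm_formRep_eq hy w'
  have h1 : (fun z => metricRep V c z w w') =ᶠ[𝓝 y] fun z =>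
      volumeDensity c z * formInner ((chartAt (Euc n) c).symm z)
        (θ ((chartAt (Euc n) c).symm z)) (η ((chartAt (Euc n) c).symm z)) := by
    filter_upwards [hθw, hηw, (isOpen_coordDomain (G := F) (E := V) c).mem_nhds hy]
      with z h1 h2 h3
    rw [← metricRep_formRep h3, h1, h2]
  refine ContDiffAt.congr_of_eventuallyEq ?_ h1
  exact (contDiffAt_volumeDensity hy.1).mul
    (contDiffAt_comp_chart_symm hy.1 (contMDiff_formInner hθ hη _))

theorem metricRep_self_pos {c : M} {k : ℕ} {y : Euc n} (hy : y ∈ coordDomain n F V c)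
    {w : Euc n [⋀^Fin k]→L[ℝ] F} (hw : w ≠ 0) : 0 < metricRep V c y w w := by
  rw [metricRep_apply]
  refine mul_pos (volumeDensity_pos hy.1) (lt_of_le_of_ne (formInner_self_nonneg _ _) fun h => hw ?_)
  have h1 := eq_zero_of_formInner_self_eq_zero _ _ h.symm
  rw [← formRep_formOf (V := V) (w := fun _ => w) hy, formRep_congr (η := 0) h1, formRep_zero]

/-- The metric on forms is uniformly equivalent to a fixed norm near each point of a chart. -/
theorem exists_metricRep_lower_bound {c : M} (k : ℕ) {y : Euc n} (hy : y ∈ coordDomain n F V c) :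
    ∃ κ > 0, ∃ U ∈ 𝓝 y, U ⊆ coordDomain n F V c ∧
      ∀ z ∈ U, ∀ w : Euc n [⋀^Fin k]→L[ℝ] F, κ * ‖w‖ ^ 2 ≤ metricRep V c z w w := by
  have : ProperSpace (Euc n [⋀^Fin k]→L[ℝ] F) := FiniteDimensional.proper_real _
  obtain ⟨r, hr, hball⟩ := Metric.nhds_basis_closedBall.mem_iff.1
    ((isOpen_coordDomain (G := F) (E := V) c).mem_nhds hy)
  let bs := Module.finBasis ℝ (Euc n [⋀^Fin k]→L[ℝ] F)
  have hexp : ∀ z (w : Euc n [⋀^Fin k]→L[ℝ] F), metricRep V c z w w =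
      ∑ i, ∑ j, bs.repr w i * (bs.repr w j * metricRep V c z (bs i) (bs j)) := fun z w => by
    conv_lhs => rw [← bs.sum_repr w]
    simp only [map_sum, map_smul, LinearMap.sum_apply, LinearMap.smul_apply, smul_eq_mul,
      Finset.mul_sum]
    rw [Finset.sum_comm]
    exact Finset.sum_congr rfl fun i _ => Finset.sum_congr rfl fun j _ => by ring
  have hcont : ContinuousOn (fun p : Euc n × (Euc n [⋀^Fin k]→L[ℝ] F) =>
      metricRep V c p.1 p.2 p.2) (Metric.closedBall y r ×ˢ Metric.sphere 0 1) := by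
    simp only [hexp]
    have hr : ∀ i, Continuous fun p : Euc n × (Euc n [⋀^Fin k]→L[ℝ] F) => bs.repr p.2 i := fun i =>
      (LinearMap.toContinuousLinearMap (bs.coord i)).continuous.comp continuous_snd
    refine continuousOn_finsetSum _ fun i _ => continuousOn_finsetSum _ fun j _ =>
      (hr i).continuousOn.mul ((hr j).continuousOn.mul ?_)
    have h1 : ContinuousOn (fun z => metricRep V c z (bs i) (bs j)) (Metric.closedBall y r) :=
      fun z hz => (contDiffAt_metricRep (hball hz) _ _).continuousAt.continuousWithinAt
    exact h1.comp continuous_fst.continuousOn fun p hp => hp.1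
  -- positive definiteness is uniform on the product of a compact ball with the unit sphere
  obtain ⟨κ, hκ, hle⟩ := ((isCompact_closedBall y r).prod (isCompact_sphere 0 1)).exists_forall_le'
    hcont (a := 0) fun p hp => metricRep_self_pos (hball hp.1) (by
      intro h0
      have := hp.2
      rw [h0] at this
      simp at this)
  refine ⟨κ, hκ, _, Metric.closedBall_mem_nhds y hr, hball, fun z hz w => ?_⟩
  by_cases hw : w = 0
  · simp [hw]
  have hn : ‖w‖ ≠ 0 := norm_ne_zero_iff.2 hw
  have h1 := hle (z, ‖w‖⁻¹ • w) ⟨hz, by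
    rw [mem_sphere_zero_iff_norm, norm_smul, norm_inv, norm_norm, inv_mul_cancel₀ hn]⟩
  simp only [map_smul, LinearMap.smul_apply, smul_eq_mul] at h1
  calc κ * ‖w‖ ^ 2 ≤ ‖w‖⁻¹ * (‖w‖⁻¹ * metricRep V c z w w) * ‖w‖ ^ 2 := by gcongr
    _ = metricRep V c z w w := by field_simp

variable [MeasurableSpace M] [BorelSpace M]

/-- Measurability of a form, which is defined by scalar products with smooth sections, implies
measurability of its coefficients in a chart. -/
theorem exists_aestronglyMeasurable_formRep {c : M} (k : ℕ) {y : Euc n}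
    (hy : y ∈ coordDomain n F V c) : ∃ U ∈ 𝓝 y, ∀ η : Form n V k, MeasurableForm F η →
      AEStronglyMeasurable (formRep F c η) (volume.restrict U) := by
  obtain ⟨Φ, hΦ⟩ := exists_orthoFrame n F V ((chartAt (Euc n) c).symm y)
  choose X hX hXe using fun i : Fin n =>
    exists_field c (contDiff_const (c := (EuclideanSpace.single i (1 : ℝ) : Euc n))) hy.1
  obtain ⟨g, hg⟩ := (altCoeff n k F).toLinearMap.exists_leftInverse_of_injective
    (LinearMap.ker_eq_bot.2 altCoeff_injective)
  have hN : coordDomain n F V c ∩ (chartAt (Euc n) c).symm ⁻¹' Φ.dom ∩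
      {z | ∀ i, secRep (Euc n) c (X i) z = EuclideanSpace.single i (1 : ℝ)} ∈ 𝓝 y :=
    inter_mem (inter_mem ((isOpen_coordDomain (G := F) (E := V) c).mem_nhds hy)
      (((chartAt (Euc n) c).continuousAt_symm hy.1).preimage_mem_nhds (Φ.isOpen_dom.mem_nhds hΦ)))
      (eventually_all.2 hXe)
  obtain ⟨U, hUN, hUo, hyU⟩ := mem_nhds_iff.1 hN
  refine ⟨U, hUo.mem_nhds hyU, fun η hη => ?_⟩
  have h1 : ∀ (I : Fin k → Fin n) (a : FibIdx F), AEStronglyMeasurable (fun z =>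
      (inner ℝ (η ((chartAt (Euc n) c).symm z) fun m => X (I m) ((chartAt (Euc n) c).symm z))
        (Φ.sec a ((chartAt (Euc n) c).symm z)) : ℝ)) (volume.restrict U) := fun I a =>
    (aestronglyMeasurable_comp_chart_symm c (hη (fun m => X (I m)) _ (fun m => hX _)
      (Φ.smooth_sec a)).aestronglyMeasurable).mono_measure
        (Measure.restrict_mono (fun z hz => (hUN hz).1.1.1) le_rfl)
  have h2 : ∀ a : FibIdx F, AEStronglyMeasurable (secRep F c (Φ.sec a)) (volume.restrict U) :=
    fun a => ContinuousOn.aestronglyMeasurable (fun z hz =>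
      (SmoothSection.contDiffAt_secRep (Φ.smooth_sec a)
        (hUN hz).1.1).continuousAt.continuousWithinAt) hUo.measurableSet
  have h3 : AEStronglyMeasurable (fun z => fun I : Fin k → Fin n => ∑ a : FibIdx F,
      (inner ℝ (η ((chartAt (Euc n) c).symm z) fun m => X (I m) ((chartAt (Euc n) c).symm z))
        (Φ.sec a ((chartAt (Euc n) c).symm z)) : ℝ) • secRep F c (Φ.sec a) z)
      (volume.restrict U) := by
    have : ProperSpace F := FiniteDimensional.proper_real F
    borelize F
    refine AEMeasurable.aestronglyMeasurable (aemeasurable_pi_lambda _ fun I => ?_)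
    exact (Finset.aestronglyMeasurable_fun_sum _ fun a _ => (h1 I a).smul (h2 a)).aemeasurable
  refine ((LinearMap.toContinuousLinearMap g).continuous.comp_aestronglyMeasurable h3).congr ?_
  refine (ae_restrict_iff' hUo.measurableSet).2 (Eventually.of_forall fun z hz => ?_)
  have h4 : altCoeff n k F (formRep F c η z) = fun I : Fin k → Fin n => ∑ a : FibIdx F,
      (inner ℝ (η ((chartAt (Euc n) c).symm z) fun m => X (I m) ((chartAt (Euc n) c).symm z))
        (Φ.sec a ((chartAt (Euc n) c).symm z)) : ℝ) • secRep F c (Φ.sec a) z := by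
    funext I
    rw [altCoeff_apply]
    have h5 := secRep_form_apply (F := F) η (fun m => X (I m)) (hUN hz).1.1.1
    simp only [(hUN hz).2 _] at h5
    rw [← h5]
    obtain ⟨s, hs⟩ := Φ.exists_sec _ (hUN hz).1.2
    simp only [secRep]
    conv_lhs => rw [← s.sum_repr' (η ((chartAt (Euc n) c).symm z) fun m =>
      X (I m) ((chartAt (Euc n) c).symm z))]
    rw [map_sum]
    refine Finset.sum_congr rfl fun a _ => ?_
    rw [map_smul, hs a, real_inner_comm]
  have h6 := LinearMap.congr_fun hg (formRep F c η z)
  simp only [LinearMap.comp_apply, LinearMap.id_apply, ContinuousLinearMap.coe_coe] at h6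
  rw [h4] at h6
  exact h6

/-- Near each point of a chart, the coefficients of forms are controlled in `L²` by the
coordinate-free norm. -/
theorem exists_setIntegral_norm_sq_formRep_le {c : M} (k : ℕ) {y : Euc n}
    (hy : y ∈ coordDomain n F V c) : ∃ C : ℝ, ∃ U ∈ 𝓝 y, ∀ K ⊆ U, IsCompact K →
      ∀ η : Form n V k, MeasurableForm F η →
        Integrable (fun x => formInner x (η x) (η x)) (riemannianVolume n M) →
        MemLp (formRep F c η) 2 (volume.restrict K) ∧
          ∫ z in K, ‖formRep F c η z‖ ^ 2 ≤ C * l2FormInner η η := by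
  obtain ⟨κ, hκ, U, hU, hUd, hle⟩ := exists_metricRep_lower_bound (F := F) (V := V) k hy
  obtain ⟨U', hU', hmeas⟩ := exists_aestronglyMeasurable_formRep (F := F) (V := V) k hy
  refine ⟨κ⁻¹, U ∩ U', inter_mem hU hU', fun K hK hKc η hη hint => ?_⟩
  have hm : AEStronglyMeasurable (formRep F c η) (volume.restrict K) :=
    (hmeas η hη).mono_measure (Measure.restrict_mono (hK.trans Set.inter_subset_right) le_rfl)
  have hKt : K ⊆ (chartAt (Euc n) c).target := fun z hz => (hUd (hK hz).1).1
  have h1 := integrableOn_chart c hint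
  have h2 : ∀ z ∈ K, ‖formRep F c η z‖ ^ 2 ≤ κ⁻¹ * (volumeDensity c z *
      formInner ((chartAt (Euc n) c).symm z) (η ((chartAt (Euc n) c).symm z))
        (η ((chartAt (Euc n) c).symm z))) := fun z hz => by
    rw [← metricRep_formRep (hUd (hK hz).1), le_inv_mul_iff₀ hκ]
    exact hle z (hK hz).1 _
  have h3 : ∀ᵐ z ∂(volume.restrict K), ‖formRep F c η z‖ ^ 2 ≤ κ⁻¹ * (volumeDensity c z *
      formInner ((chartAt (Euc n) c).symm z) (η ((chartAt (Euc n) c).symm z))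
        (η ((chartAt (Euc n) c).symm z))) :=
    (ae_restrict_iff' hKc.measurableSet).2 (Eventually.of_forall h2)
  have h4 := (h1.mono_set hKt).const_mul κ⁻¹
  refine ⟨(memLp_two_iff_integrable_sq_norm hm).2 (h4.mono' (hm.norm.pow 2) ?_), ?_⟩
  · filter_upwards [h3] with z hz
    rwa [Real.norm_of_nonneg (by positivity)]
  · refine (integral_mono_of_nonneg (Eventually.of_forall fun z => by positivity) h4 h3).trans ?_
    rw [integral_const_mul]
    refine mul_le_mul_of_nonneg_left ?_ (inv_nonneg.2 hκ.le)
    refine le_trans ?_ (setIntegral_chart_le c hint fun x => formInner_self_nonneg x η)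
    exact setIntegral_mono_set h1 (Eventually.of_forall fun z =>
      mul_nonneg (volumeDensity_nonneg c z) (formInner_self_nonneg _ η))
      (Eventually.of_forall hKt)

end MetricRep

/-! ### Linear functionals of square-integrable functions -/

section LinearFunctional

variable {n : ℕ} {W : Type*} [NormedAddCommGroup W] [NormedSpace ℝ W] [FiniteDimensional ℝ W]
  {K : Set (Euc n)} {q : Euc n → W →ₗ[ℝ] ℝ}

theorem apply_eq_sum_finBasis (T : W →ₗ[ℝ] ℝ) (w : W) :
    T w = ∑ j, (Module.finBasis ℝ W).repr w j * T (Module.finBasis ℝ W j) := by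
  conv_lhs => rw [← (Module.finBasis ℝ W).sum_repr w]
  simp only [map_sum, map_smul, smul_eq_mul]

theorem exists_bound_linear (hK : IsCompact K) (hq : ∀ w, ContinuousOn (fun y => q y w) K) :
    ∃ C, ∀ y ∈ K, ∀ w, |q y w| ≤ C * ‖w‖ := by
  let bs := Module.finBasis ℝ W
  choose B hB using fun j => hK.exists_bound_of_continuousOn (hq (bs j))
  refine ⟨∑ j, ‖LinearMap.toContinuousLinearMap (bs.coord j)‖ * B j, fun y hy w => ?_⟩
  rw [apply_eq_sum_finBasis, Finset.sum_mul]
  refine (Finset.abs_sum_le_sum_abs _ _).trans (Finset.sum_le_sum fun j _ => ?_)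
  rw [abs_mul, mul_right_comm]
  exact mul_le_mul ((LinearMap.toContinuousLinearMap (bs.coord j)).le_opNorm w) (hB j y hy)
    (abs_nonneg _) (by positivity)

theorem integrableOn_linear (hK : IsCompact K) (hq : ∀ w, ContinuousOn (fun y => q y w) K)
    {w : Euc n → W} (hw : MemLp w 2 (volume.restrict K)) :
    IntegrableOn (fun y => q y (w y)) K := by
  have : IsFiniteMeasure (volume.restrict K) := ⟨by simpa using hK.measure_lt_top⟩
  obtain ⟨C, hC⟩ := exists_bound_linear hK hq
  refine (((hw.integrable (by norm_num)).norm).const_mul C).mono' ?_ ?_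
  · rw [funext fun y => apply_eq_sum_finBasis (q y) (w y)]
    refine Finset.aestronglyMeasurable_fun_sum _ fun j _ => AEStronglyMeasurable.mul ?_ ?_
    · exact (LinearMap.toContinuousLinearMap
        ((Module.finBasis ℝ W).coord j)).continuous.comp_aestronglyMeasurable hw.1
    · exact (hq _).aestronglyMeasurable hK.measurableSet
  · exact (ae_restrict_iff' hK.measurableSet).2 (Eventually.of_forall fun y hy => hC y hy _)

theorem tendsto_setIntegral_linear (hK : IsCompact K)
    (hq : ∀ w, ContinuousOn (fun y => q y w) K) {w : ℕ → Euc n → W} {w₀ : Euc n → W}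
    (hw : ∀ j, MemLp (w j) 2 (volume.restrict K)) (hw₀ : MemLp w₀ 2 (volume.restrict K))
    (hlim : Tendsto (fun j => ∫ y in K, ‖w j y - w₀ y‖ ^ 2) atTop (𝓝 0)) :
    Tendsto (fun j => ∫ y in K, q y (w j y)) atTop (𝓝 (∫ y in K, q y (w₀ y))) := by
  have : IsFiniteMeasure (volume.restrict K) := ⟨by simpa using hK.measure_lt_top⟩
  obtain ⟨C, hC⟩ := exists_bound_linear hK hq
  have h1 := tendsto_integral_zero_of_sq (μ := volume.restrict K)
    (h := fun j y => q y (w j y) - q y (w₀ y)) (s := fun j y => ‖w j y - w₀ y‖)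
    (fun j => ((hw j).sub hw₀).norm) (C := C) (fun j =>
      (ae_restrict_iff' hK.measurableSet).2 (Eventually.of_forall fun y hy => by
        rw [← map_sub]; exact hC y hy _)) hlim
  have h2 := h1.add_const (∫ y in K, q y (w₀ y))
  rw [zero_add] at h2
  refine h2.congr fun j => ?_
  rw [integral_sub (integrableOn_linear hK hq (hw j)) (integrableOn_linear hK hq hw₀),
    sub_add_cancel]

end LinearFunctional

section ChartNullSets

variable {n : ℕ} {M : Type*} [TopologicalSpace M] [SecondCountableTopology M]
  [ChartedSpace (EuclideanSpace ℝ (Fin n)) M]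
  [IsManifold (𝓡 n) ∞ M] [RiemannianBundle (fun x : M => TangentSpace (𝓡 n) x)]
  [IsContMDiffRiemannianBundle (𝓡 n) ∞ (EuclideanSpace ℝ (Fin n))
      (fun x : M => TangentSpace (𝓡 n) x)] [MeasurableSpace M] [BorelSpace M]

/-- Null sets in a chart are null sets of the Riemannian volume. -/
theorem ae_of_ae_chart (c : M) {p : M → Prop} (h : ∀ᵐ y : Euc n,
    y ∈ (chartAt (Euc n) c).target → p ((chartAt (Euc n) c).symm y)) :
    ∀ᵐ x ∂(riemannianVolume n M), x ∈ (chartAt (Euc n) c).source → p x := by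
  obtain ⟨N, hN, hNm, hN0⟩ := exists_measurable_superset_of_null (ae_iff.1 h)
  let e := chartAt (Euc n) c
  have hS : MeasurableSet (e.source ∩ e ⁻¹' N) := by
    have h1 : Measurable (e.source.domRestrict e) :=
      (continuousOn_iff_continuous_domRestrict.1 e.continuousOn).measurable
    have h2 := e.open_source.measurableSet.subtype_image (h1 hNm)
    convert h2 using 1
    ext x
    simp [and_comm]
  have hS0 : riemannianVolume n M (e.source ∩ e ⁻¹' N) = 0 := by
    rw [← Measure.restrict_eq_self _ Set.inter_subset_left, riemannianVolume_restrict,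
      chartVolume_eq, Measure.map_apply_of_aemeasurable ((aemeasurable_chart_symm c).mono_ac
        (withDensity_absolutelyContinuous _ _)) hS]
    refine withDensity_absolutelyContinuous _ _ ?_
    rw [Measure.restrict_apply' e.open_target.measurableSet]
    refine measure_mono_null (fun y hy => ?_) hN0
    have := hy.1.2
    rwa [Set.mem_preimage, e.right_inv hy.2] at this
  refine measure_mono_null (fun x hx => ?_) hS0
  simp only [Set.mem_compl_iff, Set.mem_ofPred_eq, Classical.not_imp] at hx
  refine ⟨hx.1, hN ?_⟩
  simp only [Set.mem_ofPred_eq, Classical.not_imp]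
  exact ⟨e.map_source hx.1, by rw [e.left_inv hx.1]; exact hx.2⟩

end ChartNullSets

/-! ### Local regularity of primitives -/

section LocalRegularity

variable {n : ℕ} {M : Type*} [TopologicalSpace M] [T2Space M] [SecondCountableTopology M]
  [ChartedSpace (EuclideanSpace ℝ (Fin n)) M]
  [IsManifold (𝓡 n) ∞ M] [RiemannianBundle (fun x : M => TangentSpace (𝓡 n) x)]
  [IsContMDiffRiemannianBundle (𝓡 n) ∞ (EuclideanSpace ℝ (Fin n))
      (fun x : M => TangentSpace (𝓡 n) x)]
  [MeasurableSpace M] [BorelSpace M]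
  {F : Type*} [NormedAddCommGroup F] [NormedSpace ℝ F] [FiniteDimensional ℝ F]
  {V : M → Type*} [TopologicalSpace (Bundle.TotalSpace F V)]
  [∀ x, NormedAddCommGroup (V x)] [∀ x, InnerProductSpace ℝ (V x)]
  [FiberBundle F V] [VectorBundle ℝ F V] [ContMDiffVectorBundle ∞ F V (𝓡 n)]
  [IsContMDiffRiemannianBundle (𝓡 n) ∞ F V]

/-- The components of the symbol of the exterior differential. -/
def wedgeFunctional {k : ℕ} (ℓ : F →L[ℝ] ℝ) (v : Fin (k + 1) → Euc n) :
    Euc n →ₗ[ℝ] (Euc n [⋀^Fin k]→L[ℝ] F) →ₗ[ℝ] ℝ :=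
  LinearMap.mk₂ ℝ (fun ξ w => ℓ (wedge ξ w v))
    (fun ξ ξ' w => by rw [wedge_add_left, ContinuousAlternatingMap.add_apply, map_add])
    (fun r ξ w => by rw [wedge_smul_left, ContinuousAlternatingMap.smul_apply, map_smul])
    (fun ξ w w' => by rw [wedge_add_right, ContinuousAlternatingMap.add_apply, map_add])
    (fun r ξ w => by rw [wedge_smul_right, ContinuousAlternatingMap.smul_apply, map_smul])

/-- The components of the zeroth-order part of the twisted differential. -/
def connFunctional {k : ℕ} (A : Euc n →L[ℝ] F →L[ℝ] F) (ℓ : F →L[ℝ] ℝ) (v : Fin (k + 1) → Euc n) :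
    (Euc n [⋀^Fin k]→L[ℝ] F) →ₗ[ℝ] ℝ where
  toFun w := ℓ (connWedge A w v)
  map_add' w w' := by rw [connWedge_add, ContinuousAlternatingMap.add_apply, map_add]
  map_smul' r w := by
    rw [connWedge_smul, ContinuousAlternatingMap.smul_apply, map_smul, RingHom.id_apply]

/-- Evaluation of a form on vectors, followed by a functional. -/
def evalFunctional {k : ℕ} (ℓ : F →L[ℝ] ℝ) (v : Fin k → Euc n) :
    (Euc n [⋀^Fin k]→L[ℝ] F) →ₗ[ℝ] ℝ where
  toFun w := ℓ (w v)
  map_add' w w' := by rw [ContinuousAlternatingMap.add_apply, map_add]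
  map_smul' r w := by rw [ContinuousAlternatingMap.smul_apply, map_smul, RingHom.id_apply]

theorem eq_zero_of_functionals {k : ℕ} {w : Euc n [⋀^Fin k]→L[ℝ] F}
    (h : ∀ (I : Fin k → Fin n) (a : Fin (Module.finrank ℝ F)),
      (Module.finBasis ℝ F).coord a (w fun m => EuclideanSpace.single (I m) (1 : ℝ)) = 0) :
    w = 0 := by
  refine altCoeff_injective ?_
  funext I
  rw [map_zero, altCoeff_apply, Pi.zero_apply]
  exact (Module.finBasis ℝ F).ext_elem fun a => by simpa using h I a

theorem continuousOn_apply_grad {W : Type*} [AddCommGroup W] [Module ℝ W] {O : Set (Euc n)}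
    {a : Euc n → Euc n →ₗ[ℝ] W →ₗ[ℝ] ℝ} (ha : ∀ ξ w, ContDiffOn ℝ ∞ (fun y => a y ξ w) O)
    {g : Euc n → ℝ} (hg : IsTest g) (w : W) :
    ContinuousOn (fun y => a y (grad g y) w) O := by
  have h : ∀ y, a y (grad g y) w =
      ∑ i, pd i g y * a y (EuclideanSpace.single i (1 : ℝ)) w := fun y => by
    rw [grad_eq_sum]
    simp only [map_sum, map_smul, LinearMap.sum_apply, LinearMap.smul_apply, smul_eq_mul]
  simp only [h]
  exact continuousOn_finsetSum _ fun i _ =>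
    (hg.pd i).continuous.continuousOn.mul (ha _ w).continuousOn

theorem MemL2.integrable_of_single {k : ℕ} {η : Form n V k}
    (h : MemL2 F (Pi.single k η : MixedForm n V)) :
    Integrable (fun x => formInner x (η x) (η x)) (riemannianVolume n M) := by
  refine h.2.congr (Eventually.of_forall fun x => ?_)
  rw [mixedInner_single, Pi.single_eq_same]

theorem MemL2.measurableForm_of_single {k : ℕ} {η : Form n V k}
    (h : MemL2 F (Pi.single k η : MixedForm n V)) : MeasurableForm F η := by
  have := h.1 k
  rwa [Pi.single_eq_same] at this

/-- Convergence of forms in `L²` implies convergence of their coefficients near each point. -/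
theorem exists_tendsto_formRep {c : M} (k : ℕ) {y : Euc n} (hy : y ∈ coordDomain n F V c) :
    ∃ U ∈ 𝓝 y, ∀ K ⊆ U, IsCompact K →
      (∀ η : Form n V k, MemL2 F (Pi.single k η : MixedForm n V) →
        MemLp (formRep F c η) 2 (volume.restrict K)) ∧
      ∀ (η : ℕ → Form n V k) (η₀ : Form n V k),
        (∀ j, MemL2 F (Pi.single k (η j) : MixedForm n V)) →
        MemL2 F (Pi.single k η₀ : MixedForm n V) →
        Tendsto (fun j => l2FormInner (η j - η₀) (η j - η₀)) atTop (𝓝 0) →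
        Tendsto (fun j => ∫ z in K, ‖formRep F c (η j) z - formRep F c η₀ z‖ ^ 2) atTop (𝓝 0) := by
  obtain ⟨C, U, hU, h⟩ := exists_setIntegral_norm_sq_formRep_le (F := F) (V := V) k hy
  refine ⟨U, hU, fun K hK hKc => ⟨fun η hη =>
    (h K hK hKc η hη.measurableForm_of_single hη.integrable_of_single).1,
    fun η η₀ hη hη₀ hlim => ?_⟩⟩
  have h1 := hlim.const_mul C
  rw [mul_zero] at h1
  refine squeeze_zero (fun j => integral_nonneg fun z => by positivity) (fun j => ?_) h1
  have h2 : MemL2 F (Pi.single k (η j - η₀) : MixedForm n V) := by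
    rw [Pi.single_sub]; exact (hη j).sub hη₀
  have h3 := (h K hK hKc _ h2.measurableForm_of_single h2.integrable_of_single).2
  simpa only [formRep_sub] using h3

variable (D : CovariantDerivative (𝓡 n) F V) [D.ContMDiffCovariantDerivative ∞]

theorem contDiffOn_connFunctional {k : ℕ} (c : M) (ℓ : F →L[ℝ] ℝ) (v : Fin (k + 1) → Euc n)
    (w : Euc n [⋀^Fin k]→L[ℝ] F) :
    ContDiffOn ℝ ∞ (fun y => connFunctional (connForm D c y) ℓ v w) (coordDomain n F V c) := by
  intro y hy
  have h : ∀ y, connFunctional (connForm D c y) ℓ v w = ∑ i : Fin (k + 1), (-1 : ℝ) ^ (i : ℕ) *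
      ℓ (connForm D c y (v i) (w (i.removeNth v))) := fun y => by
    show ℓ (connWedge (connForm D c y) w v) = _
    rw [connWedge_apply, map_sum]
    simp only [map_smul, smul_eq_mul]
  simp only [h]
  refine (ContDiffAt.sum fun i _ => contDiffAt_const.mul ?_).contDiffWithinAt
  exact ℓ.contDiff.contDiffAt.comp y
    (((contDiffAt_connForm D c hy).clm_apply contDiffAt_const).clm_apply contDiffAt_const)

/-- The equation `d u = α` holds in the sense of distributions in local coordinates, if `u` is the
limit of test forms `θⱼ` and `α` is the limit of their differentials. -/
theorem integral_wedgeFunctional_eq_zero {m : ℕ} {α : Form n V (m + 1)}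
    {θ : ℕ → Form n V m} (hθ : ∀ j, TestForm F (θ j)) {u : Form n V m} {c : M} {K : Set (Euc n)}
    (hK : IsCompact K) (hKd : K ⊆ coordDomain n F V c)
    (hm : ∀ j, MemLp (formRep F c (θ j)) 2 (volume.restrict K))
    (hu : MemLp (formRep F c u) 2 (volume.restrict K))
    (hm' : ∀ j, MemLp (formRep F c (extDerivD D (θ j))) 2 (volume.restrict K))
    (hα : MemLp (formRep F c α) 2 (volume.restrict K))
    (h1 : Tendsto (fun j => ∫ z in K, ‖formRep F c (θ j) z - formRep F c u z‖ ^ 2) atTop (𝓝 0))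
    (h2 : Tendsto (fun j => ∫ z in K, ‖formRep F c (extDerivD D (θ j)) z - formRep F c α z‖ ^ 2)
      atTop (𝓝 0)) {g : Euc n → ℝ} (hg : IsTest g) (hgK : tsupport g ⊆ K) (ℓ : F →L[ℝ] ℝ)
    (v : Fin (m + 1) → Euc n) :
    ∫ y in K, (wedgeFunctional ℓ v (grad g y) (formRep F c u y) -
      g y * (- evalFunctional ℓ v (formRep F c α y) +
        connFunctional (connForm D c y) ℓ v (formRep F c u y))) = 0 := by
  let q₁ : Euc n → (Euc n [⋀^Fin m]→L[ℝ] F) →ₗ[ℝ] ℝ := fun y =>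
    wedgeFunctional ℓ v (grad g y) - g y • connFunctional (connForm D c y) ℓ v
  let q₂ : Euc n → (Euc n [⋀^Fin (m + 1)]→L[ℝ] F) →ₗ[ℝ] ℝ := fun y => g y • evalFunctional ℓ v
  have hq₁ : ∀ w, ContinuousOn (fun y => q₁ y w) K := fun w =>
    (continuousOn_apply_grad (a := fun _ => wedgeFunctional ℓ v) (fun _ _ => contDiffOn_const) hg
      w).sub (hg.continuous.continuousOn.mul
        ((contDiffOn_connFunctional D c ℓ v w).continuousOn.mono hKd))
  have hq₂ : ∀ w, ContinuousOn (fun y => q₂ y w) K := fun w =>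
    hg.continuous.continuousOn.mul continuousOn_const
  -- the equation holds for the smooth forms `θⱼ`, and both terms pass to the limit
  have hj : ∀ j, (∫ y in K, q₁ y (formRep F c (θ j) y)) +
      ∫ y in K, q₂ y (formRep F c (extDerivD D (θ j)) y) = 0 := fun j => by
    rw [← integral_add (integrableOn_linear hK hq₁ (hm j)) (integrableOn_linear hK hq₂ (hm' j))]
    have h3 := integral_wedge_add (connForm D c) (isOpen_coordDomain (G := F) (E := V) c)
      (fun y hy => (hθ j).1.contDiffAt_formRep hy) hg (hgK.trans hKd) ℓ v
    rw [← setIntegral_eq_integral_of_forall_compl_eq_zero (s := K)] at h3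
    · rw [← h3]
      refine setIntegral_congr_fun hK.measurableSet fun y hy => ?_
      rw [← formRep_extDerivD D (hθ j).1 (hKd hy)]
      show ℓ (wedge (grad g y) (formRep F c (θ j) y) v) -
        g y * ℓ (connWedge (connForm D c y) (formRep F c (θ j) y) v) +
        g y * ℓ (formRep F c (extDerivD D (θ j)) y v) = _
      ring
    · intro y hy
      have hy' : y ∉ tsupport g := fun h => hy (hgK h)
      rw [grad_eq_zero_of_notMem hy', image_eq_zero_of_notMem_tsupport hy', wedge_apply]
      simp
  have h3 := tendsto_nhds_unique ((tendsto_setIntegral_linear hK hq₁ hm hu h1).add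
    (tendsto_setIntegral_linear hK hq₂ hm' hα h2)) (tendsto_const_nhds.congr fun j => (hj j).symm)
  rw [← integral_add (integrableOn_linear hK hq₁ hu) (integrableOn_linear hK hq₂ hα)] at h3
  rw [← h3]
  refine integral_congr_ae (Eventually.of_forall fun y => ?_)
  simp only [q₁, q₂, LinearMap.sub_apply, LinearMap.smul_apply, smul_eq_mul]
  ring

end LocalRegularity

section LocalSystem

variable {n : ℕ} {M : Type*} [TopologicalSpace M] [T2Space M] [SecondCountableTopology M]
  [ChartedSpace (EuclideanSpace ℝ (Fin n)) M]
  [IsManifold (𝓡 n) ∞ M] [RiemannianBundle (fun x : M => TangentSpace (𝓡 n) x)]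
  [IsContMDiffRiemannianBundle (𝓡 n) ∞ (EuclideanSpace ℝ (Fin n))
      (fun x : M => TangentSpace (𝓡 n) x)]
  [MeasurableSpace M] [BorelSpace M]
  {F : Type*} [NormedAddCommGroup F] [NormedSpace ℝ F] [FiniteDimensional ℝ F]
  {V : M → Type*} [TopologicalSpace (Bundle.TotalSpace F V)]
  [∀ x, NormedAddCommGroup (V x)] [∀ x, InnerProductSpace ℝ (V x)]
  [FiberBundle F V] [VectorBundle ℝ F V] [ContMDiffVectorBundle ∞ F V (𝓡 n)]
  [IsContMDiffRiemannianBundle (𝓡 n) ∞ F V]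
  (D : CovariantDerivative (𝓡 n) F V) [D.ContMDiffCovariantDerivative ∞]

/-- Local regularity of solutions of `d u = α`, completed by further equations to a system with
injective symbol. -/
theorem exists_local_smooth_of_system {m : ℕ} {α : Form n V (m + 1)} (hα : SmoothForm F α)
    (hα2 : MemL2 F (Pi.single (m + 1) α : MixedForm n V))
    {θ : ℕ → Form n V m} (hθ : ∀ j, TestForm F (θ j)) {u : Form n V m}
    (hu : MemL2 F (Pi.single m u : MixedForm n V))
    (h1 : Tendsto (fun j => l2FormInner (extDerivD D (θ j) - α) (extDerivD D (θ j) - α))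
      atTop (𝓝 0))
    (h3 : Tendsto (fun j => l2FormInner (θ j - u) (θ j - u)) atTop (𝓝 0))
    {c : M} {y₀ : Euc n} (hy₀ : y₀ ∈ coordDomain n F V c) {L : Type*} [Fintype L]
    {a : L → Euc n → Euc n →ₗ[ℝ] (Euc n [⋀^Fin m]→L[ℝ] F) →ₗ[ℝ] ℝ}
    {b : L → Euc n → (Euc n [⋀^Fin m]→L[ℝ] F) →ₗ[ℝ] ℝ}
    (ha : ∀ l ξ w, ContDiffOn ℝ ∞ (fun y => a l y ξ w) (coordDomain n F V c))
    (hb : ∀ l w, ContDiffOn ℝ ∞ (fun y => b l y w) (coordDomain n F V c))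
    (hsymb : ∀ ξ : Euc n, ξ ≠ 0 → ∀ w : Euc n [⋀^Fin m]→L[ℝ] F, wedge ξ w = 0 →
      (∀ l, a l y₀ ξ w = 0) → w = 0)
    (heq : ∀ l g, IsTest g → tsupport g ⊆ coordDomain n F V c →
      ∫ y, (a l y (grad g y) (formRep F c u y) - g y * b l y (formRep F c u y)) = 0) :
    ∃ U ∈ 𝓝 y₀, ∃ v : Euc n → Euc n [⋀^Fin m]→L[ℝ] F, ContDiff ℝ ∞ v ∧
      ∀ᵐ y, y ∈ U → formRep F c u y = v y := by
  obtain ⟨U₁, hU₁, hconv₁⟩ := exists_tendsto_formRep (F := F) (V := V) m hy₀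
  obtain ⟨U₂, hU₂, hconv₂⟩ := exists_tendsto_formRep (F := F) (V := V) (m + 1) hy₀
  obtain ⟨r, hr, hball⟩ := Metric.nhds_basis_closedBall.mem_iff.1 (inter_mem (inter_mem hU₁ hU₂)
    ((isOpen_coordDomain (G := F) (E := V) c).mem_nhds hy₀))
  have hKc := isCompact_closedBall y₀ r
  obtain ⟨hmem₁, hlim₁⟩ := hconv₁ _ (fun y hy => (hball hy).1.1) hKc
  obtain ⟨hmem₂, hlim₂⟩ := hconv₂ _ (fun y hy => (hball hy).1.2) hKc
  have hKd : Metric.closedBall y₀ r ⊆ coordDomain n F V c := fun y hy => (hball hy).2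
  have hOd : Metric.ball y₀ r ⊆ coordDomain n F V c := Metric.ball_subset_closedBall.trans hKd
  let bF := Module.finBasis ℝ F
  let ℓ : Fin (Module.finrank ℝ F) → F →L[ℝ] ℝ := fun i =>
    LinearMap.toContinuousLinearMap (bF.coord i)
  let e : (Fin (m + 1) → Fin n) → Fin (m + 1) → Euc n := fun I s =>
    EuclideanSpace.single (I s) (1 : ℝ)
  -- the system consists of the components of `d u = α`, followed by the given equations
  let L₁ := (Fin (m + 1) → Fin n) × Fin (Module.finrank ℝ F)
  let a' : L₁ ⊕ L → Euc n → Euc n →ₗ[ℝ] (Euc n [⋀^Fin m]→L[ℝ] F) →ₗ[ℝ] ℝ :=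
    Sum.elim (fun i _ => wedgeFunctional (ℓ i.2) (e i.1)) a
  let b' : L₁ ⊕ L → Euc n → (Euc n [⋀^Fin m]→L[ℝ] F) →ₗ[ℝ] ℝ :=
    Sum.elim (fun i y => connFunctional (connForm D c y) (ℓ i.2) (e i.1)) b
  let f' : L₁ ⊕ L → Euc n → ℝ :=
    Sum.elim (fun i y => - evalFunctional (ℓ i.2) (e i.1) (formRep F c α y)) fun _ _ => 0
  have ha' : ∀ l ξ w, ContDiffOn ℝ ∞ (fun y => a' l y ξ w) (coordDomain n F V c) := by
    rintro (i | l) ξ w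
    · exact contDiffOn_const
    · exact ha l ξ w
  have hb' : ∀ l w, ContDiffOn ℝ ∞ (fun y => b' l y w) (coordDomain n F V c) := by
    rintro (i | l) w
    · exact contDiffOn_connFunctional D c _ _ w
    · exact hb l w
  have hf' : ∀ l, ContDiffOn ℝ ∞ (f' l) (coordDomain n F V c) := by
    rintro (i | l)
    · intro y hy
      exact (((ℓ i.2).contDiff.contDiffAt.comp y (ContDiffAt.alt_apply
        (hα.contDiffAt_formRep hy) fun _ => contDiffAt_const)).neg).contDiffWithinAt
    · exact contDiffOn_const
  have hũ := hmem₁ u hu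
  have heq' : ∀ l g, IsTest g → tsupport g ⊆ Metric.closedBall y₀ r →
      ∫ y in Metric.closedBall y₀ r, (a' l y (grad g y) (formRep F c u y) -
        g y * (f' l y + b' l y (formRep F c u y))) = 0 := by
    rintro (i | l) g hg hgK
    · exact integral_wedgeFunctional_eq_zero D hθ hKc hKd (fun j => hmem₁ _ (hθ j).single.memL2)
        hũ (fun j => hmem₂ _ ((hθ j).extDerivD D).single.memL2) (hmem₂ _ hα2)
        (hlim₁ _ _ (fun j => (hθ j).single.memL2) hu h3)
        (hlim₂ _ _ (fun j => ((hθ j).extDerivD D).single.memL2) hα2 h1) hg hgK (ℓ i.2) (e i.1)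
    · rw [← heq l g hg (hgK.trans hKd)]
      simp only [a', b', f', Sum.elim_inr, zero_add]
      refine setIntegral_eq_integral_of_forall_compl_eq_zero fun y hy => ?_
      have hy' : y ∉ tsupport g := fun h => hy (hgK h)
      rw [grad_eq_zero_of_notMem hy', image_eq_zero_of_notMem_tsupport hy', map_zero,
        LinearMap.zero_apply, zero_mul, sub_zero]
  refine elliptic_regularity_vector Metric.isOpen_ball (Metric.mem_ball_self hr)
    (a := a') (b := b') (f := f') (fun l ξ w => (ha' l ξ w).mono hOd)
    (fun l w => (hb' l w).mono hOd) (fun l => (hf' l).mono hOd) (fun ξ hξ w hw => ?_)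
    (fun K hK hKO => hũ.mono_measure (Measure.restrict_mono
      (hKO.trans Metric.ball_subset_closedBall) le_rfl)) (fun l g hg hgO => ?_)
  · exact hsymb ξ hξ w (eq_zero_of_functionals fun I i => hw (Sum.inl (I, i)))
      fun l => hw (Sum.inr l)
  · have hgK := hgO.trans Metric.ball_subset_closedBall
    have hz : ∀ y, y ∉ Metric.closedBall y₀ r → y ∉ tsupport g := fun y hy h => hy (hgK h)
    rw [← setIntegral_eq_integral_of_forall_compl_eq_zero (s := Metric.closedBall y₀ r)
      (f := fun y => a' l y (grad g y) (formRep F c u y)) fun y hy => by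
        rw [grad_eq_zero_of_notMem (hz y hy), map_zero, LinearMap.zero_apply],
      ← setIntegral_eq_integral_of_forall_compl_eq_zero (s := Metric.closedBall y₀ r)
      (f := fun y => g y * (f' l y + b' l y (formRep F c u y))) fun y hy => by
        rw [image_eq_zero_of_notMem_tsupport (hz y hy), zero_mul], ← sub_eq_zero, ← integral_sub]
    · exact heq' l g hg hgK
    · exact integrableOn_linear hKc (q := fun y => a' l y (grad g y)) (fun w =>
        (continuousOn_apply_grad (ha' l) hg w).mono hKd) hũ
    · simp only [mul_add]
      refine Integrable.add ?_ ?_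
      · exact (hg.continuous.continuousOn.mul
          ((hf' l).continuousOn.mono hKd)).integrableOn_compact hKc
      · exact integrableOn_linear hKc (q := fun y => g y • b' l y) (fun w =>
          hg.continuous.continuousOn.mul ((hb' l w).continuousOn.mono hKd)) hũ

theorem contDiffOn_metricRep_right {m : ℕ} {c : M} (w : Euc n [⋀^Fin m]→L[ℝ] F)
    {W : Euc n → Euc n [⋀^Fin m]→L[ℝ] F} (hW : ContDiffOn ℝ ∞ W (coordDomain n F V c)) :
    ContDiffOn ℝ ∞ (fun y => metricRep V c y w (W y)) (coordDomain n F V c) := by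
  intro y hy
  simp only [fun y => apply_eq_sum_finBasis (metricRep V c y w) (W y)]
  refine ContDiffWithinAt.sum fun j _ => ContDiffWithinAt.mul ?_
    (contDiffAt_metricRep hy _ _).contDiffWithinAt
  exact (LinearMap.toContinuousLinearMap
    ((Module.finBasis ℝ (Euc n [⋀^Fin m]→L[ℝ] F)).coord j)).contDiff.contDiffAt.comp_contDiffWithinAt
      y (hW y hy)

theorem contDiffOn_connWedge {q : ℕ} (c : M) (w : Euc n [⋀^Fin q]→L[ℝ] F) :
    ContDiffOn ℝ ∞ (fun y => connWedge (connForm D c y) w) (coordDomain n F V c) := by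
  intro y hy
  refine (contDiffAt_alt fun v => ?_).contDiffWithinAt
  simp only [connWedge_apply]
  exact ContDiffAt.sum fun i _ => contDiffAt_const.smul
    (((contDiffAt_connForm D c hy).clm_apply contDiffAt_const).clm_apply contDiffAt_const)

/-- The principal part of the equation `δ u = 0`, tested with the form `w'`. -/
def coclosedSymbol (V : M → Type*) [TopologicalSpace (Bundle.TotalSpace F V)]
    [∀ x, NormedAddCommGroup (V x)] [∀ x, InnerProductSpace ℝ (V x)]
    [FiberBundle F V] [VectorBundle ℝ F V] [ContMDiffVectorBundle ∞ F V (𝓡 n)]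
    [IsContMDiffRiemannianBundle (𝓡 n) ∞ F V] {q : ℕ} (c : M)
    (w' : Euc n [⋀^Fin q]→L[ℝ] F) (y : Euc n) :
    Euc n →ₗ[ℝ] (Euc n [⋀^Fin (q + 1)]→L[ℝ] F) →ₗ[ℝ] ℝ :=
  LinearMap.mk₂ ℝ (fun ξ w => metricRep V c y w (wedge ξ w'))
    (fun ξ ξ' w => by rw [wedge_add_left, map_add])
    (fun r ξ w => by rw [wedge_smul_left, map_smul])
    (fun ξ w₁ w₂ => by rw [map_add, LinearMap.add_apply])
    (fun r ξ w => by rw [map_smul, LinearMap.smul_apply])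

/-- The equation `δ u = 0` in the sense of distributions in local coordinates. -/
theorem integral_coclosedSymbol_eq_zero {q : ℕ} {u : Form n V (q + 1)}
    (hu : MemL2 F (Pi.single (q + 1) u : MixedForm n V))
    (hco : ∀ ψ : Form n V q, TestForm F ψ → l2FormInner u (extDerivD D ψ) = 0) {c : M}
    (w' : Euc n [⋀^Fin q]→L[ℝ] F) {g : Euc n → ℝ} (hg : IsTest g)
    (hgs : tsupport g ⊆ coordDomain n F V c) :
    ∫ y, (coclosedSymbol V c w' y (grad g y) (formRep F c u y) -
      g y * - metricRep V c y (formRep F c u y) (connWedge (connForm D c y) w')) = 0 := by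
  have hs : tsupport (fun y => g y • w') ⊆ tsupport g := tsupport_smul_subset_left _ _
  have hψ : TestForm F (formIn V c fun y => g y • w') :=
    testForm_formIn (hg.1.smul contDiff_const) hg.2.smul_right (hs.trans hgs)
  have hsupp : ∀ x, x ∉ (chartAt (Euc n) c).symm '' tsupport g →
      extDerivD D (formIn V c fun y => g y • w') x = 0 := fun x hx =>
    eq_zero_of_notMem_formSupport fun h => hx (Set.image_mono hs
      (formSupport_formIn_subset hg.2.smul_right (hs.trans hgs)
        (formSupport_extDerivD_subset D hψ.1 h)))
  have h1 := hco _ hψ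
  have hmeas : AEStronglyMeasurable (fun x => formInner x (u x)
      (extDerivD D (formIn V c fun y => g y • w') x)) (riemannianVolume n M) := by
    have h2 := (aestronglyMeasurable_coefMap hu.1).inner (𝕜 := ℝ)
      (aestronglyMeasurable_coefMap ((hψ.extDerivD D).single.memL2).1)
    refine h2.congr (Eventually.of_forall fun x => ?_)
    simp only [inner_coefMap, mixedInner_single, Pi.single_eq_same]
  rw [l2FormInner, integral_eq_integral_chart c hmeas fun x hx => by
    rw [hsupp x fun ⟨y, hy, hyx⟩ => hx (hyx ▸ (chartAt (Euc n) c).map_target (hgs hy).1),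
      formInner_zero_right]] at h1
  rw [← h1, ← setIntegral_eq_integral_of_forall_compl_eq_zero
    (s := (chartAt (Euc n) c).target)]
  · refine setIntegral_congr_fun (chartAt (Euc n) c).open_target.measurableSet fun y hy => ?_
    by_cases hyg : y ∈ tsupport g
    · have hyd := hgs hyg
      have h2 : formRep F c (extDerivD D (formIn V c fun y => g y • w')) y =
          wedge (grad g y) w' + g y • connWedge (connForm D c y) w' := by
        rw [formRep_extDerivD D hψ.1 hyd, ← twistedD_smul_const _ (hg.differentiable y)]
        refine twistedD_congr ?_
        filter_upwards [(isOpen_coordDomain (G := F) (E := V) c).mem_nhds hyd] with z hz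
        exact formRep_formIn hz
      rw [← metricRep_formRep hyd, h2, map_add, map_smul, smul_eq_mul, mul_neg, sub_neg_eq_add]
      rfl
    · have h2 : extDerivD D (formIn V c fun y => g y • w') ((chartAt (Euc n) c).symm y) = 0 :=
        hsupp _ fun ⟨z, hz, hzy⟩ => hyg (by
          rwa [← (chartAt (Euc n) c).symm.injOn (hgs hz).1 hy hzy])
      simp only [h2, formInner_zero_right, mul_zero]
      rw [grad_eq_zero_of_notMem hyg, image_eq_zero_of_notMem_tsupport hyg, map_zero,
        LinearMap.zero_apply, zero_mul, sub_zero]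
  · intro y hy
    have hyg : y ∉ tsupport g := fun h => hy (hgs h).1
    rw [grad_eq_zero_of_notMem hyg, image_eq_zero_of_notMem_tsupport hyg, map_zero,
      LinearMap.zero_apply, zero_mul, sub_zero]

end LocalSystem

/-! ### Smoothness of the primitive and the vanishing theorem -/

section GlobalRegularity

variable {n : ℕ} {M : Type*} [TopologicalSpace M] [T2Space M] [SecondCountableTopology M]
  [ChartedSpace (EuclideanSpace ℝ (Fin n)) M]
  [IsManifold (𝓡 n) ∞ M] [RiemannianBundle (fun x : M => TangentSpace (𝓡 n) x)]
  [IsContMDiffRiemannianBundle (𝓡 n) ∞ (EuclideanSpace ℝ (Fin n))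
      (fun x : M => TangentSpace (𝓡 n) x)]
  [MeasurableSpace M] [BorelSpace M]
  {F : Type*} [NormedAddCommGroup F] [NormedSpace ℝ F] [FiniteDimensional ℝ F]
  {V : M → Type*} [TopologicalSpace (Bundle.TotalSpace F V)]
  [∀ x, NormedAddCommGroup (V x)] [∀ x, InnerProductSpace ℝ (V x)]
  [FiberBundle F V] [VectorBundle ℝ F V] [ContMDiffVectorBundle ∞ F V (𝓡 n)]
  [IsContMDiffRiemannianBundle (𝓡 n) ∞ F V]
  {D : CovariantDerivative (𝓡 n) F V} [D.ContMDiffCovariantDerivative ∞]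

/-- The equations `d u = α` and `δ u = 0` form a first-order system with injective symbol: if
`ξ ∧ w = 0`, then `w = ξ ∧ w'`, and `w` is orthogonal to all such forms if the symbol of `δ` kills
`w`. In degree zero the first equation suffices. -/
theorem exists_local_smooth {m : ℕ} {α : Form n V (m + 1)} (hα : SmoothForm F α)
    (hα2 : MemL2 F (Pi.single (m + 1) α : MixedForm n V))
    {θ : ℕ → Form n V m} (hθ : ∀ j, TestForm F (θ j)) {u : Form n V m}
    (hu : MemL2 F (Pi.single m u : MixedForm n V))
    (h1 : Tendsto (fun j => l2FormInner (extDerivD D (θ j) - α) (extDerivD D (θ j) - α))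
      atTop (𝓝 0))
    (h3 : Tendsto (fun j => l2FormInner (θ j - u) (θ j - u)) atTop (𝓝 0))
    (hco : ∀ φ : MixedForm n V, TestMixed F φ → l2Inner (Pi.single m u) (dD D φ) = 0)
    {c : M} {y₀ : Euc n} (hy₀ : y₀ ∈ coordDomain n F V c) :
    ∃ U ∈ 𝓝 y₀, ∃ v : Euc n → Euc n [⋀^Fin m]→L[ℝ] F, ContDiff ℝ ∞ v ∧
      ∀ᵐ y, y ∈ U → formRep F c u y = v y := by
  cases m with
  | zero =>
    exact exists_local_smooth_of_system D hα hα2 hθ hu h1 h3 hy₀ (L := Empty)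
      (a := fun l => l.elim) (b := fun l => l.elim) (fun l => l.elim) (fun l => l.elim)
      (fun ξ hξ w hw _ => eq_zero_of_wedge_eq_zero hξ hw) fun l => l.elim
  | succ q =>
    have hco' : ∀ ψ : Form n V q, TestForm F ψ → l2FormInner u (extDerivD D ψ) = 0 := fun ψ hψ => by
      have := hco _ hψ.single
      rwa [dD_single, l2Inner_single, Pi.single_eq_same] at this
    let bs := Module.finBasis ℝ (Euc n [⋀^Fin q]→L[ℝ] F)
    have ha : ∀ l ξ w, ContDiffOn ℝ ∞ (fun y => coclosedSymbol V c (bs l) y ξ w)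
        (coordDomain n F V c) := fun l ξ w y hy => by
      have := contDiffAt_metricRep (F := F) (V := V) hy w (wedge ξ (bs l))
      exact this.contDiffWithinAt
    have hb : ∀ l w, ContDiffOn ℝ ∞ (fun y => (-(metricRep V c y).flip
        (connWedge (connForm D c y) (bs l))) w) (coordDomain n F V c) := fun l w => by
      simp only [LinearMap.neg_apply, LinearMap.flip_apply]
      exact (contDiffOn_metricRep_right w (contDiffOn_connWedge D c (bs l))).neg
    refine exists_local_smooth_of_system D hα hα2 hθ hu h1 h3 hy₀ ha hb
      (fun ξ hξ w hw hl => ?_) fun l g hg hgs => ?_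
    swap
    · simp only [LinearMap.neg_apply, LinearMap.flip_apply]
      exact integral_coclosedSymbol_eq_zero D hu hco' (bs l) hg hgs
    -- `w` is a multiple of `ξ`, and orthogonal to all multiples of `ξ`
    obtain ⟨w', rfl⟩ := exists_eq_wedge hξ hw
    by_contra hne
    refine (metricRep_self_pos hy₀ hne).ne' ?_
    have h4 : ∀ w'', metricRep V c y₀ (wedge ξ w') (wedge ξ w'') = 0 := fun w'' => by
      let T : (Euc n [⋀^Fin q]→L[ℝ] F) →ₗ[ℝ] ℝ :=
        { toFun := fun w'' => metricRep V c y₀ (wedge ξ w') (wedge ξ w'')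
          map_add' := fun w₁ w₂ => by rw [wedge_add_right, map_add]
          map_smul' := fun r w₁ => by rw [wedge_smul_right, map_smul, RingHom.id_apply] }
      have hT : T = 0 := bs.ext fun l => hl l
      exact LinearMap.congr_fun hT w''
    exact h4 w'

theorem eq_zero_of_ae_eq_zero {k : ℕ} {η : Form n V k} (hη : SmoothForm F η) {O : Set M}
    (hO : IsOpen O) (h : ∀ᵐ x ∂(riemannianVolume n M), x ∈ O → η x = 0) {x : M} (hx : x ∈ O) :
    η x = 0 := by
  refine eq_zero_of_l2FormInner_eq_zero hη hO (fun φ _ hs => ?_) hx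
  refine integral_eq_zero_of_ae ?_
  filter_upwards [h] with z hz
  by_cases hzO : z ∈ O
  · rw [hz hzO, formInner_zero_right, Pi.zero_apply]
  · rw [eq_zero_of_notMem_formSupport fun hz' => hzO (hs hz'), formInner_zero_left, Pi.zero_apply]

/-- Local smooth representatives agree on overlaps, by continuity, and hence can be glued. -/
theorem exists_smooth_of_locally {k : ℕ} {u : Form n V k}
    (h : ∀ p : M, ∃ W : Set M, IsOpen W ∧ p ∈ W ∧ ∃ v : Form n V k, SmoothForm F v ∧
      ∀ᵐ x ∂(riemannianVolume n M), x ∈ W → u x = v x) :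
    ∃ v : Form n V k, SmoothForm F v ∧ ∀ᵐ x ∂(riemannianVolume n M), u x = v x := by
  choose W hW hpW v hv huv using h
  have heq : ∀ p x, x ∈ W p → v x x = v p x := fun p x hx => by
    have h1 := eq_zero_of_ae_eq_zero ((hv x).sub (hv p)) ((hW x).inter (hW p)) (by
      filter_upwards [huv x, huv p] with z h1 h2 hz
      rw [Pi.sub_apply, ← h1 hz.1, ← h2 hz.2, sub_self]) ⟨hpW x, hx⟩
    exact sub_eq_zero.1 h1
  refine ⟨fun x => v x x, smoothForm_of_formRep fun x => ⟨x, mem_chart_source (Euc n) x,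
    FiberBundle.mem_baseSet_trivializationAt F V x, ?_⟩, ?_⟩
  · have hy : chartAt (Euc n) x x ∈ coordDomain n F V x := chart_mem_coordDomain
      (mem_chart_source (Euc n) x) (FiberBundle.mem_baseSet_trivializationAt F V x)
    refine ((hv x).contDiffAt_formRep hy).congr_of_eventuallyEq ?_
    have h1 : (chartAt (Euc n) x).symm ⁻¹' W x ∈ 𝓝 (chartAt (Euc n) x x) :=
      ((chartAt (Euc n) x).continuousAt_symm hy.1).preimage_mem_nhds ((hW x).mem_nhds (by
        rw [(chartAt (Euc n) x).left_inv (mem_chart_source (Euc n) x)]; exact hpW x))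
    filter_upwards [h1] with z hz
    exact formRep_congr (heq x _ hz)
  · obtain ⟨S, hS, hcov⟩ := TopologicalSpace.countable_cover_nhds fun p =>
      (hW p).mem_nhds (hpW p)
    filter_upwards [(ae_ball_iff hS).2 fun p _ => huv p] with x hx
    obtain ⟨p, hp, hxp⟩ := Set.mem_iUnion₂.1 (hcov.symm ▸ Set.mem_univ x : x ∈ ⋃ p ∈ S, W p)
    rw [hx p hp hxp, heq p x hxp]

/-- A coclosed limit of test forms whose differentials converge to a smooth form is smooth. -/
theorem exists_smooth_representative {m : ℕ} {α : Form n V (m + 1)} (hα : SmoothForm F α)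
    (hα2 : MemL2 F (Pi.single (m + 1) α : MixedForm n V))
    {θ : ℕ → Form n V m} (hθ : ∀ j, TestForm F (θ j)) {u : Form n V m}
    (hu : MemL2 F (Pi.single m u : MixedForm n V))
    (h1 : Tendsto (fun j => l2FormInner (extDerivD D (θ j) - α) (extDerivD D (θ j) - α))
      atTop (𝓝 0))
    (h3 : Tendsto (fun j => l2FormInner (θ j - u) (θ j - u)) atTop (𝓝 0))
    (hco : ∀ φ : MixedForm n V, TestMixed F φ → l2Inner (Pi.single m u) (dD D φ) = 0) :
    ∃ v : Form n V m, SmoothForm F v ∧ ∀ᵐ x ∂(riemannianVolume n M), u x = v x := by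
  refine exists_smooth_of_locally fun p => ?_
  let e := chartAt (Euc n) p
  have hy₀ : e p ∈ coordDomain n F V p := chart_mem_coordDomain
    (mem_chart_source (Euc n) p) (FiberBundle.mem_baseSet_trivializationAt F V p)
  obtain ⟨U, hU, v, hv, huv⟩ := exists_local_smooth hα hα2 hθ hu h1 h3 hco hy₀
  obtain ⟨r, hr, hball⟩ := Metric.nhds_basis_closedBall.mem_iff.1
    (inter_mem hU ((isOpen_coordDomain (G := F) (E := V) p).mem_nhds hy₀))
  let χ : ContDiffBump (e p) := ⟨r / 2, r, by positivity, by linarith⟩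
  have hχ : ContDiff ℝ ∞ (χ : Euc n → ℝ) := χ.contDiff
  have hc : HasCompactSupport fun z => χ z • v z := χ.hasCompactSupport.smul_right
  have hs : tsupport (fun z => χ z • v z) ⊆ coordDomain n F V p := by
    refine (tsupport_smul_subset_left _ _).trans ?_
    rw [χ.tsupport_eq]
    exact fun y hy => (hball hy).2
  refine ⟨e.source ∩ e ⁻¹' Metric.ball (e p) (r / 2),
    e.isOpen_inter_preimage Metric.isOpen_ball,
    ⟨mem_chart_source (Euc n) p, Metric.mem_ball_self (half_pos hr)⟩,
    formIn V p fun z => χ z • v z, (testForm_formIn (hχ.smul hv) hc hs).1, ?_⟩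
  have h4 := ae_of_ae_chart p (p := fun x => e x ∈ Metric.ball (e p) (r / 2) →
    u x = formIn V p (fun z => χ z • v z) x) (by
      filter_upwards [huv] with y hy hyt hyb
      rw [show e (e.symm y) = y from e.right_inv hyt] at hyb
      have hyr := hball (Metric.ball_subset_closedBall (Metric.ball_subset_ball (by linarith) hyb))
      refine eq_of_formRep_eq hyr.2 ?_
      rw [formRep_formIn hyr.2, χ.one_of_mem_closedBall (Metric.ball_subset_closedBall hyb), one_smul,
        hy hyr.1])
  filter_upwards [h4] with x hx hxW
  exact hx hxW.1 hxW.2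

end GlobalRegularity

section Vanishing

variable {n : ℕ} {M : Type*} [TopologicalSpace M] [T2Space M] [SecondCountableTopology M]
  [ChartedSpace (EuclideanSpace ℝ (Fin n)) M]
  [IsManifold (𝓡 n) ∞ M] [RiemannianBundle (fun x : M => TangentSpace (𝓡 n) x)]
  [IsContMDiffRiemannianBundle (𝓡 n) ∞ (EuclideanSpace ℝ (Fin n))
      (fun x : M => TangentSpace (𝓡 n) x)]
  [MeasurableSpace M] [BorelSpace M]
  {F : Type*} [NormedAddCommGroup F] [NormedSpace ℝ F] [FiniteDimensional ℝ F]
  {V : M → Type*} [TopologicalSpace (Bundle.TotalSpace F V)]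
  [∀ x, NormedAddCommGroup (V x)] [∀ x, InnerProductSpace ℝ (V x)]
  [FiberBundle F V] [VectorBundle ℝ F V] [ContMDiffVectorBundle ∞ F V (𝓡 n)]
  [IsContMDiffRiemannianBundle (𝓡 n) ∞ F V]
  {D : CovariantDerivative (𝓡 n) F V} [D.ContMDiffCovariantDerivative ∞]

theorem MemL2.congr_single {m : ℕ} {u v : Form n V m}
    (hu : MemL2 F (Pi.single m u : MixedForm n V))
    (huv : ∀ᵐ x ∂(riemannianVolume n M), u x = v x) :
    MemL2 F (Pi.single m v : MixedForm n V) := by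
  refine memL2_iff.2 ((memL2_iff.1 hu).ae_eq ?_)
  filter_upwards [huv] with x hx
  refine coefMap_congr fun k _ => ?_
  by_cases h : k = m
  · subst h; rw [Pi.single_eq_same, Pi.single_eq_same, hx]
  · rw [Pi.single_eq_of_ne h, Pi.single_eq_of_ne h]

theorem smoothMixed_single {m : ℕ} {v : Form n V m} (hv : SmoothForm F v) :
    SmoothMixed F (Pi.single m v : MixedForm n V) := fun j => by
  by_cases h : j = m
  · subst h; rwa [Pi.single_eq_same]
  · rw [Pi.single_eq_of_ne h]; exact smoothForm_zero

theorem HomogeneousOfDegree.eq_single {k : ℕ} {α : MixedForm n V} (h : HomogeneousOfDegree k α) :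
    α = Pi.single k (α k) := funext fun j => by
  by_cases hj : j = k
  · subst hj; rw [Pi.single_eq_same]
  · rw [Pi.single_eq_of_ne hj, h j (by exact_mod_cast hj)]

/-- A closed form of positive degree has a coexact primitive, which is smooth if the form is. -/
theorem exists_primitive (hD : IsFlat D) (hb : ∀ k ≤ n, SpectralBound D k)
    (hesa : IsEssentiallySelfAdjointP D) {m : ℕ} {α : Form n V (m + 1)}
    (hα : MemL2 F (Pi.single (m + 1) α : MixedForm n V))
    (hclosed : ∀ φ, TestMixed F φ → l2Inner (Pi.single (m + 1) α) (deltaD D φ) = 0) :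
    ∃ u : Form n V m, DMin D (Pi.single m u) (Pi.single (m + 1) α) ∧
      MemH1Min D (Pi.single m u) ∧ IsCoexactForm D (Pi.single m u) ∧
      (SmoothForm F α → SmoothForm F u) := by
  obtain ⟨θ, hθ, u, hu, h1, h2, h3⟩ := exists_tendsto_l2FormInner hD hb hesa hα hclosed
  by_cases hs : SmoothForm F α
  · obtain ⟨v, hv, huv⟩ := exists_smooth_representative hs hα hθ hu h1 h3 fun φ hφ =>
      l2Inner_dD_eq_zero_of_tendsto hesa.isAdjointPair hθ hu h2 h3 hφ
    have h3' : Tendsto (fun j => l2FormInner (θ j - v) (θ j - v)) atTop (𝓝 0) := by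
      refine h3.congr fun j => integral_congr_ae ?_
      filter_upwards [huv] with x hx
      rw [Pi.sub_apply, Pi.sub_apply, hx]
    obtain ⟨h4, h5, h6⟩ := properties_of_tendsto hD hb hesa hα hθ (hu.congr_single huv) h1 h2 h3'
    exact ⟨v, h4, h5, h6, fun _ => hv⟩
  · obtain ⟨h4, h5, h6⟩ := properties_of_tendsto hD hb hesa hα hθ hu h1 h2 h3
    exact ⟨u, h4, h5, h6, fun h => absurd h hs⟩

theorem dD_zero : dD D (0 : MixedForm n V) = 0 := by
  have h := dD_single D (0 : Form n V 0)
  rwa [extDerivD_zero, Pi.single_zero, Pi.single_zero] at h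

theorem deltaD_zero : deltaD D (0 : MixedForm n V) = 0 := funext fun _ => coDerivD_zero D

/-- A closed form of degree zero vanishes almost everywhere, i.e. it is the differential of zero. -/
theorem dMin_zero_of_isClosed (hD : IsFlat D) (hb : ∀ k ≤ n, SpectralBound D k)
    (hesa : IsEssentiallySelfAdjointP D) {α : Form n V 0}
    (hα : MemL2 F (Pi.single 0 α : MixedForm n V))
    (hclosed : ∀ φ, TestMixed F φ → l2Inner (Pi.single 0 α) (deltaD D φ) = 0) :
    DMin D 0 (Pi.single 0 α) := by
  refine ⟨memL2_zero, hα, fun _ => 0, fun _ => testMixed_zero, ?_, ?_⟩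
  · simp [l2Inner, mixedInner, formInner_zero_left]
  · have h : l2Inner (0 - Pi.single 0 α : MixedForm n V) (0 - Pi.single 0 α) = 0 := by
      rw [← l2FormInner_self_eq_zero_of_isClosed hD hb hesa hα hclosed, ← l2Inner_single_self]
      simp [l2Inner, mixedInner, formInner]
    simp only [dD_zero, h, tendsto_const_nhds]

end Vanishing

end TwistedL2

end

theorem proposition5p2 {n : ℕ}
    {M : Type*} [TopologicalSpace M] [T2Space M] [SecondCountableTopology M]
    [ChartedSpace (EuclideanSpace ℝ (Fin n)) M] [IsManifold (𝓡 n) ∞ M]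
    [RiemannianBundle (fun x : M => TangentSpace (𝓡 n) x)]
    [IsContMDiffRiemannianBundle (𝓡 n) ∞ (EuclideanSpace ℝ (Fin n))
      (fun x : M => TangentSpace (𝓡 n) x)]
    [MeasurableSpace M] [BorelSpace M]
    {F : Type*} [NormedAddCommGroup F] [NormedSpace ℝ F] [FiniteDimensional ℝ F]
    {V : M → Type*} [TopologicalSpace (Bundle.TotalSpace F V)]
    [∀ x, NormedAddCommGroup (V x)] [∀ x, InnerProductSpace ℝ (V x)]
    [FiberBundle F V] [VectorBundle ℝ F V] [ContMDiffVectorBundle ∞ F V (𝓡 n)]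
    [IsContMDiffRiemannianBundle (𝓡 n) ∞ F V]
    (D : CovariantDerivative (𝓡 n) F V) [D.ContMDiffCovariantDerivative ∞]
    (hflat : TwistedL2.IsFlat D)
    (hbound : ∀ k ≤ n, TwistedL2.SpectralBound D k)
    (hesa : TwistedL2.IsEssentiallySelfAdjointP D) :
    ∀ (k : ℕ) (α : TwistedL2.MixedForm n V),
      TwistedL2.MemL2 F α → TwistedL2.HomogeneousOfDegree k α → TwistedL2.IsClosedForm D α →
      ∃ γ : TwistedL2.MixedForm n V,
        TwistedL2.HomogeneousOfDegree ((k : ℤ) - 1) γ ∧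
        TwistedL2.DMin D γ α ∧
        TwistedL2.MemH1Min D γ ∧
        TwistedL2.IsCoexactForm D γ ∧
        (TwistedL2.SmoothMixed F α → TwistedL2.SmoothMixed F γ) := by
  intro k α hα hhom hclosed
  have hcl : ∀ φ, TwistedL2.TestMixed F φ → TwistedL2.l2Inner α (TwistedL2.deltaD D φ) = 0 :=
    fun φ hφ => by
      rw [hclosed.2.2 φ hφ]
      simp [TwistedL2.l2Inner, TwistedL2.mixedInner, TwistedL2.formInner_zero_left]
  rw [TwistedL2.HomogeneousOfDegree.eq_single hhom] at hα hcl ⊢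
  cases k with
  | zero =>
    refine ⟨0, fun _ _ => rfl, TwistedL2.dMin_zero_of_isClosed hflat hbound hesa hα hcl,
      ⟨_, TwistedL2.minExt_self TwistedL2.testMixed_zero (TwistedL2.TestMixed.opP D TwistedL2.testMixed_zero)⟩,
      ⟨0, ?_⟩, fun _ _ => TwistedL2.smoothForm_zero⟩
    have h := TwistedL2.minExt_self (A := TwistedL2.deltaD D) TwistedL2.testMixed_zero
      (TwistedL2.TestMixed.deltaD D TwistedL2.testMixed_zero)
    rwa [TwistedL2.deltaD_zero] at h
  | succ m =>
    obtain ⟨u, h1, h2, h3, h4⟩ := TwistedL2.exists_primitive hflat hbound hesa hα hcl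
    refine ⟨Pi.single m u, ?_, h1, h2, h3, fun hs => TwistedL2.smoothMixed_single (h4 ?_)⟩
    · rw [Nat.cast_succ, add_sub_cancel_right]
      exact TwistedL2.homogeneousOfDegree_single u
    · simpa using hs (m + 1)
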